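/- **Setting.** Let $d\ge 1$, let $\Omega\subset\mathbb R^d$ be a polygonal (polyhedral) domain, let $A:\Omega\to\mathbb R^{d\times d}$ be symmetric, uniformly positive definite and piecewise Lipschitz continuous (Lipschitz on each of finitely many disjoint open pieces of $\Omega$ that cover $\Omega$ up to a null set), and let $0\le c\in L^\infty(\Omega)$. Put $$a(u,v)=(A\nabla u,\nabla v)+(cu,v),\qquad b(u,v)=(u,v)\qquad (u,v\in H^1_0(\Omega)),$$ $\|u\|_a=\sqrt{a(u,u)}$, and $\operatorname{dist}_a(X,Y)=\sup_{u\in X,\|u\|_a=1}\inf_{v\in Y}\|u-v\|_a$. Let $\lambda_1<\dots<\lambda_q$ be the $q$ smallest distinct eigenvalues of the problem $a(u,v)=\lambda b(u,v)$ for all $v\in H_0^1(\Omega)$, with eigenspaces $M(\lambda_i)$ of dimension $d_i$, and let $N=\sum_{i=1}^q d_i$. Let $k\ge1$ and $\gamma^*$ be fixed. Let $\mathscr T_{h_n}$ ($n\ge0$) be conforming simplicial meshes of $\Omega$ with $h_T\le\gamma^*\rho_T$ for all elements $T$ ($h_T$ the diameter of $T$, $\rho_T$ the diameter of the biggest ball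 in $T$), with mesh sizes $h_n\le h_0$, such that the interior of each element lies in one of the pieces on which $A$ is Lipschitz. Let $\mathscr E_{h_n}$ be the set of interior sides of $\mathscr T_{h_n}$, and $V^{h_n}\subset H^1_0(\Omega)$ the space of continuous functions that are polynomials of degree at most $k$ on each element. *FE approximations.* Let $(\lambda^{h_n}_{ij},u^{h_n}_{ij})$, $1\le i\le q$, $1\le j\le d_i$, be the $N$ smallest eigenpairs of $a(u,v)=\lambda b(u,v)$ for all $v\in V^{h_n}$, ordered lexicographically, with $b(u^{h_n}_{ij},u^{h_n}_{kl})=\delta_{ik}\delta_{jl}$; let $M_{h_n}(\lambda_i)=\operatorname{span}_j\{u_{ij}^{h_n}\}$. Let $K_{h_n}:L^2(\Omega)\to V^{h_n}$ be given by $a(K_{h_n}w,v)=b(w,v)$ for all $v\in V^{h_n}$, and $$E^{(i)}_{h_n}=\frac1{2\pi\mathrm i}\int_{\Gamma_i}(z-K_{h_n})^{-1}\,dz,$$ where $\Gamma_i$ is a fixed circle centred at $\lambda_i^{-1}$ such that the reciprocals of all other eigenvalues of the problem on $H_0^1(\Omega)$ lie strictly outside $\Gamma_i$. *ParO approximations.*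 Let $(\lambda^{(n)}_{ij},u^{(n)}_{ij})$ be $N$ pairs with $u_{ij}^{(n)}\in V^{h_n}$, $b(u^{(n)}_{ij},u^{(n)}_{kl})=\delta_{ik}\delta_{jl}$, that solve the projected eigenvalue problem $$a(u^{(n)}_{ij},v)=\lambda^{(n)}_{ij}b(u^{(n)}_{ij},v)\qquad\text{for all } v\in\tilde X_n:=\operatorname{span}_{i,j}\{u^{(n)}_{ij}\};$$ let $\tilde M_n(\lambda_i)=\operatorname{span}_j\{u^{(n)}_{ij}\}$, and let $\tilde E^{(i)}_n=\mathcal P^{(i)}\circ E^{(i)}_{h_n}$, where $\mathcal P^{(i)}$ is the $a$-orthogonal projection onto $\tilde M_n(\lambda_i)$. *Estimators.* For $w\in V^{h_n}$ and an element $T$ put $$\eta_{h_n}^2(w,T)=h_T^2\Big\|\sum_{i,j}b(w,u^{h_n}_{ij})\lambda^{h_n}_{ij}u^{h_n}_{ij}+\nabla\cdot(A\nabla w)-cw\Big\|_{0,T}^2+\sum_{e\in\mathscr E_{h_n},\,e\subset\partial T}h_e\big\|A\nabla w^+\cdot\nu^++A\nabla w^-\cdot\nu^-\big\|_{0,e}^2,$$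 where $e$ is the common side of $T^+$ and $T^-$ with outward unit normals $\nu^\pm$, and $h_e$ is the diameter of $e$ (for $d=1$: the length of the shorter adjacent element). Define $\tilde\eta_{h_n}^2(w,T)$ in the same way with $(\lambda^{(n)}_{ij},u^{(n)}_{ij})$ in place of $(\lambda^{h_n}_{ij},u^{h_n}_{ij})$. For $W=(w_{ij})$ let $\eta_{h_n}^2(W,\Omega)=\sum_{T}\sum_{i,j}\eta_{h_n}^2(w_{ij},T)$, and likewise $\tilde\eta_{h_n}^2(W,\Omega)$. **Proposition.** There are constants $h^*>0$ and $C>0$, independent of the meshes (and of the choice of all approximations), such that the following holds whenever $h_0\le h^*$. If $U=(u_{11},\dots,u_{qd_q})$, where $\{u_{ij}\}_{j=1}^{d_i}$ is a basis of $M(\lambda_i)$ for each $i$ and $b(u_{ij},u_{kl})=\delta_{ik}\delta_{jl}$, and if $\mathcal E_{h_n}U=(E^{(i)}_{h_n}u_{ij})_{i,j}$ and $\tilde{\mathcal E}_nU=(\tilde E^{(i)}_nu_{ij})_{i,j}$, then for every $n\ge0$ $$\left|\eta_{h_n}(\mathcal E_{h_n}U,\Omega)-\tilde\eta_{h_n}(\tilde{\mathcal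 E}_nU,\Omega)\right|^2\le C\sum_{i=1}^q\Big(\operatorname{dist}_a^2\big(M_{h_n}(\lambda_i),\tilde M_n(\lambda_i)\big)+\sum_{j=1}^{d_i}\big|\lambda^{h_n}_{ij}-\lambda^{(n)}_{ij}\big|^2\Big).$$ -/

import Mathlib

open MeasureTheory Set

noncomputable section

namespace ParO

/-- The space `ℝ^d` with its Euclidean norm. -/
abbrev Space (d : ℕ) := EuclideanSpace ℝ (Fin d)

/-- The real Lebesgue space `L²(Ω)`. -/
abbrev L2 {d : ℕ} (Ω : Set (Space d)) := Lp ℝ 2 (volume.restrict Ω)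

/-- The space `L²(Ω; ℝ^d)` of square integrable vector fields. -/
abbrev L2Field {d : ℕ} (Ω : Set (Space d)) := Lp (Space d) 2 (volume.restrict Ω)

/-- The complex Lebesgue space `L²(Ω; ℂ)`. -/
abbrev L2C {d : ℕ} (Ω : Set (Space d)) := Lp ℂ 2 (volume.restrict Ω)

/-! ### Sobolev spaces -/

/-- Smooth functions with compact support in `Ω`. -/
def IsTestFunction {d : ℕ} (Ω : Set (Space d)) (φ : Space d → ℝ) : Prop :=
  ContDiff ℝ (⊤ : ℕ∞) φ ∧ HasCompactSupport φ ∧ tsupport φ ⊆ Ω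

/-- `g ∈ L²(Ω; ℝ^d)` is the weak gradient of `u ∈ L²(Ω)`. -/
def IsWeakGradient {d : ℕ} {Ω : Set (Space d)} (u : L2 Ω) (g : L2Field Ω) : Prop :=
  ∀ φ : Space d → ℝ, IsTestFunction Ω φ →
    ∫ x in Ω, u x • gradient φ x = - ∫ x in Ω, φ x • g x

open Classical in
/-- The weak gradient `∇u` (it is unique when it exists; the value is `0` if there is none). -/
def weakGradient {d : ℕ} {Ω : Set (Space d)} (u : L2 Ω) : L2Field Ω :=
  if h : ∃ g : L2Field Ω, IsWeakGradient u g then h.choose else 0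

/-- The linear space of all pairs `(φ, ∇φ)` in `L²(Ω) × L²(Ω; ℝ^d)` with `φ` a test function. -/
def testGraph {d : ℕ} (Ω : Set (Space d)) : Submodule ℝ (L2 Ω × L2Field Ω) :=
  Submodule.span ℝ {p | ∃ φ : Space d → ℝ, IsTestFunction Ω φ ∧
    p.1 =ᵐ[volume.restrict Ω] φ ∧ p.2 =ᵐ[volume.restrict Ω] gradient φ}

/-- `H₀¹(Ω)`: the closure of the test functions with respect to the `H¹` norm. It is the set of all
`u ∈ L²(Ω)` such that some `(u, g)` is a limit of pairs `(φ, ∇φ)`; then `g` is the weak gradient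
of `u`. -/
def H10 {d : ℕ} (Ω : Set (Space d)) : Submodule ℝ (L2 Ω) :=
  (testGraph Ω).topologicalClosure.map (LinearMap.fst ℝ (L2 Ω) (L2Field Ω))

/-! ### The model problem -/

/-- A polygonal (polyhedral) domain: a nonempty connected open set which is the interior of a
finite union of closed nondegenerate `d`-simplices. -/
def IsPolygonalDomain {d : ℕ} (Ω : Set (Space d)) : Prop :=
  IsOpen Ω ∧ IsConnected Ω ∧
    ∃ S : Finset (Finset (Space d)),
      (∀ s ∈ S, s.card = d + 1 ∧ AffineIndependent ℝ ((↑) : s → Space d)) ∧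
      Ω = interior (⋃ s ∈ S, convexHull ℝ (s : Set (Space d)))

/-- The data of the elliptic operator `u ↦ -∇·(A∇u) + c u` on a polygonal domain `Ω`: `A` is
symmetric, uniformly positive definite and piecewise Lipschitz continuous, and
`0 ≤ c ∈ L^∞(Ω)`. The field `pieces` is the finite family of disjoint open subsets of `Ω`, covering
`Ω` up to a null set, on each of which `A` is Lipschitz continuous. -/
structure ModelProblem (d : ℕ) where
  Ω : Set (Space d)
  A : Space d → Matrix (Fin d) (Fin d) ℝ
  c : Space d → ℝ
  pieces : Finset (Set (Space d))
  polygonal : IsPolygonalDomain Ω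
  symm : ∀ x ∈ Ω, (A x).IsSymm
  elliptic : ∃ α : ℝ, 0 < α ∧ ∀ x ∈ Ω, ∀ ξ : Space d,
    α * ‖ξ‖ ^ 2 ≤ inner ℝ (Matrix.toEuclideanLin (A x) ξ) ξ
  pieces_open : ∀ D ∈ pieces, IsOpen D ∧ D ⊆ Ω
  pieces_disjoint : ∀ D ∈ pieces, ∀ D' ∈ pieces, D ≠ D' → Disjoint D D'
  pieces_cover : volume (Ω \ ⋃ D ∈ pieces, D) = 0
  lipschitz : ∃ L : NNReal, ∀ D ∈ pieces, ∀ r s : Fin d, LipschitzOnWith L (fun x => A x r s) D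
  c_bounded : MemLp c ⊤ (volume.restrict Ω)
  c_nonneg : ∀ᵐ x ∂(volume.restrict Ω), 0 ≤ c x

variable {d : ℕ}

/-- `b(u, v) = (u, v)`, the `L²(Ω)` inner product. -/
def bForm (P : ModelProblem d) (u v : L2 P.Ω) : ℝ := ∫ x in P.Ω, u x * v x

/-- `a(u, v) = (A∇u, ∇v) + (cu, v)`, for `u, v` with weak gradients in `L²`. -/
def aForm (P : ModelProblem d) (u v : L2 P.Ω) : ℝ :=
  (∫ x in P.Ω, inner ℝ (Matrix.toEuclideanLin (P.A x) (weakGradient u x)) (weakGradient v x)) +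
    ∫ x in P.Ω, P.c x * u x * v x

/-- The energy norm `‖u‖_a = √a(u, u)`. -/
def aNorm (P : ModelProblem d) (u : L2 P.Ω) : ℝ := Real.sqrt (aForm P u u)

/-- `dist_a(X, Y) = sup_{u ∈ X, ‖u‖_a = 1} inf_{v ∈ Y} ‖u - v‖_a`. -/
def distA (P : ModelProblem d) (X Y : Submodule ℝ (L2 P.Ω)) : ℝ :=
  ⨆ u : {u : L2 P.Ω // u ∈ X ∧ aNorm P u = 1}, ⨅ v : Y, aNorm P (u.1 - v.1)

/-- `(μ, v)` is an eigenpair in `X`: `0 ≠ v ∈ X` and `a(v, w) = μ b(v, w)` for all `w ∈ X`. -/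
def IsEigenpair (P : ModelProblem d) (X : Submodule ℝ (L2 P.Ω)) (μ : ℝ) (v : L2 P.Ω) : Prop :=
  v ∈ X ∧ v ≠ 0 ∧ ∀ w ∈ X, aForm P v w = μ * bForm P v w

/-- `b(u_ij, u_kl) = δ_ik δ_jl` for a doubly indexed family. -/
def IsBOrthonormal (P : ModelProblem d) {q : ℕ} {m : Fin q → ℕ}
    (u : (i : Fin q) → Fin (m i) → L2 P.Ω) : Prop :=
  (∀ i j, bForm P (u i j) (u i j) = 1) ∧
    ∀ i j i' j', (⟨i, j⟩ : Σ i, Fin (m i)) ≠ ⟨i', j'⟩ → bForm P (u i j) (u i' j') = 0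

/-- `lam 0 < lam 1 < ...` are the `q` smallest distinct eigenvalues of the problem on `H₀¹(Ω)`. -/
def AreSmallestEigenvalues (P : ModelProblem d) {q : ℕ} (lam : Fin q → ℝ) : Prop :=
  StrictMono lam ∧ (∀ i, ∃ v, IsEigenpair P (H10 P.Ω) (lam i) v) ∧
    ∀ μ v, IsEigenpair P (H10 P.Ω) μ v → (∃ i, μ = lam i) ∨ ∀ i, lam i < μ

/-- `(u_{i1}, ..., u_{i m_i})` is a `b`-orthonormal basis of the full eigenspace `M(lam_i)` for each
`i`; in particular `m_i` is the multiplicity of `lam_i`. -/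
def IsEigenbasis (P : ModelProblem d) {q : ℕ} (lam : Fin q → ℝ) {m : Fin q → ℕ}
    (u : (i : Fin q) → Fin (m i) → L2 P.Ω) : Prop :=
  (∀ i j, IsEigenpair P (H10 P.Ω) (lam i) (u i j)) ∧ IsBOrthonormal P u ∧
    ∀ i v, IsEigenpair P (H10 P.Ω) (lam i) v → v ∈ Submodule.span ℝ (range (u i))

/-! ### Meshes and finite element spaces -/

/-- A conforming simplicial mesh of `Ω`: a finite pure `d`-dimensional simplicial complex which
covers the closure of `Ω`. Simplices are given by their sets of vertices. -/
structure Mesh {d : ℕ} (Ω : Set (Space d)) where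
  complex : Geometry.SimplicialComplex ℝ (Space d)
  finite : complex.faces.Finite
  pure : ∀ s ∈ complex.faces, ∃ t ∈ complex.faces, s ⊆ t ∧ t.card = d + 1
  space_eq : complex.space = closure Ω

/-- The closed simplex with the given vertices. -/
def cell (T : Finset (Space d)) : Set (Space d) := convexHull ℝ (T : Set (Space d))

namespace Mesh

variable {Ω : Set (Space d)} (M : Mesh Ω)

open Classical in
/-- The elements `T` of the mesh. -/
def elements : Finset (Finset (Space d)) := M.finite.toFinset.filter (fun T => T.card = d + 1)

open Classical in
/-- The interior sides of the mesh: the `(d-1)`-simplices which are common to two elements. -/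
def sides : Finset (Finset (Space d)) :=
  M.finite.toFinset.filter (fun e => e.card = d ∧
    ∃ T ∈ M.elements, ∃ T' ∈ M.elements, T ≠ T' ∧ e ⊆ T ∧ e ⊆ T')

/-- The mesh size `h = max h_T`, where `h_T` is the diameter of `T`. -/
def size : ℝ := ⨆ T : M.elements, Metric.diam (cell T.1)

/-- Shape regularity: `h_T ≤ γ ρ_T`, where `ρ_T` is the diameter of the biggest ball in `T`. -/
def ShapeRegular (γ : ℝ) : Prop :=
  ∀ T ∈ M.elements, Metric.diam (cell T) ≤
    γ * (2 * sSup {r : ℝ | 0 < r ∧ ∃ x, Metric.closedBall x r ⊆ cell T})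

end Mesh

/-- The mesh resolves the discontinuities of `A`: each open element lies in one of the pieces on
which `A` is Lipschitz continuous. -/
def Resolves {P : ModelProblem d} (M : Mesh P.Ω) : Prop :=
  ∀ T ∈ M.elements, ∃ D ∈ P.pieces, interior (cell T) ⊆ D

/-- `v` is continuous on the closure of `Ω` and a polynomial of degree at most `k` on each
element. -/
def IsPiecewisePolynomial {Ω : Set (Space d)} (M : Mesh Ω) (k : ℕ) (v : Space d → ℝ) : Prop :=
  ContinuousOn v (closure Ω) ∧ ∀ T ∈ M.elements, ∃ p : MvPolynomial (Fin d) ℝ,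
    p.totalDegree ≤ k ∧ ∀ x ∈ cell T, v x = MvPolynomial.eval (fun i => x i) p

/-- The space `S^h(Ω)`, as a subspace of `L²(Ω)`. -/
def feSpace {Ω : Set (Space d)} (M : Mesh Ω) (k : ℕ) : Submodule ℝ (L2 Ω) where
  carrier := {w | ∃ v, IsPiecewisePolynomial M k v ∧ w =ᵐ[volume.restrict Ω] v}
  zero_mem' := ⟨0, ⟨continuousOn_const, fun _ _ => ⟨0, by simp, by simp⟩⟩, Lp.coeFn_zero _ _ _⟩
  add_mem' := by
    rintro w w' ⟨v, ⟨hc, hp⟩, hw⟩ ⟨v', ⟨hc', hp'⟩, hw'⟩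
    refine ⟨v + v', ⟨hc.add hc', fun T hT => ?_⟩, (Lp.coeFn_add w w').trans (hw.add hw')⟩
    obtain ⟨p, hd, hv⟩ := hp T hT
    obtain ⟨p', hd', hv'⟩ := hp' T hT
    exact ⟨p + p', (MvPolynomial.totalDegree_add p p').trans (max_le hd hd'),
      fun x hx => by simp [hv x hx, hv' x hx]⟩
  smul_mem' := by
    rintro r w ⟨v, ⟨hc, hp⟩, hw⟩
    refine ⟨r • v, ⟨hc.const_smul r, fun T hT => ?_⟩,
      (Lp.coeFn_smul r w).trans (hw.const_smul r)⟩
    obtain ⟨p, hd, hv⟩ := hp T hT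
    exact ⟨r • p, (MvPolynomial.totalDegree_smul_le r p).trans hd,
      fun x hx => by simp [hv x hx]⟩

/-- The finite element space `V^h = S^h(Ω) ∩ H₀¹(Ω)`. -/
def Vh {Ω : Set (Space d)} (M : Mesh Ω) (k : ℕ) : Submodule ℝ (L2 Ω) := feSpace M k ⊓ H10 Ω

open Classical in
/-- The continuous piecewise polynomial representative of a finite element function (it is unique
on the closure of `Ω`; the value is `0` if there is none). -/
def feRep {Ω : Set (Space d)} (M : Mesh Ω) (k : ℕ) (w : L2 Ω) : Space d → ℝ :=
  if h : ∃ v, IsPiecewisePolynomial M k v ∧ w =ᵐ[volume.restrict Ω] v then h.choose else 0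

/-- `(lam_ij, u_ij)` are the smallest eigenpairs of the discretization in `V`, in lexicographic
order and with `b`-orthonormal eigenfunctions: every further eigenfunction, orthogonal to these,
belongs to an eigenvalue which is at least as large. -/
def AreSmallestDiscreteEigenpairs (P : ModelProblem d) (V : Submodule ℝ (L2 P.Ω)) {q : ℕ}
    {m : Fin q → ℕ} (lam : (i : Fin q) → Fin (m i) → ℝ)
    (u : (i : Fin q) → Fin (m i) → L2 P.Ω) : Prop :=
  (∀ i j, IsEigenpair P V (lam i j) (u i j)) ∧ IsBOrthonormal P u ∧
    (∀ i j j', j ≤ j' → lam i j ≤ lam i j') ∧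
    (∀ i i' j j', i < i' → lam i j ≤ lam i' j') ∧
    ∀ μ v, IsEigenpair P V μ v → (∀ i j, bForm P v (u i j) = 0) → ∀ i j, lam i j ≤ μ

/-- `(lam_ij, u_ij)` are `N` eigenpair approximations in `V` which solve the projected eigenvalue
problem in the subspace `X` that they span, with `b`-orthonormal eigenvectors. -/
def AreParOApproximations (P : ModelProblem d) (V : Submodule ℝ (L2 P.Ω)) {q : ℕ}
    {m : Fin q → ℕ} (lam : (i : Fin q) → Fin (m i) → ℝ)
    (u : (i : Fin q) → Fin (m i) → L2 P.Ω) : Prop :=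
  ∃ X : Submodule ℝ (L2 P.Ω), X ≤ V ∧ X = Submodule.span ℝ {w | ∃ i j, w = u i j} ∧
    (∀ i j, IsEigenpair P X (lam i j) (u i j)) ∧ IsBOrthonormal P u

/-! ### Spectral projections -/

open Classical in
/-- The solution operator `K : L²(Ω) → V` with `a(K w, v) = b(w, v)` for all `w ∈ L²(Ω)`, `v ∈ V`
(it exists and is unique for a finite dimensional subspace `V` of `H₀¹(Ω)`, by coercivity). -/
def solutionOperator (P : ModelProblem d) (V : Submodule ℝ (L2 P.Ω)) : L2 P.Ω →L[ℝ] L2 P.Ω :=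
  if h : ∃ K : L2 P.Ω →L[ℝ] L2 P.Ω, ∀ w, K w ∈ V ∧ ∀ v ∈ V, aForm P (K w) v = bForm P w v
  then h.choose else 0

/-- The inclusion of `L²(Ω)` into `L²(Ω; ℂ)`. -/
def toComplex (Ω : Set (Space d)) : L2 Ω →L[ℝ] L2C Ω :=
  Complex.ofRealCLM.compLpL 2 (volume.restrict Ω)

/-- The real part of an element of `L²(Ω; ℂ)`. -/
def rePart (Ω : Set (Space d)) : L2C Ω →L[ℝ] L2 Ω :=
  Complex.reCLM.compLpL 2 (volume.restrict Ω)

/-- The imaginary part of an element of `L²(Ω; ℂ)`. -/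
def imPart (Ω : Set (Space d)) : L2C Ω →L[ℝ] L2 Ω :=
  Complex.imCLM.compLpL 2 (volume.restrict Ω)

theorem rePart_smul (Ω : Set (Space d)) (z : ℂ) (w : L2C Ω) :
    rePart Ω (z • w) = z.re • rePart Ω w - z.im • imPart Ω w := by
  apply Lp.ext
  filter_upwards [Complex.reCLM.coeFn_compLpL (p := 2) (μ := volume.restrict Ω) (z • w),
    Complex.reCLM.coeFn_compLpL (p := 2) (μ := volume.restrict Ω) w,
    Complex.imCLM.coeFn_compLpL (p := 2) (μ := volume.restrict Ω) w,
    Lp.coeFn_smul z w, Lp.coeFn_sub (z.re • rePart Ω w) (z.im • imPart Ω w),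
    Lp.coeFn_smul z.re (rePart Ω w), Lp.coeFn_smul z.im (imPart Ω w)] with x h1 h2 h3 h4 h5 h6 h7
  rw [h5, Pi.sub_apply, h6, h7, Pi.smul_apply, Pi.smul_apply]
  simp only [rePart, imPart]
  rw [h1, h2, h3, h4]
  simp [Complex.mul_re]

theorem imPart_smul (Ω : Set (Space d)) (z : ℂ) (w : L2C Ω) :
    imPart Ω (z • w) = z.re • imPart Ω w + z.im • rePart Ω w := by
  apply Lp.ext
  filter_upwards [Complex.imCLM.coeFn_compLpL (p := 2) (μ := volume.restrict Ω) (z • w),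
    Complex.reCLM.coeFn_compLpL (p := 2) (μ := volume.restrict Ω) w,
    Complex.imCLM.coeFn_compLpL (p := 2) (μ := volume.restrict Ω) w,
    Lp.coeFn_smul z w, Lp.coeFn_add (z.re • imPart Ω w) (z.im • rePart Ω w),
    Lp.coeFn_smul z.re (imPart Ω w), Lp.coeFn_smul z.im (rePart Ω w)] with x h1 h2 h3 h4 h5 h6 h7
  rw [h5, Pi.add_apply, h6, h7, Pi.smul_apply, Pi.smul_apply]
  simp only [rePart, imPart]
  rw [h1, h2, h3, h4]
  simp [Complex.mul_im]

/-- The complex linear extension of a real operator: `K(u + i v) = K u + i K v`. -/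
def complexify {Ω : Set (Space d)} (K : L2 Ω →L[ℝ] L2 Ω) : L2C Ω →L[ℂ] L2C Ω where
  toFun w := toComplex Ω (K (rePart Ω w)) + Complex.I • toComplex Ω (K (imPart Ω w))
  map_add' w w' := by simp only [map_add, smul_add]; abel
  map_smul' z w := by
    have hz : ∀ (t : ℝ) (y : L2C Ω), t • y = (t : ℂ) • y := fun t y => (Complex.coe_smul t y).symm
    simp only [rePart_smul, imPart_smul, map_add, map_sub, map_smul, hz, RingHom.id_apply]
    generalize toComplex Ω (K (rePart Ω w)) = p
    generalize toComplex Ω (K (imPart Ω w)) = s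
    have h : z = (z.re : ℂ) + (z.im : ℂ) * Complex.I := (Complex.re_add_im z).symm
    have hI : Complex.I * Complex.I = -1 := Complex.I_mul_I
    conv_rhs => rw [h]
    have e : ((z.im : ℂ) * Complex.I) • Complex.I • s = -((z.im : ℂ) • s) := by
      rw [smul_smul, mul_assoc, hI, mul_neg_one, neg_smul]
    simp only [smul_add, add_smul, e]
    simp only [smul_smul, mul_comm]
    abel
  cont := by fun_prop

/-- The spectral projection `(2πi)⁻¹ ∮_Γ (z - K)⁻¹ dz`, where `Γ` is the circle with the given
centre and radius. -/
def spectralProjection {Ω : Set (Space d)} (K : L2C Ω →L[ℂ] L2C Ω) (z₀ : ℂ) (r : ℝ) :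
    L2C Ω →L[ℂ] L2C Ω :=
  ((2 * Real.pi * Complex.I : ℂ)⁻¹) • ∮ z in C(z₀, r), resolvent K z

/-- `E_h u`, where `E_h` is the spectral projection that belongs to the solution operator `K_h` on
`V` and the circle of radius `r` around `lam⁻¹`. (The operator `K_h` is real and the circle is
symmetric about the real axis, so `E_h u` is real for real `u`.) -/
def feProjection (P : ModelProblem d) (V : Submodule ℝ (L2 P.Ω)) (lam r : ℝ) (u : L2 P.Ω) :
    L2 P.Ω :=
  rePart P.Ω (spectralProjection (complexify (solutionOperator P V)) ((lam⁻¹ : ℝ) : ℂ) r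
    (toComplex P.Ω u))

open Classical in
/-- The `a`-orthogonal projection onto `Y` (unique for `Y ⊆ H₀¹(Ω)`, and it exists for finite
dimensional `Y`; the value is `0` if it does not exist). -/
def aProjection (P : ModelProblem d) (Y : Submodule ℝ (L2 P.Ω)) (w : L2 P.Ω) : L2 P.Ω :=
  if h : ∃ p ∈ Y, ∀ v ∈ Y, aForm P (w - p) v = 0 then h.choose else 0

/-! ### Error estimators -/

/-- The classical divergence `∇·F = ∑ ∂_i F_i` (defined almost everywhere for Lipschitz `F`). -/
def divergence (F : Space d → Space d) (x : Space d) : ℝ :=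
  ∑ i, fderiv ℝ (fun y => F y i) x (EuclideanSpace.single i 1)

/-- The flux `A∇w` of a finite element function, inside the elements. -/
def flux (P : ModelProblem d) (M : Mesh P.Ω) (k : ℕ) (w : L2 P.Ω) (x : Space d) : Space d :=
  Matrix.toEuclideanLin (P.A x) (gradient (feRep M k w) x)

/-- The element residual `∑_{i,j} b(w, u_ij) lam_ij u_ij + ∇·(A∇w) - c w`. -/
def elementResidual (P : ModelProblem d) (M : Mesh P.Ω) (k : ℕ) {q : ℕ} {m : Fin q → ℕ}
    (lam : (i : Fin q) → Fin (m i) → ℝ) (u : (i : Fin q) → Fin (m i) → L2 P.Ω)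
    (w : L2 P.Ω) (x : Space d) : ℝ :=
  (∑ i, ∑ j, bForm P w (u i j) * lam i j * u i j x) + divergence (flux P M k w) x
    - P.c x * feRep M k w x

open Classical in
/-- The unit normal of the side `e` of the simplex `T` which points out of `T`. -/
def outwardNormal (T e : Finset (Space d)) : Space d :=
  if h : ∃ ν : Space d, ‖ν‖ = 1 ∧ (∀ x ∈ e, ∀ y ∈ e, inner ℝ ν (x - y) = 0) ∧
    ∀ x ∈ T, ∀ y ∈ e, inner ℝ ν (x - y) ≤ 0 then h.choose else 0

open Classical in
/-- The jump residual `-A∇w⁺·ν⁺ - A∇w⁻·ν⁻` on the side `e` of the two elements `T⁺, T⁻`: the sum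
over these elements, with the traces of the fluxes from the interior of each of them. -/
def jumpResidual (P : ModelProblem d) (M : Mesh P.Ω) (k : ℕ) (w : L2 P.Ω)
    (e : Finset (Space d)) (x : Space d) : ℝ :=
  ∑ T ∈ M.elements.filter (fun T => e ⊆ T),
    -inner ℝ (extendFrom (interior (cell T)) (flux P M k w) x) (outwardNormal T e)

/-- The size `h_e` of a side: its diameter. In dimension one, where sides are points, it is the
length of the shorter one of the adjacent elements. -/
def sideSize {Ω : Set (Space d)} (M : Mesh Ω) (e : Finset (Space d)) : ℝ :=
  if d = 1 then ⨅ T : {T : Finset (Space d) // T ∈ M.elements ∧ e ⊆ T}, Metric.diam (cell T.1)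
  else Metric.diam (cell e)

open Classical in
/-- The square of the local error indicator,
`h_T² ‖R_T(w)‖²_{0,T} + ∑_{e ⊆ ∂T} h_e ‖J_e(w)‖²_{0,e}`, built from the pairs `(lam_ij, u_ij)`.
The surface measure on the sides is the `(d-1)`-dimensional Hausdorff measure. -/
def localIndicatorSq (P : ModelProblem d) (M : Mesh P.Ω) (k : ℕ) {q : ℕ} {m : Fin q → ℕ}
    (lam : (i : Fin q) → Fin (m i) → ℝ) (u : (i : Fin q) → Fin (m i) → L2 P.Ω)
    (w : L2 P.Ω) (T : Finset (Space d)) : ℝ :=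
  Metric.diam (cell T) ^ 2 * (∫ x in cell T, elementResidual P M k lam u w x ^ 2) +
    ∑ e ∈ M.sides.filter (fun e => e ⊆ T),
      sideSize M e * ∫ x in cell e, jumpResidual P M k w e x ^ 2 ∂(μHE[d - 1])

/-- The global error estimator of a family `W`, built from the pairs `(lam_ij, u_ij)`. -/
def estimator (P : ModelProblem d) (M : Mesh P.Ω) (k : ℕ) {q : ℕ} {m : Fin q → ℕ}
    (lam : (i : Fin q) → Fin (m i) → ℝ) (u : (i : Fin q) → Fin (m i) → L2 P.Ω)
    (W : (i : Fin q) → Fin (m i) → L2 P.Ω) : ℝ :=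
  Real.sqrt (∑ T ∈ M.elements, ∑ i, ∑ j, localIndicatorSq P M k lam u (W i j) T)

end ParO

end

/-!
The error estimator is an `ℓ²` combination of weighted `L²` norms of residuals. By the reverse
triangle inequality, the difference of two estimators is bounded by the same combination of norms of
the differences of the residuals. Inverse inequalities on shape regular elements, which come from
the equivalence of norms on polynomials of bounded degree on a reference ball
(`exists_inverse_inequality`), absorb the powers of the mesh size: `h_T² ‖∇·(A∇p)‖²` and
`h_e ‖J_e‖²` are bounded by `‖∇p‖²` (`exists_divConormal_le`, `exists_jump_le`). Since a side belongs
to at most two elements, summation over the mesh shows that the difference of the estimators is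
bounded by the `L²` norms of the differences of the source terms `∑ b(w, u_ij) λ_ij u_ij`
(`weightedSum`), of the finite element functions, and of their gradients (`exists_estimator_sub_le`).

To identify the discrete spectral projections, fix an eigenbasis of the first `q` eigenspaces.
Rellich's theorem (`isCompactOperator_fst`) and Poincaré's inequality (`exists_poincare`) yield a
next eigenvalue `Λ`, which bounds the Rayleigh quotient on the orthogonal complement from below
(`exists_next_eigenvalue`). As `1 / Λ` lies outside the circles, so does the interval `[0, 1 / Λ]`.
Nodal interpolation of test functions shows that `H₀¹` functions are approximated by finite element
functions on all fine shape regular meshes (`exists_approx`). A min-max argument then places each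
discrete eigenvalue of the cluster at or slightly above the exact one, and all further discrete
eigenvalues above `Λ` (`IsEigenfamily.eigenvalue_le`, `IsEigenfamily.sqrt_eigenvalue_mul_le`,
`IsEigenfamily.next_le`). So on fine meshes the contour integral of the resolvent around `1 / λ_i` is
the `L²` orthogonal projection onto the span of the discrete eigenfunctions `uh_ij` with this `i`,
and the discrete eigenvalues in question are bounded (`exists_discrete_bounds`).

It remains to compare `w`, the spectral projection of an eigenfunction, with its `a`-orthogonal
projection `p` onto the span of the `un_ij`. The energy norm of `w - p` is at most the distance
`dist_a` of the two spans times the energy norm of `w` (`aNorm_sub_le_distA`), and by coercivity it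
controls the `L²` norms of `w - p` and of its gradient. The source term of `w` represents the
functional `a(w, ·)` on the finite element space. The `un_ij` solve a projected eigenvalue problem,
so the source term of `p` is the `L²` orthogonal projection of the source term of `w` onto the span
of the `un_ij`. Being the best `L²` approximation, it is at least as close as the `a`-orthogonal
projection of the source term of `w`, whose distance is again controlled by `dist_a`
(`IsEigenfamily.sub_projection_le`, `sub_aProjection_le`). This comparison does not use that
`λ_ij^h` and `λ_ij^(n)` are close to each other, so the bound holds with `dist_a` alone, and the
nonnegative differences of the eigenvalues only enlarge the right-hand side.
-/

noncomputable section

namespace ParO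

variable {d : ℕ}

open scoped Topology InnerProductSpace ENNReal

/-! ### Weak gradients and `H₀¹` -/

section Sobolev

variable {Ω : Set (Space d)}

theorem IsTestFunction.mono {D : Set (Space d)} {φ : Space d → ℝ} (h : IsTestFunction D φ)
    (hD : D ⊆ Ω) : IsTestFunction Ω φ := ⟨h.1, h.2.1, h.2.2.trans hD⟩

theorem continuous_gradient {f : Space d → ℝ} (h : ContDiff ℝ 1 f) : Continuous (gradient f) :=
  (InnerProductSpace.toDual ℝ (Space d)).symm.continuous.comp (h.continuous_fderiv one_ne_zero)

theorem hasCompactSupport_gradient {f : Space d → ℝ} (h : HasCompactSupport f) :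
    HasCompactSupport (gradient f) :=
  (h.fderiv ℝ).comp_left (g := (InnerProductSpace.toDual ℝ (Space d)).symm) (map_zero _)

theorem IsTestFunction.continuous {φ : Space d → ℝ} (h : IsTestFunction Ω φ) : Continuous φ :=
  h.1.continuous

theorem IsTestFunction.contDiff_one {φ : Space d → ℝ} (h : IsTestFunction Ω φ) :
    ContDiff ℝ 1 φ := h.1.of_le (by exact_mod_cast le_top)

theorem IsTestFunction.differentiable {φ : Space d → ℝ} (h : IsTestFunction Ω φ) :
    Differentiable ℝ φ := h.contDiff_one.differentiable one_ne_zero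

theorem IsTestFunction.memLp {φ : Space d → ℝ} (h : IsTestFunction Ω φ) (μ : Measure (Space d))
    [IsFiniteMeasureOnCompacts μ] : MemLp φ 2 μ :=
  h.continuous.memLp_of_hasCompactSupport h.2.1

theorem IsTestFunction.memLp_gradient {φ : Space d → ℝ} (h : IsTestFunction Ω φ)
    (μ : Measure (Space d)) [IsFiniteMeasureOnCompacts μ] : MemLp (gradient φ) 2 μ :=
  (continuous_gradient h.contDiff_one).memLp_of_hasCompactSupport (hasCompactSupport_gradient h.2.1)

theorem IsTestFunction.memLp_smul_const {φ : Space d → ℝ} (h : IsTestFunction Ω φ)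
    (μ : Measure (Space d)) [IsFiniteMeasureOnCompacts μ] (v : Space d) :
    MemLp (fun x => φ x • v) 2 μ :=
  (h.continuous.smul continuous_const).memLp_of_hasCompactSupport
    (h.2.1.mono fun x hx h0 => hx (by simp [h0]))

theorem IsTestFunction.memLp_inner_gradient {φ : Space d → ℝ} (h : IsTestFunction Ω φ)
    (μ : Measure (Space d)) [IsFiniteMeasureOnCompacts μ] (v : Space d) :
    MemLp (fun x => ⟪gradient φ x, v⟫_ℝ) 2 μ :=
  (h.memLp_gradient μ).inner_const v

theorem IsTestFunction.eq_zero {φ : Space d → ℝ} (h : IsTestFunction Ω φ) {x : Space d}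
    (hx : x ∉ Ω) : φ x = 0 :=
  image_eq_zero_of_notMem_tsupport fun hx' => hx (h.2.2 hx')

theorem IsTestFunction.gradient_eq_zero {φ : Space d → ℝ} (h : IsTestFunction Ω φ) {x : Space d}
    (hx : x ∉ Ω) : gradient φ x = 0 := by
  have : x ∉ tsupport (fderiv ℝ φ) := fun hx' => hx (h.2.2 (tsupport_fderiv_subset ℝ hx'))
  rw [gradient, image_eq_zero_of_notMem_tsupport this, map_zero]

/-- The weak gradient condition, tested with one function and in one direction at a time, as an
identity between continuous linear functionals. -/
theorem isWeakGradient_iff (u : L2 Ω) (g : L2Field Ω) :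
    IsWeakGradient u g ↔ ∀ φ (h : IsTestFunction Ω φ) (v : Space d),
      ⟪(h.memLp_inner_gradient (volume.restrict Ω) v).toLp, u⟫_ℝ
        + ⟪(h.memLp_smul_const (volume.restrict Ω) v).toLp, g⟫_ℝ = 0 := by
  have hint1 : ∀ φ (h : IsTestFunction Ω φ),
      Integrable (fun x => u x • gradient φ x) (volume.restrict Ω) := fun φ h =>
    memLp_one_iff_integrable.1 ((h.memLp_gradient (volume.restrict Ω)).smul (Lp.memLp u))
  have hint2 : ∀ φ (h : IsTestFunction Ω φ),
      Integrable (fun x => φ x • g x) (volume.restrict Ω) := fun φ h =>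
    memLp_one_iff_integrable.1 ((Lp.memLp g).smul (h.memLp (volume.restrict Ω)))
  have key1 : ∀ φ (h : IsTestFunction Ω φ) (v : Space d),
      ⟪(h.memLp_inner_gradient (volume.restrict Ω) v).toLp, u⟫_ℝ
        = ⟪v, ∫ x in Ω, u x • gradient φ x⟫_ℝ := by
    intro φ h v
    rw [← integral_inner (hint1 φ h), L2.inner_def]
    refine integral_congr_ae ?_
    filter_upwards [MemLp.coeFn_toLp (h.memLp_inner_gradient (volume.restrict Ω) v)]
      with x hx
    rw [hx, real_inner_smul_right, real_inner_comm v]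
    simp
  have key2 : ∀ φ (h : IsTestFunction Ω φ) (v : Space d),
      ⟪(h.memLp_smul_const (volume.restrict Ω) v).toLp, g⟫_ℝ
        = ⟪v, ∫ x in Ω, φ x • g x⟫_ℝ := by
    intro φ h v
    rw [← integral_inner (hint2 φ h), L2.inner_def]
    refine integral_congr_ae ?_
    filter_upwards [MemLp.coeFn_toLp (h.memLp_smul_const (volume.restrict Ω) v)] with x hx
    rw [hx]
    simp [real_inner_smul_right, real_inner_smul_left]
  constructor
  · intro H φ h v
    rw [key1 φ h, key2 φ h, H φ h, inner_neg_right]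
    ring
  · intro H φ h
    refine ext_inner_left ℝ fun v => ?_
    have := H φ h v
    rw [key1 φ h, key2 φ h] at this
    rw [inner_neg_right]
    linarith

/-- Weak gradients pass to limits in `L²`. -/
theorem isClosed_isWeakGradient :
    IsClosed {p : L2 Ω × L2Field Ω | IsWeakGradient p.1 p.2} := by
  simp only [isWeakGradient_iff, ofPred_forall]
  refine isClosed_iInter fun φ => isClosed_iInter fun h => isClosed_iInter fun v => ?_
  exact isClosed_eq (by fun_prop) continuous_const

theorem IsWeakGradient.add {u u' : L2 Ω} {g g' : L2Field Ω} (h : IsWeakGradient u g)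
    (h' : IsWeakGradient u' g') : IsWeakGradient (u + u') (g + g') := by
  rw [isWeakGradient_iff] at *
  intro φ hφ v
  rw [inner_add_right, inner_add_right]
  linarith [h φ hφ v, h' φ hφ v]

theorem IsWeakGradient.smul {u : L2 Ω} {g : L2Field Ω} (h : IsWeakGradient u g) (t : ℝ) :
    IsWeakGradient (t • u) (t • g) := by
  rw [isWeakGradient_iff] at *
  intro φ hφ v
  rw [inner_smul_right, inner_smul_right, ← mul_add, h φ hφ v, mul_zero]

theorem isWeakGradient_zero : IsWeakGradient (0 : L2 Ω) 0 := by
  rw [isWeakGradient_iff]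
  intro φ hφ v
  simp

/-- Integration by parts against a test function. -/
theorem integral_smul_gradient {f φ : Space d → ℝ} (hf : ContDiff ℝ 1 f)
    (hφ : IsTestFunction Ω φ) :
    ∫ x in Ω, f x • gradient φ x = - ∫ x in Ω, φ x • gradient f x := by
  rw [setIntegral_eq_integral_of_forall_compl_eq_zero
      (fun x hx => by rw [hφ.gradient_eq_zero hx, smul_zero]),
    setIntegral_eq_integral_of_forall_compl_eq_zero
      (fun x hx => by rw [hφ.eq_zero hx, zero_smul])]
  have hc1 : Continuous fun x => f x • gradient φ x :=
    hf.continuous.smul (continuous_gradient hφ.contDiff_one)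
  have hc2 : Continuous fun x => φ x • gradient f x :=
    hφ.continuous.smul (continuous_gradient hf)
  have hs1 : HasCompactSupport fun x => f x • gradient φ x :=

    (hasCompactSupport_gradient hφ.2.1).mono fun x hx h0 => hx (by simp [h0])
  have hs2 : HasCompactSupport fun x => φ x • gradient f x :=
    hφ.2.1.mono fun x hx h0 => hx (by simp [h0])
  have hi1 : Integrable fun x => f x • gradient φ x := hc1.integrable_of_hasCompactSupport hs1
  have hi2 : Integrable fun x => φ x • gradient f x := hc2.integrable_of_hasCompactSupport hs2
  refine ext_inner_left ℝ fun v => ?_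
  rw [inner_neg_right, ← integral_inner hi1, ← integral_inner hi2]
  have e1 : (fun x => ⟪v, f x • gradient φ x⟫_ℝ) = fun x => f x * fderiv ℝ φ x v := by
    funext x
    rw [real_inner_smul_right, inner_gradient_right]; simp
  have e2 : (fun x => ⟪v, φ x • gradient f x⟫_ℝ) = fun x => fderiv ℝ f x v * φ x := by
    funext x
    rw [real_inner_smul_right, inner_gradient_right]; simp [mul_comm]
  have hi1' := hi1.const_inner (𝕜 := ℝ) v
  have hi2' := hi2.const_inner (𝕜 := ℝ) v
  rw [e1] at hi1' ⊢
  rw [e2] at hi2' ⊢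
  refine integral_mul_fderiv_eq_neg_fderiv_mul_of_integrable hi2' hi1' ?_ ?_ ?_
  · exact (hf.continuous.mul hφ.continuous).integrable_of_hasCompactSupport
      (hφ.2.1.mono fun x hx h0 => hx (by simp [h0]))
  · exact fun x _ => (hf.differentiable one_ne_zero) x
  · exact fun x _ => hφ.differentiable x

theorem isWeakGradient_of_ae_eq {f : Space d → ℝ} (hf : ContDiff ℝ 1 f) {u : L2 Ω}
    {g : L2Field Ω} (hu : u =ᵐ[volume.restrict Ω] f) (hg : g =ᵐ[volume.restrict Ω] gradient f) :
    IsWeakGradient u g := by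
  intro φ hφ
  rw [integral_congr_ae (g := fun x => f x • gradient φ x),
    integral_smul_gradient hf hφ, integral_congr_ae (f := fun x => φ x • g x)]
  · filter_upwards [hg] with x hx
    rw [hx]
  · filter_upwards [hu] with x hx
    rw [hx]

/-- The second component of a limit of pairs `(φ, ∇φ)` is a weak gradient of the first one. Hence
the junk value of `weakGradient` does not occur on `H₀¹(Ω)`. -/
theorem isWeakGradient_of_mem_closure {p : L2 Ω × L2Field Ω}
    (hp : p ∈ (testGraph Ω).topologicalClosure) : IsWeakGradient p.1 p.2 := by
  have hsub : (testGraph Ω : Set (L2 Ω × L2Field Ω)) ⊆ {p | IsWeakGradient p.1 p.2} := by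
    intro p hp
    refine Submodule.span_induction (p := fun p _ => IsWeakGradient p.1 p.2) ?_ ?_ ?_ ?_ hp
    · rintro x ⟨φ, hφ, h1, h2⟩
      exact isWeakGradient_of_ae_eq hφ.contDiff_one h1 h2
    · exact isWeakGradient_zero
    · exact fun x y _ _ hx hy => hx.add hy
    · exact fun t x _ hx => hx.smul t
  exact closure_minimal hsub isClosed_isWeakGradient hp

/-- A weak gradient is determined, on open sets where the function is smooth, by the classical
gradient. -/
theorem IsWeakGradient.ae_eq_gradient {u : L2 Ω} {g : L2Field Ω} (h : IsWeakGradient u g)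
    (hΩm : MeasurableSet Ω) {D : Set (Space d)} (hD : IsOpen D) (hDΩ : D ⊆ Ω)
    {f : Space d → ℝ} (hf : ContDiff ℝ 1 f) (hu : u =ᵐ[volume.restrict D] f) :
    g =ᵐ[volume.restrict D] gradient f := by
  have hDm := hD.measurableSet
  have hg2 : MemLp g 2 (volume.restrict D) :=
    (Lp.memLp g).mono_measure (Measure.restrict_mono hDΩ le_rfl)
  have hloc : LocallyIntegrableOn (fun x => g x - gradient f x) D volume := by
    rw [locallyIntegrableOn_iff hD.isLocallyClosed]
    intro K hKD hK
    have : IsFiniteMeasure (volume.restrict K) := ⟨by simpa using hK.measure_lt_top⟩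
    refine Integrable.sub ?_ ((continuous_gradient hf).continuousOn.integrableOn_compact hK)
    exact (hg2.mono_measure (Measure.restrict_mono hKD le_rfl)).integrable (by norm_num)
  have key := hD.ae_eq_zero_of_integral_contDiff_smul_eq_zero hloc (fun φ h1 h2 h3 => by
    have hφD : IsTestFunction D φ := ⟨h1, h2, h3⟩
    have hφ := hφD.mono hDΩ
    have e1 := h φ hφ
    have e2 := integral_smul_gradient hf hφD
    have r1 : ∫ x in Ω, u x • gradient φ x = ∫ x in D, u x • gradient φ x :=
      (setIntegral_eq_of_subset_of_forall_sdiff_eq_zero hΩm hDΩ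
        fun x hx => by rw [hφD.gradient_eq_zero hx.2, smul_zero])
    have r2 : ∫ x in Ω, φ x • g x = ∫ x in D, φ x • g x :=
      (setIntegral_eq_of_subset_of_forall_sdiff_eq_zero hΩm hDΩ
        fun x hx => by rw [hφD.eq_zero hx.2, zero_smul])
    have r3 : ∫ x in D, u x • gradient φ x = ∫ x in D, f x • gradient φ x := by
      refine integral_congr_ae ?_
      filter_upwards [hu] with x hx
      rw [hx]
    rw [← setIntegral_eq_integral_of_forall_compl_eq_zero (s := D)
      (fun x hx => by rw [hφD.eq_zero hx, zero_smul])]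
    simp only [smul_sub]
    rw [integral_sub]
    · rw [r1, r2, r3, e2, neg_inj] at e1
      rw [e1, sub_self]
    · exact memLp_one_iff_integrable.1 (hg2.smul (hφ.memLp (volume.restrict D)))
    · exact ((hφ.continuous.smul (continuous_gradient hf)).integrable_of_hasCompactSupport
        (hφ.2.1.mono fun x hx h0 => hx (by simp [h0]))).integrableOn)
  rw [Filter.EventuallyEq, ae_restrict_iff' hDm]
  filter_upwards [key] with x hx hxD
  exact sub_eq_zero.1 (hx hxD)

/-- By the fundamental lemma of the calculus of variations. -/
theorem IsWeakGradient.unique (hΩ : IsOpen Ω) {u : L2 Ω} {g g' : L2Field Ω}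
    (h : IsWeakGradient u g) (h' : IsWeakGradient u g') : g = g' := by
  have h0 : IsWeakGradient (0 : L2 Ω) (g - g') := by
    simpa [sub_eq_add_neg] using h.add (h'.smul (-1))
  have := h0.ae_eq_gradient hΩ.measurableSet hΩ subset_rfl (contDiff_const (c := (0 : ℝ)))
    (Lp.coeFn_zero ℝ 2 (volume.restrict Ω))
  rw [← sub_eq_zero]
  refine Lp.ext ?_
  filter_upwards [this, Lp.coeFn_zero (Space d) 2 (volume.restrict Ω)] with x hx h0
  rw [hx, h0]
  simp [gradient]

theorem IsWeakGradient.weakGradient_eq (hΩ : IsOpen Ω) {u : L2 Ω} {g : L2Field Ω}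
    (h : IsWeakGradient u g) : weakGradient u = g := by
  have hex : ∃ g : L2Field Ω, IsWeakGradient u g := ⟨g, h⟩
  rw [weakGradient, dif_pos hex]
  exact hex.choose_spec.unique hΩ h

theorem mem_H10_iff (hΩ : IsOpen Ω) {u : L2 Ω} :
    u ∈ H10 Ω ↔ (u, weakGradient u) ∈ (testGraph Ω).topologicalClosure := by
  constructor
  · rintro ⟨p, hp, rfl⟩
    have := (isWeakGradient_of_mem_closure hp).weakGradient_eq hΩ
    simp only [LinearMap.fst_apply, this]
    exact hp
  · exact fun h => ⟨_, h, rfl⟩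

theorem isWeakGradient_weakGradient (hΩ : IsOpen Ω) {u : L2 Ω} (hu : u ∈ H10 Ω) :
    IsWeakGradient u (weakGradient u) :=
  isWeakGradient_of_mem_closure ((mem_H10_iff hΩ).1 hu)

theorem weakGradient_add (hΩ : IsOpen Ω) {u v : L2 Ω} (hu : u ∈ H10 Ω) (hv : v ∈ H10 Ω) :
    weakGradient (u + v) = weakGradient u + weakGradient v :=
  ((isWeakGradient_weakGradient hΩ hu).add (isWeakGradient_weakGradient hΩ hv)).weakGradient_eq hΩ

theorem weakGradient_smul (hΩ : IsOpen Ω) {u : L2 Ω} (hu : u ∈ H10 Ω) (t : ℝ) :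
    weakGradient (t • u) = t • weakGradient u :=
  ((isWeakGradient_weakGradient hΩ hu).smul t).weakGradient_eq hΩ

/-- A test function as an element of the graph of the gradient. -/
theorem IsTestFunction.mem_testGraph {φ : Space d → ℝ} (h : IsTestFunction Ω φ) :
    ((h.memLp (volume.restrict Ω)).toLp, (h.memLp_gradient (volume.restrict Ω)).toLp)
      ∈ testGraph Ω :=
  Submodule.subset_span ⟨φ, h, MemLp.coeFn_toLp (h.memLp _),
    MemLp.coeFn_toLp (h.memLp_gradient _)⟩

/-- The span in `testGraph` is superfluous: test functions form a vector space. -/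
theorem exists_of_mem_testGraph {p : L2 Ω × L2Field Ω} (hp : p ∈ testGraph Ω) :
    ∃ φ, IsTestFunction Ω φ ∧ p.1 =ᵐ[volume.restrict Ω] φ ∧
      p.2 =ᵐ[volume.restrict Ω] gradient φ := by
  refine Submodule.span_induction (p := fun p _ => ∃ φ, IsTestFunction Ω φ ∧
    p.1 =ᵐ[volume.restrict Ω] φ ∧ p.2 =ᵐ[volume.restrict Ω] gradient φ) ?_ ?_ ?_ ?_ hp
  · exact fun x hx => hx
  · refine ⟨0, ⟨contDiff_const, HasCompactSupport.zero, by simp [tsupport]⟩,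
      Lp.coeFn_zero _ _ _, ?_⟩
    filter_upwards [Lp.coeFn_zero (Space d) 2 (volume.restrict Ω)] with x hx
    rw [Prod.snd_zero, hx]
    simp [gradient]
  · rintro x y _ _ ⟨φ, hφ, h1, h2⟩ ⟨ψ, hψ, h3, h4⟩
    refine ⟨φ + ψ, ⟨hφ.1.add hψ.1, hφ.2.1.add hψ.2.1,
      (tsupport_add φ ψ).trans (union_subset hφ.2.2 hψ.2.2)⟩,
      (Lp.coeFn_add _ _).trans (h1.add h3), (Lp.coeFn_add _ _).trans ?_⟩
    filter_upwards [h2, h4] with z h2 h4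
    rw [Pi.add_apply, h2, h4, gradient, gradient, gradient,
      fderiv_add (hφ.differentiable z) (hψ.differentiable z), map_add]
  · rintro t x _ ⟨φ, hφ, h1, h2⟩
    refine ⟨t • φ, ⟨hφ.1.const_smul t, hφ.2.1.smul_left, ?_⟩,
      (Lp.coeFn_smul _ _).trans (h1.const_smul t), (Lp.coeFn_smul _ _).trans ?_⟩
    · exact (closure_mono (Function.support_const_smul_subset t φ)).trans hφ.2.2
    · filter_upwards [h2] with z h2
      rw [Pi.smul_apply, h2, gradient, gradient, fderiv_const_smul (hφ.differentiable z), map_smul]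

end Sobolev

/-! ### The translation estimate, Poincaré's inequality and Rellich's theorem -/

theorem norm_sq_eq_integral {α E : Type*} [MeasurableSpace α] {μ : Measure α}
    [NormedAddCommGroup E] [InnerProductSpace ℝ E] (f : Lp E 2 μ) :
    ‖f‖ ^ 2 = ∫ x, ‖f x‖ ^ 2 ∂μ := by
  rw [← real_inner_self_eq_norm_sq, L2.inner_def]
  simp only [real_inner_self_eq_norm_sq]

theorem integrable_norm_sq {α E : Type*} [MeasurableSpace α] {μ : Measure α}
    [NormedAddCommGroup E] (f : Lp E 2 μ) :
    Integrable (fun x => ‖f x‖ ^ 2) μ := (Lp.memLp f).integrable_norm_pow (by norm_num)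

theorem ofReal_norm_sq_eq_lintegral {α E : Type*} [MeasurableSpace α] {μ : Measure α}
    [NormedAddCommGroup E] [InnerProductSpace ℝ E] (f : Lp E 2 μ) :
    ENNReal.ofReal (‖f‖ ^ 2) = ∫⁻ x, ENNReal.ofReal (‖f x‖ ^ 2) ∂μ := by
  rw [norm_sq_eq_integral, ofReal_integral_eq_lintegral_ofReal (integrable_norm_sq f)]
  exact Filter.Eventually.of_forall fun x => by positivity

theorem sq_integral_le_integral_sq {α : Type*} [MeasurableSpace α] {μ : Measure α}
    [IsProbabilityMeasure μ] {f : α → ℝ} (hf : Integrable f μ)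
    (hf2 : Integrable (fun x => f x ^ 2) μ) : (∫ x, f x ∂μ) ^ 2 ≤ ∫ x, f x ^ 2 ∂μ := by
  set s := ∫ x, f x ∂μ with hs
  have h : 0 ≤ ∫ x, (f x ^ 2 - 2 * s * f x + s ^ 2) ∂μ :=
    integral_nonneg fun x => by
      have := sq_nonneg (f x - s)
      simp only [Pi.zero_apply]
      nlinarith
  rw [integral_add (f := fun x => f x ^ 2 - 2 * s * f x) (hf2.sub (hf.const_mul _))
    (integrable_const _), integral_sub hf2 (hf.const_mul _), integral_const_mul, ← hs] at h
  simp at h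
  nlinarith

section Estimates

variable {Ω : Set (Space d)}

/-- The translation estimate `‖φ(· + t) - φ‖ ≤ ‖t‖ ‖∇φ‖`, from which both Poincaré's inequality and
Rellich's theorem follow. -/
theorem IsTestFunction.lintegral_translate_sq_le {φ : Space d → ℝ} (h : IsTestFunction Ω φ)
    (t : Space d) :
    ∫⁻ x, ENNReal.ofReal ((φ (x + t) - φ x) ^ 2)
      ≤ ENNReal.ofReal (‖t‖ ^ 2) * ∫⁻ x, ENNReal.ofReal (‖gradient φ x‖ ^ 2) := by
  have hg := continuous_gradient h.contDiff_one
  -- the fundamental theorem of calculus along the segment from `x` to `x + t`, and Jensen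
  have hpt : ∀ x, ENNReal.ofReal ((φ (x + t) - φ x) ^ 2)
      ≤ ∫⁻ s in Ioc (0 : ℝ) 1, ENNReal.ofReal (‖t‖ ^ 2 * ‖gradient φ (x + s • t)‖ ^ 2) := by
    intro x
    have hcont : Continuous fun s : ℝ => ⟪gradient φ (x + s • t), t⟫_ℝ := by fun_prop
    have hder : ∀ s : ℝ,
        HasDerivAt (fun s : ℝ => φ (x + s • t)) ⟪gradient φ (x + s • t), t⟫_ℝ s := by
      intro s
      have h1 : HasDerivAt (fun s : ℝ => x + s • t) t s := by
        simpa using ((hasDerivAt_id s).smul_const t).const_add x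
      have h2 := (h.differentiable (x + s • t)).hasFDerivAt.comp_hasDerivAt s h1
      rw [inner_gradient_left]
      exact h2
    have hftc : ∫ s in Ioc (0 : ℝ) 1, ⟪gradient φ (x + s • t), t⟫_ℝ = φ (x + t) - φ x := by
      rw [← intervalIntegral.integral_of_le zero_le_one,
        intervalIntegral.integral_eq_sub_of_hasDerivAt (fun s _ => hder s)
          (hcont.intervalIntegrable _ _)]
      simp
    have : IsProbabilityMeasure (volume.restrict (Ioc (0 : ℝ) 1)) := ⟨by simp⟩
    have hi : Integrable (fun s : ℝ => ⟪gradient φ (x + s • t), t⟫_ℝ)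
        (volume.restrict (Ioc (0 : ℝ) 1)) := (hcont.integrableOn_Icc).mono_set Ioc_subset_Icc_self
    have hi2 : Integrable (fun s : ℝ => ⟪gradient φ (x + s • t), t⟫_ℝ ^ 2)
        (volume.restrict (Ioc (0 : ℝ) 1)) :=
      ((hcont.pow 2).integrableOn_Icc).mono_set Ioc_subset_Icc_self
    rw [← hftc]
    refine (ENNReal.ofReal_le_ofReal (sq_integral_le_integral_sq hi hi2)).trans ?_
    rw [ofReal_integral_eq_lintegral_ofReal hi2 (Filter.Eventually.of_forall fun s => sq_nonneg _)]
    refine lintegral_mono fun s => ENNReal.ofReal_le_ofReal ?_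
    have := abs_real_inner_le_norm (gradient φ (x + s • t)) t
    rw [← mul_pow, ← sq_abs, mul_comm]
    gcongr
  refine (lintegral_mono hpt).trans ?_
  rw [lintegral_lintegral_swap]
  · have : ∀ s : ℝ, ∫⁻ x, ENNReal.ofReal (‖t‖ ^ 2 * ‖gradient φ (x + s • t)‖ ^ 2)
        = ENNReal.ofReal (‖t‖ ^ 2) * ∫⁻ x, ENNReal.ofReal (‖gradient φ x‖ ^ 2) := by
      intro s
      simp_rw [ENNReal.ofReal_mul (sq_nonneg ‖t‖)]
      rw [lintegral_const_mul' _ _ ENNReal.ofReal_ne_top,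
        lintegral_add_right_eq_self (fun x => ENNReal.ofReal (‖gradient φ x‖ ^ 2))]
    rw [lintegral_congr this]
    simp
  · refine Continuous.aemeasurable ?_
    exact ENNReal.continuous_ofReal.comp (by fun_prop)

theorem IsTestFunction.lintegral_gradient_eq {φ : Space d → ℝ} (h : IsTestFunction Ω φ)
    (hΩ : MeasurableSet Ω) :
    ∫⁻ x, ENNReal.ofReal (‖gradient φ x‖ ^ 2)
      = ∫⁻ x in Ω, ENNReal.ofReal (‖gradient φ x‖ ^ 2) := by
  rw [← lintegral_indicator hΩ]
  refine lintegral_congr fun x => ?_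
  by_cases hx : x ∈ Ω
  · rw [indicator_of_mem hx]
  · rw [indicator_of_notMem hx, h.gradient_eq_zero hx]
    simp

theorem lintegral_gradient_eq_of_ae_eq {φ : Space d → ℝ} (h : IsTestFunction Ω φ)
    (hΩ : MeasurableSet Ω) {g : L2Field Ω} (hg : g =ᵐ[volume.restrict Ω] gradient φ) :
    ∫⁻ x, ENNReal.ofReal (‖gradient φ x‖ ^ 2) = ENNReal.ofReal (‖g‖ ^ 2) := by
  rw [h.lintegral_gradient_eq hΩ, ofReal_norm_sq_eq_lintegral]
  refine lintegral_congr_ae ?_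
  filter_upwards [hg] with x hx
  rw [hx]

theorem isClosed_norm_fst_le (C : ℝ) (T : L2 Ω →L[ℝ] L2 Ω) :
    IsClosed {p : L2 Ω × L2Field Ω | ‖T p.1‖ ≤ C * ‖p.2‖} :=
  isClosed_le (by fun_prop) (by fun_prop)

/-- Poincaré's inequality: translate by more than the diameter of `Ω`. -/
theorem exists_poincare (hd : 1 ≤ d) (hΩ : MeasurableSet Ω) (hb : Bornology.IsBounded Ω) :
    ∃ C : ℝ, 0 < C ∧ ∀ p ∈ (testGraph Ω).topologicalClosure, ‖p.1‖ ≤ C * ‖p.2‖ := by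
  obtain ⟨R, hR0, hR⟩ := hb.exists_pos_norm_lt
  let t : Space d := EuclideanSpace.single ⟨0, hd⟩ (2 * R)
  have ht : ‖t‖ = 2 * R := by simp [t, abs_of_pos hR0]
  refine ⟨2 * R, by positivity, fun p hp => ?_⟩
  refine closure_minimal ?_ (isClosed_norm_fst_le (2 * R) (ContinuousLinearMap.id ℝ (L2 Ω))) hp
  intro p hp
  obtain ⟨φ, hφ, h1, h2⟩ := exists_of_mem_testGraph hp
  have hsplit : ∀ x, φ (x + t) = 0 ∨ φ x = 0 := by
    intro x
    by_contra! hne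
    have hx1 : x + t ∈ Ω := by_contra fun hx => hne.1 (hφ.eq_zero hx)
    have hx2 : x ∈ Ω := by_contra fun hx => hne.2 (hφ.eq_zero hx)
    have := norm_sub_le (x + t) x
    rw [add_sub_cancel_left, ht] at this
    linarith [hR _ hx1, hR _ hx2]
  have key : ∫⁻ x, ENNReal.ofReal (φ x ^ 2)
      ≤ ∫⁻ x, ENNReal.ofReal ((φ (x + t) - φ x) ^ 2) := by
    refine lintegral_mono fun x => ENNReal.ofReal_le_ofReal ?_
    rcases hsplit x with h0 | h0 <;> simp [h0, sq_nonneg]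
  have h3 : ENNReal.ofReal (‖p.1‖ ^ 2) ≤ ENNReal.ofReal ((2 * R * ‖p.2‖) ^ 2) := by
    calc ENNReal.ofReal (‖p.1‖ ^ 2) = ∫⁻ x in Ω, ENNReal.ofReal (φ x ^ 2) := by
          rw [ofReal_norm_sq_eq_lintegral]
          refine lintegral_congr_ae ?_
          filter_upwards [h1] with x hx
          rw [hx, Real.norm_eq_abs, sq_abs]
      _ ≤ ∫⁻ x, ENNReal.ofReal (φ x ^ 2) := setLIntegral_le_lintegral _ _
      _ ≤ _ := key.trans (hφ.lintegral_translate_sq_le t)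
      _ = _ := by
          rw [lintegral_gradient_eq_of_ae_eq hφ hΩ h2, ← ENNReal.ofReal_mul (sq_nonneg _), ht,
            ← mul_pow]
  rw [ENNReal.ofReal_le_ofReal_iff (by positivity)] at h3
  simpa using (sq_le_sq₀ (norm_nonneg _) (by positivity)).1 h3

/-- The mean value of `u`, extended by zero, over the ball of radius `ε` around `c`, as an element
of `L²(Ω)` that represents it. -/
def ballMean (Ω : Set (Space d)) (c : Space d) (ε : ℝ) : L2 Ω :=
  (volume.real (Metric.ball c ε))⁻¹ • indicatorConstLp 2 (measurableSet_ball (x := c) (ε := ε))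
    (((Measure.restrict_apply_le _ _).trans_lt measure_ball_lt_top).ne) (1 : ℝ)

/-- The finite rank operator which replaces `u` near each value `c` of the simple function `s` by
the mean value of `u` over the ball of radius `ε` around `c`. -/
def localMean (Ω : Set (Space d)) (s : SimpleFunc (Space d) (Space d)) (ε : ℝ) (hb : volume Ω ≠ ⊤) :
    L2 Ω →L[ℝ] L2 Ω :=
  ∑ c ∈ s.range, (innerSL ℝ (ballMean Ω c ε)).smulRight
    (indicatorConstLp 2 (s.measurableSet_fiber c)
      (((measure_mono (subset_univ _)).trans_lt
        (by rw [Measure.restrict_apply_univ]; exact hb.lt_top)).ne) (1 : ℝ))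

theorem isCompactOperator_localMean (s : SimpleFunc (Space d) (Space d)) (ε : ℝ)
    (hb : volume Ω ≠ ⊤) : IsCompactOperator (localMean Ω s ε hb) := by
  have : localMean Ω s ε hb ∈ (compactOperator (RingHom.id ℝ) (L2 Ω) (L2 Ω)) := by
    refine Submodule.sum_mem _ fun c _ => ?_
    exact (isCompactOperator_of_locallyCompactSpace_rng
      (ContinuousLinearMap.toSpanSingleton ℝ _)).comp_clm (innerSL ℝ (ballMean Ω c ε))
  exact this

theorem inner_ballMean (c : Space d) (ε : ℝ) {φ : Space d → ℝ}
    (hφ : IsTestFunction Ω φ) {u : L2 Ω} (hu : u =ᵐ[volume.restrict Ω] φ) :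
    ⟪ballMean Ω c ε, u⟫_ℝ = ⨍ x in Metric.ball c ε, φ x := by
  rw [ballMean, real_inner_smul_left, L2.inner_indicatorConstLp_one, setAverage_eq, smul_eq_mul]
  congr 1
  rw [integral_congr_ae (g := φ) (hu.filter_mono (ae_mono Measure.restrict_le_self)),
    Measure.restrict_restrict measurableSet_ball]
  refine (setIntegral_eq_of_subset_of_forall_sdiff_eq_zero measurableSet_ball inter_subset_left
    fun x hx => hφ.eq_zero fun hxΩ => hx.2 ⟨hx.1, hxΩ⟩).symm

theorem localMean_ae_eq (s : SimpleFunc (Space d) (Space d)) (ε : ℝ)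
    (hb : volume Ω ≠ ⊤) {φ : Space d → ℝ} (hφ : IsTestFunction Ω φ) {u : L2 Ω}
    (hu : u =ᵐ[volume.restrict Ω] φ) :
    localMean Ω s ε hb u =ᵐ[volume.restrict Ω] fun x => ⨍ y in Metric.ball (s x) ε, φ y := by
  have hfin : ∀ c, volume.restrict Ω (s ⁻¹' {c}) ≠ ⊤ := fun c =>
    ((measure_mono (subset_univ _)).trans_lt
      (by rw [Measure.restrict_apply_univ]; exact hb.lt_top)).ne
  have hsum : localMean Ω s ε hb u = ∑ c ∈ s.range, (⨍ y in Metric.ball c ε, φ y) •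
      indicatorConstLp 2 (s.measurableSet_fiber c) (hfin c) (1 : ℝ) := by
    rw [localMean, sum_apply]
    refine Finset.sum_congr rfl fun c _ => ?_
    rw [ContinuousLinearMap.smulRight_apply, innerSL_apply_apply, inner_ballMean c ε hφ hu]
  have hind : ∀ᵐ x ∂(volume.restrict Ω), ∀ c ∈ s.range,
      ((⨍ y in Metric.ball c ε, φ y) •
        indicatorConstLp 2 (s.measurableSet_fiber c) (hfin c) (1 : ℝ) : L2 Ω) x
      = (⨍ y in Metric.ball c ε, φ y) * (s ⁻¹' {c}).indicator (fun _ => (1 : ℝ)) x := by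
    refine (ae_ball_iff s.range.countable_toSet).2 fun c _ => ?_
    filter_upwards [Lp.coeFn_smul (⨍ y in Metric.ball c ε, φ y)
        (indicatorConstLp 2 (s.measurableSet_fiber c) (hfin c) (1 : ℝ)),
      indicatorConstLp_coeFn (p := 2) (hs := s.measurableSet_fiber c) (hμs := hfin c)
        (c := (1 : ℝ))]
      with x h1 h2
    rw [h1, Pi.smul_apply, h2, smul_eq_mul]
  rw [hsum]
  filter_upwards [hind, Lp.coeFn_finsetSum (p := 2) (μ := volume.restrict Ω) s.range fun c =>
    (⨍ y in Metric.ball c ε, φ y) •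
      indicatorConstLp 2 (s.measurableSet_fiber c) (hfin c) (1 : ℝ)] with x h1 h2
  rw [h2, Finset.sum_apply, Finset.sum_congr rfl h1, Finset.sum_eq_single (s x)]
  · simp
  · intro c _ hc
    simp [hc.symm]
  · exact fun h => absurd (s.mem_range_self x) h

/-- The deviation from the mean over a ball that contains `x` is bounded by an average of squared
differences `φ(x + t) - φ(x)` over `‖t‖ < 2 ε`, to which the translation estimate applies. -/
theorem IsTestFunction.sq_sub_mean_le {φ : Space d → ℝ} (hφ : IsTestFunction Ω φ) {ε : ℝ}
    (hε : 0 < ε) {x c : Space d} (hx : dist c x < ε) :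
    ENNReal.ofReal ((φ x - ⨍ y in Metric.ball c ε, φ y) ^ 2)
      ≤ (volume (Metric.ball (0 : Space d) ε))⁻¹ *
        ∫⁻ t in Metric.ball (0 : Space d) (2 * ε), ENNReal.ofReal ((φ (x + t) - φ x) ^ 2) := by
  have hB0 : volume (Metric.ball c ε) ≠ 0 := (Metric.measure_ball_pos _ _ hε).ne'
  have hBt : volume (Metric.ball c ε) ≠ ⊤ := measure_ball_lt_top.ne
  set ν : Measure (Space d) :=
    (volume.restrict (Metric.ball c ε) univ)⁻¹ • volume.restrict (Metric.ball c ε) with hν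
  have hνp : IsProbabilityMeasure ν := ⟨by simp [hν, ENNReal.inv_mul_cancel hB0 hBt]⟩
  have hc := hφ.continuous
  have hint : ∀ f : Space d → ℝ, Continuous f → Integrable f ν := fun f hf =>
    (IntegrableOn.mono_set (hf.continuousOn.integrableOn_compact (isCompact_closedBall c ε))
      Metric.ball_subset_closedBall).smul_measure (by simpa using hB0)
  have h1 : φ x - ⨍ y in Metric.ball c ε, φ y = ∫ y, (φ x - φ y) ∂ν := by
    rw [integral_sub (integrable_const _) (hint φ hc), integral_const, probReal_univ, one_smul]
    rfl
  rw [h1]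
  have hi2 := hint (fun y => (φ x - φ y) ^ 2) (by fun_prop)
  refine (ENNReal.ofReal_le_ofReal (sq_integral_le_integral_sq (hint _ (by fun_prop)) hi2)).trans ?_
  rw [ofReal_integral_eq_lintegral_ofReal hi2 (Filter.Eventually.of_forall fun s => sq_nonneg _),
    hν, lintegral_smul_measure, Measure.restrict_apply_univ, Measure.addHaar_ball_center,
    smul_eq_mul]
  refine mul_le_mul_right ?_ _
  rw [← lintegral_indicator measurableSet_ball, ← lintegral_indicator measurableSet_ball,
    ← lintegral_add_left_eq_self _ x]
  refine lintegral_mono fun t => ?_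
  by_cases ht : x + t ∈ Metric.ball c ε
  · have ht' : t ∈ Metric.ball (0 : Space d) (2 * ε) := by
      rw [mem_ball_zero_iff]
      have h2 : t = (x + t - c) + (c - x) := by abel
      rw [h2]
      refine (norm_add_le _ _).trans_lt ?_
      rw [← dist_eq_norm, ← dist_eq_norm]
      linarith [Metric.mem_ball.1 ht]
    rw [indicator_of_mem ht, indicator_of_mem ht']
    refine ENNReal.ofReal_le_ofReal (le_of_eq ?_)
    ring
  · rw [indicator_of_notMem ht]
    exact zero_le

/-- Local means approximate uniformly on bounded sets of `H₀¹`, at a rate proportional to the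
radius `ε`. -/
theorem norm_sub_localMean_le (hΩ : MeasurableSet Ω) (hb : volume Ω ≠ ⊤)
    (s : SimpleFunc (Space d) (Space d)) {ε : ℝ} (hε : 0 < ε) (hs : ∀ x ∈ Ω, dist (s x) x < ε)
    {p : L2 Ω × L2Field Ω} (hp : p ∈ testGraph Ω) :
    ‖p.1 - localMean Ω s ε hb p.1‖ ^ 2 ≤ 2 ^ d * (2 * ε) ^ 2 * ‖p.2‖ ^ 2 := by
  obtain ⟨φ, hφ, h1, h2⟩ := exists_of_mem_testGraph hp
  rw [← ENNReal.ofReal_le_ofReal_iff (by positivity), ofReal_norm_sq_eq_lintegral]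
  calc _ = ∫⁻ x in Ω, ENNReal.ofReal ((φ x - ⨍ y in Metric.ball (s x) ε, φ y) ^ 2) := by
        refine lintegral_congr_ae ?_
        filter_upwards [h1, localMean_ae_eq s ε hb hφ h1,
          Lp.coeFn_sub p.1 (localMean Ω s ε hb p.1)] with x h1 h2 h3
        rw [h3, Pi.sub_apply, h1, h2, Real.norm_eq_abs, sq_abs]
    _ ≤ ∫⁻ x in Ω, (volume (Metric.ball (0 : Space d) ε))⁻¹ *
        ∫⁻ t in Metric.ball (0 : Space d) (2 * ε), ENNReal.ofReal ((φ (x + t) - φ x) ^ 2) :=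
        setLIntegral_mono' hΩ fun x hx => hφ.sq_sub_mean_le hε (hs x hx)
    _ ≤ (volume (Metric.ball (0 : Space d) ε))⁻¹ * ∫⁻ x,
        ∫⁻ t in Metric.ball (0 : Space d) (2 * ε), ENNReal.ofReal ((φ (x + t) - φ x) ^ 2) := by
        rw [lintegral_const_mul' _ _ (ENNReal.inv_ne_top.2 (Metric.measure_ball_pos _ _ hε).ne')]
        gcongr
        exact Measure.restrict_le_self
    _ = (volume (Metric.ball (0 : Space d) ε))⁻¹ *
        ∫⁻ t in Metric.ball (0 : Space d) (2 * ε),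
          ∫⁻ x, ENNReal.ofReal ((φ (x + t) - φ x) ^ 2) := by
        rw [lintegral_lintegral_swap]
        refine Continuous.aemeasurable ?_
        have := hφ.continuous
        exact ENNReal.continuous_ofReal.comp (by fun_prop)
    _ ≤ (volume (Metric.ball (0 : Space d) ε))⁻¹ * ∫⁻ t in Metric.ball (0 : Space d) (2 * ε),
        ENNReal.ofReal ((2 * ε) ^ 2 * ‖p.2‖ ^ 2) := by
        -- the translation estimate with `‖t‖ < 2 ε`
        gcongr 1
        refine setLIntegral_mono' measurableSet_ball fun t ht => ?_
        refine (hφ.lintegral_translate_sq_le t).trans ?_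
        rw [lintegral_gradient_eq_of_ae_eq hφ hΩ h2, ← ENNReal.ofReal_mul (sq_nonneg _)]
        refine ENNReal.ofReal_le_ofReal ?_
        have := (mem_ball_zero_iff.1 ht).le
        gcongr
    _ = _ := by
        have hB0 : volume (Metric.ball (0 : Space d) ε) ≠ 0 := (Metric.measure_ball_pos _ _ hε).ne'
        have hBt : volume (Metric.ball (0 : Space d) ε) ≠ ⊤ := measure_ball_lt_top.ne
        rw [setLIntegral_const, Measure.addHaar_ball_mul_of_pos volume 0 two_pos,
          finrank_euclideanSpace, Fintype.card_fin, mul_comm _ (_ * volume _), ← mul_assoc,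
          mul_comm (ENNReal.ofReal (2 ^ d)), ← mul_assoc, ENNReal.inv_mul_cancel hB0 hBt, one_mul,
          ← ENNReal.ofReal_mul (by positivity), mul_assoc]

/-- An embedding is compact if compact operators approximate it uniformly on the unit ball; by
density the estimate is needed on `G` only. -/
theorem isCompactOperator_fst_of_approx {E F : Type*} [NormedAddCommGroup E] [NormedSpace ℝ E]
    [CompleteSpace E] [NormedAddCommGroup F] [NormedSpace ℝ F] (G : Submodule ℝ (E × F))
    {T : ℕ → E →L[ℝ] E} {c : ℕ → ℝ} (hT : ∀ n, IsCompactOperator (T n)) (hc0 : ∀ n, 0 ≤ c n)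
    (hc : Filter.Tendsto c Filter.atTop (𝓝 0))
    (h : ∀ n, ∀ p ∈ G, ‖p.1 - T n p.1‖ ≤ c n * ‖p.2‖) :
    IsCompactOperator ((ContinuousLinearMap.fst ℝ E F).comp G.topologicalClosure.subtypeL) := by
  set ι := (ContinuousLinearMap.fst ℝ E F).comp G.topologicalClosure.subtypeL with hι
  refine isCompactOperator_of_tendsto (l := Filter.atTop) (F := fun n => (T n).comp ι) ?_
    (Filter.Eventually.of_forall fun n => (hT n).comp_clm ι)
  rw [tendsto_iff_norm_sub_tendsto_zero]
  refine squeeze_zero (fun n => norm_nonneg _) (fun n => ?_) hc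
  refine ContinuousLinearMap.opNorm_le_bound _ (hc0 n) fun p => ?_
  have hcl : IsClosed {p : E × F | ‖p.1 - T n p.1‖ ≤ c n * ‖p.2‖} :=
    isClosed_le (by fun_prop) (by fun_prop)
  have h1 : ‖(p : E × F).1 - T n (p : E × F).1‖ ≤ c n * ‖(p : E × F).2‖ :=
    closure_minimal (h n) hcl p.2
  have h2 : ‖(p : E × F).2‖ ≤ ‖p‖ := norm_snd_le _
  rw [sub_apply, ← norm_neg, neg_sub]
  exact h1.trans (mul_le_mul_of_nonneg_left h2 (hc0 n))

/-- Rellich's theorem: the embedding of `H₀¹(Ω)` into `L²(Ω)` is a limit of finite rank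
operators. -/
theorem isCompactOperator_fst (hΩ : MeasurableSet Ω) (hb : Bornology.IsBounded Ω) :
    IsCompactOperator ((ContinuousLinearMap.fst ℝ (L2 Ω) (L2Field Ω)).comp
      (testGraph Ω).topologicalClosure.subtypeL) := by
  have hvol : volume Ω ≠ ⊤ := hb.measure_lt_top.ne
  have hex : ∀ n : ℕ, ∃ s : SimpleFunc (Space d) (Space d),
      ∀ x ∈ Ω, dist (s x) x < 1 / ((n : ℝ) + 1) := by
    intro n
    have hε : 0 < 1 / ((n : ℝ) + 1) := by positivity
    obtain ⟨e, he⟩ := TopologicalSpace.exists_dense_seq (Space d)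
    have hcov : closure Ω ⊆ ⋃ k : ℕ, Metric.ball (e k) (1 / ((n : ℝ) + 1)) := fun x _ => by
      obtain ⟨k, hk⟩ := Metric.denseRange_iff.1 he x _ hε
      exact mem_iUnion.2 ⟨k, hk⟩
    obtain ⟨F, hF⟩ := hb.isCompact_closure.elim_finite_subcover _
      (fun k => Metric.isOpen_ball) hcov
    refine ⟨SimpleFunc.nearestPt e (F.sup id), fun x hx => ?_⟩
    obtain ⟨k, hk, hxk⟩ := mem_iUnion₂.1 (hF (subset_closure hx))
    have h1 := SimpleFunc.edist_nearestPt_le e x (Finset.le_sup (f := id) hk)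
    rw [id, edist_dist, edist_dist, ENNReal.ofReal_le_ofReal_iff dist_nonneg] at h1
    rw [Metric.mem_ball, dist_comm] at hxk
    exact h1.trans_lt hxk
  choose s hs using hex
  refine isCompactOperator_fst_of_approx _
    (T := fun n => localMean Ω (s n) (1 / ((n : ℝ) + 1)) hvol)
    (c := fun n => (Real.sqrt (2 ^ d) * (2 * (1 / ((n : ℝ) + 1)))))
    (fun n => isCompactOperator_localMean _ _ hvol) (fun n => by positivity) ?_ fun n p hp => ?_
  · simpa using (tendsto_one_div_add_atTop_nhds_zero_nat (𝕜 := ℝ)).const_mul 2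
      |>.const_mul (Real.sqrt (2 ^ d))
  · have h1 := norm_sub_localMean_le hΩ hvol (s n) (by positivity) (hs n) hp
    have h2 : (2 : ℝ) ^ d * (2 * (1 / ((n : ℝ) + 1))) ^ 2 * ‖p.2‖ ^ 2
        = ((Real.sqrt (2 ^ d) * (2 * (1 / ((n : ℝ) + 1)))) * ‖p.2‖) ^ 2 := by
      rw [mul_pow (_ * _) ‖p.2‖, mul_pow (Real.sqrt _), Real.sq_sqrt (by positivity)]
    rw [h2, sq_le_sq₀ (norm_nonneg _) (by positivity)] at h1
    exact h1

end Estimates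

/-! ### The energy form -/

namespace ModelProblem

variable (P : ModelProblem d)

theorem isOpen : IsOpen P.Ω := P.polygonal.1

theorem isBounded : Bornology.IsBounded P.Ω := by
  obtain ⟨_, _, S, _, hS⟩ := P.polygonal
  rw [hS]
  refine Bornology.IsBounded.subset ?_ interior_subset
  rw [Bornology.isBounded_biUnion_finset]
  exact fun s _ => isBounded_convexHull.2 s.finite_toSet.isBounded

theorem volume_ne_top : volume P.Ω ≠ ⊤ := P.isBounded.measure_lt_top.ne

theorem toEuclideanLin_eq_sum (B : Matrix (Fin d) (Fin d) ℝ) (ξ : Space d) :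
    Matrix.toEuclideanLin B ξ = ∑ r, ∑ s, (B r s * ξ s) • EuclideanSpace.single r (1 : ℝ) := by
  ext i
  simp [Matrix.toEuclideanLin, Matrix.mulVec, dotProduct, Finset.sum_apply,
    Pi.single_apply, Finset.sum_ite_eq]

theorem norm_toEuclideanLin_le {B : Matrix (Fin d) (Fin d) ℝ} {K : ℝ}
    (hB : ∀ r s, |B r s| ≤ K) (ξ : Space d) :
    ‖Matrix.toEuclideanLin B ξ‖ ≤ d * (d * K) * ‖ξ‖ := by
  rw [toEuclideanLin_eq_sum]
  refine (norm_sum_le _ _).trans ?_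
  calc _ ≤ ∑ _r : Fin d, ∑ _s : Fin d, K * ‖ξ‖ := by
        refine Finset.sum_le_sum fun r _ => (norm_sum_le _ _).trans
          (Finset.sum_le_sum fun s _ => ?_)
        rw [norm_smul, PiLp.norm_single, norm_one, mul_one, norm_mul]
        have h1 := PiLp.norm_apply_le ξ s
        exact mul_le_mul (hB r s) h1 (norm_nonneg _) ((abs_nonneg _).trans (hB r s))
    _ = _ := by simp; ring

/-- The coefficients are bounded: they are Lipschitz continuous on finitely many bounded pieces. -/
theorem exists_abs_coeff_le : ∃ K : ℝ, 0 ≤ K ∧ ∀ D ∈ P.pieces, ∀ x ∈ D, ∀ r s, |P.A x r s| ≤ K := by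
  obtain ⟨L, hL⟩ := P.lipschitz
  have h1 : ∀ D ∈ P.pieces, ∃ K : ℝ, ∀ x ∈ D, ∀ r s, |P.A x r s| ≤ K := by
    intro D hD
    rcases D.eq_empty_or_nonempty with rfl | ⟨y, hy⟩
    · exact ⟨0, by simp⟩
    have hDb : Bornology.IsBounded D := P.isBounded.subset (P.pieces_open D hD).2
    refine ⟨(∑ r, ∑ s, |P.A y r s|) + L * Metric.diam D, fun x hx r s => ?_⟩
    have h2 := (hL D hD r s).dist_le_mul x hx y hy
    have h3 : dist x y ≤ Metric.diam D := Metric.dist_le_diam_of_mem hDb hx hy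
    have h4 : |P.A y r s| ≤ ∑ r, ∑ s, |P.A y r s| :=
      (Finset.single_le_sum (f := fun s => |P.A y r s|) (fun _ _ => abs_nonneg _)
        (Finset.mem_univ s)).trans
      (Finset.single_le_sum (f := fun r => ∑ s, |P.A y r s|)
        (fun _ _ => Finset.sum_nonneg fun _ _ => abs_nonneg _) (Finset.mem_univ r))
    have h5 : |P.A x r s| ≤ |P.A y r s| + dist (P.A x r s) (P.A y r s) := by
      rw [Real.dist_eq]
      have := abs_add_le (P.A y r s) (P.A x r s - P.A y r s)
      simpa using this
    have h6 : (L : ℝ) * dist x y ≤ L * Metric.diam D := by gcongr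
    linarith
  choose! K hK using h1
  refine ⟨∑ D ∈ P.pieces, |K D|, Finset.sum_nonneg fun _ _ => abs_nonneg _, fun D hD x hx r s => ?_⟩
  exact (hK D hD x hx r s).trans ((le_abs_self _).trans
    (Finset.single_le_sum (f := fun D => |K D|) (fun _ _ => abs_nonneg _) hD))

theorem exists_norm_flux_le :
    ∃ K : ℝ, 0 ≤ K ∧ ∀ D ∈ P.pieces, ∀ x ∈ D, ∀ ξ : Space d,
      ‖Matrix.toEuclideanLin (P.A x) ξ‖ ≤ K * ‖ξ‖ := by
  obtain ⟨K, hK0, hK⟩ := P.exists_abs_coeff_le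
  exact ⟨d * (d * K), by positivity, fun D hD x hx ξ => norm_toEuclideanLin_le (hK D hD x hx) ξ⟩

theorem ae_exists_mem_pieces : ∀ᵐ x ∂(volume.restrict P.Ω), ∃ D ∈ P.pieces, x ∈ D := by
  rw [ae_restrict_iff' P.isOpen.measurableSet]
  filter_upwards [measure_eq_zero_iff_ae_notMem.1 P.pieces_cover] with x hx hxΩ
  by_contra! h
  exact hx ⟨hxΩ, by simpa using h⟩

/-- The coefficients are continuous on the union of the pieces, which is open and of full measure.
-/
theorem aestronglyMeasurable_coeff (r s : Fin d) :
    AEStronglyMeasurable (fun x => P.A x r s) (volume.restrict P.Ω) := by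
  obtain ⟨L, hL⟩ := P.lipschitz
  have hopen : IsOpen (⋃ D ∈ P.pieces, D) :=
    isOpen_biUnion fun D hD => (P.pieces_open D hD).1
  have hcont : ContinuousOn (fun x => P.A x r s) (⋃ D ∈ P.pieces, D) := by
    intro x hx
    obtain ⟨D, hD, hxD⟩ := mem_iUnion₂.1 hx
    exact ((hL D hD r s).continuousOn.continuousAt
      ((P.pieces_open D hD).1.mem_nhds hxD)).continuousWithinAt
  have hres : volume.restrict P.Ω = volume.restrict (⋃ D ∈ P.pieces, D) := by
    refine Measure.restrict_congr_set ?_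
    refine Filter.EventuallyLE.antisymm ?_ ?_
    · filter_upwards [measure_eq_zero_iff_ae_notMem.1 P.pieces_cover] with x hx hxΩ
      by_contra h
      exact hx ⟨hxΩ, h⟩
    · refine (LE.le.eventuallyLE ?_)
      exact iUnion₂_subset fun D hD => (P.pieces_open D hD).2
  rw [hres]
  exact hcont.aestronglyMeasurable hopen.measurableSet

theorem memLp_flux (g : L2Field P.Ω) :
    MemLp (fun x => Matrix.toEuclideanLin (P.A x) (g x)) 2 (volume.restrict P.Ω) := by
  obtain ⟨K, hK0, hK⟩ := P.exists_norm_flux_le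
  refine MemLp.of_le_mul (c := K) (Lp.memLp g) ?_ ?_
  · simp_rw [toEuclideanLin_eq_sum]
    refine Finset.aestronglyMeasurable_fun_sum _ fun r _ =>
      Finset.aestronglyMeasurable_fun_sum _ fun s _ => ?_
    refine AEStronglyMeasurable.smul (AEStronglyMeasurable.mul
      (P.aestronglyMeasurable_coeff r s) ?_)
      aestronglyMeasurable_const
    exact (EuclideanSpace.proj s : Space d →L[ℝ] ℝ).continuous.comp_aestronglyMeasurable
      (Lp.aestronglyMeasurable g)
  · filter_upwards [P.ae_exists_mem_pieces] with x hx
    obtain ⟨D, hD, hxD⟩ := hx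
    exact hK D hD x hxD _

theorem memLp_coeff_mul (u : L2 P.Ω) : MemLp (fun x => P.c x * u x) 2 (volume.restrict P.Ω) :=
  (Lp.memLp u).mul P.c_bounded

theorem integrable_flux_inner (g g' : L2Field P.Ω) :
    Integrable (fun x => ⟪Matrix.toEuclideanLin (P.A x) (g x), g' x⟫_ℝ) (volume.restrict P.Ω) := by
  have h := L2.integrable_inner (𝕜 := ℝ) (P.memLp_flux g).toLp g'
  refine h.congr ?_
  filter_upwards [(P.memLp_flux g).coeFn_toLp] with x hx
  rw [hx]

theorem integrable_coeff_mul (u v : L2 P.Ω) :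
    Integrable (fun x => P.c x * u x * v x) (volume.restrict P.Ω) :=
  (P.memLp_coeff_mul u).integrable_mul (Lp.memLp v)

end ModelProblem

section Form

variable (P : ModelProblem d)

theorem bForm_eq_inner (u v : L2 P.Ω) : bForm P u v = ⟪u, v⟫_ℝ := by
  rw [bForm, L2.inner_def]
  refine integral_congr_ae (Filter.Eventually.of_forall fun x => ?_)
  simp [mul_comm]

variable {P}

theorem aForm_add_left {u u' v : L2 P.Ω} (hu : u ∈ H10 P.Ω) (hu' : u' ∈ H10 P.Ω) :
    aForm P (u + u') v = aForm P u v + aForm P u' v := by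
  have h1 : ∫ x in P.Ω, ⟪Matrix.toEuclideanLin (P.A x) (weakGradient (u + u') x),
        weakGradient v x⟫_ℝ
      = (∫ x in P.Ω, ⟪Matrix.toEuclideanLin (P.A x) (weakGradient u x), weakGradient v x⟫_ℝ)
        + ∫ x in P.Ω, ⟪Matrix.toEuclideanLin (P.A x) (weakGradient u' x), weakGradient v x⟫_ℝ := by
    rw [← integral_add (P.integrable_flux_inner _ _) (P.integrable_flux_inner _ _),
      weakGradient_add P.isOpen hu hu']
    refine integral_congr_ae ?_
    filter_upwards [Lp.coeFn_add (weakGradient u) (weakGradient u')] with x hx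
    rw [hx, Pi.add_apply, map_add, inner_add_left]
  have h2 : ∫ x in P.Ω, P.c x * (u + u') x * v x
      = (∫ x in P.Ω, P.c x * u x * v x) + ∫ x in P.Ω, P.c x * u' x * v x := by
    rw [← integral_add (P.integrable_coeff_mul _ _) (P.integrable_coeff_mul _ _)]
    refine integral_congr_ae ?_
    filter_upwards [Lp.coeFn_add u u'] with x hx
    rw [hx, Pi.add_apply]
    ring
  rw [aForm, h1, h2, aForm, aForm]
  ring

theorem aForm_smul_left {u v : L2 P.Ω} (hu : u ∈ H10 P.Ω) (t : ℝ) :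
    aForm P (t • u) v = t * aForm P u v := by
  have h1 : ∫ x in P.Ω, ⟪Matrix.toEuclideanLin (P.A x) (weakGradient (t • u) x),
        weakGradient v x⟫_ℝ
      = t * (∫ x in P.Ω, ⟪Matrix.toEuclideanLin (P.A x) (weakGradient u x),
          weakGradient v x⟫_ℝ) := by
    rw [← integral_const_mul, weakGradient_smul P.isOpen hu]
    refine integral_congr_ae ?_
    filter_upwards [Lp.coeFn_smul t (weakGradient u)] with x hx
    rw [hx, Pi.smul_apply, map_smul, real_inner_smul_left]
  have h2 : ∫ x in P.Ω, P.c x * (t • u) x * v x = t * (∫ x in P.Ω, P.c x * u x * v x) := by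
    rw [← integral_const_mul]
    refine integral_congr_ae ?_
    filter_upwards [Lp.coeFn_smul t u] with x hx
    rw [hx, Pi.smul_apply, smul_eq_mul]
    ring
  rw [aForm, h1, h2, aForm]
  ring

theorem aForm_comm (u v : L2 P.Ω) : aForm P u v = aForm P v u := by
  rw [aForm, aForm]
  congr 1
  · refine setIntegral_congr_fun P.isOpen.measurableSet fun x hx => ?_
    have hs : (Matrix.toEuclideanLin (P.A x)).IsSymmetric := by
      rw [Matrix.isSymmetric_toEuclideanLin_iff]
      rw [Matrix.IsHermitian, Matrix.conjTranspose_eq_transpose_of_trivial]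
      exact P.symm x hx
    exact (hs _ _).trans (real_inner_comm _ _)
  · refine integral_congr_ae (Filter.Eventually.of_forall fun x => ?_)
    ring

theorem exists_aForm_ge (P : ModelProblem d) :
    ∃ α : ℝ, 0 < α ∧ ∀ u : L2 P.Ω, α * ‖weakGradient u‖ ^ 2 ≤ aForm P u u := by
  obtain ⟨α, hα, h⟩ := P.elliptic
  refine ⟨α, hα, fun u => ?_⟩
  have h1 : α * ‖weakGradient u‖ ^ 2 ≤
      ∫ x in P.Ω, ⟪Matrix.toEuclideanLin (P.A x) (weakGradient u x), weakGradient u x⟫_ℝ := by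
    rw [norm_sq_eq_integral, ← integral_const_mul]
    refine setIntegral_mono_on ((integrable_norm_sq _).const_mul α) (P.integrable_flux_inner _ _)
      P.isOpen.measurableSet fun x hx => h x hx _
  have h2 : 0 ≤ ∫ x in P.Ω, P.c x * u x * u x := by
    refine integral_nonneg_of_ae ?_
    filter_upwards [P.c_nonneg] with x hx
    rw [mul_assoc]
    exact mul_nonneg hx (mul_self_nonneg _)
  rw [aForm]
  linarith

theorem exists_aForm_le (P : ModelProblem d) :
    ∃ K : ℝ, 0 < K ∧ ∀ u : L2 P.Ω, aForm P u u ≤ K * (‖u‖ ^ 2 + ‖weakGradient u‖ ^ 2) := by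
  obtain ⟨K, hK0, hK⟩ := P.exists_norm_flux_le
  obtain ⟨c, hc0, hc⟩ : ∃ c : ℝ, 0 ≤ c ∧ ∀ᵐ x ∂(volume.restrict P.Ω), |P.c x| ≤ c := by
    refine ⟨(eLpNorm P.c ⊤ (volume.restrict P.Ω)).toReal, ENNReal.toReal_nonneg, ?_⟩
    have := ae_le_eLpNormEssSup (f := P.c) (μ := volume.restrict P.Ω)
    filter_upwards [this] with x hx
    rw [← eLpNorm_exponent_top] at hx
    have h2 := ENNReal.toReal_mono P.c_bounded.2.ne hx
    simpa using h2
  refine ⟨K + c + 1, by positivity, fun u => ?_⟩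
  have h1 : ∫ x in P.Ω, ⟪Matrix.toEuclideanLin (P.A x) (weakGradient u x), weakGradient u x⟫_ℝ
      ≤ K * ‖weakGradient u‖ ^ 2 := by
    rw [norm_sq_eq_integral, ← integral_const_mul]
    refine integral_mono_ae (P.integrable_flux_inner _ _) ((integrable_norm_sq _).const_mul K) ?_
    filter_upwards [P.ae_exists_mem_pieces] with x hx
    obtain ⟨D, hD, hxD⟩ := hx
    refine (real_inner_le_norm _ _).trans ?_
    have := hK D hD x hxD (weakGradient u x)
    nlinarith [norm_nonneg (weakGradient u x)]
  have h2 : ∫ x in P.Ω, P.c x * u x * u x ≤ c * ‖u‖ ^ 2 := by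
    rw [norm_sq_eq_integral, ← integral_const_mul]
    refine integral_mono_ae (P.integrable_coeff_mul _ _) ((integrable_norm_sq _).const_mul c) ?_
    filter_upwards [hc] with x hx
    rw [mul_assoc, Real.norm_eq_abs, sq_abs, ← pow_two]
    exact mul_le_mul_of_nonneg_right ((le_abs_self _).trans hx) (sq_nonneg _)
  rw [aForm]
  nlinarith [sq_nonneg ‖u‖, sq_nonneg ‖weakGradient u‖]

/-- Poincaré's inequality in `H₀¹(Ω)`. -/
theorem exists_norm_le_weakGradient (hd : 1 ≤ d) (P : ModelProblem d) :
    ∃ C : ℝ, 0 < C ∧ ∀ u ∈ H10 P.Ω, ‖u‖ ≤ C * ‖weakGradient u‖ := by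
  obtain ⟨C, hC, h⟩ := exists_poincare hd P.isOpen.measurableSet P.isBounded
  exact ⟨C, hC, fun u hu => h (u, weakGradient u) ((mem_H10_iff P.isOpen).1 hu)⟩

/-- Uniform ellipticity and Poincaré's inequality; the term with `c` is nonnegative. -/
theorem exists_coercive (hd : 1 ≤ d) (P : ModelProblem d) :
    ∃ κ : ℝ, 0 < κ ∧ ∀ u ∈ H10 P.Ω, κ * (‖u‖ ^ 2 + ‖weakGradient u‖ ^ 2) ≤ aForm P u u := by
  obtain ⟨α, hα, h1⟩ := exists_aForm_ge P
  obtain ⟨C, hC, h2⟩ := exists_norm_le_weakGradient hd P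
  refine ⟨α / (C ^ 2 + 1), by positivity, fun u hu => ?_⟩
  have h3 := h2 u hu
  have h4 : ‖u‖ ^ 2 ≤ C ^ 2 * ‖weakGradient u‖ ^ 2 := by
    rw [← mul_pow]; gcongr
  refine le_trans ?_ (h1 u)
  rw [div_mul_eq_mul_div, div_le_iff₀ (by positivity)]
  nlinarith [sq_nonneg ‖weakGradient u‖]

variable (P) in
/-- The energy form as a bilinear form on `H₀¹(Ω)`, which carries the inner product `b`. -/
def energy : LinearMap.BilinForm ℝ (H10 P.Ω) :=
  LinearMap.mk₂ ℝ (fun u v => aForm P u v)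
    (fun u u' v => aForm_add_left u.2 u'.2)
    (fun t u v => aForm_smul_left u.2 t)
    (fun u v v' => by
      rw [aForm_comm, Submodule.coe_add, aForm_add_left v.2 v'.2, aForm_comm _ (u : L2 P.Ω),
        aForm_comm _ (u : L2 P.Ω)])
    (fun t u v => by
      rw [aForm_comm, Submodule.coe_smul, aForm_smul_left v.2, aForm_comm _ (u : L2 P.Ω),
        smul_eq_mul])

@[simp] theorem energy_apply (u v : H10 P.Ω) : energy P u v = aForm P u v := rfl

theorem energy_comm (u v : H10 P.Ω) : energy P u v = energy P v u := aForm_comm _ _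

/-- Rellich's theorem in terms of the energy. -/
theorem exists_cauchySeq_of_energy_le (hd : 1 ≤ d) (P : ModelProblem d) (u : ℕ → H10 P.Ω) (B : ℝ)
    (hB : ∀ n, energy P (u n) (u n) ≤ B) : ∃ φ : ℕ → ℕ, StrictMono φ ∧ CauchySeq (u ∘ φ) := by
  obtain ⟨κ, hκ, h⟩ := exists_coercive hd P
  have hc := isCompactOperator_fst P.isOpen.measurableSet P.isBounded
  set G := (testGraph P.Ω).topologicalClosure
  let p : ℕ → G := fun n => ⟨((u n : L2 P.Ω), weakGradient (u n : L2 P.Ω)),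
    (mem_H10_iff P.isOpen).1 (u n).2⟩
  have hp : ∀ n, ‖p n‖ ≤ Real.sqrt (B / κ) := by
    intro n
    have h1 := (h _ (u n).2).trans (hB n)
    rw [mul_comm, ← le_div_iff₀ hκ] at h1
    refine max_le (Real.le_sqrt_of_sq_le ?_) (Real.le_sqrt_of_sq_le ?_)
    · exact (le_add_of_nonneg_right (sq_nonneg _)).trans h1
    · exact (le_add_of_nonneg_left (sq_nonneg _)).trans h1
  obtain ⟨K, hK, hsub⟩ := hc.image_closedBall_subset_compact (f := (((ContinuousLinearMap.fst ℝ
    (L2 P.Ω) (L2Field P.Ω)).comp G.subtypeL : G →L[ℝ] L2 P.Ω) : G →ₗ[ℝ] L2 P.Ω)) (Real.sqrt (B / κ))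
  have hmem : ∀ n, (u n : L2 P.Ω) ∈ K := fun n =>
    hsub ⟨p n, mem_closedBall_zero_iff.2 (hp n), rfl⟩
  obtain ⟨x, _, φ, hφ, hx⟩ := hK.tendsto_subseq hmem
  refine ⟨φ, hφ, ?_⟩
  have h2 := Metric.cauchySeq_iff.1 hx.cauchySeq
  exact Metric.cauchySeq_iff.2 h2

theorem weakGradient_sub {Ω : Set (Space d)} (hΩ : IsOpen Ω) {u v : L2 Ω} (hu : u ∈ H10 Ω)
    (hv : v ∈ H10 Ω) : weakGradient (u - v) = weakGradient u - weakGradient v := by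
  rw [sub_eq_add_neg, ← neg_one_smul ℝ v, weakGradient_add hΩ hu (Submodule.smul_mem _ _ hv),
    weakGradient_smul hΩ hv, neg_one_smul, sub_eq_add_neg]

theorem norm_prod_sq_le {E F : Type*} [SeminormedAddCommGroup E] [SeminormedAddCommGroup F]
    (p : E × F) : ‖p‖ ^ 2 ≤ ‖p.1‖ ^ 2 + ‖p.2‖ ^ 2 := by
  rw [Prod.norm_def]
  rcases max_choice ‖p.1‖ ‖p.2‖ with h | h <;> rw [h]
  · exact le_add_of_nonneg_right (sq_nonneg _)
  · exact le_add_of_nonneg_left (sq_nonneg _)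

theorem aForm_self_nonneg (P : ModelProblem d) (u : L2 P.Ω) : 0 ≤ aForm P u u := by
  obtain ⟨α, hα, h⟩ := exists_aForm_ge P
  exact le_trans (by positivity) (h u)

/-- `H₀¹(Ω)` is complete with respect to the energy norm. -/
theorem exists_energy_limit (hd : 1 ≤ d) (P : ModelProblem d) (u : ℕ → H10 P.Ω)
    (hu : ∀ ε > 0, ∃ N, ∀ m ≥ N, ∀ n ≥ N, energy P (u m - u n) (u m - u n) < ε) :
    ∃ v : H10 P.Ω, Filter.Tendsto (fun n => energy P (u n - v) (u n - v)) Filter.atTop (𝓝 0) := by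
  obtain ⟨κ, hκ, h⟩ := exists_coercive hd P
  obtain ⟨K, hK, hle⟩ := exists_aForm_le P
  set G := (testGraph P.Ω).topologicalClosure
  let p : H10 P.Ω → L2 P.Ω × L2Field P.Ω := fun u => ((u : L2 P.Ω), weakGradient (u : L2 P.Ω))
  have hp : ∀ u, p u ∈ G := fun u => (mem_H10_iff P.isOpen).1 u.2
  have hdist : ∀ x y : H10 P.Ω, κ * dist (p x) (p y) ^ 2 ≤ energy P (x - y) (x - y) := by
    intro x y
    refine le_trans ?_ (h _ (x - y).2)
    rw [Submodule.coe_sub, weakGradient_sub P.isOpen x.2 y.2, dist_eq_norm]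
    exact mul_le_mul_of_nonneg_left (norm_prod_sq_le _) hκ.le
  have hcauchy : CauchySeq (fun n => p (u n)) := by
    rw [Metric.cauchySeq_iff]
    intro ε hε
    obtain ⟨N, hN⟩ := hu (κ * ε ^ 2) (by positivity)
    refine ⟨N, fun m hm n hn => ?_⟩
    have h1 := (hdist (u m) (u n)).trans_lt (hN m hm n hn)
    exact lt_of_pow_lt_pow_left₀ 2 hε.le (lt_of_mul_lt_mul_left h1 hκ.le)
  obtain ⟨y, hy⟩ := cauchySeq_tendsto_of_complete hcauchy
  have hyG : y ∈ G := (Submodule.isClosed_topologicalClosure _).mem_of_tendsto hy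
    (Filter.Eventually.of_forall fun n => hp _)
  have hyw : weakGradient y.1 = y.2 := (isWeakGradient_of_mem_closure hyG).weakGradient_eq P.isOpen
  have hyH : y.1 ∈ H10 P.Ω := ⟨y, hyG, rfl⟩
  refine ⟨⟨y.1, hyH⟩, ?_⟩
  have h1 : Filter.Tendsto (fun n => (u n : L2 P.Ω) - y.1) Filter.atTop (𝓝 (y.1 - y.1)) :=
    ((continuous_fst.tendsto y).comp hy).sub_const y.1
  have h2 : Filter.Tendsto (fun n => weakGradient (u n : L2 P.Ω) - y.2) Filter.atTop
      (𝓝 (y.2 - y.2)) := ((continuous_snd.tendsto y).comp hy).sub_const y.2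
  have h3 := ((h1.norm.pow 2).add (h2.norm.pow 2)).const_mul K
  rw [sub_self, sub_self, norm_zero, norm_zero] at h3
  refine squeeze_zero (fun n => aForm_self_nonneg P _) (fun n => ?_) (by simpa using h3)
  rw [energy_apply, Submodule.coe_sub]
  refine (hle _).trans (le_of_eq ?_)
  rw [weakGradient_sub P.isOpen (u n).2 hyH, hyw]

end Form

/-! ### Eigenvalues of a coercive symmetric form -/

section Spectral

variable {V : Type*} [NormedAddCommGroup V] [InnerProductSpace ℝ V]

/-- A symmetric bilinear form which dominates `κ` times the squared norm. -/
structure IsCoerciveForm (a : LinearMap.BilinForm ℝ V) (κ : ℝ) : Prop where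
  symm : ∀ u v, a u v = a v u
  pos : 0 < κ
  le : ∀ u, κ * ‖u‖ ^ 2 ≤ a u u

/-- An orthonormal family of eigenvectors of the form `a` restricted to the subspace `S`. -/
structure IsEigenfamily (a : LinearMap.BilinForm ℝ V) (S : Submodule ℝ V) {σ : Type*}
    (lam : σ → ℝ) (x : σ → V) : Prop where
  orthonormal : Orthonormal ℝ x
  mem : ∀ s, x s ∈ S
  apply : ∀ s, ∀ w ∈ S, a (x s) w = lam s * ⟪x s, w⟫_ℝ

/-- The norm `‖u‖_a = √a(u, u)`. -/
def formNorm (a : LinearMap.BilinForm ℝ V) (u : V) : ℝ := Real.sqrt (a u u)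

variable {a : LinearMap.BilinForm ℝ V} {κ : ℝ}

namespace IsCoerciveForm

variable (h : IsCoerciveForm a κ)
include h

theorem nonneg (u : V) : 0 ≤ a u u :=
  (mul_nonneg h.pos.le (sq_nonneg _)).trans (h.le u)

theorem pos_of_ne {u : V} (hu : u ≠ 0) : 0 < a u u :=
  lt_of_lt_of_le (mul_pos h.pos (pow_pos (norm_pos_iff.2 hu) 2)) (h.le u)

theorem formNorm_sq (u : V) : formNorm a u ^ 2 = a u u := Real.sq_sqrt (h.nonneg u)

theorem abs_apply_le (u v : V) : |a u v| ≤ formNorm a u * formNorm a v := by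
  have h1 := LinearMap.BilinForm.apply_sq_le_of_symm a h.nonneg ⟨fun x y => h.symm x y⟩ u v
  rw [formNorm, formNorm, ← Real.sqrt_mul (h.nonneg u)]
  exact Real.abs_le_sqrt h1

theorem formNorm_add_le (u v : V) : formNorm a (u + v) ≤ formNorm a u + formNorm a v := by
  refine Real.sqrt_le_iff.2 ⟨add_nonneg (Real.sqrt_nonneg _) (Real.sqrt_nonneg _), ?_⟩
  have h1 := (le_abs_self _).trans (h.abs_apply_le u v)
  have h2 := h.formNorm_sq u
  have h3 := h.formNorm_sq v
  simp only [map_add, LinearMap.add_apply]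
  rw [h.symm v u]
  nlinarith

theorem sqrt_mul_norm_le (u : V) : Real.sqrt κ * ‖u‖ ≤ formNorm a u := by
  refine Real.le_sqrt_of_sq_le ?_
  rw [mul_pow, Real.sq_sqrt h.pos.le]
  exact h.le u

omit h in
theorem _root_.ParO.formNorm_nonneg (u : V) : 0 ≤ formNorm a u := Real.sqrt_nonneg _

omit h in
theorem _root_.ParO.formNorm_smul (t : ℝ) (u : V) : formNorm a (t • u) = |t| * formNorm a u := by
  rw [formNorm, formNorm, ← Real.sqrt_sq_eq_abs, ← Real.sqrt_mul (sq_nonneg t)]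
  congr 1
  simp
  ring

theorem formNorm_sum_le {σ : Type*} (A : Finset σ) (x : σ → V) :
    formNorm a (∑ s ∈ A, x s) ≤ ∑ s ∈ A, formNorm a (x s) := by
  classical
  induction A using Finset.induction_on with
  | empty => simp [formNorm]
  | insert s A hs ih =>
    rw [Finset.sum_insert hs, Finset.sum_insert hs]
    exact (h.formNorm_add_le _ _).trans (by gcongr)

end IsCoerciveForm

theorem inner_sum_eq_zero {σ : Type*} {x : σ → V} (A : Finset σ) (c : σ → ℝ) (w : V)
    (hw : ∀ s ∈ A, ⟪x s, w⟫_ℝ = 0) : ⟪∑ s ∈ A, c s • x s, w⟫_ℝ = 0 := by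
  rw [sum_inner]
  exact Finset.sum_eq_zero fun s hs => by rw [real_inner_smul_left, hw s hs, mul_zero]

namespace IsEigenfamily

variable {S : Submodule ℝ V} {σ : Type*} {lam : σ → ℝ} {x : σ → V}

theorem apply_self (hx : IsEigenfamily a S lam x) (s : σ) : a (x s) (x s) = lam s := by
  rw [hx.apply s _ (hx.mem s), real_inner_self_eq_norm_sq, hx.orthonormal.1 s]
  ring

theorem pos (hx : IsEigenfamily a S lam x) (h : IsCoerciveForm a κ) (s : σ) : 0 < lam s := by
  rw [← hx.apply_self s]
  exact h.pos_of_ne (hx.orthonormal.ne_zero s)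

theorem norm_sq_sum (hx : IsEigenfamily a S lam x) (A : Finset σ) (c : σ → ℝ) :
    ‖∑ s ∈ A, c s • x s‖ ^ 2 = ∑ s ∈ A, c s ^ 2 := by
  rw [← real_inner_self_eq_norm_sq, hx.orthonormal.inner_sum]
  simp [sq]

theorem apply_sum (hx : IsEigenfamily a S lam x) (A : Finset σ) (c : σ → ℝ) {w : V} (hw : w ∈ S) :
    a (∑ s ∈ A, c s • x s) w = ∑ s ∈ A, c s * (lam s * ⟪x s, w⟫_ℝ) := by
  rw [map_sum, LinearMap.sum_apply]
  refine Finset.sum_congr rfl fun s _ => ?_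
  rw [map_smul, LinearMap.smul_apply, hx.apply s w hw, smul_eq_mul]

theorem inner_sum_right (hx : IsEigenfamily a S lam x) {A : Finset σ} (c : σ → ℝ) {s : σ}
    (hs : s ∈ A) : ⟪x s, ∑ t ∈ A, c t • x t⟫_ℝ = c s := hx.orthonormal.inner_right_sum c hs

theorem apply_sum_self (hx : IsEigenfamily a S lam x) (A : Finset σ) (c : σ → ℝ) :
    a (∑ s ∈ A, c s • x s) (∑ s ∈ A, c s • x s) = ∑ s ∈ A, lam s * c s ^ 2 := by
  rw [hx.apply_sum A c (Submodule.sum_mem _ fun s _ => Submodule.smul_mem _ _ (hx.mem s))]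
  refine Finset.sum_congr rfl fun s hs => ?_
  rw [hx.inner_sum_right c hs]
  ring

/-- Upper bound of the form on the span of some eigenvectors. -/
theorem apply_sum_self_le (hx : IsEigenfamily a S lam x) (A : Finset σ) (c : σ → ℝ) {μ : ℝ}
    (hμ : ∀ s ∈ A, lam s ≤ μ) :
    a (∑ s ∈ A, c s • x s) (∑ s ∈ A, c s • x s) ≤ μ * ‖∑ s ∈ A, c s • x s‖ ^ 2 := by
  rw [hx.apply_sum_self, hx.norm_sq_sum, Finset.mul_sum]
  exact Finset.sum_le_sum fun s hs => mul_le_mul_of_nonneg_right (hμ s hs) (sq_nonneg _)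

variable [Fintype σ]

theorem sub_sum_mem (hx : IsEigenfamily a S lam x) {v : V} (hv : v ∈ S) :
    v - ∑ s, ⟪x s, v⟫_ℝ • x s ∈ S :=
  S.sub_mem hv (Submodule.sum_mem _ fun s _ => Submodule.smul_mem _ _ (hx.mem s))

theorem inner_sub_sum (hx : IsEigenfamily a S lam x) (v : V) (s : σ) :
    ⟪x s, v - ∑ s, ⟪x s, v⟫_ℝ • x s⟫_ℝ = 0 := by
  rw [inner_sub_right, hx.inner_sum_right _ (Finset.mem_univ s), sub_self]

/-- Lower bound of the form on the orthogonal complement of the low eigenvectors. -/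
theorem le_apply_self (hx : IsEigenfamily a S lam x) (h : IsCoerciveForm a κ) {Λ μ : ℝ}
    (hΛ : ∀ w ∈ S, (∀ s, ⟪x s, w⟫_ℝ = 0) → Λ * ‖w‖ ^ 2 ≤ a w w) (hμ : μ ≤ Λ) {v : V} (hv : v ∈ S)
    (hvx : ∀ s, lam s < μ → ⟪x s, v⟫_ℝ = 0) : μ * ‖v‖ ^ 2 ≤ a v v := by
  set y := ∑ s, ⟪x s, v⟫_ℝ • x s with hy
  set w := v - y with hw
  have hwS : w ∈ S := hx.sub_sum_mem hv
  have hwx : ∀ s, ⟪x s, w⟫_ℝ = 0 := hx.inner_sub_sum v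
  have hvw : v = y + w := by rw [hw]; abel
  have hyw : a y w = 0 := by
    rw [hy, hx.apply_sum _ _ hwS]
    exact Finset.sum_eq_zero fun s _ => by rw [hwx, mul_zero, mul_zero]
  have hyw' : ⟪y, w⟫_ℝ = 0 := inner_sum_eq_zero _ _ w fun s _ => hwx s
  have h1 : a v v = a y y + a w w := by
    rw [hvw]
    simp only [map_add, LinearMap.add_apply]
    rw [h.symm w y, hyw]
    ring
  have h2 : ‖v‖ ^ 2 = ‖y‖ ^ 2 + ‖w‖ ^ 2 := by
    rw [hvw, sq, sq, sq, norm_add_sq_eq_norm_sq_add_norm_sq_of_inner_eq_zero _ _ hyw']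
  have h3 : μ * ‖y‖ ^ 2 ≤ a y y := by
    rw [hy, hx.apply_sum_self, hx.norm_sq_sum, Finset.mul_sum]
    refine Finset.sum_le_sum fun s _ => ?_
    rcases lt_or_ge (lam s) μ with hs | hs
    · rw [hvx s hs]; simp
    · exact mul_le_mul_of_nonneg_right hs (sq_nonneg _)
  have h4 := hΛ w hwS hwx
  have h5 : μ * ‖w‖ ^ 2 ≤ Λ * ‖w‖ ^ 2 := mul_le_mul_of_nonneg_right hμ (sq_nonneg _)
  rw [h1, h2]
  linarith

end IsEigenfamily

/-- A nonnegative quadratic function which vanishes at `0` has no linear term. -/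
theorem eq_zero_of_forall_quadratic_nonneg {b c : ℝ} (h : ∀ t : ℝ, 0 ≤ t * b + t ^ 2 * c) :
    b = 0 := by
  by_contra hb
  have hc : 0 ≤ |c| := abs_nonneg c
  have h1 := h (-b / (1 + |c|))
  have h2 : (-b / (1 + |c|)) * b + (-b / (1 + |c|)) ^ 2 * c
      = (b ^ 2 / (1 + |c|) ^ 2) * (c - (1 + |c|)) := by
    field_simp
    ring
  rw [h2] at h1
  have h3 : 0 < b ^ 2 / (1 + |c|) ^ 2 := by positivity
  have h4 : c - (1 + |c|) < 0 := by linarith [le_abs_self c]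
  exact absurd h1 (not_le.2 (mul_neg_of_pos_of_neg h3 h4))

/-- The Rayleigh quotient attains its infimum on the orthogonal complement of finitely many
eigenvectors, provided that bounded sequences have convergent subsequences and the space is
complete in the norm of the form. The parallelogram identity shows that a minimizing sequence which
converges in the weak norm converges in the norm of the form. -/
theorem IsEigenfamily.exists_next (h : IsCoerciveForm a κ)
    (hcomp : ∀ (u : ℕ → V) (B : ℝ), (∀ n, a (u n) (u n) ≤ B) →
      ∃ φ : ℕ → ℕ, StrictMono φ ∧ CauchySeq (u ∘ φ))
    (hcompl : ∀ u : ℕ → V, (∀ ε > 0, ∃ N, ∀ m ≥ N, ∀ n ≥ N, a (u m - u n) (u m - u n) < ε) →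
      ∃ v, Filter.Tendsto (fun n => a (u n - v) (u n - v)) Filter.atTop (𝓝 0))
    {σ : Type*} [Fintype σ] {lam : σ → ℝ} {x : σ → V} (hx : IsEigenfamily a ⊤ lam x)
    (hne : ∃ w : V, w ≠ 0 ∧ ∀ s, ⟪x s, w⟫_ℝ = 0) :
    ∃ (Λ : ℝ) (v : V), v ≠ 0 ∧ (∀ s, ⟪x s, v⟫_ℝ = 0) ∧ (∀ w, a v w = Λ * ⟪v, w⟫_ℝ) ∧
      ∀ w, (∀ s, ⟪x s, w⟫_ℝ = 0) → Λ * ‖w‖ ^ 2 ≤ a w w := by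
  set R : Set ℝ := {t | ∃ w : V, ‖w‖ = 1 ∧ (∀ s, ⟪x s, w⟫_ℝ = 0) ∧ a w w = t} with hR
  set Λ := sInf R with hΛ
  have hbdd : BddBelow R := ⟨0, by rintro t ⟨w, -, -, rfl⟩; exact h.nonneg w⟩
  have hRne : R.Nonempty := by
    obtain ⟨w, hw, hwx⟩ := hne
    exact ⟨_, ‖w‖⁻¹ • w, norm_smul_inv_norm hw,
      fun s => by rw [real_inner_smul_right, hwx, mul_zero], rfl⟩
  have hle : ∀ w, (∀ s, ⟪x s, w⟫_ℝ = 0) → Λ * ‖w‖ ^ 2 ≤ a w w := by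
    intro w hw
    rcases eq_or_ne w 0 with rfl | hw0
    · simp
    have h1 : Λ ≤ a (‖w‖⁻¹ • w) (‖w‖⁻¹ • w) :=
      csInf_le hbdd ⟨‖w‖⁻¹ • w, norm_smul_inv_norm hw0,
        fun s => by rw [real_inner_smul_right, hw, mul_zero], rfl⟩
    have h2 : a (‖w‖⁻¹ • w) (‖w‖⁻¹ • w) = a w w / ‖w‖ ^ 2 := by
      simp
      field_simp
    rw [h2, le_div_iff₀ (by positivity)] at h1
    exact h1
  have hΛ0 : 0 ≤ Λ := Real.sInf_nonneg (by rintro t ⟨w, -, -, rfl⟩; exact h.nonneg w)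
  -- a minimizing sequence, and a subsequence of it which is Cauchy in the weak norm
  have hseq : ∀ n : ℕ, ∃ w : V, ‖w‖ = 1 ∧ (∀ s, ⟪x s, w⟫_ℝ = 0) ∧
      a w w < Λ + 1 / ((n : ℝ) + 1) := by
    intro n
    obtain ⟨t, ⟨w, h1, h2, rfl⟩, h3⟩ := exists_lt_of_csInf_lt hRne
      (lt_add_of_pos_right Λ (by positivity : 0 < 1 / ((n : ℝ) + 1)))
    exact ⟨w, h1, h2, h3⟩
  choose w0 hw01 hw02 hw03 using hseq
  obtain ⟨φ, hφ, hcau⟩ := hcomp w0 (Λ + 1) fun n => (hw03 n).le.trans (by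
    have : 1 / ((n : ℝ) + 1) ≤ 1 := by
      rw [div_le_one (by positivity)]; linarith [(Nat.cast_nonneg n : (0 : ℝ) ≤ n)]
    linarith)
  set w := w0 ∘ φ with hw
  have hw1 : ∀ n, ‖w n‖ = 1 := fun n => hw01 _
  have hw2 : ∀ n s, ⟪x s, w n⟫_ℝ = 0 := fun n => hw02 _
  have hw3 : ∀ n : ℕ, a (w n) (w n) < Λ + 1 / ((n : ℝ) + 1) := fun n => by
    refine (hw03 (φ n)).trans_le ?_
    have : (n : ℝ) ≤ φ n := by exact_mod_cast hφ.id_le n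
    gcongr
  -- the parallelogram identity for both norms, and the lower bound of the form at `w m + w n`
  have hpar : ∀ m n, a (w m - w n) (w m - w n)
      ≤ 2 * (1 / ((m : ℝ) + 1)) + 2 * (1 / ((n : ℝ) + 1)) + Λ * ‖w m - w n‖ ^ 2 := by
    intro m n
    have h1 := hle (w m + w n) fun s => by rw [inner_add_right, hw2, hw2, add_zero]
    have h2 : a (w m - w n) (w m - w n)
        = 2 * a (w m) (w m) + 2 * a (w n) (w n) - a (w m + w n) (w m + w n) := by
      simp only [map_add, map_sub, LinearMap.add_apply, LinearMap.sub_apply]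
      ring
    have h3 := parallelogram_law_with_norm ℝ (w m) (w n)
    rw [hw1, hw1] at h3
    have h4 : ‖w m + w n‖ ^ 2 = 4 - ‖w m - w n‖ ^ 2 := by nlinarith
    rw [h4] at h1
    rw [h2]
    nlinarith [hw3 m, hw3 n]
  have hinv : Filter.Tendsto (fun n : ℕ => 1 / ((n : ℝ) + 1)) Filter.atTop (𝓝 0) :=
    tendsto_one_div_add_atTop_nhds_zero_nat
  obtain ⟨v, hv⟩ := hcompl w fun ε hε => by
    obtain ⟨N1, hN1⟩ := Filter.eventually_atTop.1 (hinv.eventually_lt_const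
      (by positivity : (0 : ℝ) < ε / 8))
    obtain ⟨N2, hN2⟩ := Metric.cauchySeq_iff.1 hcau (Real.sqrt (ε / (2 * (Λ + 1))))
      (Real.sqrt_pos.2 (by positivity))
    refine ⟨max N1 N2, fun m hm n hn => (hpar m n).trans_lt ?_⟩
    have e1 := hN1 m (le_of_max_le_left hm)
    have e2 := hN1 n (le_of_max_le_left hn)
    have e3 := hN2 m (le_of_max_le_right hm) n (le_of_max_le_right hn)
    rw [dist_eq_norm, Real.lt_sqrt (norm_nonneg _), lt_div_iff₀ (by positivity)] at e3
    have e4 : Λ * ‖w m - w n‖ ^ 2 ≤ (Λ + 1) * ‖w m - w n‖ ^ 2 :=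
      mul_le_mul_of_nonneg_right (by linarith) (sq_nonneg _)
    have e5 : ‖w m - w n‖ ^ 2 * (2 * (Λ + 1)) = 2 * ((Λ + 1) * ‖w m - w n‖ ^ 2) := by ring
    have e6 : ‖(w0 ∘ φ) m - (w0 ∘ φ) n‖ = ‖w m - w n‖ := rfl
    rw [e6] at e3
    linarith
  -- the constraints and the value of the quotient pass to the limit `v`
  have hvn : Filter.Tendsto (fun n => formNorm a (w n - v)) Filter.atTop (𝓝 0) := by
    have := (Real.continuous_sqrt.tendsto 0).comp hv
    simpa [formNorm, Function.comp_def] using this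
  have hwv : Filter.Tendsto w Filter.atTop (𝓝 v) := by
    rw [tendsto_iff_norm_sub_tendsto_zero]
    have h1 : ∀ n, ‖w n - v‖ ≤ (Real.sqrt κ)⁻¹ * formNorm a (w n - v) := fun n => by
      rw [inv_mul_eq_div, le_div_iff₀ (Real.sqrt_pos.2 h.pos), mul_comm]
      exact h.sqrt_mul_norm_le _
    refine squeeze_zero (fun n => norm_nonneg _) h1 ?_
    simpa using hvn.const_mul (Real.sqrt κ)⁻¹
  have hv1 : ‖v‖ = 1 := tendsto_nhds_unique hwv.norm (by simp [hw1])
  have hvx : ∀ s, ⟪x s, v⟫_ℝ = 0 := fun s =>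
    tendsto_nhds_unique (Filter.Tendsto.inner tendsto_const_nhds hwv) (by simp [hw2])
  have hva : a v v ≤ Λ := by
    have h1 : ∀ n : ℕ, formNorm a v ≤ Real.sqrt (Λ + 1 / ((n : ℝ) + 1)) + formNorm a (w n - v) := by
      intro n
      have h2 : v = w n + (-1 : ℝ) • (w n - v) := by simp
      have h3 := h.formNorm_add_le (w n) ((-1 : ℝ) • (w n - v))
      rw [← h2, formNorm_smul] at h3
      have h4 : formNorm a (w n) ≤ Real.sqrt (Λ + 1 / ((n : ℝ) + 1)) := Real.sqrt_le_sqrt (hw3 n).le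
      rw [abs_neg, abs_one, one_mul] at h3
      linarith
    have h2 : Filter.Tendsto (fun n : ℕ => Real.sqrt (Λ + 1 / ((n : ℝ) + 1))
        + formNorm a (w n - v)) Filter.atTop (𝓝 (Real.sqrt (Λ + 0) + 0)) :=
      ((Real.continuous_sqrt.tendsto _).comp (hinv.const_add Λ)).add hvn
    have h3 := ge_of_tendsto' h2 h1
    rw [add_zero, add_zero] at h3
    exact (Real.sqrt_le_sqrt_iff hΛ0).1 h3
  have hva' : a v v = Λ := le_antisymm hva (by simpa [hv1] using hle v hvx)
  -- the first variation of the quotient vanishes on the complement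
  have hEL : ∀ y, (∀ s, ⟪x s, y⟫_ℝ = 0) → a v y = Λ * ⟪v, y⟫_ℝ := by
    intro y hy
    have key : 2 * (a v y - Λ * ⟪v, y⟫_ℝ) = 0 := by
      refine eq_zero_of_forall_quadratic_nonneg (c := a y y - Λ * ‖y‖ ^ 2) fun t => ?_
      have h1 := hle (v + t • y) fun s => by
        rw [inner_add_right, real_inner_smul_right, hvx, hy]; simp
      rw [norm_add_sq_real, norm_smul, real_inner_smul_right, hv1, mul_pow, Real.norm_eq_abs,
        sq_abs] at h1
      simp only [map_add, LinearMap.add_apply, map_smul, LinearMap.smul_apply, smul_eq_mul] at h1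
      rw [h.symm y v, hva'] at h1
      nlinarith
    linarith
  refine ⟨Λ, v, fun h0 => by simp [h0] at hv1, hvx, fun y => ?_, hle⟩
  -- in the directions `x s` both sides of the eigenvalue equation vanish
  have hy := hEL _ (hx.inner_sub_sum y)
  have h1 : a v (∑ s, ⟪x s, y⟫_ℝ • x s) = 0 := by
    rw [h.symm, hx.apply_sum _ _ Submodule.mem_top]
    exact Finset.sum_eq_zero fun s _ => by rw [hvx, mul_zero, mul_zero]
  have h2 : ⟪v, ∑ s, ⟪x s, y⟫_ℝ • x s⟫_ℝ = 0 := by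
    rw [real_inner_comm]
    exact inner_sum_eq_zero _ _ _ fun s _ => hvx s
  rw [map_sub, inner_sub_right, h1, h2, sub_zero, sub_zero] at hy
  exact hy

/-- There is a nontrivial linear combination of the `x s`, `s ∈ A`, which is orthogonal to all
`y t`, `t ∈ B`, if `A` has more elements than `B`. -/
theorem exists_combination {σ τ : Type*} [DecidableEq σ] (A : Finset σ) (B : Finset τ)
    (hcard : B.card < A.card) (x : σ → V) (y : τ → V) :
    ∃ c : σ → ℝ, 0 < ∑ s ∈ A, c s ^ 2 ∧ ∀ t ∈ B, ⟪y t, ∑ s ∈ A, c s • x s⟫_ℝ = 0 := by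
  let f : (A → ℝ) →ₗ[ℝ] (B → ℝ) :=
    { toFun := fun c t => ⟪y t, ∑ s : A, c s • x s⟫_ℝ
      map_add' := fun c c' => by
        funext t
        simp [add_smul, Finset.sum_add_distrib, inner_add_right]
      map_smul' := fun r c => by
        funext t
        simp [mul_smul, ← Finset.smul_sum, real_inner_smul_right] }
  have hker : LinearMap.ker f ≠ ⊥ := f.ker_ne_bot_of_finrank_lt (by simpa using hcard)
  obtain ⟨c, hc, hc0⟩ := (Submodule.ne_bot_iff _).1 hker
  have hext : ∀ (g : σ → ℝ → V), ∑ s ∈ A, g s (if h : s ∈ A then c ⟨s, h⟩ else 0)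
      = ∑ s : A, g s (c s) := by
    intro g
    rw [← Finset.sum_coe_sort]
    exact Finset.sum_congr rfl fun s _ => by rw [dif_pos s.2]
  refine ⟨fun s => if h : s ∈ A then c ⟨s, h⟩ else 0, ?_, fun t ht => ?_⟩
  · obtain ⟨s, hs⟩ := Function.ne_iff.1 hc0
    refine Finset.sum_pos' (fun _ _ => sq_nonneg _) ⟨s, s.2, ?_⟩
    simp only [dif_pos s.2]
    exact sq_pos_of_ne_zero hs
  · rw [hext fun s r => r • x s]
    exact congr_fun (LinearMap.mem_ker.1 hc) ⟨t, ht⟩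

/-- The vectors of `S` which are orthogonal to all `x s`. -/
def orthogonalIn {σ : Type*} (S : Submodule ℝ V) (x : σ → V) : Submodule ℝ V :=
  S ⊓ (Submodule.span ℝ (range x))ᗮ

theorem mem_orthogonalIn {σ : Type*} {S : Submodule ℝ V} {x : σ → V} {w : V} :
    w ∈ orthogonalIn S x ↔ w ∈ S ∧ ∀ s, ⟪x s, w⟫_ℝ = 0 := by
  rw [orthogonalIn, Submodule.mem_inf, Submodule.mem_orthogonal]
  refine and_congr_right fun _ => ⟨fun h s => h _ (Submodule.subset_span ⟨s, rfl⟩),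
    fun h u hu => ?_⟩
  refine Submodule.span_induction (p := fun u _ => ⟪u, w⟫_ℝ = 0) ?_ (by simp) ?_ ?_ hu
  · rintro _ ⟨s, rfl⟩
    exact h s
  · intro y z _ _ hy hz
    rw [inner_add_left, hy, hz, add_zero]
  · intro t y _ hy
    rw [real_inner_smul_left, hy, mul_zero]

section Discrete

variable {σ : Type*} [Fintype σ] {lam : σ → ℝ} {U : σ → V} {S : Submodule ℝ V}
  {lamh : σ → ℝ} {x : σ → V} {Λ : ℝ}

/-- The eigenvalues in a subspace are upper bounds of those in the whole space. -/
theorem IsEigenfamily.eigenvalue_le (h : IsCoerciveForm a κ) (hU : IsEigenfamily a ⊤ lam U)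
    (hΛ : ∀ w, (∀ s, ⟪U s, w⟫_ℝ = 0) → Λ * ‖w‖ ^ 2 ≤ a w w) (hlam : ∀ s, lam s ≤ Λ)
    (hx : IsEigenfamily a S lamh x) (hmono : ∀ s t, lam s < lam t → lamh s ≤ lamh t) (s : σ) :
    lam s ≤ lamh s := by
  classical
  -- more eigenvectors of `S` have eigenvalues `≤ lamh s` than eigenvectors of the whole space have
  -- eigenvalues `< lam s`
  obtain ⟨c, hc, hcU⟩ := exists_combination (Finset.univ.filter fun t => lamh t ≤ lamh s)
    (Finset.univ.filter fun t => lam t < lam s) (Finset.card_lt_card (by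
      refine ⟨fun t ht => ?_, fun hsub => ?_⟩
      · rw [Finset.mem_filter] at ht ⊢
        exact ⟨Finset.mem_univ _, hmono t s ht.2⟩
      · have := hsub (Finset.mem_filter.2 ⟨Finset.mem_univ s, le_rfl⟩)
        exact lt_irrefl _ (Finset.mem_filter.1 this).2)) x U
  set A := Finset.univ.filter fun t => lamh t ≤ lamh s
  have h1 := hU.le_apply_self h (fun w _ => hΛ w) (hlam s) (v := ∑ s ∈ A, c s • x s)
    Submodule.mem_top fun t ht => hcU t (Finset.mem_filter.2 ⟨Finset.mem_univ t, ht⟩)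
  have h2 := h1.trans (hx.apply_sum_self_le A c fun t ht => (Finset.mem_filter.1 ht).2)
  rw [hx.norm_sq_sum] at h2
  exact le_of_mul_le_mul_right h2 hc

/-- A further eigenvalue in a subspace is an upper bound of the next eigenvalue in the whole
space. -/
theorem IsEigenfamily.next_le
    (hΛ : ∀ w, (∀ s, ⟪U s, w⟫_ℝ = 0) → Λ * ‖w‖ ^ 2 ≤ a w w) (hx : IsEigenfamily a S lamh x)
    {μ : ℝ} {v : V} (hv0 : v ≠ 0) (hvS : v ∈ S) (hv : ∀ w ∈ S, a v w = μ * ⟪v, w⟫_ℝ)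
    (hvx : ∀ s, ⟪x s, v⟫_ℝ = 0) (hμ : ∀ s, lamh s ≤ μ) : Λ ≤ μ := by
  classical
  -- one vector more than there are constraints
  let x' : Option σ → V := fun o => o.elim (‖v‖⁻¹ • v) x
  have hx' : IsEigenfamily a S (fun o => o.elim μ lamh) x' := by
    refine ⟨⟨?_, ?_⟩, ?_, ?_⟩
    · rintro (_ | s)
      · exact norm_smul_inv_norm hv0
      · exact hx.orthonormal.1 s
    · rintro (_ | s) (_ | t) hst
      · exact absurd rfl hst
      · change ⟪‖v‖⁻¹ • v, x t⟫_ℝ = 0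
        rw [real_inner_smul_left, real_inner_comm, hvx, mul_zero]
      · change ⟪x s, ‖v‖⁻¹ • v⟫_ℝ = 0
        rw [real_inner_smul_right, hvx, mul_zero]
      · exact hx.orthonormal.2 fun h => hst (by rw [h])
    · rintro (_ | s)
      · exact S.smul_mem _ hvS
      · exact hx.mem s
    · rintro (_ | s) w hw
      · change a (‖v‖⁻¹ • v) w = μ * ⟪‖v‖⁻¹ • v, w⟫_ℝ
        rw [map_smul, LinearMap.smul_apply, hv w hw, real_inner_smul_left, smul_eq_mul]
        ring
      · exact hx.apply s w hw
  obtain ⟨c, hc, hcU⟩ := exists_combination (Finset.univ : Finset (Option σ))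
    (Finset.univ : Finset σ) (by simp) x' U
  have h1 := hΛ _ fun s => hcU s (Finset.mem_univ s)
  have h2 := h1.trans (hx'.apply_sum_self_le Finset.univ c (μ := μ) (by
    rintro (_ | s) _
    · exact le_rfl
    · exact hμ s))
  rw [hx'.norm_sq_sum] at h2
  exact le_of_mul_le_mul_right h2 hc

/-- Upper bound of the eigenvalues in a subspace which contains approximations `v s` of the
eigenvectors of the whole space, up to an error `ε` in the energy norm. -/
theorem IsEigenfamily.sqrt_eigenvalue_mul_le (h : IsCoerciveForm a κ)
    (hU : IsEigenfamily a ⊤ lam U) (hx : IsEigenfamily a S lamh x)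
    (hmono : ∀ s t, lam s < lam t → lamh s ≤ lamh t)
    (hxc : ∀ s, ∀ w ∈ S, (∀ s, ⟪x s, w⟫_ℝ = 0) → lamh s * ‖w‖ ^ 2 ≤ a w w)
    {ε : ℝ} {v : σ → V} (hvS : ∀ s, v s ∈ S) (hv : ∀ s, formNorm a (v s - U s) ≤ ε) (s : σ) :
    Real.sqrt (lamh s) * (1 - ε * Real.sqrt (Fintype.card σ) / Real.sqrt κ)
      ≤ Real.sqrt (lam s) + ε * Real.sqrt (Fintype.card σ) := by
  classical
  -- a combination of approximate eigenvectors with eigenvalues `≤ lam s` which is orthogonal to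
  -- all eigenvectors of `S` with eigenvalues `< lamh s`
  obtain ⟨c, hc, hcx⟩ := exists_combination (Finset.univ.filter fun t => lam t ≤ lam s)
    (Finset.univ.filter fun t => lamh t < lamh s) (Finset.card_lt_card (by
      refine ⟨fun t ht => ?_, fun hsub => ?_⟩
      · rw [Finset.mem_filter] at ht ⊢
        refine ⟨Finset.mem_univ _, ?_⟩
        by_contra! hlt
        exact absurd (hmono s t hlt) (not_le.2 ht.2)
      · have := hsub (Finset.mem_filter.2 ⟨Finset.mem_univ s, le_rfl⟩)
        exact lt_irrefl _ (Finset.mem_filter.1 this).2)) v x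
  set A := Finset.univ.filter fun t => lam t ≤ lam s
  set n := Real.sqrt (∑ s ∈ A, c s ^ 2) with hn
  have hn0 : 0 < n := Real.sqrt_pos.2 hc
  have hε : 0 ≤ ε := (formNorm_nonneg _).trans (hv s)
  set w := ∑ t ∈ A, c t • v t with hw
  set u := ∑ t ∈ A, c t • U t with hu
  have hwS : w ∈ S := Submodule.sum_mem _ fun t _ => S.smul_mem _ (hvS t)
  have hun : ‖u‖ = n := by
    rw [hn, ← hU.norm_sq_sum, Real.sqrt_sq (norm_nonneg _)]
  have hua : formNorm a u ≤ Real.sqrt (lam s) * n := by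
    rw [formNorm, ← hun, ← Real.sqrt_sq (norm_nonneg u), ← Real.sqrt_mul (hU.pos h s).le]
    exact Real.sqrt_le_sqrt (hU.apply_sum_self_le A c fun t ht => (Finset.mem_filter.1 ht).2)
  have hwu : formNorm a (w - u) ≤ ε * Real.sqrt (Fintype.card σ) * n := by
    have e1 : w - u = ∑ t ∈ A, c t • (v t - U t) := by
      rw [hw, hu, ← Finset.sum_sub_distrib]
      exact Finset.sum_congr rfl fun t _ => by rw [smul_sub]
    rw [e1]
    refine (h.formNorm_sum_le A _).trans ?_
    have e2 : ∑ t ∈ A, formNorm a (c t • (v t - U t)) ≤ ε * ∑ t ∈ A, |c t| * 1 := by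
      rw [Finset.mul_sum]
      refine Finset.sum_le_sum fun t _ => ?_
      rw [formNorm_smul, mul_one, mul_comm]
      exact mul_le_mul_of_nonneg_right (hv t) (abs_nonneg _)
    refine e2.trans ?_
    rw [mul_assoc]
    refine mul_le_mul_of_nonneg_left ?_ hε
    have e3 := Finset.sum_mul_sq_le_sq_mul_sq A (fun t => |c t|) (fun _ => (1 : ℝ))
    refine (Real.le_sqrt_of_sq_le e3).trans ?_
    rw [mul_comm, Real.sqrt_mul (by positivity)]
    simp only [sq_abs, one_pow, Finset.sum_const, nsmul_eq_mul, mul_one]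
    gcongr
    exact_mod_cast Finset.card_le_univ A
  have hwn : (1 - ε * Real.sqrt (Fintype.card σ) / Real.sqrt κ) * n ≤ ‖w‖ := by
    have e1 : ‖w - u‖ ≤ ε * Real.sqrt (Fintype.card σ) * n / Real.sqrt κ := by
      rw [le_div_iff₀ (Real.sqrt_pos.2 h.pos), mul_comm]
      exact (h.sqrt_mul_norm_le _).trans hwu
    have e2 := norm_sub_norm_le u w
    rw [norm_sub_rev, hun] at e2
    have e3 : (1 - ε * Real.sqrt (Fintype.card σ) / Real.sqrt κ) * n
        = n - ε * Real.sqrt (Fintype.card σ) * n / Real.sqrt κ := by ring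
    linarith
  have hwa : Real.sqrt (lamh s) * ‖w‖ ≤ formNorm a w := by
    have e1 := hx.le_apply_self h (hxc s) le_rfl hwS
      fun t ht => hcx t (Finset.mem_filter.2 ⟨Finset.mem_univ t, ht⟩)
    rw [formNorm, ← Real.sqrt_sq (norm_nonneg w), ← Real.sqrt_mul (hx.pos h s).le]
    exact Real.sqrt_le_sqrt e1
  have hfin : Real.sqrt (lamh s) * ((1 - ε * Real.sqrt (Fintype.card σ) / Real.sqrt κ) * n)
      ≤ (Real.sqrt (lam s) + ε * Real.sqrt (Fintype.card σ)) * n := by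
    have e1 : formNorm a w ≤ formNorm a u + formNorm a (w - u) := by
      simpa using h.formNorm_add_le u (w - u)
    have e2 := mul_le_mul_of_nonneg_left hwn (Real.sqrt_nonneg (lamh s))
    linarith
  rw [← mul_assoc] at hfin
  exact le_of_mul_le_mul_right hfin hn0

/-- The form restricted to a finite dimensional subspace has a complete orthonormal family of
eigenvectors. -/
theorem exists_eigenbasis (h : IsCoerciveForm a κ) (R : Submodule ℝ V) [FiniteDimensional ℝ R] :
    ∃ (n : ℕ) (μ : Fin n → ℝ) (e : Fin n → V), IsEigenfamily a R μ e ∧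
      ∀ w ∈ R, w = ∑ t, ⟪e t, w⟫_ℝ • e t := by
  let b := stdOrthonormalBasis ℝ R
  let T : R →ₗ[ℝ] R := ∑ i, (LinearMap.toSpanSingleton ℝ R (b i)).comp
    ((a.flip (b i : V)).comp R.subtype)
  have hT : ∀ v w : R, ⟪T v, w⟫_ℝ = a v w := by
    intro v w
    have h1 : T v = ∑ i, a (v : V) (b i : V) • b i := by simp [T, LinearMap.sum_apply]
    rw [h1, sum_inner]
    conv_rhs => rw [← b.sum_repr' w]
    rw [Submodule.coe_sum, map_sum]
    refine Finset.sum_congr rfl fun i _ => ?_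
    rw [real_inner_smul_left, Submodule.coe_smul, map_smul, smul_eq_mul, mul_comm]
  have hsymm : T.IsSymmetric := fun v w => by
    rw [hT, real_inner_comm, hT, h.symm]
  let e := hsymm.eigenvectorBasis rfl
  refine ⟨Module.finrank ℝ R, hsymm.eigenvalues rfl, fun t => (e t : V), ⟨?_, fun t => (e t).2, ?_⟩,
    ?_⟩
  · exact e.orthonormal.comp_linearIsometry R.subtypeₗᵢ
  · intro t w hw
    have h1 := hT (e t) ⟨w, hw⟩
    rw [← h1, hsymm.apply_eigenvectorBasis]
    simp [real_inner_smul_left, e]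
  · intro w hw
    have h1 := congr_arg (Subtype.val) (e.sum_repr' ⟨w, hw⟩)
    rw [Submodule.coe_sum] at h1
    exact h1.symm

/-- An orthonormal family of eigenvectors in a finite dimensional subspace can be completed: the
remaining eigenvectors span the orthogonal complement. -/
theorem IsEigenfamily.exists_complement (h : IsCoerciveForm a κ) [FiniteDimensional ℝ S]
    (hx : IsEigenfamily a S lamh x) :
    ∃ (n : ℕ) (μ : Fin n → ℝ) (e : Fin n → V), IsEigenfamily a S μ e ∧
      (∀ s t, ⟪x s, e t⟫_ℝ = 0) ∧
      ∀ w ∈ S, w = ∑ s, ⟪x s, w⟫_ℝ • x s + ∑ t, ⟪e t, w⟫_ℝ • e t := by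
  have hfin : FiniteDimensional ℝ (orthogonalIn S x) :=
    Submodule.finiteDimensional_of_le (inf_le_left : orthogonalIn S x ≤ S)
  obtain ⟨n, μ, e, he, hcomplete⟩ := exists_eigenbasis h (orthogonalIn S x)
  have hex : ∀ s t, ⟪x s, e t⟫_ℝ = 0 := fun s t => (mem_orthogonalIn.1 (he.mem t)).2 s
  refine ⟨n, μ, e, ⟨he.orthonormal, fun t => (mem_orthogonalIn.1 (he.mem t)).1, ?_⟩, hex, ?_⟩
  · intro t w hw
    have h1 := he.apply t _ (mem_orthogonalIn.2 ⟨hx.sub_sum_mem hw, hx.inner_sub_sum w⟩)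
    have h2 : a (e t) (∑ s, ⟪x s, w⟫_ℝ • x s) = 0 := by
      rw [h.symm, hx.apply_sum _ _ (mem_orthogonalIn.1 (he.mem t)).1]
      exact Finset.sum_eq_zero fun s _ => by rw [hex, mul_zero, mul_zero]
    have h3 : ⟪e t, ∑ s, ⟪x s, w⟫_ℝ • x s⟫_ℝ = 0 := by
      rw [real_inner_comm]
      exact inner_sum_eq_zero _ _ _ fun s _ => hex s t
    rwa [map_sub, inner_sub_right, h2, h3, sub_zero, sub_zero] at h1
  · intro w hw
    have h1 := hcomplete _ (mem_orthogonalIn.2 ⟨hx.sub_sum_mem hw, hx.inner_sub_sum w⟩)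
    have h2 : ∀ t, ⟪e t, w - ∑ s, ⟪x s, w⟫_ℝ • x s⟫_ℝ = ⟪e t, w⟫_ℝ := fun t => by
      rw [inner_sub_right, real_inner_comm (∑ s, ⟪x s, w⟫_ℝ • x s),
        inner_sum_eq_zero _ _ _ fun s _ => hex s t, sub_zero]
    simp_rw [h2] at h1
    rw [← h1]
    abel

end Discrete

end Spectral

/-! ### Spectral projections of finite rank operators -/

section Idempotents

variable {B : Type*} [NormedRing B] [NormedAlgebra ℂ B] {ι : Type*} [Fintype ι] {q : ι → B}

theorem sum_smul_mul_sum_smul (hq : CompleteOrthogonalIdempotents q) (f g : ι → ℂ) :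
    (∑ i, f i • q i) * (∑ i, g i • q i) = ∑ i, (f i * g i) • q i := by
  rw [Finset.sum_mul]
  refine Finset.sum_congr rfl fun i _ => ?_
  rw [Finset.mul_sum, Finset.sum_eq_single i]
  · rw [smul_mul_smul_comm, (hq.idem i).eq]
  · intro j _ hj
    rw [smul_mul_smul_comm, hq.ortho hj.symm, smul_zero]
  · simp

theorem resolvent_sum_smul (hq : CompleteOrthogonalIdempotents q) (κ : ι → ℂ) {z : ℂ}
    (hz : ∀ i, z ≠ κ i) : resolvent (∑ i, κ i • q i) z = ∑ i, (z - κ i)⁻¹ • q i := by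
  have h1 : algebraMap ℂ B z - ∑ i, κ i • q i = ∑ i, (z - κ i) • q i := by
    rw [Algebra.algebraMap_eq_smul_one, ← hq.complete, Finset.smul_sum, ← Finset.sum_sub_distrib]
    exact Finset.sum_congr rfl fun i _ => (sub_smul _ _ _).symm
  have hinv : ∀ i, z - κ i ≠ 0 := fun i => sub_ne_zero.2 (hz i)
  let u : Bˣ :=
    { val := ∑ i, (z - κ i) • q i
      inv := ∑ i, (z - κ i)⁻¹ • q i
      val_inv := by
        rw [sum_smul_mul_sum_smul hq, ← hq.complete]
        exact Finset.sum_congr rfl fun i _ => by rw [mul_inv_cancel₀ (hinv i), one_smul]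
      inv_val := by
        rw [sum_smul_mul_sum_smul hq, ← hq.complete]
        exact Finset.sum_congr rfl fun i _ => by rw [inv_mul_cancel₀ (hinv i), one_smul] }
  rw [resolvent, h1]
  exact Ring.inverse_unit u

open Classical in
theorem circleIntegral_inv_sub {w c : ℂ} {r : ℝ} (hr : 0 < r) (hw : dist w c ≠ r) :
    ∮ z in C(c, r), (z - w)⁻¹ = if dist w c < r then 2 * Real.pi * Complex.I else 0 := by
  split_ifs with h
  · exact circleIntegral.integral_sub_inv_of_mem_ball h
  · have hlt : r < dist w c := lt_of_le_of_ne (not_lt.1 h) (Ne.symm hw)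
    refine Complex.circleIntegral_eq_zero_of_differentiable_on_off_countable hr.le countable_empty
      ?_ ?_
    · refine ContinuousOn.inv₀ (by fun_prop) fun z hz => ?_
      rw [sub_ne_zero]
      rintro rfl
      exact absurd (Metric.mem_closedBall.1 hz) (not_le.2 hlt)
    · intro z hz
      refine DifferentiableAt.inv (by fun_prop) ?_
      rw [sub_ne_zero]
      rintro rfl
      exact absurd (Metric.mem_ball.1 hz.1) (not_lt.2 hlt.le)

open Classical in
/-- The resolvent of `∑ κ i • q i` is `∑ (z - κ i)⁻¹ • q i`, so Cauchy's formula selects the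
idempotents whose eigenvalues lie inside the circle. -/
theorem circleIntegral_resolvent [CompleteSpace B] (hq : CompleteOrthogonalIdempotents q)
    (κ : ι → ℂ) {c : ℂ} {r : ℝ} (hr : 0 < r) (hκ : ∀ i, dist (κ i) c ≠ r) :
    ((2 * Real.pi * Complex.I : ℂ)⁻¹) • ∮ z in C(c, r), resolvent (∑ i, κ i • q i) z
      = ∑ i, if dist (κ i) c < r then q i else 0 := by
  have h1 : ∮ z in C(c, r), resolvent (∑ i, κ i • q i) z
      = ∮ z in C(c, r), ∑ i, (z - κ i)⁻¹ • q i :=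
    circleIntegral.integral_congr hr.le fun z hz => resolvent_sum_smul hq κ fun i hi =>
      hκ i (hi ▸ Metric.mem_sphere.1 hz)
  have hint : ∀ i ∈ Finset.univ, CircleIntegrable (fun z => (z - κ i)⁻¹ • q i) c r := by
    intro i _
    refine ContinuousOn.circleIntegrable hr.le ?_
    refine ContinuousOn.smul (ContinuousOn.inv₀ (by fun_prop) fun z hz => ?_) continuousOn_const
    rw [sub_ne_zero]
    rintro rfl
    exact hκ i (Metric.mem_sphere.1 hz)
  rw [h1, circleIntegral.integral_fun_sum hint, Finset.smul_sum]
  refine Finset.sum_congr rfl fun i _ => ?_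
  rw [circleIntegral.integral_smul_const, circleIntegral_inv_sub hr (hκ i), smul_smul]
  split_ifs
  · rw [inv_mul_cancel₀ Complex.two_pi_I_ne_zero, one_smul]
  · rw [mul_zero, zero_smul]

open Classical in
/-- The missing idempotent `1 - ∑ p i` belongs to the eigenvalue `0`, which lies outside the
circle. -/
theorem circleIntegral_resolvent_of_orthogonal [CompleteSpace B] {p : ι → B}
    (hp : OrthogonalIdempotents p) (κ : ι → ℂ) {c : ℂ} {r : ℝ} (hr : 0 < r) (h0 : r < dist 0 c)
    (hκ : ∀ i, dist (κ i) c ≠ r) :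
    ((2 * Real.pi * Complex.I : ℂ)⁻¹) • ∮ z in C(c, r), resolvent (∑ i, κ i • p i) z
      = ∑ i, if dist (κ i) c < r then p i else 0 := by
  have hK := circleIntegral_resolvent (CompleteOrthogonalIdempotents.option hp)
    (fun o : Option ι => o.elim 0 κ) hr (c := c) (by
    rintro (_ | t)
    · exact h0.ne'
    · exact hκ t)
  rw [Fintype.sum_option, Fintype.sum_option] at hK
  simp only [Option.elim, zero_smul, zero_add] at hK
  exact hK.trans ((congr_arg₂ (· + ·) (if_neg (not_lt.2 h0.le)) rfl).trans (zero_add _))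

end Idempotents

section Complexify

variable {Ω : Set (Space d)}

theorem rePart_toComplex (u : L2 Ω) : rePart Ω (toComplex Ω u) = u := by
  apply Lp.ext
  filter_upwards [Complex.reCLM.coeFn_compLpL (p := 2) (μ := volume.restrict Ω) (toComplex Ω u),
    Complex.ofRealCLM.coeFn_compLpL (p := 2) (μ := volume.restrict Ω) u] with x h1 h2
  rw [rePart, h1, toComplex, h2]
  simp

theorem imPart_toComplex (u : L2 Ω) : imPart Ω (toComplex Ω u) = 0 := by
  apply Lp.ext
  filter_upwards [Complex.imCLM.coeFn_compLpL (p := 2) (μ := volume.restrict Ω) (toComplex Ω u),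
    Complex.ofRealCLM.coeFn_compLpL (p := 2) (μ := volume.restrict Ω) u,
    Lp.coeFn_zero ℝ 2 (volume.restrict Ω)] with x h1 h2 h3
  rw [imPart, h1, toComplex, h2, h3]
  simp

theorem complexify_apply (K : L2 Ω →L[ℝ] L2 Ω) (w : L2C Ω) :
    complexify K w = toComplex Ω (K (rePart Ω w)) + Complex.I • toComplex Ω (K (imPart Ω w)) := rfl

theorem rePart_complexify (K : L2 Ω →L[ℝ] L2 Ω) (w : L2C Ω) :
    rePart Ω (complexify K w) = K (rePart Ω w) := by
  rw [complexify_apply, map_add, rePart_smul, rePart_toComplex, rePart_toComplex, imPart_toComplex]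
  simp

theorem imPart_complexify (K : L2 Ω →L[ℝ] L2 Ω) (w : L2C Ω) :
    imPart Ω (complexify K w) = K (imPart Ω w) := by
  rw [complexify_apply, map_add, imPart_smul, rePart_toComplex, imPart_toComplex, imPart_toComplex]
  simp

theorem complexify_mul (K K' : L2 Ω →L[ℝ] L2 Ω) :
    complexify (K * K') = complexify K * complexify K' := by
  ext1 w
  change complexify (K * K') w = complexify K (complexify K' w)
  rw [complexify_apply (K * K'), complexify_apply K, rePart_complexify, imPart_complexify]
  rfl

theorem complexify_add (K K' : L2 Ω →L[ℝ] L2 Ω) :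
    complexify (K + K') = complexify K + complexify K' := by
  ext1 w
  rw [add_apply]
  simp only [complexify_apply, add_apply, map_add, smul_add]
  abel

theorem complexify_smul (t : ℝ) (K : L2 Ω →L[ℝ] L2 Ω) :
    complexify (t • K) = (t : ℂ) • complexify K := by
  ext1 w
  rw [smul_apply]
  simp only [complexify_apply, smul_apply, map_smul, smul_add]
  rw [Complex.coe_smul, Complex.coe_smul, smul_comm t Complex.I]
  rfl

theorem complexify_zero : complexify (0 : L2 Ω →L[ℝ] L2 Ω) = 0 := by
  have := complexify_smul 0 (0 : L2 Ω →L[ℝ] L2 Ω)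
  simpa using this

theorem complexify_sum {ι : Type*} (s : Finset ι) (K : ι → L2 Ω →L[ℝ] L2 Ω) :
    complexify (∑ i ∈ s, K i) = ∑ i ∈ s, complexify (K i) := by
  classical
  induction s using Finset.induction_on with
  | empty => simp [complexify_zero]
  | insert i s hi ih => rw [Finset.sum_insert hi, Finset.sum_insert hi, complexify_add, ih]

/-- The orthogonal projection onto the line spanned by a unit vector. -/
def lineProjection (e : L2 Ω) : L2 Ω →L[ℝ] L2 Ω := (innerSL ℝ e).smulRight e

theorem lineProjection_apply (e u : L2 Ω) : lineProjection e u = ⟪e, u⟫_ℝ • e := rfl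

theorem orthogonalIdempotents_lineProjection {τ : Type*} {e : τ → L2 Ω}
    (he : Orthonormal ℝ e) : OrthogonalIdempotents fun t => complexify (lineProjection (e t)) := by
  constructor
  · intro t
    rw [IsIdempotentElem, ← complexify_mul]
    congr 1
    ext1 u
    change lineProjection _ (lineProjection _ u) = _
    rw [lineProjection_apply, lineProjection_apply, real_inner_smul_right,
      real_inner_self_eq_norm_sq, he.1 t]
    simp
  · intro s t hst
    change complexify (lineProjection (e s)) * complexify (lineProjection (e t)) = 0
    rw [← complexify_mul, ← complexify_zero]
    congr 1
    ext1 u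
    change lineProjection _ (lineProjection _ u) = _
    rw [lineProjection_apply, lineProjection_apply, real_inner_smul_right, he.2 hst]
    simp

open Classical in
/-- The spectral projection of a self-adjoint operator of finite rank, in terms of an orthonormal
family of eigenvectors. The circle must not meet the spectrum, and `0`, which is always in the
spectrum, must lie outside. -/
theorem rePart_spectralProjection {τ : Type*} [Fintype τ] {e : τ → L2 Ω} (he : Orthonormal ℝ e)
    (κ : τ → ℝ) {c r : ℝ} (hr : 0 < r) (h0 : r < |c|) (hκ : ∀ t, |κ t - c| ≠ r) (u : L2 Ω) :
    rePart Ω (spectralProjection (complexify (∑ t, κ t • lineProjection (e t))) (c : ℂ) r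
      (toComplex Ω u)) = ∑ t, if |κ t - c| < r then ⟪e t, u⟫_ℝ • e t else 0 := by
  have hdist : ∀ t, dist (κ t : ℂ) (c : ℂ) = |κ t - c| := fun t => by
    rw [Complex.dist_eq, ← Complex.ofReal_sub, Complex.norm_real, Real.norm_eq_abs]
  have hdist0 : dist (0 : ℂ) (c : ℂ) = |c| := by
    rw [dist_zero_left, Complex.norm_real, Real.norm_eq_abs]
  have hK : complexify (∑ t, κ t • lineProjection (e t))
      = ∑ t, (κ t : ℂ) • complexify (lineProjection (e t)) := by
    rw [complexify_sum]
    exact Finset.sum_congr rfl fun t _ => complexify_smul _ _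
  rw [spectralProjection, hK, circleIntegral_resolvent_of_orthogonal
    (orthogonalIdempotents_lineProjection he) (fun t => (κ t : ℂ)) hr (by rwa [hdist0])
    (fun t => by rw [hdist]; exact hκ t), sum_apply, map_sum]
  refine Finset.sum_congr rfl fun t _ => ?_
  rw [hdist]
  split_ifs
  · rw [rePart_complexify, rePart_toComplex, lineProjection_apply]
  · exact map_zero _

end Complexify

section SolutionOperator

variable {P : ModelProblem d}

/-- Uniqueness in the lemma of Lax and Milgram. -/
theorem eq_of_aForm_eq {κ₀ : ℝ} (h : IsCoerciveForm (energy P) κ₀)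
    {V : Submodule ℝ (L2 P.Ω)} (hV : V ≤ H10 P.Ω) {y y' : L2 P.Ω} (hy : y ∈ V) (hy' : y' ∈ V)
    (hyy : ∀ z ∈ V, aForm P y z = aForm P y' z) : y = y' := by
  by_contra hne
  obtain ⟨x, hx⟩ : ∃ x : H10 P.Ω, (x : L2 P.Ω) = y := ⟨⟨y, hV hy⟩, rfl⟩
  obtain ⟨x', hx'⟩ : ∃ x : H10 P.Ω, (x : L2 P.Ω) = y' := ⟨⟨y', hV hy'⟩, rfl⟩
  have hne' : x - x' ≠ 0 := fun h0 => hne (by rw [← hx, ← hx', sub_eq_zero.1 h0])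
  have h2 : energy P (x - x') (x - x') = energy P x (x - x') - energy P x' (x - x') := by
    rw [LinearMap.map_sub₂]
  have h3 : ((x - x' : H10 P.Ω) : L2 P.Ω) ∈ V := by
    rw [Submodule.coe_sub, hx, hx']
    exact V.sub_mem hy hy'
  have h4 := hyy _ h3
  rw [← hx, ← hx', ← energy_apply, ← energy_apply] at h4
  rw [h4, sub_self] at h2
  exact (h.pos_of_ne hne').ne' h2

/-- The solution operator is determined by its defining equation. -/
theorem solutionOperator_eq_of_forall {κ₀ : ℝ} (h : IsCoerciveForm (energy P) κ₀)
    {V : Submodule ℝ (L2 P.Ω)} (hV : V ≤ H10 P.Ω) {K : L2 P.Ω →L[ℝ] L2 P.Ω}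
    (hK : ∀ w, K w ∈ V ∧ ∀ v ∈ V, aForm P (K w) v = bForm P w v) : solutionOperator P V = K := by
  have hex : ∃ K : L2 P.Ω →L[ℝ] L2 P.Ω, ∀ w, K w ∈ V ∧ ∀ v ∈ V, aForm P (K w) v = bForm P w v :=
    ⟨K, hK⟩
  rw [solutionOperator, dif_pos hex]
  ext1 w
  obtain ⟨h1, h2⟩ := hex.choose_spec w
  obtain ⟨h3, h4⟩ := hK w
  exact eq_of_aForm_eq h hV h1 h3 fun z hz => by rw [h2 z hz, h4 z hz]

/-- The spectral decomposition of the discrete solution operator, from a complete family of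
discrete eigenfunctions. -/
theorem solutionOperator_eq {κ₀ : ℝ} (h : IsCoerciveForm (energy P) κ₀)
    {V : Submodule ℝ (L2 P.Ω)} (hV : V ≤ H10 P.Ω) {τ : Type*} [Fintype τ] {μ : τ → ℝ}
    {e : τ → H10 P.Ω} (he : IsEigenfamily (energy P) (V.comap (H10 P.Ω).subtype) μ e)
    (hcomplete : ∀ w ∈ V.comap (H10 P.Ω).subtype, w = ∑ t, ⟪e t, w⟫_ℝ • e t) :
    solutionOperator P V = ∑ t, (μ t)⁻¹ • lineProjection (e t : L2 P.Ω) := by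
  refine solutionOperator_eq_of_forall h hV fun w => ?_
  have hKe : (∑ t, (μ t)⁻¹ • lineProjection (e t : L2 P.Ω)) w
      = ((∑ t, ((μ t)⁻¹ * ⟪(e t : L2 P.Ω), w⟫_ℝ) • e t : H10 P.Ω) : L2 P.Ω) := by
    rw [sum_apply, Submodule.coe_sum]
    refine Finset.sum_congr rfl fun t _ => ?_
    rw [smul_apply, lineProjection_apply, smul_smul, Submodule.coe_smul]
  rw [hKe]
  have hmem : (∑ t, ((μ t)⁻¹ * ⟪(e t : L2 P.Ω), w⟫_ℝ) • e t) ∈ V.comap (H10 P.Ω).subtype :=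
    Submodule.sum_mem _ fun t _ => Submodule.smul_mem _ _ (he.mem t)
  refine ⟨hmem, fun v hv => ?_⟩
  obtain ⟨x, hx⟩ : ∃ x : H10 P.Ω, (x : L2 P.Ω) = v := ⟨⟨v, hV hv⟩, rfl⟩
  have hxV : x ∈ V.comap (H10 P.Ω).subtype := by
    rw [Submodule.mem_comap, Submodule.subtype_apply, hx]
    exact hv
  rw [← hx, ← energy_apply, he.apply_sum _ _ hxV, bForm_eq_inner]
  have h1 : (x : L2 P.Ω) = ∑ t, ⟪e t, x⟫_ℝ • (e t : L2 P.Ω) := by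
    have := congr_arg Subtype.val (hcomplete _ hxV)
    rwa [Submodule.coe_sum] at this
  conv_rhs => rw [h1]
  rw [inner_sum]
  refine Finset.sum_congr rfl fun t _ => ?_
  rw [real_inner_smul_right, real_inner_comm]
  have := (he.pos h t).ne'
  field_simp

/-- The discrete spectral projection onto the span of the discrete eigenfunctions whose eigenvalues
have their reciprocals inside the circle. -/
theorem feProjection_eq_sum {κ₀ : ℝ} (h : IsCoerciveForm (energy P) κ₀)
    {V : Submodule ℝ (L2 P.Ω)} (hV : V ≤ H10 P.Ω) {σ τ : Type*} [Fintype σ] [Fintype τ]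
    {lamh : σ → ℝ} {μ : τ → ℝ} {x : σ → H10 P.Ω} {e : τ → H10 P.Ω}
    (hx : IsEigenfamily (energy P) (V.comap (H10 P.Ω).subtype) lamh x)
    (he : IsEigenfamily (energy P) (V.comap (H10 P.Ω).subtype) μ e)
    (hxe : ∀ s t, ⟪x s, e t⟫_ℝ = 0)
    (hcomplete : ∀ w ∈ V.comap (H10 P.Ω).subtype,
      w = ∑ s, ⟪x s, w⟫_ℝ • x s + ∑ t, ⟪e t, w⟫_ℝ • e t)
    {lam r : ℝ} (hr : 0 < r) (h0 : r < |lam⁻¹|) (S : Finset σ)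
    (hin : ∀ s ∈ S, |(lamh s)⁻¹ - lam⁻¹| < r) (hout : ∀ s ∉ S, r < |(lamh s)⁻¹ - lam⁻¹|)
    (hμ : ∀ t, r < |(μ t)⁻¹ - lam⁻¹|) (u : L2 P.Ω) :
    feProjection P V lam r u = ∑ s ∈ S, ⟪(x s : L2 P.Ω), u⟫_ℝ • (x s : L2 P.Ω) := by
  classical
  have horth : Orthonormal ℝ (Sum.elim x e) := by
    refine ⟨?_, ?_⟩
    · rintro (s | t)
      exacts [hx.orthonormal.1 s, he.orthonormal.1 t]
    · rintro (s | t) (s' | t') hst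
      · exact hx.orthonormal.2 fun hh => hst (by rw [hh])
      · exact hxe s t'
      · exact (real_inner_comm _ _).trans (hxe s' t)
      · exact he.orthonormal.2 fun hh => hst (by rw [hh])
  have hfam : IsEigenfamily (energy P) (V.comap (H10 P.Ω).subtype) (Sum.elim lamh μ)
      (Sum.elim x e) := by
    refine ⟨horth, ?_, ?_⟩
    · rintro (s | t)
      exacts [hx.mem s, he.mem t]
    · rintro (s | t)
      exacts [hx.apply s, he.apply t]
  have hK := solutionOperator_eq h hV hfam fun w hw => by
    rw [Fintype.sum_sum_type]
    exact hcomplete w hw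
  have horth' : Orthonormal ℝ fun t => ((Sum.elim x e t : H10 P.Ω) : L2 P.Ω) :=
    ⟨fun t => horth.1 t, fun s t hst => horth.2 hst⟩
  rw [feProjection, hK, rePart_spectralProjection horth' _ hr h0, Fintype.sum_sum_type]
  · simp only [Sum.elim_inl, Sum.elim_inr]
    refine (congr_arg₂ (· + ·) ?_ (Finset.sum_eq_zero fun t _ =>
      if_neg (not_lt.2 (hμ t).le))).trans (add_zero _)
    refine (Finset.sum_subset (Finset.subset_univ S) fun s _ hs =>
      if_neg (not_lt.2 (hout s hs).le)).symm.trans ?_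
    exact Finset.sum_congr rfl fun s hs => if_pos (hin s hs)
  · rintro (s | t)
    · by_cases hs : s ∈ S
      exacts [(hin s hs).ne, (hout s hs).ne']
    · exact (hμ t).ne'

end SolutionOperator

/-! ### Geometry of simplicial meshes -/

theorem IsPolygonalDomain.interior_closure_subset {Ω : Set (Space d)} (h : IsPolygonalDomain Ω) :
    interior (closure Ω) ⊆ Ω := by
  obtain ⟨-, -, S, -, hS⟩ := h
  have hF : IsClosed (⋃ s ∈ S, convexHull ℝ (s : Set (Space d))) :=
    S.finite_toSet.isClosed_biUnion fun s _ => s.finite_toSet.isClosed_convexHull ℝ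
  have h1 : closure Ω ⊆ ⋃ s ∈ S, convexHull ℝ (s : Set (Space d)) := by
    rw [hS]
    exact closure_minimal interior_subset hF
  conv_rhs => rw [hS]
  exact interior_mono h1

theorem isCompact_cell (T : Finset (Space d)) : IsCompact (cell T) :=
  T.finite_toSet.isCompact_convexHull ℝ

theorem convex_cell (T : Finset (Space d)) : Convex ℝ (cell T) := convex_convexHull ℝ _

theorem cell_mono {e T : Finset (Space d)} (h : e ⊆ T) : cell e ⊆ cell T :=
  convexHull_mono (Finset.coe_subset.2 h)

theorem subset_cell (T : Finset (Space d)) : (T : Set (Space d)) ⊆ cell T := subset_convexHull ℝ _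

theorem volume_frontier_cell (T : Finset (Space d)) : volume (frontier (cell T)) = 0 :=
  (convex_cell T).addHaar_frontier volume

theorem interior_cell_ae_eq (T : Finset (Space d)) : interior (cell T) =ᵐ[volume] cell T :=
  interior_ae_eq_of_null_frontier (volume_frontier_cell T)

theorem restrict_cell (T : Finset (Space d)) :
    (volume : Measure (Space d)).restrict (cell T) = volume.restrict (interior (cell T)) :=
  (Measure.restrict_congr_set (interior_cell_ae_eq T)).symm

theorem diam_cell_nonneg (T : Finset (Space d)) : 0 ≤ Metric.diam (cell T) := Metric.diam_nonneg

theorem dist_le_diam_cell {T : Finset (Space d)} {x y : Space d} (hx : x ∈ cell T)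
    (hy : y ∈ cell T) : dist x y ≤ Metric.diam (cell T) :=
  Metric.dist_le_diam_of_mem (isCompact_cell T).isBounded hx hy

theorem affineSpan_eq_top_iff_card {s : Finset (Space d)}
    (hs : AffineIndependent ℝ ((↑) : s → Space d)) :
    affineSpan ℝ (s : Set (Space d)) = ⊤ ↔ s.card = d + 1 := by
  have := hs.affineSpan_eq_top_iff_card_eq_finrank_add_one
  rw [finrank_euclideanSpace_fin, Fintype.card_coe] at this
  rwa [← Subtype.range_coe (s := (s : Set (Space d)))]

namespace Mesh

variable {Ω : Set (Space d)} (M : Mesh Ω)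

theorem mem_elements {T : Finset (Space d)} :
    T ∈ M.elements ↔ T ∈ M.complex.faces ∧ T.card = d + 1 := by
  classical
  rw [elements, Finset.mem_filter, Set.Finite.mem_toFinset]

variable {M} {T T' : Finset (Space d)}

theorem affineIndependent (hT : T ∈ M.elements) : AffineIndependent ℝ ((↑) : T → Space d) :=
  M.complex.indep (M.mem_elements.1 hT).1

theorem cell_subset_closure (hT : T ∈ M.elements) : cell T ⊆ closure Ω := by
  rw [← M.space_eq]
  exact Geometry.SimplicialComplex.convexHull_subset_space (M.mem_elements.1 hT).1

theorem interior_cell_subset (hΩ : IsPolygonalDomain Ω) (hT : T ∈ M.elements) :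
    interior (cell T) ⊆ Ω :=
  (interior_mono (cell_subset_closure hT)).trans hΩ.interior_closure_subset

theorem interior_cell_nonempty (hT : T ∈ M.elements) : (interior (cell T)).Nonempty := by
  rw [cell, interior_convexHull_nonempty_iff_affineSpan_eq_top,
    affineSpan_eq_top_iff_card (affineIndependent hT)]
  exact (M.mem_elements.1 hT).2

theorem closure_interior_cell (hT : T ∈ M.elements) : closure (interior (cell T)) = cell T := by
  rw [(convex_cell T).closure_interior_eq_closure_of_nonempty_interior (interior_cell_nonempty hT),
    (isCompact_cell T).isClosed.closure_eq]

theorem inter_cell_subset (hT : T ∈ M.elements) (hT' : T' ∈ M.elements) :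
    cell T ∩ cell T' ⊆ convexHull ℝ (T ∩ T' : Set (Space d)) :=
  M.complex.inter_subset_convexHull (M.mem_elements.1 hT).1 (M.mem_elements.1 hT').1

/-- Elements meet in the convex hull of their common vertices only, which has no interior if the
elements are different. -/
theorem disjoint_interior_cell (hT : T ∈ M.elements) (hT' : T' ∈ M.elements) (hne : T ≠ T') :
    Disjoint (interior (cell T)) (interior (cell T')) := by
  classical
  rw [Set.disjoint_iff_inter_eq_empty, ← interior_inter]
  by_contra hemp
  have h1 : (interior (convexHull ℝ ((T ∩ T' : Finset (Space d)) : Set (Space d)))).Nonempty := by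
    rw [Finset.coe_inter]
    exact (nonempty_iff_ne_empty.2 hemp).mono (interior_mono (inter_cell_subset hT hT'))
  have hi : AffineIndependent ℝ ((↑) : (T ∩ T' : Finset (Space d)) → Space d) :=
    (affineIndependent hT).mono (Finset.coe_subset.2 Finset.inter_subset_left)
  rw [interior_convexHull_nonempty_iff_affineSpan_eq_top, affineSpan_eq_top_iff_card hi] at h1
  have h2 := (M.mem_elements.1 hT).2
  have h3 := (M.mem_elements.1 hT').2
  have h4 : T ∩ T' = T := Finset.eq_of_subset_of_card_le Finset.inter_subset_left (by omega)
  have h5 : T ∩ T' = T' := Finset.eq_of_subset_of_card_le Finset.inter_subset_right (by omega)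
  exact hne (h4.symm.trans h5)

theorem exists_mem_cell {x : Space d} (hx : x ∈ closure Ω) : ∃ T ∈ M.elements, x ∈ cell T := by
  rw [← M.space_eq, Geometry.SimplicialComplex.mem_space_iff] at hx
  obtain ⟨s, hs, hxs⟩ := hx
  obtain ⟨T, hT, hsT, hc⟩ := M.pure s hs
  exact ⟨T, M.mem_elements.2 ⟨hT, hc⟩, convexHull_mono (Finset.coe_subset.2 hsT) hxs⟩

variable (M) in
theorem ae_notMem_frontier : ∀ᵐ x : Space d, ∀ T ∈ M.elements, x ∉ frontier (cell T) := by
  refine (ae_ball_iff M.elements.countable_toSet).2 ?_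
  exact fun T _ => measure_eq_zero_iff_ae_notMem.1 (volume_frontier_cell T)

variable (M) in
theorem ae_exists_mem_interior :
    ∀ᵐ x ∂(volume.restrict (closure Ω)), ∃ T ∈ M.elements, x ∈ interior (cell T) := by
  filter_upwards [ae_restrict_of_ae M.ae_notMem_frontier,
    ae_restrict_mem isClosed_closure.measurableSet] with x hx hxΩ
  obtain ⟨T, hT, hxT⟩ := M.exists_mem_cell hxΩ
  refine ⟨T, hT, ?_⟩
  by_contra h
  exact hx T hT ⟨subset_closure hxT, h⟩

/-- The interiors of the elements are disjoint and contained in `Ω`, and the boundaries of the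
elements are null sets. -/
theorem sum_setIntegral_cell_le (hΩ : IsPolygonalDomain Ω) {f : Space d → ℝ} (hf : 0 ≤ f)
    (hi : IntegrableOn f Ω) : ∑ T ∈ M.elements, ∫ x in cell T, f x ≤ ∫ x in Ω, f x := by
  have h1 : ∑ T ∈ M.elements, ∫ x in cell T, f x
      = ∫ x in ⋃ T ∈ M.elements, interior (cell T), f x := by
    rw [integral_biUnion_finset]
    · exact Finset.sum_congr rfl fun T _ => by rw [restrict_cell]
    · exact fun T _ => isOpen_interior.measurableSet
    · exact fun T hT T' hT' hne => disjoint_interior_cell hT hT' hne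
    · exact fun T hT => hi.mono_set (interior_cell_subset hΩ hT)
  rw [h1]
  exact setIntegral_mono_set hi (Filter.Eventually.of_forall hf)
    (LE.le.eventuallyLE (iUnion₂_subset fun T hT => interior_cell_subset hΩ hT))

theorem diam_cell_pos (hd : 1 ≤ d) (hT : T ∈ M.elements) : 0 < Metric.diam (cell T) := by
  have hc : 1 < T.card := by
    have := (M.mem_elements.1 hT).2
    omega
  obtain ⟨x, hx, y, hy, hxy⟩ := Finset.one_lt_card.1 hc
  exact (dist_pos.2 hxy).trans_le (dist_le_diam_cell (subset_cell T hx) (subset_cell T hy))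

theorem diam_cell_le_size (hT : T ∈ M.elements) : Metric.diam (cell T) ≤ M.size :=
  le_ciSup (f := fun T : M.elements => Metric.diam (cell T.1)) (Set.finite_range _).bddAbove ⟨T, hT⟩

/-- Each element contains a ball and is contained in a concentric ball, with a fixed ratio of the
radii. -/
theorem ShapeRegular.exists_ball {γ : ℝ} (hM : M.ShapeRegular γ) (hd : 1 ≤ d)
    (hT : T ∈ M.elements) :
    0 < γ ∧ ∃ x₀, Metric.closedBall x₀ ((4 * γ)⁻¹ * Metric.diam (cell T)) ⊆ cell T ∧
      cell T ⊆ Metric.closedBall x₀ (Metric.diam (cell T)) := by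
  have hpos := diam_cell_pos hd hT
  have h1 := hM T hT
  set R := {r : ℝ | 0 < r ∧ ∃ x, Metric.closedBall x r ⊆ cell T} with hR
  have hs0 : 0 ≤ sSup R := Real.sSup_nonneg fun r hr => hr.1.le
  have hs : 0 < sSup R := by
    refine lt_of_le_of_ne hs0 fun h0 => ?_
    rw [← h0] at h1
    simp only [mul_zero] at h1
    exact absurd h1 (not_le.2 hpos)
  have hγ : 0 < γ := by
    by_contra hγ
    have : γ * (2 * sSup R) ≤ 0 := mul_nonpos_of_nonpos_of_nonneg (not_lt.1 hγ) (by positivity)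
    linarith
  have hne : R.Nonempty := by
    by_contra he
    rw [not_nonempty_iff_eq_empty.1 he, Real.sSup_empty] at hs
    exact lt_irrefl _ hs
  have hlt : (4 * γ)⁻¹ * Metric.diam (cell T) < sSup R := by
    rw [inv_mul_lt_iff₀ (by positivity)]
    nlinarith [mul_pos hγ hs]
  obtain ⟨r, ⟨hr0, x, hx⟩, hr⟩ := exists_lt_of_lt_csSup hne hlt
  refine ⟨hγ, x, (Metric.closedBall_subset_closedBall hr.le).trans hx, fun y hy => ?_⟩
  exact Metric.mem_closedBall.2 (dist_le_diam_cell hy (hx (Metric.mem_closedBall_self hr0.le)))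

theorem sideSize_nonneg (M : Mesh Ω) (e : Finset (Space d)) : 0 ≤ sideSize M e := by
  rw [sideSize]
  split_ifs
  · exact Real.iInf_nonneg fun T => Metric.diam_nonneg
  · exact Metric.diam_nonneg

theorem sideSize_le {e : Finset (Space d)} (hT : T ∈ M.elements) (he : e ⊆ T) :
    sideSize M e ≤ Metric.diam (cell T) := by
  rw [sideSize]
  split_ifs
  · exact ciInf_le (f := fun T : {T : Finset (Space d) // T ∈ M.elements ∧ e ⊆ T} =>
      Metric.diam (cell T.1)) ⟨0, by rintro _ ⟨T, rfl⟩; exact Metric.diam_nonneg⟩ ⟨T, hT, he⟩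
  · exact Metric.diam_mono (cell_mono he) (isCompact_cell T).isBounded

theorem mem_sides {e : Finset (Space d)} (he : e ∈ M.sides) : e.card = d ∧ e.Nonempty := by
  classical
  rw [sides, Finset.mem_filter, Set.Finite.mem_toFinset] at he
  exact ⟨he.2.1, Geometry.SimplicialComplex.nonempty_of_mem_faces he.1⟩

/-- Barycentric coordinates of an element. -/
def barycentricBasis (hT : T ∈ M.elements) : AffineBasis T ℝ (Space d) where
  toFun := (↑)
  ind' := affineIndependent hT
  tot' := by
    have := (affineSpan_eq_top_iff_card (affineIndependent hT)).2 (M.mem_elements.1 hT).2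
    have h : range ((↑) : T → Space d) = (T : Set (Space d)) := Subtype.range_coe
    rwa [h]

@[simp] theorem barycentricBasis_apply (hT : T ∈ M.elements) (y : T) :
    barycentricBasis hT y = y := rfl

theorem mem_cell_iff (hT : T ∈ M.elements) {x : Space d} :
    x ∈ cell T ↔ ∀ y, 0 ≤ (barycentricBasis hT).coord y x := by
  have h := (barycentricBasis hT).convexHull_eq_nonneg_coord
  have h1 : range (barycentricBasis hT) = (T : Set (Space d)) := Subtype.range_coe
  rw [h1] at h
  rw [cell, h]
  rfl

end Mesh

theorem affineMap_sum_smul (f : Space d →ᵃ[ℝ] ℝ) {ι : Type*} (s : Finset ι) (w : ι → ℝ)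
    (p : ι → Space d) (hw : ∑ i ∈ s, w i = 1) :
    f (∑ i ∈ s, w i • p i) = ∑ i ∈ s, w i * f (p i) := by
  have h : ∀ x, f x = f.linear x + f 0 := fun x => by
    have := f.map_vadd 0 x
    simpa using this
  rw [h, map_sum]
  have h1 : ∀ i ∈ s, w i * f (p i) = f.linear (w i • p i) + w i * f 0 := fun i _ => by
    rw [h (p i), map_smul, smul_eq_mul, mul_add]
  rw [Finset.sum_congr rfl h1, Finset.sum_add_distrib, ← Finset.sum_mul, hw, one_mul]

theorem affineMap_eq_zero_of_mem_cell {f : Space d →ᵃ[ℝ] ℝ} {e : Finset (Space d)}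
    (hf : ∀ y ∈ e, f y = 0) {x : Space d} (hx : x ∈ cell e) : f x = 0 := by
  obtain ⟨w, -, hw, rfl⟩ := Finset.mem_convexHull'.1 hx
  rw [affineMap_sum_smul f e w _ hw]
  exact Finset.sum_eq_zero fun y hy => by rw [hf y hy, mul_zero]

namespace Mesh

variable {Ω : Set (Space d)} {M : Mesh Ω} {T T' e : Finset (Space d)}

/-- The vertex of an element opposite to a given side. -/
theorem exists_vertex (hT : T ∈ M.elements) (he : e ⊆ T) (hc : e.card = d) :
    ∃ v : T, (v : Space d) ∉ e ∧ ∀ y ∈ T, y ≠ v → y ∈ e := by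
  classical
  have h1 : (T \ e).card = 1 := by
    rw [Finset.card_sdiff_of_subset he, (M.mem_elements.1 hT).2, hc]
    omega
  obtain ⟨v, hv⟩ := Finset.card_eq_one.1 h1
  have hvm : v ∈ T \ e := by rw [hv]; exact Finset.mem_singleton_self v
  refine ⟨⟨v, (Finset.mem_sdiff.1 hvm).1⟩, (Finset.mem_sdiff.1 hvm).2, fun y hy hyv => ?_⟩
  by_contra hye
  have : y ∈ T \ e := Finset.mem_sdiff.2 ⟨hy, hye⟩
  rw [hv, Finset.mem_singleton] at this
  exact hyv this

theorem coord_eq_zero_of_mem (hT : T ∈ M.elements) (he : e ⊆ T) {v : T} (hv : (v : Space d) ∉ e)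
    {y : Space d} (hy : y ∈ e) : (barycentricBasis hT).coord v y = 0 := by
  have := (barycentricBasis hT).coord_apply_ne (i := v) (j := ⟨y, he hy⟩)
    (fun h => hv (by rw [h]; exact hy))
  exact this

/-- An affine function which vanishes on a side of an element is a multiple of a barycentric
coordinate. -/
theorem affineMap_eq_mul_coord (hT : T ∈ M.elements) {v : T} (hv' : ∀ y ∈ T, y ≠ v → y ∈ e)
    {f : Space d →ᵃ[ℝ] ℝ} (hf : ∀ y ∈ e, f y = 0) (x : Space d) :
    f x = f v * (barycentricBasis hT).coord v x := by
  have h1 := (barycentricBasis hT).linear_combination_coord_eq_self x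
  have h2 := affineMap_sum_smul f Finset.univ (fun i => (barycentricBasis hT).coord i x)
    (fun i => (i : Space d)) ((barycentricBasis hT).sum_coord_apply_eq_one x)
  simp only [barycentricBasis_apply] at h1
  rw [h1, Finset.sum_eq_single v] at h2
  · rw [h2, mul_comm]
  · intro b _ hb
    rw [hf b (hv' b b.2 fun h => hb (Subtype.ext h)), mul_zero]
  · simp

/-- Two elements with a common side lie on different sides of it. -/
theorem coord_opposite_nonpos (hT : T ∈ M.elements) (hT' : T' ∈ M.elements) (hne : T ≠ T')
    (he : e ⊆ T) (he' : e ⊆ T') {v : T} {v' : T'} (hv : (v : Space d) ∉ e)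
    (hv1 : ∀ y ∈ T, y ≠ v → y ∈ e) (hv2 : ∀ y ∈ T', y ≠ v' → y ∈ e) :
    (barycentricBasis hT).coord v v' ≤ 0 := by
  classical
  by_contra! hpos
  have hv'e : (v' : Space d) ∉ e := fun h => by
    rw [coord_eq_zero_of_mem hT he hv h] at hpos
    exact lt_irrefl _ hpos
  set b := barycentricBasis hT with hb
  -- the weight of a vertex of `e` compensates a negative coordinate of `v'`
  let N : Space d → ℝ := fun y => if h : y ∈ T then |b.coord ⟨y, h⟩ v'| else 0
  have hN : ∀ y, 0 ≤ N y := fun y => by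
    simp only [N]
    split_ifs
    exacts [abs_nonneg _, le_rfl]
  set S := 1 + ∑ y ∈ e, N y with hS
  have hSpos : 0 < S := by
    have := Finset.sum_nonneg fun y (_ : y ∈ e) => hN y
    linarith
  let w : Space d → ℝ := fun y => if y = v' then S⁻¹ else S⁻¹ * N y
  have hwe : ∀ y ∈ e, w y = S⁻¹ * N y := fun y hy =>
    if_neg fun h : y = v' => hv'e (h ▸ hy)
  have hwv : w v' = S⁻¹ := if_pos rfl
  have hsum : ∑ y ∈ insert (v' : Space d) e, w y = 1 := by
    rw [Finset.sum_insert hv'e, hwv, Finset.sum_congr rfl hwe, ← Finset.mul_sum]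
    field_simp
    rw [hS]
  have hw0 : ∀ y, 0 ≤ w y := fun y => by
    simp only [w]
    split_ifs
    exacts [by positivity, mul_nonneg (by positivity) (hN y)]
  set z := ∑ y ∈ insert (v' : Space d) e, w y • y with hz
  have hzT' : z ∈ cell T' := by
    have h1 : z ∈ cell (insert (v' : Space d) e) :=
      Finset.mem_convexHull'.2 ⟨w, fun y _ => hw0 y, hsum, rfl⟩
    exact cell_mono (Finset.insert_subset v'.2 he') h1
  have hcoord : ∀ i : T, b.coord i z = S⁻¹ * (b.coord i v' + ∑ y ∈ e, N y * b.coord i y) := by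
    intro i
    rw [hz, affineMap_sum_smul _ _ w _ hsum, Finset.sum_insert hv'e, hwv, mul_add, Finset.mul_sum]
    congr 1
    exact Finset.sum_congr rfl fun y hy => by rw [hwe y hy, mul_assoc]
  have hcv : b.coord v z = S⁻¹ * b.coord v v' := by
    rw [hcoord, Finset.sum_eq_zero, add_zero]
    exact fun y hy => by rw [coord_eq_zero_of_mem hT he hv hy, mul_zero]
  have hzT : z ∈ cell T := by
    rw [mem_cell_iff hT]
    intro i
    by_cases hi : i = v
    · rw [hi, ← hb, hcv]
      positivity
    · have hie : (i : Space d) ∈ e := hv1 i i.2 fun h => hi (Subtype.ext h)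
      rw [← hb, hcoord, Finset.sum_eq_single (i : Space d)]
      · have h1 : b.coord i (i : Space d) = 1 := b.coord_apply_eq i
        have h2 : N i = |b.coord i v'| := dif_pos i.2
        rw [h1, h2, mul_one]
        exact mul_nonneg (by positivity) (by linarith [neg_abs_le (b.coord i v')])
      · intro y hy hyi
        have h1 : b.coord i y = 0 := b.coord_apply_ne (j := ⟨y, he hy⟩)
          fun h => hyi (by rw [h])
        rw [h1, mul_zero]
      · exact fun h => absurd hie h
  have hze : z ∈ cell e := by
    have h1 := inter_cell_subset hT hT' ⟨hzT, hzT'⟩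
    have h2 : (T ∩ T' : Set (Space d)) ⊆ e := fun y hy => by
      by_contra hye
      have h3 : y = v := by_contra fun h => hye (hv1 y hy.1 h)
      have h4 : y = v' := by_contra fun h => hye (hv2 y hy.2 h)
      refine hne (Finset.Subset.antisymm (fun t ht => ?_) fun t ht => ?_)
      · by_cases htv : t = v
        · rw [htv, ← h3, h4]
          exact v'.2
        · exact he' (hv1 t ht htv)
      · by_cases htv : t = v'
        · rw [htv, ← h4, h3]
          exact v.2
        · exact he (hv2 t ht htv)
    exact convexHull_mono h2 h1
  have h0 := affineMap_eq_zero_of_mem_cell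
    (fun y hy => coord_eq_zero_of_mem hT he hv hy) hze
  rw [← hb, hcv] at h0
  have : 0 < S⁻¹ * b.coord v v' := mul_pos (inv_pos.2 hSpos) hpos
  exact this.ne' h0

open Classical in
/-- A side belongs to at most two elements. -/
theorem card_elements_of_side_le (hc : e.card = d) :
    (M.elements.filter fun T => e ⊆ T).card ≤ 2 := by
  by_contra! h
  obtain ⟨T₁, h1, T₂, h2, T₃, h3, h12, h13, h23⟩ := Finset.two_lt_card.1 h
  rw [Finset.mem_filter] at h1 h2 h3
  obtain ⟨v₁, hv1, hw1⟩ := exists_vertex h1.1 h1.2 hc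
  obtain ⟨v₂, hv2, hw2⟩ := exists_vertex h2.1 h2.2 hc
  obtain ⟨v₃, hv3, hw3⟩ := exists_vertex h3.1 h3.2 hc
  have hz : ∀ y ∈ e, (barycentricBasis h1.1).coord v₁ y = 0 := fun y hy =>
    coord_eq_zero_of_mem h1.1 h1.2 hv1 hy
  have hone : (barycentricBasis h1.1).coord v₁ v₁ = 1 := (barycentricBasis h1.1).coord_apply_eq v₁
  have e12 := coord_opposite_nonpos h1.1 h2.1 h12 h1.2 h2.2 hv1 hw1 hw2
  have e13 := coord_opposite_nonpos h1.1 h3.1 h13 h1.2 h3.2 hv1 hw1 hw3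
  have e23 := coord_opposite_nonpos h2.1 h3.1 h23 h2.2 h3.2 hv2 hw2 hw3
  have f1 := affineMap_eq_mul_coord h2.1 hw2 hz v₁
  have f2 := affineMap_eq_mul_coord h3.1 hw3 hz v₁
  have f3 := affineMap_eq_mul_coord h2.1 hw2 hz v₃
  rw [hone] at f1 f2
  have g : 0 ≤ (barycentricBasis h1.1).coord v₁ v₃ := by
    rw [f3]
    exact mul_nonneg_of_nonpos_of_nonpos e12 e23
  rw [le_antisymm e13 g, zero_mul] at f2
  exact one_ne_zero f2

end Mesh

/-- The surface measure of a `(d-1)`-simplex is bounded by a power of its diameter: the simplex lies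
in the affine image of a cube. -/
theorem exists_measure_side_le (d : ℕ) : ∃ C : ℝ, 0 < C ∧ ∀ e : Finset (Space d), e.card = d →
    e.Nonempty → ∀ h : ℝ, (∀ x ∈ e, ∀ y ∈ e, dist x y ≤ h) →
    (μHE[d - 1] : Measure (Space d)) (cell e) ≤ ENNReal.ofReal (C * h ^ (d - 1)) := by
  classical
  set s : NNReal := (volume : Measure (EuclideanSpace ℝ (Fin (d - 1)))).addHaarScalarFactor
    (μH[(d - 1 : ℕ)] : Measure (EuclideanSpace ℝ (Fin (d - 1)))) with hs
  refine ⟨s * d ^ (d - 1) + 1, by positivity, fun e hc hne h hh => ?_⟩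
  obtain ⟨p, hp⟩ := hne
  have h0 : 0 ≤ h := by
    have := hh p hp p hp
    rwa [dist_self] at this
  let ι := {x // x ∈ e.erase p}
  have hcard : Fintype.card ι = d - 1 := by
    rw [Fintype.card_coe, Finset.card_erase_of_mem hp, hc]
  let f : (ι → ℝ) → Space d := fun c => p + ∑ i, c i • ((i : Space d) - p)
  have hf : LipschitzWith (Real.toNNReal (d * h)) f := by
    refine LipschitzWith.of_dist_le_mul fun c c' => ?_
    rw [Real.coe_toNNReal _ (by positivity), dist_eq_norm]
    have h1 : f c - f c' = ∑ i, (c i - c' i) • ((i : Space d) - p) := by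
      simp only [f, add_sub_add_left_eq_sub, ← Finset.sum_sub_distrib, sub_smul]
    rw [h1]
    calc ‖∑ i, (c i - c' i) • ((i : Space d) - p)‖
        ≤ ∑ i : ι, dist c c' * h := by
          refine norm_sum_le_of_le _ fun i _ => ?_
          rw [norm_smul]
          refine mul_le_mul ?_ ?_ (norm_nonneg _) dist_nonneg
          · rw [Real.norm_eq_abs, ← Real.dist_eq]
            exact dist_le_pi_dist c c' i
          · rw [← dist_eq_norm]
            exact hh _ (Finset.mem_of_mem_erase i.2) _ hp
      _ = (d - 1 : ℕ) * (dist c c' * h) := by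
          rw [Finset.sum_const, Finset.card_univ, hcard, nsmul_eq_mul]
      _ ≤ d * (dist c c' * h) := by
          have : ((d - 1 : ℕ) : ℝ) ≤ d := by exact_mod_cast Nat.sub_le d 1
          gcongr
      _ = d * h * dist c c' := by ring
  have hsub : cell e ⊆ f '' Icc 0 1 := by
    intro x hx
    obtain ⟨w, hw0, hw, rfl⟩ := Finset.mem_convexHull'.1 hx
    refine ⟨fun i => w i, ⟨fun i => hw0 _ (Finset.mem_of_mem_erase i.2), fun i => ?_⟩, ?_⟩
    · change w i ≤ 1
      rw [← hw]
      exact Finset.single_le_sum (f := w) hw0 (Finset.mem_of_mem_erase i.2)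
    · have h1 : ∑ i : ι, w i • ((i : Space d) - p) = ∑ y ∈ e.erase p, w y • (y - p) :=
        Finset.sum_coe_sort (e.erase p) fun y => w y • (y - p)
      have h2 : ∑ y ∈ e.erase p, w y • (y - p) = ∑ y ∈ e, w y • (y - p) :=
        Finset.sum_erase _ (by rw [sub_self, smul_zero])
      change p + ∑ i : ι, w i • ((i : Space d) - p) = _
      rw [h1, h2]
      simp only [smul_sub, Finset.sum_sub_distrib, ← Finset.sum_smul, hw, one_smul]
      abel
  have hvol : (μH[((d - 1 : ℕ) : ℝ)] : Measure (ι → ℝ)) (Icc 0 1) = 1 := by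
    rw [← hcard, hausdorffMeasure_pi_real, Real.volume_Icc_pi]
    simp
  have hH : (μH[((d - 1 : ℕ) : ℝ)] : Measure (Space d)) (cell e)
      ≤ ENNReal.ofReal ((d * h) ^ (d - 1)) := by
    refine (measure_mono hsub).trans ((hf.hausdorffMeasure_image_le (by positivity) _).trans ?_)
    rw [hvol, mul_one, ENNReal.rpow_natCast, ENNReal.ofReal_pow (by positivity)]
    rfl
  rw [Measure.euclideanHausdorffMeasure_def, ← hs, Measure.smul_apply, ENNReal.smul_def,
    smul_eq_mul]
  refine (mul_le_mul_right hH _).trans ?_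
  rw [← ENNReal.ofReal_coe_nnreal, ← ENNReal.ofReal_mul (NNReal.coe_nonneg s)]
  refine ENNReal.ofReal_le_ofReal ?_
  rw [mul_pow, add_mul]
  have : 0 ≤ h ^ (d - 1) := by positivity
  nlinarith

/-! ### Polynomial functions and inverse inequalities -/

/-- Evaluation of polynomials, as a linear map into the functions on `ℝ^d`. -/
def polyEval (d : ℕ) : MvPolynomial (Fin d) ℝ →ₗ[ℝ] (Space d → ℝ) where
  toFun p x := MvPolynomial.eval (fun i => x i) p
  map_add' p q := by ext x; simp
  map_smul' t p := by ext x; simp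

/-- The polynomial functions of degree at most `k`. -/
def polySpace (d k : ℕ) : Submodule ℝ (Space d → ℝ) :=
  (MvPolynomial.restrictTotalDegree (Fin d) ℝ k).map (polyEval d)

instance (k : ℕ) : FiniteDimensional ℝ (polySpace d k) := by
  unfold polySpace
  infer_instance

variable {k : ℕ}

theorem mem_polySpace {f : Space d → ℝ} : f ∈ polySpace d k ↔
    ∃ p : MvPolynomial (Fin d) ℝ, p.totalDegree ≤ k ∧
      f = fun x => MvPolynomial.eval (fun i => x i) p := by
  rw [polySpace, Submodule.mem_map]
  simp only [MvPolynomial.mem_restrictTotalDegree]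
  exact exists_congr fun p => and_congr_right fun _ => eq_comm

theorem analyticOnNhd_of_mem_polySpace {f : Space d → ℝ} (hf : f ∈ polySpace d k) :
    AnalyticOnNhd ℝ f univ := by
  obtain ⟨p, -, rfl⟩ := mem_polySpace.1 hf
  have h := AnalyticOnNhd.eval_continuousLinearMap'
    (fun i : Fin d => (EuclideanSpace.proj i : Space d →L[ℝ] ℝ)) p
  exact h

theorem contDiff_of_mem_polySpace {f : Space d → ℝ} (hf : f ∈ polySpace d k) {n : WithTop ℕ∞} :
    ContDiff ℝ n f :=
  contDiffOn_univ.1 (analyticOnNhd_of_mem_polySpace hf).contDiffOn_of_completeSpace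

theorem eq_zero_of_eqOn_of_mem_polySpace {f : Space d → ℝ} (hf : f ∈ polySpace d k)
    {U : Set (Space d)} (hU : IsOpen U) (hne : U.Nonempty) (h : ∀ x ∈ U, f x = 0) : f = 0 := by
  obtain ⟨x, hx⟩ := hne
  have h1 := (analyticOnNhd_of_mem_polySpace hf).eqOn_zero_of_preconnected_of_eventuallyEq_zero
    isPreconnected_univ (mem_univ x) (Filter.eventually_of_mem (hU.mem_nhds hx) h)
  exact funext fun y => h1 (mem_univ y)

theorem totalDegree_pderiv_le (i : Fin d) (p : MvPolynomial (Fin d) ℝ) :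
    (MvPolynomial.pderiv i p).totalDegree ≤ p.totalDegree := by
  conv_lhs => rw [← MvPolynomial.support_sum_monomial_coeff p, map_sum]
  refine MvPolynomial.totalDegree_finsetSum_le fun m hm => ?_
  rw [MvPolynomial.pderiv_monomial]
  refine (MvPolynomial.totalDegree_monomial_le _ _).trans (le_trans ?_
    (MvPolynomial.le_totalDegree hm))
  rw [Finsupp.sum_fintype _ _ fun _ => rfl, Finsupp.sum_fintype _ _ fun _ => rfl]
  exact Finset.sum_le_sum fun j _ => Nat.sub_le _ _

theorem hasFDerivAt_eval (p : MvPolynomial (Fin d) ℝ) (x : Space d) :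
    HasFDerivAt (fun x : Space d => MvPolynomial.eval (fun i => x i) p)
      (∑ i, MvPolynomial.eval (fun i => x i) (MvPolynomial.pderiv i p) •
        (EuclideanSpace.proj i : Space d →L[ℝ] ℝ)) x := by
  induction p using MvPolynomial.induction_on with
  | C a => simpa using hasFDerivAt_const a x
  | add p q hp hq =>
    simp only [map_add, add_smul, Finset.sum_add_distrib]
    exact hp.add hq
  | mul_X p j hp =>
    have h1 : HasFDerivAt (fun x : Space d => x j) (EuclideanSpace.proj j : Space d →L[ℝ] ℝ) x :=
      (EuclideanSpace.proj j : Space d →L[ℝ] ℝ).hasFDerivAt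
    have h2 := hp.mul h1
    simp only [map_mul, MvPolynomial.eval_X]
    refine h2.congr_fderiv ?_
    have h3 : ∀ i, MvPolynomial.eval (fun i => x i) (MvPolynomial.pderiv i (p * MvPolynomial.X j))
        = MvPolynomial.eval (fun i => x i) p * (if i = j then 1 else 0)
          + x j * MvPolynomial.eval (fun i => x i) (MvPolynomial.pderiv i p) := by
      intro i
      have h4 : MvPolynomial.eval (fun i => x i) (MvPolynomial.pderiv i
          (MvPolynomial.X j : MvPolynomial (Fin d) ℝ)) = if i = j then 1 else 0 := by
        rw [MvPolynomial.pderiv_X, Pi.single_apply]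
        by_cases h : i = j
        · rw [if_pos h.symm, if_pos h, map_one]
        · rw [if_neg (Ne.symm h), if_neg h, map_zero]
      rw [MvPolynomial.pderiv_mul, map_add, map_mul, map_mul, MvPolynomial.eval_X, h4]
      ring
    symm
    rw [Finset.sum_congr rfl fun i _ => by rw [h3 i, add_smul], Finset.sum_add_distrib,
      Finset.smul_sum]
    refine congr_arg₂ (· + ·) ?_ ?_
    · rw [Finset.sum_eq_single j]
      · rw [if_pos rfl, mul_one]
      · exact fun i _ hij => by rw [if_neg hij, mul_zero, zero_smul]
      · simp
    · exact Finset.sum_congr rfl fun i _ => by rw [smul_smul]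

/-- Partial derivatives of polynomial functions. -/
theorem partial_mem_polySpace {f : Space d → ℝ} (hf : f ∈ polySpace d k) (i : Fin d) :
    (fun x => fderiv ℝ f x (EuclideanSpace.single i 1)) ∈ polySpace d k := by
  obtain ⟨p, hp, rfl⟩ := mem_polySpace.1 hf
  refine mem_polySpace.2 ⟨MvPolynomial.pderiv i p, (totalDegree_pderiv_le i p).trans hp, ?_⟩
  ext x
  rw [(hasFDerivAt_eval p x).fderiv, sum_apply]
  simp

/-- Invariance under translation and scaling, which reduces the inverse inequalities to the unit
ball. -/
theorem comp_affine_mem_polySpace {f : Space d → ℝ} (hf : f ∈ polySpace d k) (x₀ : Space d)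
    (h : ℝ) : (fun y => f (x₀ + h • y)) ∈ polySpace d k := by
  obtain ⟨p, hp, rfl⟩ := mem_polySpace.1 hf
  let a : Fin d → MvPolynomial (Fin d) ℝ := fun i =>
    MvPolynomial.C (x₀ i) + MvPolynomial.C h * MvPolynomial.X i
  have ha : ∀ i, (a i).totalDegree ≤ 1 := fun i => by
    refine (MvPolynomial.totalDegree_add _ _).trans (max_le (by simp) ?_)
    refine (MvPolynomial.totalDegree_mul _ _).trans ?_
    simp
  refine mem_polySpace.2 ⟨MvPolynomial.bind₁ a p, ?_, ?_⟩
  · conv_lhs => rw [← MvPolynomial.support_sum_monomial_coeff p, map_sum]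
    refine MvPolynomial.totalDegree_finsetSum_le fun m hm => ?_
    rw [MvPolynomial.bind₁_monomial]
    refine (MvPolynomial.totalDegree_mul _ _).trans ?_
    rw [MvPolynomial.totalDegree_C, zero_add]
    refine le_trans ?_ ((MvPolynomial.le_totalDegree hm).trans hp)
    refine (MvPolynomial.totalDegree_finsetProd _ _).trans (Finset.sum_le_sum fun i _ => ?_)
    refine (MvPolynomial.totalDegree_pow _ _).trans ?_
    nlinarith [ha i]
  · ext y
    rw [MvPolynomial.eval, MvPolynomial.eval₂Hom_bind₁]
    exact congr_arg (fun v => MvPolynomial.eval v p) (funext fun i => by simp [a])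

theorem memLp_of_continuousOn_isCompact {E : Type*} [NormedAddCommGroup E]
    {μ : Measure (Space d)} {S : Set (Space d)} (hS : IsCompact S) (hμ : μ S ≠ ∞)
    {f : Space d → E} (hf : ContinuousOn f S) (p : ℝ≥0∞) : MemLp f p (μ.restrict S) := by
  have : IsFiniteMeasure (μ.restrict S) := ⟨by rw [Measure.restrict_apply_univ]; exact hμ.lt_top⟩
  obtain ⟨C, hC⟩ := hS.exists_bound_of_continuousOn hf
  exact MemLp.of_bound (hf.aestronglyMeasurable_of_isCompact hS hS.measurableSet) C
    (ae_restrict_of_forall_mem hS.measurableSet hC)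

/-- Equivalence of norms on a finite dimensional space of polynomials: maximum norms on the unit
ball are bounded by the `L²` norm on a smaller ball. -/
theorem exists_inverse_unit (d k : ℕ) {δ : ℝ} (hδ : 0 < δ) : ∃ C : ℝ, 0 < C ∧
    ∀ g ∈ polySpace d k, ∀ y ∈ Metric.closedBall (0 : Space d) 1,
      g y ^ 2 ≤ C * ∫ x in Metric.closedBall (0 : Space d) δ, g x ^ 2 ∧
      ‖fderiv ℝ g y‖ ^ 2 ≤ C * ∫ x in Metric.closedBall (0 : Space d) δ, g x ^ 2 := by
  set S := Metric.closedBall (0 : Space d) δ with hS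
  have hSc : IsCompact S := isCompact_closedBall _ _
  have hmem : ∀ g : polySpace d k, MemLp (g : Space d → ℝ) 2 (volume.restrict S) := fun g =>
    memLp_of_continuousOn_isCompact hSc hSc.measure_ne_top
      (contDiff_of_mem_polySpace g.2 (n := 0)).continuous.continuousOn 2
  let Λ : polySpace d k →ₗ[ℝ] Lp ℝ 2 (volume.restrict S) :=
    { toFun := fun g => (hmem g).toLp _
      map_add' := fun g g' => MemLp.toLp_add (hmem g) (hmem g')
      map_smul' := fun t g => MemLp.toLp_const_smul t (hmem g) }
  have hΛ : ∀ g, ‖Λ g‖ ^ 2 = ∫ x in S, (g : Space d → ℝ) x ^ 2 := fun g => by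
    rw [norm_sq_eq_integral]
    refine integral_congr_ae ?_
    filter_upwards [(hmem g).coeFn_toLp] with x hx
    change ‖((hmem g).toLp _) x‖ ^ 2 = _
    rw [hx, Real.norm_eq_abs, sq_abs]
  have hker : LinearMap.ker Λ = ⊥ := by
    refine LinearMap.ker_eq_bot'.2 fun g hg => ?_
    have h1 : (g : Space d → ℝ) =ᵐ[volume.restrict (Metric.ball (0 : Space d) δ)]
        fun _ => (0 : ℝ) := by
      refine ae_restrict_of_ae_restrict_of_subset Metric.ball_subset_closedBall ?_
      filter_upwards [(hmem g).coeFn_toLp, Lp.coeFn_zero ℝ 2 (volume.restrict S)] with x hx h0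
      rw [← hx]
      change Λ g x = 0
      rw [hg, h0, Pi.zero_apply]
    have h2 := Measure.eqOn_open_of_ae_eq h1 Metric.isOpen_ball
      (contDiff_of_mem_polySpace g.2 (n := 0)).continuous.continuousOn continuousOn_const
    exact Subtype.ext (eq_zero_of_eqOn_of_mem_polySpace g.2 Metric.isOpen_ball
      ⟨0, Metric.mem_ball_self hδ⟩ h2)
  let b := Module.finBasis ℝ (polySpace d k)
  let F := Λ ∘ₗ b.equivFun.symm.toLinearMap
  have hF : LinearMap.ker F = ⊥ := by
    rw [LinearMap.ker_eq_bot] at hker ⊢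
    exact hker.comp b.equivFun.symm.injective
  obtain ⟨K, -, hK⟩ := F.exists_antilipschitzWith hF
  have hb : ∀ i, ∃ B : ℝ, 0 ≤ B ∧ ∀ y ∈ Metric.closedBall (0 : Space d) 1,
      |(b i : Space d → ℝ) y| ≤ B ∧ ‖fderiv ℝ (b i : Space d → ℝ) y‖ ≤ B := fun i => by
    have hc := contDiff_of_mem_polySpace (b i).2 (n := 1)
    obtain ⟨B₁, h1⟩ := (isCompact_closedBall (0 : Space d) 1).exists_bound_of_continuousOn
      hc.continuous.continuousOn
    obtain ⟨B₂, h2⟩ := (isCompact_closedBall (0 : Space d) 1).exists_bound_of_continuousOn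
      (hc.continuous_fderiv (by norm_num)).continuousOn
    exact ⟨max 0 (max B₁ B₂), le_max_left _ _, fun y hy => ⟨(h1 y hy).trans
      ((le_max_left _ _).trans (le_max_right _ _)), (h2 y hy).trans
      ((le_max_right _ _).trans (le_max_right _ _))⟩⟩
  choose B hB0 hB using hb
  refine ⟨(K * ∑ i, B i) ^ 2 + 1, by positivity, fun g hg y hy => ?_⟩
  obtain ⟨g, rfl⟩ : ∃ g' : polySpace d k, (g' : Space d → ℝ) = g := ⟨⟨g, hg⟩, rfl⟩
  set c := b.equivFun g with hc
  have hcn : ‖c‖ ≤ K * ‖Λ g‖ := by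
    have h1 := hK.le_mul_dist c 0
    rw [map_zero, dist_zero_right, dist_zero_right] at h1
    have h2 : F c = Λ g := by
      change Λ (b.equivFun.symm (b.equivFun g)) = _
      rw [LinearEquiv.symm_apply_apply]
    rwa [h2] at h1
  have hsum : (g : Space d → ℝ) = fun x => ∑ i, c i * (b i : Space d → ℝ) x := by
    have h1 := congr_arg Subtype.val (b.sum_equivFun g)
    rw [← h1, Submodule.coe_sum]
    ext x
    rw [Finset.sum_apply]
    rfl
  have hbound : ∀ v : Fin _ → ℝ, (∀ i, v i ≤ B i) → ∑ i, ‖c i‖ * v i ≤ K * (∑ i, B i) * ‖Λ g‖ := by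
    intro v hv
    calc ∑ i, ‖c i‖ * v i ≤ ∑ i, (K * ‖Λ g‖) * B i := Finset.sum_le_sum fun i _ =>
          mul_le_mul_of_nonneg (((norm_le_pi_norm c i).trans hcn)) (hv i) (norm_nonneg _) (hB0 i)
      _ = _ := by rw [← Finset.mul_sum]; ring
  have hfin : ∀ t : ℝ, 0 ≤ t → t ≤ K * (∑ i, B i) * ‖Λ g‖ →
      t ^ 2 ≤ ((K * ∑ i, B i) ^ 2 + 1) * ∫ x in S, (g : Space d → ℝ) x ^ 2 := by
    intro t ht0 ht
    rw [← hΛ]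
    have h1 : t ^ 2 ≤ (K * (∑ i, B i) * ‖Λ g‖) ^ 2 := by gcongr
    rw [mul_pow] at h1
    nlinarith [sq_nonneg ‖Λ g‖]
  constructor
  · rw [← sq_abs]
    refine hfin _ (abs_nonneg _) ?_
    refine le_trans ?_ (hbound (fun i => |(b i : Space d → ℝ) y|) fun i => (hB i y hy).1)
    rw [hsum]
    refine (Finset.abs_sum_le_sum_abs _ _).trans (Finset.sum_le_sum fun i _ => ?_)
    rw [abs_mul, Real.norm_eq_abs]
  · refine hfin _ (norm_nonneg _) ?_
    refine le_trans ?_ (hbound (fun i => ‖fderiv ℝ (b i : Space d → ℝ) y‖) fun i => (hB i y hy).2)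
    have hd : ∀ i ∈ Finset.univ, DifferentiableAt ℝ (fun x => c i * (b i : Space d → ℝ) x) y :=
      fun i _ => (((contDiff_of_mem_polySpace (b i).2 (n := 1)).differentiable
        (by norm_num)) y).const_mul (c i)
    rw [hsum, fderiv_fun_sum hd]
    refine norm_sum_le_of_le _ fun i _ => ?_
    rw [fderiv_const_mul (((contDiff_of_mem_polySpace (b i).2 (n := 1)).differentiable
        (by norm_num)) y), norm_smul]

/-- Inverse inequalities on sets which are comparable to a ball of radius `h`. -/
theorem exists_inverse_inequality (d k : ℕ) {δ : ℝ} (hδ : 0 < δ) : ∃ C : ℝ, 0 < C ∧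
    ∀ (S : Set (Space d)) (x₀ : Space d) (h : ℝ), 0 < h → IsCompact S →
      Metric.closedBall x₀ (δ * h) ⊆ S → S ⊆ Metric.closedBall x₀ h →
      ∀ g ∈ polySpace d k, ∀ y ∈ S,
        h ^ d * g y ^ 2 ≤ C * ∫ x in S, g x ^ 2 ∧
        h ^ d * (h ^ 2 * ‖fderiv ℝ g y‖ ^ 2) ≤ C * ∫ x in S, g x ^ 2 := by
  obtain ⟨C, hC, hg⟩ := exists_inverse_unit d k hδ
  refine ⟨C, hC, fun S x₀ h hh hS h1 h2 g hgk y hy => ?_⟩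
  set G : Space d → ℝ := fun y => g (x₀ + h • y) with hG
  have hGk : G ∈ polySpace d k := comp_affine_mem_polySpace hgk x₀ h
  set η := h⁻¹ • (y - x₀) with hη
  have hyη : x₀ + h • η = y := by
    rw [hη, smul_smul, mul_inv_cancel₀ hh.ne', one_smul]
    abel
  have hη1 : η ∈ Metric.closedBall (0 : Space d) 1 := by
    rw [mem_closedBall_zero_iff, hη, norm_smul, norm_inv, Real.norm_of_nonneg hh.le,
      inv_mul_le_iff₀ hh, mul_one, ← dist_eq_norm]
    exact Metric.mem_closedBall.1 (h2 hy)
  have hint : h ^ d * ∫ x in Metric.closedBall (0 : Space d) δ, G x ^ 2 ≤ ∫ x in S, g x ^ 2 := by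
    have e1 := Measure.setIntegral_comp_smul_of_pos (volume : Measure (Space d))
      (fun z => g (x₀ + z) ^ 2) (Metric.closedBall (0 : Space d) δ) hh
    rw [finrank_euclideanSpace_fin, smul_closedBall _ _ hδ.le, smul_zero,
      Real.norm_of_nonneg hh.le, smul_eq_mul] at e1
    have e2 := (measurePreserving_add_left (volume : Measure (Space d)) x₀).setIntegral_preimage_emb
      (MeasurableEquiv.addLeft x₀).measurableEmbedding (fun z => g z ^ 2)
      (Metric.closedBall x₀ (h * δ))
    have e3 : (fun z => x₀ + z) ⁻¹' Metric.closedBall x₀ (h * δ)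
        = Metric.closedBall (0 : Space d) (h * δ) := by
      ext z
      simp [dist_eq_norm]
    rw [e3] at e2
    rw [e1, e2, ← mul_assoc, mul_inv_cancel₀ (pow_pos hh d).ne', one_mul]
    refine setIntegral_mono_set ?_ (Filter.Eventually.of_forall fun x => sq_nonneg _)
      (LE.le.eventuallyLE (mul_comm δ h ▸ h1))
    exact ((contDiff_of_mem_polySpace hgk (n := 1)).continuous.pow
      2).continuousOn.integrableOn_compact hS
  obtain ⟨f1, f2⟩ := hg G hGk η hη1
  have hGη : G η = g y := by rw [hG]; exact congr_arg g hyη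
  have hGη' : fderiv ℝ G η = h • fderiv ℝ g y := by
    have h3 : HasFDerivAt (fun z : Space d => x₀ + h • z)
        (h • ContinuousLinearMap.id ℝ (Space d)) η :=
      ((hasFDerivAt_id η).const_smul h).const_add x₀
    have h4 : HasFDerivAt g (fderiv ℝ g (x₀ + h • η)) (x₀ + h • η) :=
      ((contDiff_of_mem_polySpace hgk (n := 1)).differentiable (by norm_num) _).hasFDerivAt
    change fderiv ℝ (g ∘ fun z => x₀ + h • z) η = _
    rw [(h4.comp η h3).fderiv, hyη]
    ext z
    simp
  rw [hGη] at f1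
  rw [hGη', norm_smul, mul_pow, Real.norm_of_nonneg hh.le] at f2
  have hhd : 0 ≤ h ^ d := by positivity
  constructor
  · calc h ^ d * g y ^ 2 ≤ h ^ d * (C * ∫ x in Metric.closedBall (0 : Space d) δ, G x ^ 2) := by
          gcongr
      _ = C * (h ^ d * ∫ x in Metric.closedBall (0 : Space d) δ, G x ^ 2) := by ring
      _ ≤ _ := by gcongr
  · calc h ^ d * (h ^ 2 * ‖fderiv ℝ g y‖ ^ 2)
        ≤ h ^ d * (C * ∫ x in Metric.closedBall (0 : Space d) δ, G x ^ 2) := by gcongr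
      _ = C * (h ^ d * ∫ x in Metric.closedBall (0 : Space d) δ, G x ^ 2) := by ring
      _ ≤ _ := by gcongr

/-! ### Finite element functions on an element -/

theorem inner_gradient_eq (f : Space d → ℝ) (x v : Space d) :
    ⟪gradient f x, v⟫_ℝ = fderiv ℝ f x v := by
  rw [gradient, InnerProductSpace.toDual_symm_apply]

theorem gradient_apply_eq (f : Space d → ℝ) (x : Space d) (i : Fin d) :
    gradient f x i = fderiv ℝ f x (EuclideanSpace.single i 1) := by
  rw [← inner_gradient_eq, EuclideanSpace.inner_single_right]
  simp

theorem norm_gradient_sq (f : Space d → ℝ) (x : Space d) :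
    ‖gradient f x‖ ^ 2 = ∑ i, fderiv ℝ f x (EuclideanSpace.single i 1) ^ 2 := by
  rw [EuclideanSpace.real_norm_sq_eq]
  exact Finset.sum_congr rfl fun i _ => by rw [gradient_apply_eq]

theorem gradient_sub_of_mem_polySpace {k : ℕ} {p p' : Space d → ℝ} (hp : p ∈ polySpace d k)
    (hp' : p' ∈ polySpace d k) (x : Space d) :
    gradient (p - p') x = gradient p x - gradient p' x := by
  rw [gradient, fderiv_sub ((contDiff_of_mem_polySpace hp (n := 1)).differentiable (by norm_num) x)
    ((contDiff_of_mem_polySpace hp' (n := 1)).differentiable (by norm_num) x), map_sub]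
  rfl

variable {Ω : Set (Space d)} {M : Mesh Ω} {k : ℕ} {w w' : L2 Ω} {T : Finset (Space d)}

theorem feRep_spec (hw : w ∈ feSpace M k) :
    IsPiecewisePolynomial M k (feRep M k w) ∧ w =ᵐ[volume.restrict Ω] feRep M k w := by
  have h : ∃ v, IsPiecewisePolynomial M k v ∧ w =ᵐ[volume.restrict Ω] v := hw
  rw [feRep, dif_pos h]
  exact h.choose_spec

open Classical in
/-- The polynomial which coincides with a finite element function on the element `T`. -/
def elementPoly (M : Mesh Ω) (k : ℕ) (w : L2 Ω) (T : Finset (Space d)) : Space d → ℝ :=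
  if h : ∃ p ∈ polySpace d k, ∀ x ∈ cell T, feRep M k w x = p x then h.choose else 0

theorem elementPoly_mem : elementPoly M k w T ∈ polySpace d k := by
  rw [elementPoly]
  split_ifs with h
  · exact h.choose_spec.1
  · exact Submodule.zero_mem _

theorem contDiff_elementPoly {n : WithTop ℕ∞} : ContDiff ℝ n (elementPoly M k w T) :=
  contDiff_of_mem_polySpace elementPoly_mem

theorem feRep_eq_elementPoly (hw : w ∈ feSpace M k) (hT : T ∈ M.elements) {x : Space d}
    (hx : x ∈ cell T) : feRep M k w x = elementPoly M k w T x := by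
  have h : ∃ p ∈ polySpace d k, ∀ x ∈ cell T, feRep M k w x = p x := by
    obtain ⟨p, hp, he⟩ := (feRep_spec hw).1.2 T hT
    exact ⟨_, mem_polySpace.2 ⟨p, hp, rfl⟩, he⟩
  rw [elementPoly, dif_pos h]
  exact h.choose_spec.2 x hx

theorem ae_eq_elementPoly (hΩ : IsPolygonalDomain Ω) (hw : w ∈ feSpace M k) (hT : T ∈ M.elements) :
    w =ᵐ[volume.restrict (interior (cell T))] elementPoly M k w T := by
  filter_upwards [ae_restrict_of_ae_restrict_of_subset (Mesh.interior_cell_subset hΩ hT)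
    (feRep_spec hw).2, ae_restrict_mem isOpen_interior.measurableSet] with x hx hxT
  rw [hx, feRep_eq_elementPoly hw hT (interior_subset hxT)]

theorem elementPoly_unique (hΩ : IsPolygonalDomain Ω) (hw : w ∈ feSpace M k) (hT : T ∈ M.elements)
    {p : Space d → ℝ} (hp : p ∈ polySpace d k)
    (h : w =ᵐ[volume.restrict (interior (cell T))] p) : elementPoly M k w T = p := by
  have h1 := Measure.eqOn_open_of_ae_eq ((ae_eq_elementPoly hΩ hw hT).symm.trans h) isOpen_interior
    (contDiff_elementPoly (n := 0)).continuous.continuousOn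
    (contDiff_of_mem_polySpace hp (n := 0)).continuous.continuousOn
  refine sub_eq_zero.1 (eq_zero_of_eqOn_of_mem_polySpace (Submodule.sub_mem _ elementPoly_mem hp)
    isOpen_interior (Mesh.interior_cell_nonempty hT) fun x hx => ?_)
  rw [Pi.sub_apply, h1 hx, sub_self]

theorem elementPoly_add (hΩ : IsPolygonalDomain Ω) (hw : w ∈ feSpace M k) (hw' : w' ∈ feSpace M k)
    (hT : T ∈ M.elements) :
    elementPoly M k (w + w') T = elementPoly M k w T + elementPoly M k w' T := by
  refine elementPoly_unique hΩ (Submodule.add_mem _ hw hw') hT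
    (Submodule.add_mem _ elementPoly_mem elementPoly_mem) ?_
  filter_upwards [ae_restrict_of_ae_restrict_of_subset (Mesh.interior_cell_subset hΩ hT)
    (Lp.coeFn_add w w'), ae_eq_elementPoly hΩ hw hT, ae_eq_elementPoly hΩ hw' hT] with x h1 h2 h3
  rw [h1, Pi.add_apply, Pi.add_apply, h2, h3]

theorem elementPoly_smul (hΩ : IsPolygonalDomain Ω) (hw : w ∈ feSpace M k) (t : ℝ)
    (hT : T ∈ M.elements) : elementPoly M k (t • w) T = t • elementPoly M k w T := by
  refine elementPoly_unique hΩ (Submodule.smul_mem _ t hw) hT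
    (Submodule.smul_mem _ t elementPoly_mem) ?_
  filter_upwards [ae_restrict_of_ae_restrict_of_subset (Mesh.interior_cell_subset hΩ hT)
    (Lp.coeFn_smul t w), ae_eq_elementPoly hΩ hw hT] with x h1 h2
  rw [h1, Pi.smul_apply, Pi.smul_apply, h2]

theorem elementPoly_sub (hΩ : IsPolygonalDomain Ω) (hw : w ∈ feSpace M k) (hw' : w' ∈ feSpace M k)
    (hT : T ∈ M.elements) :
    elementPoly M k (w - w') T = elementPoly M k w T - elementPoly M k w' T := by
  have h := elementPoly_add hΩ (Submodule.sub_mem _ hw hw') hw' hT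
  rw [sub_add_cancel] at h
  rw [h, add_sub_cancel_right]

/-- A finite element function is determined by its polynomials on the elements. -/
theorem finiteDimensional_feSpace (hΩ : IsPolygonalDomain Ω) :
    FiniteDimensional ℝ (feSpace M k) := by
  let Λ : feSpace M k →ₗ[ℝ] (M.elements → polySpace d k) :=
    { toFun := fun w T => ⟨elementPoly M k w T, elementPoly_mem⟩
      map_add' := fun w w' => funext fun T => Subtype.ext (elementPoly_add hΩ w.2 w'.2 T.2)
      map_smul' := fun t w => funext fun T => Subtype.ext (elementPoly_smul hΩ w.2 t T.2) }
  refine FiniteDimensional.of_injective Λ ((injective_iff_map_eq_zero Λ).2 fun w hw => ?_)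
  have h0 : ∀ T ∈ M.elements, elementPoly M k (w : L2 Ω) T = 0 := fun T hT =>
    congr_arg Subtype.val (congr_fun hw ⟨T, hT⟩)
  refine Subtype.ext (Lp.ext ?_)
  filter_upwards [(feRep_spec w.2).2, ae_restrict_mem hΩ.1.measurableSet,
    Lp.coeFn_zero ℝ 2 (volume.restrict Ω)] with x hx hxΩ hx0
  obtain ⟨T, hT, hxT⟩ := M.exists_mem_cell (subset_closure hxΩ)
  rw [hx, feRep_eq_elementPoly w.2 hT hxT, h0 T hT]
  exact hx0.symm

theorem gradient_feRep (hw : w ∈ feSpace M k) (hT : T ∈ M.elements) {x : Space d}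
    (hx : x ∈ interior (cell T)) :
    gradient (feRep M k w) x = gradient (elementPoly M k w T) x := by
  refine Filter.EventuallyEq.gradient_eq ?_
  filter_upwards [isOpen_interior.mem_nhds hx] with y hy
  exact feRep_eq_elementPoly hw hT (interior_subset hy)

/-- On each element the weak gradient of a finite element function is the classical gradient of its
polynomial. -/
theorem weakGradient_ae_eq (hΩ : IsPolygonalDomain Ω) (hw : w ∈ Vh M k) (hT : T ∈ M.elements) :
    weakGradient w =ᵐ[volume.restrict (interior (cell T))] gradient (elementPoly M k w T) :=
  IsWeakGradient.ae_eq_gradient (isWeakGradient_weakGradient hΩ.1 hw.2) hΩ.1.measurableSet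
    isOpen_interior (Mesh.interior_cell_subset hΩ hT) contDiff_elementPoly
    (ae_eq_elementPoly hΩ hw.1 hT)

theorem sum_integral_gradient_sq_le (hΩ : IsPolygonalDomain Ω) (hw : w ∈ Vh M k) :
    ∑ T ∈ M.elements, ∫ x in cell T, ‖gradient (elementPoly M k w T) x‖ ^ 2
      ≤ ‖weakGradient w‖ ^ 2 := by
  rw [norm_sq_eq_integral]
  refine le_trans (le_of_eq ?_) (Mesh.sum_setIntegral_cell_le hΩ (M := M)
    (f := fun x => ‖weakGradient w x‖ ^ 2) (fun x => sq_nonneg _) (integrable_norm_sq _))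
  refine Finset.sum_congr rfl fun T hT => ?_
  rw [restrict_cell]
  refine integral_congr_ae ?_
  filter_upwards [weakGradient_ae_eq hΩ hw hT] with x hx
  rw [hx]

theorem sum_integral_sq_le (hΩ : IsPolygonalDomain Ω) (hw : w ∈ feSpace M k) :
    ∑ T ∈ M.elements, ∫ x in cell T, elementPoly M k w T x ^ 2 ≤ ‖w‖ ^ 2 := by
  rw [norm_sq_eq_integral]
  refine le_trans (le_of_eq ?_) (Mesh.sum_setIntegral_cell_le hΩ (M := M)
    (f := fun x => ‖w x‖ ^ 2) (fun x => sq_nonneg _) (integrable_norm_sq _))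
  refine Finset.sum_congr rfl fun T hT => ?_
  rw [restrict_cell]
  refine integral_congr_ae ?_
  filter_upwards [ae_eq_elementPoly hΩ hw hT] with x hx
  rw [hx, Real.norm_eq_abs, sq_abs]

/-! ### The flux and its divergence on an element -/

/-- The partial derivative `∂_i f`. -/
def partialDeriv (i : Fin d) (f : Space d → ℝ) (x : Space d) : ℝ :=
  fderiv ℝ f x (EuclideanSpace.single i 1)

/-- The field `a∇p`, for a matrix of coefficient functions `a`. -/
def conormal (a : Fin d → Fin d → Space d → ℝ) (p : Space d → ℝ) (x : Space d) : Space d :=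
  Matrix.toEuclideanLin (Matrix.of fun r s => a r s x) (gradient p x)

/-- The expanded form `∑_{r,s} (∂_r a_rs ∂_s p + a_rs ∂_r ∂_s p)` of the divergence of `a∇p`. -/
def divConormal (a : Fin d → Fin d → Space d → ℝ) (p : Space d → ℝ) (x : Space d) : ℝ :=
  ∑ r, ∑ s, (partialDeriv r (a r s) x * partialDeriv s p x
    + a r s x * partialDeriv r (partialDeriv s p) x)

variable {k : ℕ} {p p' : Space d → ℝ} {a : Fin d → Fin d → Space d → ℝ}

theorem partialDeriv_mem (hp : p ∈ polySpace d k) (i : Fin d) : partialDeriv i p ∈ polySpace d k :=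
  partial_mem_polySpace hp i

theorem continuous_of_mem_polySpace (hp : p ∈ polySpace d k) : Continuous p :=
  (contDiff_of_mem_polySpace hp (n := 0)).continuous

theorem differentiable_of_mem_polySpace (hp : p ∈ polySpace d k) : Differentiable ℝ p :=
  (contDiff_of_mem_polySpace hp (n := 1)).differentiable (by norm_num)

theorem partialDeriv_sub (hp : p ∈ polySpace d k) (hp' : p' ∈ polySpace d k) (i : Fin d) :
    partialDeriv i (p - p') = partialDeriv i p - partialDeriv i p' := by
  ext x
  rw [partialDeriv, fderiv_sub (differentiable_of_mem_polySpace hp x)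
    (differentiable_of_mem_polySpace hp' x)]
  rfl

theorem norm_single_one (i : Fin d) : ‖(EuclideanSpace.single i 1 : Space d)‖ = 1 := by simp

theorem abs_partialDeriv_le (i : Fin d) (f : Space d → ℝ) (x : Space d) :
    |partialDeriv i f x| ≤ ‖fderiv ℝ f x‖ := by
  have := (fderiv ℝ f x).le_opNorm (EuclideanSpace.single i 1)
  rwa [norm_single_one, mul_one] at this

theorem norm_gradient_sq_eq (f : Space d → ℝ) (x : Space d) :
    ‖gradient f x‖ ^ 2 = ∑ i, partialDeriv i f x ^ 2 := norm_gradient_sq f x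

theorem conormal_apply (a : Fin d → Fin d → Space d → ℝ) (p : Space d → ℝ) (x : Space d)
    (r : Fin d) : conormal a p x r = ∑ s, a r s x * partialDeriv s p x := by
  simp [conormal, Matrix.toEuclideanLin, Matrix.mulVec, dotProduct, gradient_apply_eq, partialDeriv]

theorem conormal_sub (hp : p ∈ polySpace d k) (hp' : p' ∈ polySpace d k) (x : Space d) :
    conormal a (p - p') x = conormal a p x - conormal a p' x := by
  rw [conormal, gradient_sub_of_mem_polySpace hp hp', map_sub]
  rfl

theorem divConormal_sub (hp : p ∈ polySpace d k) (hp' : p' ∈ polySpace d k) (x : Space d) :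
    divConormal a (p - p') x = divConormal a p x - divConormal a p' x := by
  simp only [divConormal, ← Finset.sum_sub_distrib]
  refine Finset.sum_congr rfl fun r _ => Finset.sum_congr rfl fun s _ => ?_
  rw [partialDeriv_sub hp hp', partialDeriv_sub (partialDeriv_mem hp s) (partialDeriv_mem hp' s)]
  simp only [Pi.sub_apply]
  ring

theorem continuous_gradient_of_mem_polySpace (hp : p ∈ polySpace d k) : Continuous (gradient p) :=
  continuous_gradient (contDiff_of_mem_polySpace hp)

theorem continuous_conormal (ha : ∀ r s, Continuous (a r s)) (hp : p ∈ polySpace d k) :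
    Continuous (conormal a p) := by
  have h : conormal a p = fun x => ∑ r, ∑ s, (a r s x * gradient p x s) •
      (EuclideanSpace.single r (1 : ℝ) : Space d) := by
    ext1 x
    exact ModelProblem.toEuclideanLin_eq_sum _ _
  rw [h]
  have hg := continuous_gradient_of_mem_polySpace hp
  refine continuous_finsetSum _ fun r _ => continuous_finsetSum _ fun s _ => ?_
  refine ((ha r s).mul ?_).smul continuous_const
  exact (EuclideanSpace.proj s : Space d →L[ℝ] ℝ).continuous.comp hg

theorem divergence_conormal {x : Space d} (ha : ∀ r s, DifferentiableAt ℝ (a r s) x)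
    (hp : p ∈ polySpace d k) : divergence (conormal a p) x = divConormal a p x := by
  rw [divergence, divConormal]
  refine Finset.sum_congr rfl fun r _ => ?_
  have h1 : (fun y => conormal a p y r) = fun y => ∑ s, a r s y * partialDeriv s p y :=
    funext fun y => conormal_apply a p y r
  have hd : ∀ s, DifferentiableAt ℝ (partialDeriv s p) x := fun s =>
    differentiable_of_mem_polySpace (partialDeriv_mem hp s) x
  have hm : ∀ s ∈ Finset.univ, DifferentiableAt ℝ (fun y => a r s y * partialDeriv s p y) x :=
    fun s _ => (ha r s).fun_mul (hd s)
  rw [h1, fderiv_fun_sum hm, sum_apply]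
  refine Finset.sum_congr rfl fun s _ => ?_
  rw [fderiv_fun_mul (ha r s) (hd s)]
  simp only [partialDeriv, add_apply, smul_apply, smul_eq_mul]
  ring

theorem abs_divConormal_le {B : ℝ} {x : Space d} (ha : ∀ r s, |a r s x| ≤ B)
    (ha' : ∀ r s, ‖fderiv ℝ (a r s) x‖ ≤ B) :
    |divConormal a p x|
      ≤ d * B * ∑ s, (|partialDeriv s p x| + ‖fderiv ℝ (partialDeriv s p) x‖) := by
  have h : ∀ r, |∑ s, (partialDeriv r (a r s) x * partialDeriv s p x
      + a r s x * partialDeriv r (partialDeriv s p) x)|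
      ≤ B * ∑ s, (|partialDeriv s p x| + ‖fderiv ℝ (partialDeriv s p) x‖) := by
    intro r
    rw [Finset.mul_sum]
    refine (Finset.abs_sum_le_sum_abs _ _).trans (Finset.sum_le_sum fun s _ => ?_)
    refine (abs_add_le _ _).trans ?_
    rw [abs_mul, abs_mul, mul_add]
    have hB : 0 ≤ B := (abs_nonneg _).trans (ha r s)
    exact add_le_add (mul_le_mul_of_nonneg_right ((abs_partialDeriv_le _ _ _).trans (ha' r s))
      (abs_nonneg _)) (mul_le_mul (ha r s) (abs_partialDeriv_le _ _ _) (abs_nonneg _) hB)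
  refine (Finset.abs_sum_le_sum_abs _ _).trans ((Finset.sum_le_sum fun r _ => h r).trans ?_)
  rw [Finset.sum_const, Finset.card_univ, Fintype.card_fin, nsmul_eq_mul, mul_assoc]

theorem measurable_divConormal (ha : ∀ r s, Continuous (a r s)) (hp : p ∈ polySpace d k) :
    Measurable (divConormal a p) := by
  refine Finset.measurable_fun_sum _ fun r _ => Finset.measurable_fun_sum _ fun s _ => ?_
  refine ((measurable_fderiv_apply_const ℝ (a r s) _).mul
    (continuous_of_mem_polySpace (partialDeriv_mem hp s)).measurable).add
    ((ha r s).measurable.mul (continuous_of_mem_polySpace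
      (partialDeriv_mem (partialDeriv_mem hp s) r)).measurable)

/-- The functions `a` extend the coefficients of the operator from the interior of `T` to Lipschitz
continuous functions on the whole space, which are bounded on `T`. -/
structure IsLocalCoeff (P : ModelProblem d) (T : Finset (Space d)) (B : ℝ)
    (a : Fin d → Fin d → Space d → ℝ) : Prop where
  lipschitz : ∀ r s, ∃ L : NNReal, LipschitzWith L (a r s)
  norm_fderiv_le : ∀ r s x, ‖fderiv ℝ (a r s) x‖ ≤ B
  eq : ∀ x ∈ interior (cell T), ∀ r s, a r s x = P.A x r s
  abs_le : ∀ x ∈ closure (interior (cell T)), ∀ r s, |a r s x| ≤ B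

theorem IsLocalCoeff.continuous {P : ModelProblem d} {T : Finset (Space d)} {B : ℝ}
    (h : IsLocalCoeff P T B a) (r s : Fin d) : Continuous (a r s) := by
  obtain ⟨L, hL⟩ := h.lipschitz r s
  exact hL.continuous

/-- Real-valued Lipschitz functions on a subset extend to the whole space with the same constant;
the bound on an element follows by continuity up to its boundary. -/
theorem exists_isLocalCoeff (P : ModelProblem d) : ∃ B : ℝ, 0 ≤ B ∧ ∀ T : Finset (Space d),
    (∃ D ∈ P.pieces, interior (cell T) ⊆ D) → ∃ a, IsLocalCoeff P T B a := by
  obtain ⟨L, hL⟩ := P.lipschitz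
  obtain ⟨K, hK0, hK⟩ := P.exists_abs_coeff_le
  refine ⟨max (L : ℝ) K, hK0.trans (le_max_right _ _), fun T ⟨D, hD, hTD⟩ => ?_⟩
  have h1 : ∀ r s, ∃ g : Space d → ℝ, LipschitzWith L g ∧
      EqOn (fun x => P.A x r s) g (interior (cell T)) := fun r s =>
    ((hL D hD r s).mono hTD).extend_real
  choose a ha hae using h1
  refine ⟨a, fun r s => ⟨L, ha r s⟩, fun r s x => (norm_fderiv_le_of_lipschitz ℝ (ha r s)).trans
    (le_max_left _ _), fun x hx r s => (hae r s hx).symm, fun x hx r s => ?_⟩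
  have hcl : IsClosed {y | |a r s y| ≤ max (L : ℝ) K} :=
    isClosed_le ((ha r s).continuous.abs) continuous_const
  refine closure_minimal (fun y hy => ?_) hcl hx
  change |a r s y| ≤ _
  rw [← hae r s hy]
  exact (hK D hD y (hTD hy) r s).trans (le_max_right _ _)

section Flux

variable {P : ModelProblem d} {M : Mesh P.Ω} {w : L2 P.Ω} {T : Finset (Space d)}

theorem flux_eq_conormal (hw : w ∈ feSpace M k) (hT : T ∈ M.elements)
    {B : ℝ} (ha : IsLocalCoeff P T B a) {x : Space d}
    (hx : x ∈ interior (cell T)) : flux P M k w x = conormal a (elementPoly M k w T) x := by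
  have h : Matrix.of (fun r s => a r s x) = P.A x := by
    ext r s
    exact ha.eq x hx r s
  rw [flux, conormal, h, gradient_feRep hw hT hx]

/-- The trace of the flux on the boundary of an element, given by the extended coefficients. -/
theorem extendFrom_flux (hw : w ∈ feSpace M k) (hT : T ∈ M.elements)
    {B : ℝ} (ha : IsLocalCoeff P T B a) {x : Space d} (hx : x ∈ cell T) :
    extendFrom (interior (cell T)) (flux P M k w) x = conormal a (elementPoly M k w T) x := by
  refine extendFrom_eq (by rwa [Mesh.closure_interior_cell hT]) ?_
  have h1 := ((continuous_conormal ha.continuous (elementPoly_mem (M := M) (k := k) (w := w)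
    (T := T))).tendsto x).mono_left (nhdsWithin_le_nhds (s := interior (cell T)))
  refine h1.congr' ?_
  filter_upwards [self_mem_nhdsWithin] with y hy
  exact (flux_eq_conormal hw hT ha hy).symm

/-- By Rademacher's theorem the extended coefficients are differentiable almost everywhere, and
there the product rule holds. -/
theorem divergence_flux_ae_eq (hw : w ∈ feSpace M k) (hT : T ∈ M.elements)
    {B : ℝ} (ha : IsLocalCoeff P T B a) :
    divergence (flux P M k w) =ᵐ[volume.restrict (interior (cell T))]
      divConormal a (elementPoly M k w T) := by
  have h1 : ∀ᵐ x : Space d, ∀ r s, DifferentiableAt ℝ (a r s) x := by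
    rw [ae_all_iff]
    intro r
    rw [ae_all_iff]
    intro s
    obtain ⟨L, hL⟩ := ha.lipschitz r s
    exact hL.ae_differentiableAt
  filter_upwards [ae_restrict_of_ae h1, ae_restrict_mem isOpen_interior.measurableSet] with x hx hxT
  rw [← divergence_conormal hx elementPoly_mem, divergence, divergence]
  refine Finset.sum_congr rfl fun r _ => ?_
  have h2 : (fun y => flux P M k w y r) =ᶠ[𝓝 x]
      fun y => conormal a (elementPoly M k w T) y r := by
    filter_upwards [isOpen_interior.mem_nhds hxT] with y hy
    rw [flux_eq_conormal hw hT ha hy]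
  rw [h2.fderiv_eq]

end Flux

/-! ### Differences of error estimators -/

/-- The reverse triangle inequality in `ℓ²`: square roots of sums differ by at most the `ℓ²` norm
of the differences of the square roots. -/
theorem sq_sqrt_sub_sqrt_sum_le {ι : Type*} (s : Finset ι) {Q Q' R : ι → ℝ}
    (hQ : ∀ i, 0 ≤ Q i) (hQ' : ∀ i, 0 ≤ Q' i)
    (h : ∀ i ∈ s, (√(Q i) - √(Q' i)) ^ 2 ≤ R i) :
    (√(∑ i ∈ s, Q i) - √(∑ i ∈ s, Q' i)) ^ 2 ≤ ∑ i ∈ s, R i := by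
  have h1 := Real.sum_sqrt_mul_sqrt_le s hQ hQ'
  have h2 : ∀ i, (√(Q i) - √(Q' i)) ^ 2 = Q i + Q' i - 2 * (√(Q i) * √(Q' i)) := fun i => by
    rw [sub_sq, Real.sq_sqrt (hQ i), Real.sq_sqrt (hQ' i)]
    ring
  have h3 := Finset.sum_le_sum h
  simp only [h2, Finset.sum_sub_distrib, Finset.sum_add_distrib, ← Finset.mul_sum] at h3
  rw [sub_sq, Real.sq_sqrt (Finset.sum_nonneg fun i _ => hQ i),
    Real.sq_sqrt (Finset.sum_nonneg fun i _ => hQ' i)]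
  linarith

theorem sq_sqrt_sub_sqrt_add_le {a b a' b' r s : ℝ} (ha : 0 ≤ a) (hb : 0 ≤ b) (ha' : 0 ≤ a')
    (hb' : 0 ≤ b') (h1 : (√a - √a') ^ 2 ≤ r) (h2 : (√b - √b') ^ 2 ≤ s) :
    (√(a + b) - √(a' + b')) ^ 2 ≤ r + s := by
  have h := sq_sqrt_sub_sqrt_sum_le (Finset.univ : Finset Bool) (Q := fun t => bif t then a else b)
    (Q' := fun t => bif t then a' else b') (R := fun t => bif t then r else s)
    (by rintro (_ | _) <;> assumption) (by rintro (_ | _) <;> assumption)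
    (by rintro (_ | _) - <;> assumption)
  simpa using h

/-- The reverse triangle inequality in a weighted `L²` space. -/
theorem sq_sqrt_sub_sqrt_integral_le {α : Type*} [MeasurableSpace α] {μ : Measure α} {f g : α → ℝ}
    (hf : MemLp f 2 μ) (hg : MemLp g 2 μ) {c : ℝ} (hc : 0 ≤ c) :
    (√(c * ∫ x, f x ^ 2 ∂μ) - √(c * ∫ x, g x ^ 2 ∂μ)) ^ 2
      ≤ c * ∫ x, (f x - g x) ^ 2 ∂μ := by
  have key : ∀ {f : α → ℝ} (hf : MemLp f 2 μ), ∫ x, f x ^ 2 ∂μ = ‖hf.toLp f‖ ^ 2 := by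
    intro f hf
    rw [norm_sq_eq_integral]
    refine integral_congr_ae ?_
    filter_upwards [hf.coeFn_toLp] with x hx
    rw [hx, Real.norm_eq_abs, sq_abs]
  have h3 := key (hf.sub hg)
  simp only [Pi.sub_apply] at h3
  rw [h3, key hf, key hg, MemLp.toLp_sub hf hg, Real.sqrt_mul hc, Real.sqrt_mul hc,
    Real.sqrt_sq (norm_nonneg _), Real.sqrt_sq (norm_nonneg _), ← mul_sub, mul_pow,
    Real.sq_sqrt hc]
  refine mul_le_mul_of_nonneg_left ?_ hc
  rw [← sq_abs]
  have := abs_norm_sub_norm_le (hf.toLp f) (hg.toLp g)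
  gcongr

theorem setIntegral_le_mul_measure {α : Type*} [MeasurableSpace α] {μ : Measure α} {S : Set α}
    (hμ : μ S ≠ ∞) {f : α → ℝ} {c : ℝ} (hf0 : ∀ x ∈ S, 0 ≤ f x)
    (hf : ∀ x ∈ S, f x ≤ c) : ∫ x in S, f x ∂μ ≤ c * (μ S).toReal := by
  have h := norm_setIntegral_le_of_norm_le_const (μ := μ) (s := S) (f := f) (C := c)
    hμ.lt_top (fun x hx => by rw [Real.norm_of_nonneg (hf0 x hx)]; exact hf x hx)
  exact (Real.le_norm_self _).trans h

variable {k : ℕ} {p p' : Space d → ℝ} {a : Fin d → Fin d → Space d → ℝ}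

section Local

variable {P : ModelProblem d} {M : Mesh P.Ω} {w : L2 P.Ω} {T : Finset (Space d)}

theorem memLp_divConormal {B : ℝ} (hT : T ∈ M.elements) (ha : IsLocalCoeff P T B a)
    (hp : p ∈ polySpace d k) : MemLp (divConormal a p) 2 (volume.restrict (cell T)) := by
  have hc : Continuous fun x =>
      d * B * ∑ s, (|partialDeriv s p x| + ‖fderiv ℝ (partialDeriv s p) x‖) := by
    refine continuous_const.mul (continuous_finsetSum _ fun s _ => ?_)
    have hs := contDiff_of_mem_polySpace (partialDeriv_mem hp s) (n := 1)
    exact hs.continuous.abs.add (hs.continuous_fderiv (by norm_num)).norm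
  refine (memLp_of_continuousOn_isCompact (isCompact_cell T) (isCompact_cell T).measure_ne_top
    hc.continuousOn 2).mono' (measurable_divConormal ha.continuous hp).aestronglyMeasurable ?_
  refine ae_restrict_of_forall_mem (isCompact_cell T).measurableSet fun x hx => ?_
  rw [← Mesh.closure_interior_cell hT] at hx
  exact abs_divConormal_le (ha.abs_le x hx) fun r s => ha.norm_fderiv_le r s x

/-- The function `∑_{i,j} b(w, u_ij) lam_ij u_ij`. -/
def weightedSum (P : ModelProblem d) {q : ℕ} {m : Fin q → ℕ} (lam : (i : Fin q) → Fin (m i) → ℝ)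
    (u : (i : Fin q) → Fin (m i) → L2 P.Ω) (w : L2 P.Ω) : L2 P.Ω :=
  ∑ i, ∑ j, (bForm P w (u i j) * lam i j) • u i j

theorem coeFn_weightedSum {q : ℕ} {m : Fin q → ℕ} (lam : (i : Fin q) → Fin (m i) → ℝ)
    (u : (i : Fin q) → Fin (m i) → L2 P.Ω) (w : L2 P.Ω) :
    weightedSum P lam u w =ᵐ[volume.restrict P.Ω]
      fun x => ∑ i, ∑ j, bForm P w (u i j) * lam i j * u i j x := by
  have hs : ∀ {ι : Type} (s : Finset ι) (f : ι → L2 P.Ω),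
      (∑ i ∈ s, f i : L2 P.Ω) =ᵐ[volume.restrict P.Ω] fun x => ∑ i ∈ s, f i x := by
    intro ι s f
    refine (Lp.coeFn_finsetSum s f).trans (Filter.Eventually.of_forall fun x => ?_)
    exact Finset.sum_apply _ _ _
  have h1 : ∀ᵐ x ∂(volume.restrict P.Ω), ∀ i,
      (∑ j, (bForm P w (u i j) * lam i j) • u i j : L2 P.Ω) x
        = ∑ j, ((bForm P w (u i j) * lam i j) • u i j : L2 P.Ω) x :=
    ae_all_iff.2 fun i => hs _ _
  have h2 : ∀ᵐ x ∂(volume.restrict P.Ω), ∀ i j,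
      ((bForm P w (u i j) * lam i j) • u i j : L2 P.Ω) x = bForm P w (u i j) * lam i j * u i j x :=
    ae_all_iff.2 fun i => ae_all_iff.2 fun j => Lp.coeFn_smul _ _
  rw [weightedSum]
  filter_upwards [hs Finset.univ fun i => ∑ j, (bForm P w (u i j) * lam i j) • u i j, h1, h2]
    with x e0 e1 e2
  rw [e0]
  refine Finset.sum_congr rfl fun i _ => ?_
  rw [e1]
  exact Finset.sum_congr rfl fun j _ => e2 i j

theorem elementResidual_ae_eq {q : ℕ} {m : Fin q → ℕ} {B : ℝ} (hw : w ∈ feSpace M k)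
    (hT : T ∈ M.elements) (ha : IsLocalCoeff P T B a) (lam : (i : Fin q) → Fin (m i) → ℝ)
    (u : (i : Fin q) → Fin (m i) → L2 P.Ω) :
    elementResidual P M k lam u w =ᵐ[volume.restrict (interior (cell T))]
      fun x => weightedSum P lam u w x + divConormal a (elementPoly M k w T) x
        - P.c x * elementPoly M k w T x := by
  filter_upwards [ae_restrict_of_ae_restrict_of_subset (Mesh.interior_cell_subset P.polygonal hT)
    (coeFn_weightedSum lam u w), divergence_flux_ae_eq hw hT ha,
    ae_restrict_mem isOpen_interior.measurableSet] with x h1 h2 hx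
  rw [elementResidual, h1, h2, feRep_eq_elementPoly hw hT (interior_subset hx)]

theorem memLp_coeff_mul_poly (hT : T ∈ M.elements) (hp : p ∈ polySpace d k) :
    MemLp (fun x => P.c x * p x) 2 (volume.restrict (cell T)) := by
  have h1 := memLp_of_continuousOn_isCompact (μ := volume) (isCompact_cell T)
    (isCompact_cell T).measure_ne_top (continuous_of_mem_polySpace hp).continuousOn 2
  rw [restrict_cell] at h1 ⊢
  exact h1.mul (P.c_bounded.mono_measure
    (Measure.restrict_mono (Mesh.interior_cell_subset P.polygonal hT) le_rfl))

theorem memLp_elementResidual {q : ℕ} {m : Fin q → ℕ} {B : ℝ} (hw : w ∈ feSpace M k)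
    (hT : T ∈ M.elements) (ha : IsLocalCoeff P T B a) (lam : (i : Fin q) → Fin (m i) → ℝ)
    (u : (i : Fin q) → Fin (m i) → L2 P.Ω) :
    MemLp (elementResidual P M k lam u w) 2 (volume.restrict (cell T)) := by
  have h1 := memLp_divConormal hT ha (elementPoly_mem (M := M) (k := k) (w := w) (T := T))
  have h2 := memLp_coeff_mul_poly hT (elementPoly_mem (M := M) (k := k) (w := w) (T := T))
  rw [restrict_cell] at h1 h2 ⊢
  have h3 : MemLp (weightedSum P lam u w) 2 (volume.restrict (interior (cell T))) :=
    (Lp.memLp _).mono_measure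
      (Measure.restrict_mono (Mesh.interior_cell_subset P.polygonal hT) le_rfl)
  exact (memLp_congr_ae (elementResidual_ae_eq hw hT ha lam u)).2 ((h3.add h1).sub h2)

open Classical in
theorem jumpResidual_eq {B : ℝ} {a : Finset (Space d) → Fin d → Fin d → Space d → ℝ}
    (ha : ∀ T ∈ M.elements, IsLocalCoeff P T B (a T)) (hw : w ∈ feSpace M k)
    {e : Finset (Space d)} {x : Space d} (hx : x ∈ cell e) :
    jumpResidual P M k w e x = ∑ T ∈ M.elements.filter (fun T => e ⊆ T),
      -⟪conormal (a T) (elementPoly M k w T) x, outwardNormal T e⟫_ℝ := by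
  rw [jumpResidual]
  refine Finset.sum_congr rfl fun T hT => ?_
  rw [Finset.mem_filter] at hT
  rw [extendFrom_flux hw hT.1 (ha T hT.1) (cell_mono hT.2 hx)]

theorem norm_outwardNormal_le (T e : Finset (Space d)) : ‖outwardNormal T e‖ ≤ 1 := by
  rw [outwardNormal]
  split_ifs with h
  · exact h.choose_spec.1.le
  · simp

theorem continuousOn_jumpResidual {B : ℝ} {a : Finset (Space d) → Fin d → Fin d → Space d → ℝ}
    (ha : ∀ T ∈ M.elements, IsLocalCoeff P T B (a T)) (hw : w ∈ feSpace M k)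
    (e : Finset (Space d)) : ContinuousOn (jumpResidual P M k w e) (cell e) := by
  classical
  refine ContinuousOn.congr (f := fun x => ∑ T ∈ M.elements.filter (fun T => e ⊆ T),
      -⟪conormal (a T) (elementPoly M k w T) x, outwardNormal T e⟫_ℝ) ?_ fun x hx => ?_
  · refine (continuous_finsetSum _ fun T hT => ?_).continuousOn
    rw [Finset.mem_filter] at hT
    exact ((continuous_conormal (ha T hT.1).continuous elementPoly_mem).inner continuous_const).neg
  · rw [jumpResidual_eq ha hw hx]

end Local

/-! ### Local bounds for the estimator -/

variable {k : ℕ} {p p' : Space d → ℝ} {a : Fin d → Fin d → Space d → ℝ}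

theorem sq_sum_le_card_mul {ι : Type*} [Fintype ι] (f : ι → ℝ) :
    (∑ i, f i) ^ 2 ≤ Fintype.card ι * ∑ i, f i ^ 2 := by
  have := sq_sum_le_card_mul_sum_sq (s := (Finset.univ : Finset ι)) (f := f)
  rwa [Finset.card_univ] at this

theorem integral_norm_gradient_sq {S : Set (Space d)} (hS : IsCompact S) (hp : p ∈ polySpace d k) :
    ∫ x in S, ‖gradient p x‖ ^ 2 = ∑ s, ∫ x in S, partialDeriv s p x ^ 2 := by
  simp only [norm_gradient_sq_eq]
  rw [integral_finsetSum]
  intro s _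
  exact ((continuous_of_mem_polySpace
    (partialDeriv_mem hp s)).pow 2).continuousOn.integrableOn_compact
    hS

section Shape

variable {P : ModelProblem d} {M : Mesh P.Ω} {w : L2 P.Ω} {T : Finset (Space d)}

/-- Pointwise inverse inequalities for the gradient of a polynomial on a shape regular element. -/
theorem exists_inverse_element (d k : ℕ) (γ : ℝ) : ∃ C : ℝ, 0 < C ∧
    ∀ {Ω : Set (Space d)} (M : Mesh Ω), M.ShapeRegular γ → 1 ≤ d → ∀ T ∈ M.elements,
      ∀ p ∈ polySpace d k, ∀ x ∈ cell T,
        Metric.diam (cell T) ^ d * ‖gradient p x‖ ^ 2 ≤ C * ∫ x in cell T, ‖gradient p x‖ ^ 2 ∧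
        Metric.diam (cell T) ^ d * (Metric.diam (cell T) ^ 2 *
          ∑ s, ‖fderiv ℝ (partialDeriv s p) x‖ ^ 2) ≤ C * ∫ x in cell T, ‖gradient p x‖ ^ 2 := by
  by_cases hγ : 0 < γ
  · obtain ⟨C, hC, h⟩ := exists_inverse_inequality d k (δ := (4 * γ)⁻¹) (by positivity)
    refine ⟨C, hC, fun M hM hd T hT p hp x hx => ?_⟩
    obtain ⟨-, x₀, h1, h2⟩ := hM.exists_ball hd hT
    have h3 := fun s => h (cell T) x₀ _ (Mesh.diam_cell_pos hd hT) (isCompact_cell T) h1 h2 _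
      (partialDeriv_mem hp s) x hx
    rw [integral_norm_gradient_sq (isCompact_cell T) hp, norm_gradient_sq_eq, Finset.mul_sum,
      Finset.mul_sum, Finset.mul_sum, Finset.mul_sum]
    exact ⟨Finset.sum_le_sum fun s _ => (h3 s).1, Finset.sum_le_sum fun s _ => (h3 s).2⟩
  -- an element of a shape regular mesh forces `0 < γ`
  · refine ⟨1, one_pos, fun M hM hd T hT => ?_⟩
    exact absurd (hM.exists_ball hd hT).1 hγ

/-- `h_T² ‖∇·(A∇p)‖²` is bounded by `‖∇p‖²` on the element `T`. -/
theorem exists_divConormal_le (hd : 1 ≤ d) (k : ℕ) (γ B : ℝ) : ∃ C : ℝ, 0 < C ∧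
    ∀ (P : ModelProblem d) (M : Mesh P.Ω), M.ShapeRegular γ → ∀ T ∈ M.elements,
      Metric.diam (cell T) ≤ 1 → ∀ a, IsLocalCoeff P T B a → ∀ p ∈ polySpace d k,
      Metric.diam (cell T) ^ 2 * ∫ x in cell T, divConormal a p x ^ 2
        ≤ C * ∫ x in cell T, ‖gradient p x‖ ^ 2 := by
  obtain ⟨C, hC, hinv⟩ := exists_inverse_element d k γ
  set V := (volume (Metric.closedBall (0 : Space d) 1)).toReal with hV
  refine ⟨(d * B) ^ 2 * d * (2 * (C + C)) * V + 1, by positivity,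
    fun P M hM T hT h1 a ha p hp => ?_⟩
  set h := Metric.diam (cell T) with hh
  set I := ∫ x in cell T, ‖gradient p x‖ ^ 2 with hI
  have hI0 : 0 ≤ I := integral_nonneg fun x => sq_nonneg _
  have hpos : 0 < h := Mesh.diam_cell_pos hd hT
  have hhd : 0 < h ^ d := pow_pos hpos d
  obtain ⟨-, x₀, -, hball⟩ := hM.exists_ball hd hT
  have hvol : (volume (cell T)).toReal ≤ V * h ^ d := by
    have e1 : (volume (Metric.closedBall x₀ h)).toReal = V * h ^ d := by
      rw [hV, Measure.addHaar_closedBall' volume x₀ hpos.le, finrank_euclideanSpace_fin,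
        ENNReal.toReal_mul, ENNReal.toReal_ofReal hhd.le, mul_comm]
    rw [← e1]
    exact ENNReal.toReal_mono (isCompact_closedBall x₀ h).measure_ne_top (measure_mono hball)
  have hpt : ∀ x ∈ cell T, divConormal a p x ^ 2
      ≤ (d * B) ^ 2 * d * (2 * (C + C)) * I / (h ^ d * h ^ 2) := by
    intro x hx
    obtain ⟨f1, f2⟩ := hinv M hM hd T hT p hp x hx
    have hx' := hx
    rw [← Mesh.closure_interior_cell hT] at hx'
    have g1 := abs_divConormal_le (p := p) (ha.abs_le x hx') fun r s => ha.norm_fderiv_le r s x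
    have g2 : divConormal a p x ^ 2
        ≤ (d * B * ∑ s, (|partialDeriv s p x| + ‖fderiv ℝ (partialDeriv s p) x‖)) ^ 2 := by
      rw [← sq_abs]
      exact pow_le_pow_left₀ (abs_nonneg _) g1 2
    have g3 := sq_sum_le_card_mul
      fun s => |partialDeriv s p x| + ‖fderiv ℝ (partialDeriv s p) x‖
    rw [Fintype.card_fin] at g3
    have g4 : ∑ s, (|partialDeriv s p x| + ‖fderiv ℝ (partialDeriv s p) x‖) ^ 2
        ≤ 2 * (‖gradient p x‖ ^ 2 + ∑ s, ‖fderiv ℝ (partialDeriv s p) x‖ ^ 2) := by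
      rw [norm_gradient_sq_eq, ← Finset.sum_add_distrib, Finset.mul_sum]
      refine Finset.sum_le_sum fun s _ => ?_
      rw [← sq_abs (partialDeriv s p x)]
      exact add_sq_le
    have g5 : h ^ d * h ^ 2 * (2 * (‖gradient p x‖ ^ 2 + ∑ s, ‖fderiv ℝ (partialDeriv s p) x‖ ^ 2))
        ≤ 2 * (C + C) * I := by
      have e1 : h ^ d * h ^ 2 * ‖gradient p x‖ ^ 2 ≤ h ^ d * ‖gradient p x‖ ^ 2 := by
        have : h ^ 2 ≤ 1 := pow_le_one₀ hpos.le h1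
        have e2 : 0 ≤ h ^ d * ‖gradient p x‖ ^ 2 := by positivity
        nlinarith
      have e3 : h ^ d * h ^ 2 * ∑ s, ‖fderiv ℝ (partialDeriv s p) x‖ ^ 2
          = h ^ d * (h ^ 2 * ∑ s, ‖fderiv ℝ (partialDeriv s p) x‖ ^ 2) := mul_assoc _ _ _
      nlinarith
    rw [le_div_iff₀ (by positivity)]
    calc divConormal a p x ^ 2 * (h ^ d * h ^ 2)
        ≤ (d * B) ^ 2 * (d * (2 * (‖gradient p x‖ ^ 2
            + ∑ s, ‖fderiv ℝ (partialDeriv s p) x‖ ^ 2))) * (h ^ d * h ^ 2) := by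
          rw [mul_pow] at g2
          gcongr
          refine g2.trans ?_
          gcongr
          refine g3.trans ?_
          gcongr
      _ = (d * B) ^ 2 * d * (h ^ d * h ^ 2 * (2 * (‖gradient p x‖ ^ 2
            + ∑ s, ‖fderiv ℝ (partialDeriv s p) x‖ ^ 2))) := by ring
      _ ≤ (d * B) ^ 2 * d * (2 * (C + C) * I) := by gcongr
      _ = _ := by ring
  have hint := setIntegral_le_mul_measure (μ := volume) (isCompact_cell T).measure_ne_top
    (fun x _ => sq_nonneg (divConormal a p x)) hpt
  calc h ^ 2 * ∫ x in cell T, divConormal a p x ^ 2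
      ≤ h ^ 2 * ((d * B) ^ 2 * d * (2 * (C + C)) * I / (h ^ d * h ^ 2) * (V * h ^ d)) := by
        gcongr
        refine hint.trans ?_
        gcongr
    _ = (d * B) ^ 2 * d * (2 * (C + C)) * V * I := by field_simp
    _ ≤ _ := by nlinarith

theorem norm_conormal_le {B : ℝ} (hT : T ∈ M.elements) (ha : IsLocalCoeff P T B a) {x : Space d}
    (hx : x ∈ cell T) : ‖conormal a p x‖ ≤ d * (d * B) * ‖gradient p x‖ := by
  rw [← Mesh.closure_interior_cell hT] at hx
  exact ModelProblem.norm_toEuclideanLin_le (fun r s => ha.abs_le x hx r s) _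

open Classical in
/-- Trace inequality: `h_e ‖J_e‖²` is bounded by `‖∇p‖²` on the two elements that share the side
`e`. -/
theorem exists_jump_le (hd : 1 ≤ d) (k : ℕ) (γ B : ℝ) : ∃ C : ℝ, 0 < C ∧
    ∀ (P : ModelProblem d) (M : Mesh P.Ω), M.ShapeRegular γ →
      ∀ a : Finset (Space d) → Fin d → Fin d → Space d → ℝ,
      (∀ T ∈ M.elements, IsLocalCoeff P T B (a T)) → ∀ w ∈ feSpace M k, ∀ w' ∈ feSpace M k,
      ∀ e ∈ M.sides,
      sideSize M e * ∫ x in cell e, (jumpResidual P M k w e x - jumpResidual P M k w' e x) ^ 2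
          ∂(μHE[d - 1])
        ≤ C * ∑ T ∈ M.elements.filter (fun T => e ⊆ T),
            ∫ x in cell T, ‖gradient (elementPoly M k (w - w') T) x‖ ^ 2 := by
  obtain ⟨C, hC, hinv⟩ := exists_inverse_element d k γ
  obtain ⟨Cμ, hCμ, hμ⟩ := exists_measure_side_le d
  refine ⟨2 * (d * (d * B)) ^ 2 * C * Cμ + 1, by positivity,
    fun P M hM a ha w hw w' hw' e he => ?_⟩
  obtain ⟨hc, hne⟩ := Mesh.mem_sides he
  set F := M.elements.filter (fun T => e ⊆ T) with hF
  have hFm : ∀ T ∈ F, T ∈ M.elements ∧ e ⊆ T := fun T hT => Finset.mem_filter.1 hT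
  set I : Finset (Space d) → ℝ := fun T =>
    ∫ x in cell T, ‖gradient (elementPoly M k (w - w') T) x‖ ^ 2 with hI
  have hI0 : ∀ T, 0 ≤ I T := fun T => integral_nonneg fun x => sq_nonneg _
  have hside : ∀ T ∈ F, (μHE[d - 1] : Measure (Space d)) (cell e)
      ≤ ENNReal.ofReal (Cμ * Metric.diam (cell T) ^ (d - 1)) := fun T hT =>
    hμ e hc hne _ fun x hx y hy => dist_le_diam_cell (cell_mono (hFm T hT).2 (subset_cell e hx))
      (cell_mono (hFm T hT).2 (subset_cell e hy))
  have hμfin : (μHE[d - 1] : Measure (Space d)) (cell e) ≠ ∞ := by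
    refine ((hμ e hc hne (Metric.diam (cell e)) fun x hx y hy =>
      dist_le_diam_cell (subset_cell e hx) (subset_cell e hy)).trans_lt ENNReal.ofReal_lt_top).ne
  have hpt : ∀ x ∈ cell e, (jumpResidual P M k w e x - jumpResidual P M k w' e x) ^ 2
      ≤ ∑ T ∈ F, 2 * (d * (d * B)) ^ 2 * C * I T / Metric.diam (cell T) ^ d := by
    intro x hx
    have h1 : jumpResidual P M k w e x - jumpResidual P M k w' e x
        = ∑ T ∈ F, -⟪conormal (a T) (elementPoly M k (w - w') T) x, outwardNormal T e⟫_ℝ := by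
      rw [jumpResidual_eq ha hw hx, jumpResidual_eq ha hw' hx, ← Finset.sum_sub_distrib]
      refine Finset.sum_congr rfl fun T hT => ?_
      rw [elementPoly_sub P.polygonal hw hw' (hFm T hT).1,
        conormal_sub elementPoly_mem elementPoly_mem, inner_sub_left]
      ring
    rw [h1]
    refine sq_sum_le_card_mul_sum_sq.trans ?_
    have hcard : ((F.card : ℕ) : ℝ) ≤ 2 := by
      exact_mod_cast Mesh.card_elements_of_side_le hc
    rw [Finset.mul_sum]
    refine Finset.sum_le_sum fun T hT => ?_
    have hTm := (hFm T hT).1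
    have hxT : x ∈ cell T := cell_mono (hFm T hT).2 hx
    obtain ⟨f1, -⟩ := hinv M hM hd T hTm _
      (elementPoly_mem (M := M) (k := k) (w := w - w') (T := T)) x hxT
    have hpos : 0 < Metric.diam (cell T) ^ d := pow_pos (Mesh.diam_cell_pos hd hTm) d
    have h2 : |⟪conormal (a T) (elementPoly M k (w - w') T) x, outwardNormal T e⟫_ℝ|
        ≤ d * (d * B) * ‖gradient (elementPoly M k (w - w') T) x‖ := by
      refine (abs_real_inner_le_norm _ _).trans ?_
      refine le_trans (mul_le_of_le_one_right (norm_nonneg _) (norm_outwardNormal_le T e)) ?_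
      exact norm_conormal_le hTm (ha T hTm) hxT
    have h3 : (-⟪conormal (a T) (elementPoly M k (w - w') T) x, outwardNormal T e⟫_ℝ) ^ 2
        ≤ (d * (d * B)) ^ 2 * ‖gradient (elementPoly M k (w - w') T) x‖ ^ 2 := by
      rw [neg_sq, ← sq_abs, ← mul_pow]
      exact pow_le_pow_left₀ (abs_nonneg _) h2 2
    rw [le_div_iff₀ hpos]
    calc (F.card : ℝ) * (-⟪conormal (a T) (elementPoly M k (w - w') T) x, outwardNormal T e⟫_ℝ) ^ 2
          * Metric.diam (cell T) ^ d
        ≤ 2 * ((d * (d * B)) ^ 2 * ‖gradient (elementPoly M k (w - w') T) x‖ ^ 2)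
          * Metric.diam (cell T) ^ d := by gcongr
      _ = 2 * (d * (d * B)) ^ 2 * (Metric.diam (cell T) ^ d
          * ‖gradient (elementPoly M k (w - w') T) x‖ ^ 2) := by ring
      _ ≤ 2 * (d * (d * B)) ^ 2 * (C * I T) := by gcongr
      _ = _ := by ring
  have hint := setIntegral_le_mul_measure hμfin (fun x _ => sq_nonneg _) hpt
  have hs0 := Mesh.sideSize_nonneg M e
  calc _ ≤ sideSize M e * ((∑ T ∈ F, 2 * (d * (d * B)) ^ 2 * C * I T / Metric.diam (cell T) ^ d)
          * ((μHE[d - 1] : Measure (Space d)) (cell e)).toReal) :=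
        mul_le_mul_of_nonneg_left hint hs0
    _ = ∑ T ∈ F, 2 * (d * (d * B)) ^ 2 * C * I T / Metric.diam (cell T) ^ d
          * (sideSize M e * ((μHE[d - 1] : Measure (Space d)) (cell e)).toReal) := by
        rw [← Finset.sum_mul]
        ring
    _ ≤ ∑ T ∈ F, (2 * (d * (d * B)) ^ 2 * C * Cμ + 1) * I T := by
        refine Finset.sum_le_sum fun T hT => ?_
        have hTm := (hFm T hT).1
        have hpos := Mesh.diam_cell_pos hd hTm
        have hm : ((μHE[d - 1] : Measure (Space d)) (cell e)).toReal
            ≤ Cμ * Metric.diam (cell T) ^ (d - 1) :=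
          ENNReal.toReal_le_of_le_ofReal (by positivity) (hside T hT)
        have hsm : sideSize M e * ((μHE[d - 1] : Measure (Space d)) (cell e)).toReal
            ≤ Cμ * Metric.diam (cell T) ^ d := by
          calc _ ≤ Metric.diam (cell T) * (Cμ * Metric.diam (cell T) ^ (d - 1)) :=
                mul_le_mul (Mesh.sideSize_le hTm (hFm T hT).2) hm ENNReal.toReal_nonneg hpos.le
            _ = Cμ * (Metric.diam (cell T) ^ (d - 1) * Metric.diam (cell T)) := by ring
            _ = _ := by rw [pow_sub_one_mul (by omega)]
        have hIT := hI0 T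
        calc _ ≤ 2 * (d * (d * B)) ^ 2 * C * I T / Metric.diam (cell T) ^ d
              * (Cμ * Metric.diam (cell T) ^ d) := by gcongr
          _ = 2 * (d * (d * B)) ^ 2 * C * Cμ * I T := by field_simp
          _ ≤ _ := by nlinarith
    _ = _ := by rw [Finset.mul_sum]

end Shape

/-! ### Lipschitz dependence of the estimator on its arguments -/

variable {k : ℕ}

section Local

variable {P : ModelProblem d} {M : Mesh P.Ω} {w w' : L2 P.Ω} {T : Finset (Space d)}
  {q : ℕ} {m : Fin q → ℕ} {lam lam' : (i : Fin q) → Fin (m i) → ℝ}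
  {u u' : (i : Fin q) → Fin (m i) → L2 P.Ω}

theorem localIndicatorSq_nonneg (M : Mesh P.Ω) (k : ℕ) (lam : (i : Fin q) → Fin (m i) → ℝ)
    (u : (i : Fin q) → Fin (m i) → L2 P.Ω) (w : L2 P.Ω) (T : Finset (Space d)) :
    0 ≤ localIndicatorSq P M k lam u w T := by
  rw [localIndicatorSq]
  refine add_nonneg (mul_nonneg (sq_nonneg _) (integral_nonneg fun x => sq_nonneg _))
    (Finset.sum_nonneg fun e _ => mul_nonneg (Mesh.sideSize_nonneg M e)
      (integral_nonneg fun x => sq_nonneg _))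

theorem measure_side_ne_top {e : Finset (Space d)} (he : e ∈ M.sides) :
    (μHE[d - 1] : Measure (Space d)) (cell e) ≠ ∞ := by
  obtain ⟨C, -, hC⟩ := exists_measure_side_le d
  obtain ⟨hc, hne⟩ := Mesh.mem_sides he
  refine ((hC e hc hne (Metric.diam (cell e)) fun x hx y hy =>
    dist_le_diam_cell (subset_cell e hx) (subset_cell e hy)).trans_lt ENNReal.ofReal_lt_top).ne

open Classical in
/-- The indicator on an element is a norm of the pair of residuals, so the indicators of two
functions differ by at most this norm of the differences of their residuals. -/
theorem sq_sqrt_localIndicatorSq_sub_le {B : ℝ}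
    {a : Finset (Space d) → Fin d → Fin d → Space d → ℝ}
    (ha : ∀ T ∈ M.elements, IsLocalCoeff P T B (a T)) (hw : w ∈ feSpace M k)
    (hw' : w' ∈ feSpace M k) (hT : T ∈ M.elements) :
    (√(localIndicatorSq P M k lam u w T) - √(localIndicatorSq P M k lam' u' w' T)) ^ 2
      ≤ Metric.diam (cell T) ^ 2 * (∫ x in cell T,
          (elementResidual P M k lam u w x - elementResidual P M k lam' u' w' x) ^ 2)
        + ∑ e ∈ M.sides.filter (fun e => e ⊆ T), sideSize M e *
          ∫ x in cell e, (jumpResidual P M k w e x - jumpResidual P M k w' e x) ^ 2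
            ∂(μHE[d - 1]) := by
  have hpos : ∀ (e : Finset (Space d)) (w : L2 P.Ω), 0 ≤ sideSize M e *
      ∫ x in cell e, jumpResidual P M k w e x ^ 2 ∂(μHE[d - 1]) := fun e w =>
    mul_nonneg (Mesh.sideSize_nonneg M e) (integral_nonneg fun x => sq_nonneg _)
  rw [localIndicatorSq, localIndicatorSq]
  refine sq_sqrt_sub_sqrt_add_le (mul_nonneg (sq_nonneg _) (integral_nonneg fun x => sq_nonneg _))
    (Finset.sum_nonneg fun e _ => hpos e w)
    (mul_nonneg (sq_nonneg _) (integral_nonneg fun x => sq_nonneg _))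
    (Finset.sum_nonneg fun e _ => hpos e w') ?_ ?_
  · exact sq_sqrt_sub_sqrt_integral_le (memLp_elementResidual hw hT (ha T hT) lam u)
      (memLp_elementResidual hw' hT (ha T hT) lam' u') (sq_nonneg _)
  · refine sq_sqrt_sub_sqrt_sum_le _ (fun e => hpos e w) (fun e => hpos e w') fun e he => ?_
    have hes := (Finset.mem_filter.1 he).1
    exact sq_sqrt_sub_sqrt_integral_le
      (memLp_of_continuousOn_isCompact (isCompact_cell e) (measure_side_ne_top hes)
        (continuousOn_jumpResidual ha hw e) 2)
      (memLp_of_continuousOn_isCompact (isCompact_cell e) (measure_side_ne_top hes)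
        (continuousOn_jumpResidual ha hw' e) 2) (Mesh.sideSize_nonneg M e)

theorem elementResidual_sub_ae_eq {B : ℝ} {a : Fin d → Fin d → Space d → ℝ}
    (ha : IsLocalCoeff P T B a) (hw : w ∈ feSpace M k) (hw' : w' ∈ feSpace M k)
    (hT : T ∈ M.elements) :
    (fun x => elementResidual P M k lam u w x - elementResidual P M k lam' u' w' x)
      =ᵐ[volume.restrict (interior (cell T))] fun x =>
        (weightedSum P lam u w - weightedSum P lam' u' w' : L2 P.Ω) x
          + divConormal a (elementPoly M k (w - w') T) x
          - P.c x * elementPoly M k (w - w') T x := by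
  filter_upwards [elementResidual_ae_eq hw hT ha lam u, elementResidual_ae_eq hw' hT ha lam' u',
    ae_restrict_of_ae_restrict_of_subset (Mesh.interior_cell_subset P.polygonal hT)
      (Lp.coeFn_sub (weightedSum P lam u w) (weightedSum P lam' u' w'))] with x h1 h2 h3
  rw [h1, h2, h3, elementPoly_sub P.polygonal hw hw' hT,
    divConormal_sub elementPoly_mem elementPoly_mem, Pi.sub_apply, Pi.sub_apply]
  ring

/-- The difference of the element residuals has three parts, since the divergence and the lower
order term are linear in the finite element function. -/
theorem integral_elementResidual_sub_sq_le {B c₀ : ℝ} {a : Fin d → Fin d → Space d → ℝ}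
    (ha : IsLocalCoeff P T B a) (hw : w ∈ feSpace M k) (hw' : w' ∈ feSpace M k)
    (hT : T ∈ M.elements) (hc : ∀ᵐ x ∂(volume.restrict P.Ω), |P.c x| ≤ c₀) :
    ∫ x in cell T, (elementResidual P M k lam u w x - elementResidual P M k lam' u' w' x) ^ 2
      ≤ 3 * ((∫ x in cell T,
              ‖(weightedSum P lam u w - weightedSum P lam' u' w' : L2 P.Ω) x‖ ^ 2)
          + (∫ x in cell T, divConormal a (elementPoly M k (w - w') T) x ^ 2)
          + c₀ ^ 2 * ∫ x in cell T, elementPoly M k (w - w') T x ^ 2) := by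
  set F : L2 P.Ω := weightedSum P lam u w - weightedSum P lam' u' w' with hF
  set p := elementPoly M k (w - w') T with hp
  have hpm : p ∈ polySpace d k := elementPoly_mem
  have hsub := Mesh.interior_cell_subset P.polygonal hT
  have i1 : Integrable (fun x => ‖F x‖ ^ 2) (volume.restrict (interior (cell T))) :=
    (integrable_norm_sq F).mono_measure (Measure.restrict_mono hsub le_rfl)
  have i2 : Integrable (fun x => divConormal a p x ^ 2) (volume.restrict (interior (cell T))) := by
    rw [← restrict_cell]
    exact (memLp_divConormal hT ha hpm).integrable_sq
  have i3 : Integrable (fun x => p x ^ 2) (volume.restrict (interior (cell T))) := by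
    rw [← restrict_cell]
    exact ((continuous_of_mem_polySpace hpm).pow 2).continuousOn.integrableOn_compact
      (isCompact_cell T)
  have i4 : Integrable (fun x => (elementResidual P M k lam u w x
      - elementResidual P M k lam' u' w' x) ^ 2) (volume.restrict (interior (cell T))) := by
    rw [← restrict_cell]
    exact ((memLp_elementResidual hw hT ha lam u).sub
      (memLp_elementResidual hw' hT ha lam' u')).integrable_sq
  have i5 : Integrable (fun x => ‖F x‖ ^ 2 + divConormal a p x ^ 2)
      (volume.restrict (interior (cell T))) := i1.add i2
  rw [restrict_cell, ← integral_const_mul (c₀ ^ 2), ← integral_add i1 i2,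
    ← integral_add i5 (i3.const_mul _), ← integral_const_mul]
  refine integral_mono_ae i4 ((i5.add (i3.const_mul _)).const_mul 3) ?_
  filter_upwards [elementResidual_sub_ae_eq (lam := lam) (lam' := lam') (u := u) (u' := u') ha hw
    hw' hT, ae_restrict_of_ae_restrict_of_subset hsub hc] with x h1 h2
  have h3 : (P.c x * p x) ^ 2 ≤ c₀ ^ 2 * p x ^ 2 := by
    rw [mul_pow, ← sq_abs (P.c x)]
    have := abs_nonneg (P.c x)
    gcongr
  rw [h1, Real.norm_eq_abs, sq_abs]
  nlinarith [sq_nonneg (F x - divConormal a p x), sq_nonneg (F x + P.c x * p x),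
    sq_nonneg (divConormal a p x + P.c x * p x)]

end Local

/-- Every side belongs to at most two elements, and an element with `d + 1` vertices has at most
`2 ^ (d + 1)` sides. -/
theorem sum_sides_le {Ω : Set (Space d)} (M : Mesh Ω) {I : Finset (Space d) → ℝ}
    (hI : ∀ T, 0 ≤ I T) [DecidableRel fun e T : Finset (Space d) => e ⊆ T] :
    ∑ T ∈ M.elements, ∑ e ∈ M.sides.filter (fun e => e ⊆ T),
      ∑ T' ∈ M.elements.filter (fun T' => e ⊆ T'), I T'
      ≤ 2 * 2 ^ (d + 1) * ∑ T ∈ M.elements, I T := by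
  classical
  have h1 : ∑ T ∈ M.elements, ∑ e ∈ M.sides.filter (fun e => e ⊆ T),
        ∑ T' ∈ M.elements.filter (fun T' => e ⊆ T'), I T'
      = ∑ e ∈ M.sides, ((M.elements.filter fun T => e ⊆ T).card : ℝ) *
        ∑ T' ∈ M.elements.filter (fun T' => e ⊆ T'), I T' := by
    simp only [Finset.sum_filter]
    rw [Finset.sum_comm]
    refine Finset.sum_congr rfl fun e _ => ?_
    rw [← Finset.sum_filter, Finset.sum_const, nsmul_eq_mul]
  have h2 : ∑ e ∈ M.sides, ∑ T' ∈ M.elements.filter (fun T' => e ⊆ T'), I T'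
      = ∑ T' ∈ M.elements, ((M.sides.filter fun e => e ⊆ T').card : ℝ) * I T' := by
    simp only [Finset.sum_filter]
    rw [Finset.sum_comm]
    refine Finset.sum_congr rfl fun e _ => ?_
    rw [← Finset.sum_filter, Finset.sum_const, nsmul_eq_mul]
  rw [h1]
  calc _ ≤ ∑ e ∈ M.sides, 2 * ∑ T' ∈ M.elements.filter (fun T' => e ⊆ T'), I T' := by
        refine Finset.sum_le_sum fun e he => mul_le_mul_of_nonneg_right ?_
          (Finset.sum_nonneg fun T _ => hI T)
        have := Mesh.card_elements_of_side_le (M := M) (Mesh.mem_sides he).1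
        have h3 : (M.elements.filter fun T => e ⊆ T).card ≤ 2 := by convert this
        exact_mod_cast h3
    _ = 2 * ∑ T' ∈ M.elements, ((M.sides.filter fun e => e ⊆ T').card : ℝ) * I T' := by
        rw [← Finset.mul_sum, h2]
    _ ≤ 2 * ∑ T' ∈ M.elements, 2 ^ (d + 1) * I T' := by
        gcongr with T hT
        · exact hI T
        · have h3 : (M.sides.filter fun e => e ⊆ T).card ≤ 2 ^ (d + 1) := by
            rw [← (M.mem_elements.1 hT).2, ← Finset.card_powerset]
            exact Finset.card_le_card fun e he =>
              Finset.mem_powerset.2 (Finset.mem_filter.1 he).2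
          exact_mod_cast h3
    _ = _ := by rw [← Finset.mul_sum, mul_assoc]

/-- The contributions of all elements to the difference of two estimators, for a single pair of
finite element functions. -/
theorem exists_sum_residual_le (hd : 1 ≤ d) (P : ModelProblem d) (k : ℕ) (γ : ℝ) :
    ∃ C : ℝ, 0 < C ∧ ∀ M : Mesh P.Ω, M.ShapeRegular γ → Resolves M → M.size ≤ 1 →
      ∀ {q : ℕ} {m : Fin q → ℕ} (lam lam' : (i : Fin q) → Fin (m i) → ℝ)
        (u u' : (i : Fin q) → Fin (m i) → L2 P.Ω), ∀ w ∈ Vh M k, ∀ w' ∈ Vh M k,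
      ∑ T ∈ M.elements, (√(localIndicatorSq P M k lam u w T)
          - √(localIndicatorSq P M k lam' u' w' T)) ^ 2
        ≤ C * (‖weightedSum P lam u w - weightedSum P lam' u' w'‖ ^ 2 + ‖w - w'‖ ^ 2
          + ‖weakGradient (w - w')‖ ^ 2) := by
  classical
  obtain ⟨B, hB, hcoeff⟩ := exists_isLocalCoeff P
  obtain ⟨C₁, hC₁, h₁⟩ := exists_divConormal_le hd k γ B
  obtain ⟨C₂, hC₂, h₂⟩ := exists_jump_le hd k γ B
  obtain ⟨c₀, hc₀⟩ : ∃ c : ℝ, ∀ᵐ x ∂(volume.restrict P.Ω), |P.c x| ≤ c := by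
    refine ⟨(eLpNorm P.c ⊤ (volume.restrict P.Ω)).toReal, ?_⟩
    filter_upwards [ae_le_eLpNormEssSup (f := P.c) (μ := volume.restrict P.Ω)] with x hx
    rw [← Real.norm_eq_abs, ← toReal_enorm]
    refine ENNReal.toReal_mono P.c_bounded.eLpNorm_ne_top ?_
    rwa [eLpNorm_exponent_top]
  refine ⟨3 + 3 * c₀ ^ 2 + 3 * C₁ + C₂ * (2 * 2 ^ (d + 1)), by positivity,
    fun M hM hR hsize q m lam lam' u u' w hw w' hw' => ?_⟩
  have hex : ∀ T, ∃ a, T ∈ M.elements → IsLocalCoeff P T B a := fun T => by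
    by_cases hT : T ∈ M.elements
    · obtain ⟨a, ha⟩ := hcoeff T (hR T hT)
      exact ⟨a, fun _ => ha⟩
    · exact ⟨0, fun h => absurd h hT⟩
  choose a ha using hex
  set F : L2 P.Ω := weightedSum P lam u w - weightedSum P lam' u' w' with hF
  have he : w - w' ∈ Vh M k := Submodule.sub_mem _ hw hw'
  have hgrad := sum_integral_gradient_sq_le P.polygonal he
  have hL2 := sum_integral_sq_le P.polygonal he.1
  have hF2 : ∑ T ∈ M.elements, ∫ x in cell T, ‖F x‖ ^ 2 ≤ ‖F‖ ^ 2 := by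
    rw [norm_sq_eq_integral]
    exact Mesh.sum_setIntegral_cell_le P.polygonal (fun x => sq_nonneg _) (integrable_norm_sq F)
  set I : Finset (Space d) → ℝ := fun T =>
    ∫ x in cell T, ‖gradient (elementPoly M k (w - w') T) x‖ ^ 2 with hI
  have hI0 : ∀ T, 0 ≤ I T := fun T => integral_nonneg fun x => sq_nonneg _
  have hloc : ∀ T ∈ M.elements, (√(localIndicatorSq P M k lam u w T)
      - √(localIndicatorSq P M k lam' u' w' T)) ^ 2
      ≤ (3 * (∫ x in cell T, ‖F x‖ ^ 2) + 3 * C₁ * I T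
          + 3 * c₀ ^ 2 * ∫ x in cell T, elementPoly M k (w - w') T x ^ 2)
        + C₂ * ∑ e ∈ M.sides.filter (fun e => e ⊆ T),
          ∑ T' ∈ M.elements.filter (fun T' => e ⊆ T'), I T' := by
    intro T hT
    have hdiam : Metric.diam (cell T) ≤ 1 := (Mesh.diam_cell_le_size hT).trans hsize
    have h0 := diam_cell_nonneg T
    refine (sq_sqrt_localIndicatorSq_sub_le ha hw.1 hw'.1 hT).trans (add_le_add ?_ ?_)
    · have g1 := integral_elementResidual_sub_sq_le (lam := lam) (lam' := lam') (u := u) (u' := u')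
        (ha T hT) hw.1 hw'.1 hT hc₀
      have g2 := h₁ P M hM T hT hdiam (a T) (ha T hT) _
        (elementPoly_mem (M := M) (k := k) (w := w - w') (T := T))
      have g3 : Metric.diam (cell T) ^ 2 ≤ 1 := pow_le_one₀ h0 hdiam
      have g4 : 0 ≤ ∫ x in cell T, ‖F x‖ ^ 2 := integral_nonneg fun x => sq_nonneg _
      have g5 : 0 ≤ c₀ ^ 2 * ∫ x in cell T, elementPoly M k (w - w') T x ^ 2 :=
        mul_nonneg (sq_nonneg _) (integral_nonneg fun x => sq_nonneg _)
      have g6 := mul_le_mul_of_nonneg_left g1 (sq_nonneg (Metric.diam (cell T)))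
      nlinarith
    · rw [Finset.mul_sum]
      exact Finset.sum_le_sum fun e he' =>
        h₂ P M hM a ha w hw.1 w' hw'.1 e (Finset.mem_filter.1 he').1
  refine (Finset.sum_le_sum hloc).trans ?_
  have hs := sum_sides_le M hI0
  simp only [Finset.sum_add_distrib, ← Finset.mul_sum] at hs ⊢
  have hsum : ∑ T ∈ M.elements, I T ≤ ‖weakGradient (w - w')‖ ^ 2 := hgrad
  have k1 := mul_le_mul_of_nonneg_left hs hC₂.le
  have k2 : C₂ * (2 * 2 ^ (d + 1)) * ∑ T ∈ M.elements, I T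
      ≤ C₂ * (2 * 2 ^ (d + 1)) * ‖weakGradient (w - w')‖ ^ 2 :=
    mul_le_mul_of_nonneg_left hsum (by positivity)
  have k3 : 3 * C₁ * ∑ T ∈ M.elements, I T ≤ 3 * C₁ * ‖weakGradient (w - w')‖ ^ 2 :=
    mul_le_mul_of_nonneg_left hsum (by positivity)
  have k4 := mul_le_mul_of_nonneg_left hL2 (by positivity : 0 ≤ 3 * c₀ ^ 2)
  set G := ‖weakGradient (w - w')‖ ^ 2 with hG
  set E := ‖w - w'‖ ^ 2 with hE
  set Φ := ‖F‖ ^ 2 with hΦ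
  set S : ℝ := C₂ * (2 * 2 ^ (d + 1)) with hS
  have n1 : 0 ≤ G := sq_nonneg _
  have n2 : 0 ≤ E := sq_nonneg _
  have n3 : 0 ≤ Φ := sq_nonneg _
  have n4 : 0 ≤ S := by positivity
  have n5 : 0 ≤ c₀ ^ 2 := sq_nonneg _
  have e1 : (3 + 3 * c₀ ^ 2 + 3 * C₁ + S) * (Φ + E + G) = 3 * Φ + (3 * c₀ ^ 2 * E)
      + (3 * C₁ * G + S * G) + ((3 * c₀ ^ 2 + 3 * C₁ + S) * Φ + (3 + 3 * C₁ + S) * E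
      + (3 + 3 * c₀ ^ 2) * G) := by ring
  have e2 : 0 ≤ (3 * c₀ ^ 2 + 3 * C₁ + S) * Φ + (3 + 3 * C₁ + S) * E
      + (3 + 3 * c₀ ^ 2) * G := by positivity
  linarith

/-- The estimator depends on the eigenpairs and on the finite element functions in a Lipschitz
continuous way. -/
theorem exists_estimator_sub_le (hd : 1 ≤ d) (P : ModelProblem d) (k : ℕ) (γ : ℝ) :
    ∃ C : ℝ, 0 < C ∧ ∀ M : Mesh P.Ω, M.ShapeRegular γ → Resolves M → M.size ≤ 1 →
      ∀ {q : ℕ} {m : Fin q → ℕ} (lam lam' : (i : Fin q) → Fin (m i) → ℝ)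
        (u u' W W' : (i : Fin q) → Fin (m i) → L2 P.Ω), (∀ i j, W i j ∈ Vh M k) →
        (∀ i j, W' i j ∈ Vh M k) →
      |estimator P M k lam u W - estimator P M k lam' u' W'| ^ 2
        ≤ C * ∑ i, ∑ j, (‖weightedSum P lam u (W i j) - weightedSum P lam' u' (W' i j)‖ ^ 2
          + ‖W i j - W' i j‖ ^ 2 + ‖weakGradient (W i j - W' i j)‖ ^ 2) := by
  obtain ⟨C, hC, h⟩ := exists_sum_residual_le hd P k γ
  refine ⟨C, hC, fun M hM hR hs q m lam lam' u u' W W' hW hW' => ?_⟩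
  have hnn := fun (lam : (i : Fin q) → Fin (m i) → ℝ) (u W : (i : Fin q) → Fin (m i) → L2 P.Ω)
    i j T => localIndicatorSq_nonneg M k lam u (W i j) T
  rw [sq_abs, estimator, estimator]
  refine (sq_sqrt_sub_sqrt_sum_le M.elements
    (R := fun T => ∑ i, ∑ j, (√(localIndicatorSq P M k lam u (W i j) T)
      - √(localIndicatorSq P M k lam' u' (W' i j) T)) ^ 2)
    (fun T => Finset.sum_nonneg fun i _ => Finset.sum_nonneg fun j _ => hnn lam u W i j T)
    (fun T => Finset.sum_nonneg fun i _ => Finset.sum_nonneg fun j _ => hnn lam' u' W' i j T)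
    fun T _ => ?_).trans ?_
  · refine sq_sqrt_sub_sqrt_sum_le _
      (fun i => Finset.sum_nonneg fun j _ => hnn lam u W i j T)
      (fun i => Finset.sum_nonneg fun j _ => hnn lam' u' W' i j T) fun i _ => ?_
    exact sq_sqrt_sub_sqrt_sum_le _ (fun j => hnn lam u W i j T) (fun j => hnn lam' u' W' i j T)
      fun j _ => le_rfl
  · rw [Finset.sum_comm, Finset.mul_sum]
    refine Finset.sum_le_sum fun i _ => ?_
    rw [Finset.sum_comm, Finset.mul_sum]
    exact Finset.sum_le_sum fun j _ => h M hM hR hs lam lam' u u' _ (hW i j) _ (hW' i j)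

/-! ### Piecewise affine functions belong to the Sobolev space -/

/-- On a line the function is piecewise affine with slopes bounded by `L`, and it is continuous. -/
theorem lipschitzWith_of_piecewise_affine {ι : Type*} [Finite ι] {v : Space d → ℝ}
    {S : ι → Set (Space d)} {ℓ : ι → Space d →ᵃ[ℝ] ℝ} {L : NNReal} (hS : ∀ i, IsClosed (S i))
    (hcover : ⋃ i, S i = univ) (hv : ∀ i, EqOn v (ℓ i) (S i))
    (hL : ∀ i z, |(ℓ i).linear z| ≤ L * ‖z‖) : LipschitzWith L v := by
  have hvc : Continuous v := (locallyFinite_of_finite S).continuous hcover hS fun i =>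
    ((ℓ i).continuous_of_finiteDimensional.continuousOn).congr (hv i)
  have key : ∀ x y, v y ≤ v x + L * ‖y - x‖ := by
    intro x y
    set p : ℝ → Space d := fun t => x + t • (y - x) with hp
    have hpc : Continuous p := by fun_prop
    have h := image_le_of_liminf_slope_right_le_deriv_boundary (f := fun t => v (p t)) (a := 0)
      (b := 1) (B := fun t => v x + L * ‖y - x‖ * t) (B' := fun _ => L * ‖y - x‖)
      (hvc.comp hpc).continuousOn (by simp [hp]) (by fun_prop)
      (fun t _ => by
        simpa using (((hasDerivAt_id t).const_mul (L * ‖y - x‖ : ℝ)).const_add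
          (v x)).hasDerivWithinAt)
      (fun t _ r hr => by
        -- infinitely many points to the right of `t` lie in one of the finitely many sets
        obtain ⟨i, hi⟩ : ∃ i, ∃ᶠ z in 𝓝[>] t, p z ∈ S i := by
          by_contra! hcon
          have h0 : ∀ᶠ z in 𝓝[>] t, ∀ i, p z ∉ S i :=
            Filter.eventually_all.2 hcon
          obtain ⟨z, hz⟩ := h0.exists
          have : p z ∈ ⋃ i, S i := hcover ▸ mem_univ _
          obtain ⟨i, hi⟩ := mem_iUnion.1 this
          exact hz i hi
        have ht : p t ∈ S i :=
          (hS i).mem_of_frequently_of_tendsto hi (hpc.continuousAt.mono_left nhdsWithin_le_nhds)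
        refine (hi.and_eventually self_mem_nhdsWithin).mono ?_
        rintro z ⟨hz, htz : t < z⟩
        have hd : p z - p t = (z - t) • (y - x) := by simp only [hp]; module
        have e : v (p z) - v (p t) = (z - t) * (ℓ i).linear (y - x) := by
          rw [hv i hz, hv i ht, ← smul_eq_mul, ← map_smul, ← hd, ← vsub_eq_sub, ← vsub_eq_sub,
            AffineMap.linearMap_vsub]
        rw [slope_def_field, e, mul_div_cancel_left₀ _ (sub_pos.2 htz).ne']
        exact ((le_abs_self _).trans (hL i _)).trans_lt hr)
    have := h (right_mem_Icc.2 zero_le_one)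
    simpa [hp] using this
  refine LipschitzWith.of_dist_le_mul fun x y => ?_
  rw [Real.dist_eq, abs_le, dist_eq_norm]
  have h1 := key x y
  have h2 := key y x
  rw [norm_sub_rev] at h1
  constructor <;> linarith

open scoped Convolution

/-- The mollification of a function by a normalized bump function. -/
def mollify (φ : ContDiffBump (0 : Space d)) (v : Space d → ℝ) : Space d → ℝ :=
  φ.normed volume ⋆[ContinuousLinearMap.lsmul ℝ ℝ, volume] v

theorem mollify_apply (φ : ContDiffBump (0 : Space d)) (v : Space d → ℝ) (x : Space d) :
    mollify φ v x = ∫ t, φ.normed volume t * v (x - t) := rfl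

theorem integrable_normed_mul (φ : ContDiffBump (0 : Space d)) {v : Space d → ℝ}
    (hv : Continuous v) (x : Space d) : Integrable fun t => φ.normed volume t * v (x - t) :=
  (φ.continuous_normed.mul (hv.comp (by fun_prop))).integrable_of_hasCompactSupport
    φ.hasCompactSupport_normed.mul_right

/-- The kernel of the mollification is a probability density supported in a small ball, so a bound
for the shifted functions which is uniform over this ball carries over to the mollifications. With
`w = v` this gives the Lipschitz estimate and, for `e = 0`, the gradient at points near which `v` is
affine; with `w = 0` and `c = v x` it gives the rate of convergence. -/
theorem abs_mollify_sub_le (φ : ContDiffBump (0 : Space d)) {v w : Space d → ℝ}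
    (hv : Continuous v) (hw : Continuous w) {x x' : Space d} {c e : ℝ}
    (h : ∀ t, ‖t‖ < φ.rOut → |v (x' - t) - w (x - t) - c| ≤ e) :
    |mollify φ v x' - mollify φ w x - c| ≤ e := by
  have hi : Integrable fun t => φ.normed volume t * v (x' - t) - φ.normed volume t * w (x - t) :=
    (integrable_normed_mul φ hv x').sub (integrable_normed_mul φ hw x)
  have hc := (φ.integrable_normed (μ := volume)).mul_const c
  have e1 : mollify φ v x' - mollify φ w x - c
      = ∫ t, φ.normed volume t * (v (x' - t) - w (x - t) - c) := by
    rw [mollify_apply, mollify_apply, ← integral_sub (integrable_normed_mul φ hv x')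
      (integrable_normed_mul φ hw x)]
    conv_lhs => rw [← one_mul c, ← φ.integral_normed (μ := volume), ← integral_mul_const]
    rw [← integral_sub hi hc]
    refine integral_congr_ae (Filter.Eventually.of_forall fun t => ?_)
    change φ.normed volume t * v (x' - t) - φ.normed volume t * w (x - t)
      - φ.normed volume t * c = _
    ring
  rw [e1]
  have h2 : e = ∫ t, φ.normed volume t * e := by
    rw [integral_mul_const, φ.integral_normed, one_mul]
  rw [h2]
  refine (norm_integral_le_integral_norm _).trans (integral_mono_of_nonneg
    (Filter.Eventually.of_forall fun t => norm_nonneg (φ.normed volume t * _))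
    ((φ.integrable_normed (μ := volume)).mul_const e) (Filter.Eventually.of_forall fun t => ?_))
  change ‖φ.normed volume t * (v (x' - t) - w (x - t) - c)‖ ≤ φ.normed volume t * e
  rw [norm_mul, Real.norm_of_nonneg (φ.nonneg_normed t)]
  by_cases ht : ‖t‖ < φ.rOut
  · exact mul_le_mul_of_nonneg_left (h t ht) (φ.nonneg_normed t)
  · have : φ.normed volume t = 0 := by
      have : t ∉ Function.support (φ.normed volume) := by
        rw [φ.support_normed_eq, mem_ball_zero_iff]; exact ht
      simpa using this
    simp [this]

theorem contDiff_mollify (φ : ContDiffBump (0 : Space d)) {v : Space d → ℝ}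
    (hv : Continuous v) : ContDiff ℝ (⊤ : ℕ∞) (mollify φ v) :=
  φ.hasCompactSupport_normed.contDiff_convolution_left _ φ.contDiff_normed hv.locallyIntegrable

theorem lipschitzWith_mollify (φ : ContDiffBump (0 : Space d)) {v : Space d → ℝ} {L : NNReal}
    (hv : LipschitzWith L v) : LipschitzWith L (mollify φ v) := by
  refine LipschitzWith.of_dist_le_mul fun x y => ?_
  rw [Real.dist_eq, ← sub_zero (mollify φ v x - mollify φ v y)]
  refine abs_mollify_sub_le φ hv.continuous hv.continuous fun t _ => ?_
  rw [sub_zero, ← Real.dist_eq]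
  refine (hv.dist_le_mul _ _).trans_eq ?_
  rw [dist_sub_right]

theorem abs_mollify_sub_self_le (φ : ContDiffBump (0 : Space d)) {v : Space d → ℝ} {L : NNReal}
    (hv : LipschitzWith L v) (x : Space d) : |mollify φ v x - v x| ≤ L * φ.rOut := by
  have h := abs_mollify_sub_le φ hv.continuous (continuous_const (y := (0 : ℝ))) (x' := x) (x := x)
    (c := v x) (e := L * φ.rOut) fun t ht => by
      rw [sub_zero, ← Real.dist_eq]
      refine (hv.dist_le_mul _ _).trans (mul_le_mul_of_nonneg_left ?_ L.2)
      simpa [dist_eq_norm] using ht.le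
  have h0 : mollify φ (fun _ => (0 : ℝ)) x = 0 := by simp [mollify_apply]
  rwa [h0, sub_zero] at h

theorem hasGradientAt_affine (c : ℝ) (ξ x : Space d) :
    HasGradientAt (fun y => c + ⟪ξ, y - x⟫_ℝ) ξ x := by
  rw [hasGradientAt_iff_hasFDerivAt]
  have h : (fun y : Space d => c + ⟪ξ, y - x⟫_ℝ) = fun y => (c - ⟪ξ, x⟫_ℝ) + innerSL ℝ ξ y := by
    funext y
    rw [inner_sub_right, innerSL_apply_apply]
    ring
  rw [h]
  refine ((innerSL ℝ ξ).hasFDerivAt.const_add _).congr_fderiv ?_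
  ext z
  simp

theorem gradient_mollify (φ : ContDiffBump (0 : Space d)) {v : Space d → ℝ} (hv : Continuous v)
    {x ξ : Space d} {δ : ℝ} (hδ : φ.rOut < δ)
    (h : ∀ y ∈ Metric.ball x δ, v y = v x + ⟪ξ, y - x⟫_ℝ) : gradient (mollify φ v) x = ξ := by
  have hev : ∀ᶠ y in 𝓝 x, mollify φ v y = mollify φ v x + ⟪ξ, y - x⟫_ℝ := by
    filter_upwards [Metric.ball_mem_nhds x (sub_pos.2 hδ)] with y hy
    have := abs_mollify_sub_le φ hv hv (x' := y) (x := x) (c := ⟪ξ, y - x⟫_ℝ) (e := 0)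
      fun t ht => by
        have h1 : y - t ∈ Metric.ball x δ := by
          rw [mem_ball_iff_norm] at hy ⊢
          have : ‖y - t - x‖ ≤ ‖y - x‖ + ‖t‖ := by
            rw [show y - t - x = (y - x) - t by abel]; exact norm_sub_le _ _
          linarith
        have h2 : x - t ∈ Metric.ball x δ := by
          rw [mem_ball_iff_norm, show x - t - x = -t by abel, norm_neg]
          linarith
        have e1 : ⟪ξ, y - t - x⟫_ℝ - ⟪ξ, x - t - x⟫_ℝ = ⟪ξ, y - x⟫_ℝ := by
          rw [← inner_sub_right]; congr 1; abel
        rw [h _ h1, h _ h2, ← e1]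
        ring_nf
        simp
    have := abs_nonpos_iff.1 this
    linarith
  exact ((hasGradientAt_affine _ ξ x).congr_of_eventuallyEq hev).gradient

theorem gradient_eq_of_eq_affine {v : Space d → ℝ} {x ξ : Space d} {δ : ℝ} (hδ : 0 < δ)
    (h : ∀ y ∈ Metric.ball x δ, v y = v x + ⟪ξ, y - x⟫_ℝ) : gradient v x = ξ := by
  exact ((hasGradientAt_affine _ ξ x).congr_of_eventuallyEq
    (Filter.eventually_of_mem (Metric.ball_mem_nhds x hδ) h)).gradient

/-- Dominated convergence in `L²`, on a set of finite measure. -/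
theorem tendsto_toLp_of_bounded {Ω : Set (Space d)} (hΩ : volume Ω ≠ ∞) {E : Type*}
    [NormedAddCommGroup E] [InnerProductSpace ℝ E] {f : ℕ → Space d → E} {g : Space d → E}
    (hf : ∀ n, MemLp (f n) 2 (volume.restrict Ω)) (hg : MemLp g 2 (volume.restrict Ω)) {C : ℝ}
    (hb : ∀ n, ∀ᵐ x ∂volume.restrict Ω, ‖f n x - g x‖ ≤ C)
    (hlim : ∀ᵐ x ∂volume.restrict Ω, Filter.Tendsto (fun n => f n x) Filter.atTop (𝓝 (g x))) :
    Filter.Tendsto (fun n => (hf n).toLp) Filter.atTop (𝓝 hg.toLp) := by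
  have : IsFiniteMeasure (volume.restrict Ω) := ⟨by simpa using hΩ.lt_top⟩
  rw [tendsto_iff_norm_sub_tendsto_zero]
  have key : Filter.Tendsto (fun n => ∫ x in Ω, ‖f n x - g x‖ ^ 2) Filter.atTop (𝓝 0) := by
    have := tendsto_integral_of_dominated_convergence (μ := volume.restrict Ω)
      (F := fun n x => ‖f n x - g x‖ ^ 2) (f := fun _ => (0 : ℝ)) (fun _ => C ^ 2)
      (fun n => (((hf n).1.sub hg.1).norm.pow 2)) (integrable_const _)
      (fun n => by
        filter_upwards [hb n] with x hx
        rw [Real.norm_of_nonneg (sq_nonneg _)]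
        exact pow_le_pow_left₀ (norm_nonneg _) hx 2)
      (by
        filter_upwards [hlim] with x hx
        have := ((hx.sub_const (g x)).norm.pow 2)
        simpa using this)
    simpa using this
  have e : ∀ n, ‖(hf n).toLp - hg.toLp‖ = √(∫ x in Ω, ‖f n x - g x‖ ^ 2) := by
    intro n
    rw [← MemLp.toLp_sub, Lp.norm_toLp, ((hf n).sub hg).eLpNorm_eq_integral_rpow_norm
      two_ne_zero ENNReal.ofNat_ne_top, ENNReal.toReal_ofReal (by positivity), Real.sqrt_eq_rpow]
    simp
  simp_rw [e]
  simpa [Function.comp_def] using (Real.continuous_sqrt.tendsto 0).comp key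

/-- A compactly supported Lipschitz function which is locally affine almost everywhere belongs to
`H₀¹(Ω)`: its mollifications converge to it, and so do their gradients, which are bounded by the
Lipschitz constant and eventually constant at each point near which the function is affine. -/
theorem toLp_mem_H10 {Ω : Set (Space d)} (hΩ : IsOpen Ω) (hvol : volume Ω ≠ ∞)
    {v : Space d → ℝ} {L : NNReal} (hL : LipschitzWith L v) (hc : HasCompactSupport v)
    (hs : tsupport v ⊆ Ω)
    (haff : ∀ᵐ x ∂volume.restrict Ω, ∃ δ > 0, ∃ ξ, ∀ y ∈ Metric.ball x δ,
      v y = v x + ⟪ξ, y - x⟫_ℝ) (hv : MemLp v 2 (volume.restrict Ω)) :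
    hv.toLp ∈ H10 Ω := by
  have : IsFiniteMeasure (volume.restrict Ω) := ⟨by simpa using hvol.lt_top⟩
  obtain ⟨ε, hε, hεΩ⟩ := hc.isCompact.exists_cthickening_subset_open hΩ hs
  have hgrad : ∀ {f : Space d → ℝ}, LipschitzWith L f → ∀ x, ‖gradient f x‖ ≤ L := by
    intro f hf x
    rw [gradient, LinearIsometryEquiv.norm_map]
    exact norm_fderiv_le_of_lipschitz ℝ hf
  have hgm : MemLp (gradient v) 2 (volume.restrict Ω) := by
    refine MemLp.of_bound (C := L) ?_ (Filter.Eventually.of_forall (hgrad hL))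
    exact (((InnerProductSpace.toDual ℝ (Space d)).symm.continuous.measurable.comp
      (measurable_fderiv ℝ v))).aestronglyMeasurable
  set φ : ℕ → ContDiffBump (0 : Space d) := fun n =>
    ⟨ε / (2 * (n + 1)), ε / (n + 1), by positivity, by gcongr; linarith⟩ with hφ
  have hout : ∀ n, (φ n).rOut = ε / (n + 1) := fun n => rfl
  have hlim0 : Filter.Tendsto (fun n => (φ n).rOut) Filter.atTop (𝓝 0) := by
    simp_rw [hout]
    exact tendsto_const_div_atTop_nhds_zero_nat ε |>.comp (Filter.tendsto_add_atTop_nat 1) |>.congr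
      fun n => by simp
  have hoε : ∀ n, (φ n).rOut ≤ ε := fun n => by
    rw [hout]; exact div_le_self hε.le (by linarith [n.cast_nonneg (α := ℝ)])
  have hzero : ∀ n x, x ∉ Metric.cthickening ε (tsupport v) → mollify (φ n) v x = 0 := by
    intro n x hx
    rw [mollify_apply]
    refine (integral_congr_ae (Filter.Eventually.of_forall fun t => ?_)).trans
      (integral_zero (Space d) ℝ)
    by_cases ht : t ∈ Function.support ((φ n).normed volume)
    · have hx' : x - t ∉ tsupport v := fun hmem => hx (by
        refine Metric.mem_cthickening_of_dist_le x (x - t) ε _ hmem ?_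
        rw [(φ n).support_normed_eq, mem_ball_zero_iff] at ht
        simpa [dist_eq_norm] using ht.le.trans (hoε n))
      change (φ n).normed volume t * v (x - t) = 0
      rw [image_eq_zero_of_notMem_tsupport hx', mul_zero]
    · change (φ n).normed volume t * v (x - t) = 0
      rw [Function.notMem_support.1 ht, zero_mul]
  have htest : ∀ n, IsTestFunction Ω (mollify (φ n) v) := fun n => by
    have hcs : tsupport (mollify (φ n) v) ⊆ Metric.cthickening ε (tsupport v) :=
      closure_minimal (fun x hx => by_contra fun hx' => hx (hzero n x hx'))
        Metric.isClosed_cthickening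
    exact ⟨contDiff_mollify _ hL.continuous,
      HasCompactSupport.of_support_subset_isCompact hc.isCompact.cthickening
        (subset_closure.trans hcs), hcs.trans hεΩ⟩
  have h1 := tendsto_toLp_of_bounded hvol (fun n => (htest n).memLp (volume.restrict Ω)) hv
    (C := L * ε) (fun n => Filter.Eventually.of_forall fun x =>
      (abs_mollify_sub_self_le (φ n) hL x).trans (mul_le_mul_of_nonneg_left (hoε n) L.2))
    (Filter.Eventually.of_forall fun x => by
      rw [tendsto_iff_norm_sub_tendsto_zero]
      refine squeeze_zero (fun n => norm_nonneg _)
        (fun n => abs_mollify_sub_self_le (φ n) hL x) ?_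
      simpa using hlim0.const_mul (L : ℝ))
  have h2 := tendsto_toLp_of_bounded hvol (fun n => (htest n).memLp_gradient (volume.restrict Ω))
    hgm (C := L + L) (fun n => Filter.Eventually.of_forall fun x =>
      (norm_sub_le _ _).trans (add_le_add (hgrad (lipschitzWith_mollify (φ n) hL) x) (hgrad hL x)))
    (by
      filter_upwards [haff] with x hx
      obtain ⟨δ, hδ, ξ, hξ⟩ := hx
      refine tendsto_const_nhds.congr' ?_
      filter_upwards [hlim0.eventually_lt_const hδ] with n hn
      rw [gradient_mollify (φ n) hL.continuous hn hξ, gradient_eq_of_eq_affine hδ hξ])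
  refine ⟨(hv.toLp, hgm.toLp), ?_, rfl⟩
  exact mem_closure_of_tendsto (h1.prodMk_nhds h2)
    (Filter.Eventually.of_forall fun n => (htest n).mem_testGraph)

/-! ### Approximation by finite element functions -/

theorem affine_mem_polySpace {k : ℕ} (hk : 1 ≤ k) (f : Space d →ᵃ[ℝ] ℝ) :
    (f : Space d → ℝ) ∈ polySpace d k := by
  refine mem_polySpace.2 ⟨∑ i, MvPolynomial.C (f.linear (EuclideanSpace.single i 1)) *
    MvPolynomial.X i + MvPolynomial.C (f 0), ?_, ?_⟩
  · refine (MvPolynomial.totalDegree_add _ _).trans (max_le ?_ (by simp))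
    refine MvPolynomial.totalDegree_finsetSum_le fun i _ => ?_
    refine (MvPolynomial.totalDegree_mul _ _).trans ?_
    simpa using hk
  · funext x
    have h : f x = f.linear x + f 0 := by simpa using f.map_vadd 0 x
    have hx : x = ∑ i, x i • EuclideanSpace.single i (1 : ℝ) := by
      ext j
      simp [Finset.sum_apply, Pi.single_apply]
    rw [h]
    conv_lhs => rw [hx]
    rw [map_sum]
    simp [mul_comm]

theorem abs_affineMap_le_of_mem_cell {f : Space d →ᵃ[ℝ] ℝ} {T : Finset (Space d)} {B : ℝ}
    (hf : ∀ y ∈ T, |f y| ≤ B) {x : Space d} (hx : x ∈ cell T) : |f x| ≤ B := by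
  obtain ⟨w, h0, hw, rfl⟩ := Finset.mem_convexHull'.1 hx
  rw [affineMap_sum_smul f T w _ hw]
  refine (Finset.abs_sum_le_sum_abs _ _).trans ?_
  calc ∑ y ∈ T, |w y * f y| ≤ ∑ y ∈ T, w y * B := Finset.sum_le_sum fun y hy => by
        rw [abs_mul, abs_of_nonneg (h0 y hy)]
        exact mul_le_mul_of_nonneg_left (hf y hy) (h0 y hy)
    _ = B := by rw [← Finset.sum_mul, hw, one_mul]

theorem gradient_eq_of_affineMap (f : Space d →ᵃ[ℝ] ℝ) (x z : Space d) :
    ⟪gradient f x, z⟫_ℝ = f.linear z := by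
  rw [inner_gradient_eq]
  have h : (f : Space d → ℝ) = fun y => LinearMap.toContinuousLinearMap f.linear y + f 0 := by
    funext y
    simpa using f.map_vadd 0 y
  rw [h, fderiv_add_const, ContinuousLinearMap.fderiv]
  rfl

namespace Mesh

variable {Ω : Set (Space d)} {M : Mesh Ω} {T T' : Finset (Space d)}

theorem exists_affine_interpolation (hT : T ∈ M.elements) (φ : Space d → ℝ) :
    ∃ ℓ : Space d →ᵃ[ℝ] ℝ, ∀ y ∈ T, ℓ y = φ y := by
  classical
  refine ⟨∑ y : T, φ y • (barycentricBasis hT).coord y, fun y hy => ?_⟩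
  have h : ∀ (s : Finset T) (x : Space d),
      (∑ y ∈ s, φ y • (barycentricBasis hT).coord y : Space d →ᵃ[ℝ] ℝ) x
        = ∑ y ∈ s, φ y * (barycentricBasis hT).coord y x := by
    intro s x
    induction s using Finset.induction_on with
    | empty => simp
    | insert a s ha ih => rw [Finset.sum_insert ha, Finset.sum_insert ha, ← ih]; simp
  rw [h, Finset.sum_eq_single (⟨y, hy⟩ : T)]
  · have := (barycentricBasis hT).coord_apply_eq (⟨y, hy⟩ : T)
    rw [barycentricBasis_apply] at this
    rw [this, mul_one]
  · intro z _ hz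
    have := (barycentricBasis hT).coord_apply_ne (i := z) (j := ⟨y, hy⟩) hz
    rw [barycentricBasis_apply] at this
    rw [this, mul_zero]
  · exact fun h => absurd (Finset.mem_univ _) h

/-- The piecewise affine interpolation of `φ` at the vertices of the mesh, extended by zero. -/
theorem exists_nodal_interpolant (M : Mesh Ω) (φ : Space d → ℝ) :
    ∃ (v : Space d → ℝ) (ℓ : M.elements → Space d →ᵃ[ℝ] ℝ),
      (∀ T : M.elements, ∀ y ∈ T.1, ℓ T y = φ y) ∧
      (∀ T : M.elements, ∀ x ∈ cell T.1, v x = ℓ T x) ∧ ∀ x ∉ closure Ω, v x = 0 := by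
  classical
  choose ℓ hℓ using fun T : M.elements => exists_affine_interpolation T.2 φ
  have hcons : ∀ (T T' : M.elements) (x : Space d), x ∈ cell T.1 → x ∈ cell T'.1 →
      ℓ T x = ℓ T' x := by
    intro T T' x hx hx'
    have h1 : x ∈ cell (T.1 ∩ T'.1) := by
      rw [cell, Finset.coe_inter]
      exact inter_cell_subset T.2 T'.2 ⟨hx, hx'⟩
    have := affineMap_eq_zero_of_mem_cell (f := ℓ T - ℓ T') (fun y hy => by
      rw [Finset.mem_inter] at hy
      simp [hℓ T y hy.1, hℓ T' y hy.2]) h1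
    simpa [sub_eq_zero] using this
  refine ⟨fun x => if h : ∃ T : M.elements, x ∈ cell T.1 then ℓ h.choose x else 0, ℓ, hℓ, ?_, ?_⟩
  · intro T x hx
    have h : ∃ T : M.elements, x ∈ cell T.1 := ⟨T, hx⟩
    simp only [dif_pos h]
    exact hcons _ _ _ h.choose_spec hx
  · intro x hx
    refine dif_neg ?_
    rintro ⟨T, hT⟩
    exact hx (cell_subset_closure T.2 hT)

/-- The affine interpolation differs from the first order Taylor polynomial of `φ` at `x` by at most
`Λ h_T²` at the vertices, hence on the element; as the element contains a ball of radius
comparable to `h_T`, this controls the gradient as well. -/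
theorem interpolation_error {γ : ℝ} (hM : M.ShapeRegular γ) (hd : 1 ≤ d) (hT : T ∈ M.elements)
    {φ : Space d → ℝ} (hφ : Differentiable ℝ φ) {Λ : NNReal} (hΛ : LipschitzWith Λ (fderiv ℝ φ))
    {ℓ : Space d →ᵃ[ℝ] ℝ} (hℓ : ∀ y ∈ T, ℓ y = φ y) {x : Space d} (hx : x ∈ cell T) :
    |φ x - ℓ x| ≤ Λ * Metric.diam (cell T) ^ 2 ∧
      ‖gradient (fun y => φ y - ℓ y) x‖ ≤ 8 * γ * Λ * Metric.diam (cell T) := by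
  set h := Metric.diam (cell T) with hh
  have hpos : 0 < h := diam_cell_pos hd hT
  obtain ⟨hγ, x₀, hball, -⟩ := hM.exists_ball hd hT
  set p := fderiv ℝ φ x with hp
  set f : Space d →ᵃ[ℝ] ℝ :=
    ℓ - ((p : Space d →ₗ[ℝ] ℝ).toAffineMap + AffineMap.const ℝ (Space d) (φ x - p x)) with hf
  have hfa : ∀ y, f y = ℓ y - φ x - p (y - x) := fun y => by
    simp only [hf, AffineMap.coe_sub, AffineMap.coe_add, Pi.sub_apply, Pi.add_apply,
      LinearMap.coe_toAffineMap, ContinuousLinearMap.coe_coe, AffineMap.const_apply, map_sub]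
    ring
  have hfl : ∀ z, f.linear z = ℓ.linear z - p z := fun z => by
    simp [hf]
  have hbound : ∀ y ∈ cell T, |f y| ≤ Λ * h ^ 2 := by
    refine fun y hy => abs_affineMap_le_of_mem_cell (fun y hy => ?_) hy
    have hyc := subset_cell T hy
    have h1 := (convex_cell T).norm_image_sub_le_of_norm_fderiv_le' (f := φ) (φ := p)
      (C := Λ * h) (fun z _ => hφ z) (fun z hz => by
        rw [← dist_eq_norm]
        exact (hΛ.dist_le_mul _ _).trans
          (mul_le_mul_of_nonneg_left (dist_le_diam_cell hz hx) Λ.coe_nonneg)) hx hyc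
    rw [hfa, hℓ y hy, ← Real.norm_eq_abs]
    refine h1.trans ?_
    rw [pow_two, ← mul_assoc, ← dist_eq_norm]
    exact mul_le_mul_of_nonneg_left (dist_le_diam_cell hyc hx) (by positivity)
  refine ⟨?_, ?_⟩
  · have := hbound x hx
    rw [hfa, sub_self, map_zero, sub_zero] at this
    rwa [abs_sub_comm]
  · have hlin : ∀ z, |f.linear z| ≤ 8 * γ * Λ * h * ‖z‖ := by
      intro z
      rcases eq_or_ne z 0 with rfl | hz
      · simp
      have hz' : 0 < ‖z‖ := norm_pos_iff.2 hz
      set t := (4 * γ)⁻¹ * h / ‖z‖ with ht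
      have ht0 : 0 < t := by positivity
      have hr : 0 ≤ (4 * γ)⁻¹ * h := by positivity
      have h1 : x₀ + t • z ∈ cell T := hball (by
        rw [mem_closedBall_iff_norm, add_sub_cancel_left, norm_smul, Real.norm_of_nonneg ht0.le, ht,
          div_mul_cancel₀ _ hz'.ne'])
      have h2 : x₀ ∈ cell T := hball (Metric.mem_closedBall_self hr)
      have h3 : f (x₀ + t • z) - f x₀ = t * f.linear z := by
        rw [← smul_eq_mul, ← map_smul, ← vsub_eq_sub, ← AffineMap.linearMap_vsub, vsub_eq_sub,
          add_sub_cancel_left]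
      have h4 : t * |f.linear z| ≤ 2 * (Λ * h ^ 2) := by
        rw [← abs_of_pos ht0, ← abs_mul, ← h3]
        refine (abs_sub _ _).trans ?_
        linarith [hbound _ h1, hbound _ h2]
      have h5 : t * (8 * γ * Λ * h * ‖z‖) = 2 * (Λ * h ^ 2) := by
        rw [ht]
        field_simp
        ring
      exact le_of_mul_le_mul_left (h4.trans_eq h5.symm) ht0
    have hg : ∀ z, ⟪gradient (fun y => φ y - ℓ y) x, z⟫_ℝ = - f.linear z := by
      intro z
      have h1 := gradient_eq_of_affineMap ℓ x z
      rw [inner_gradient_eq] at h1 ⊢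
      have hℓd : DifferentiableAt ℝ ℓ x :=
        ((contDiff_of_mem_polySpace (affine_mem_polySpace le_rfl ℓ) (n := 1)).differentiable
          (by norm_num)) x
      rw [fderiv_fun_sub (hφ x) hℓd, sub_apply, h1, hfl]
      ring
    set G := gradient (fun y => φ y - ℓ y) x with hG
    have h1 : ‖G‖ ^ 2 ≤ 8 * γ * Λ * h * ‖G‖ := by
      rw [← real_inner_self_eq_norm_sq, hg]
      exact (neg_le_abs _).trans (hlin G)
    rcases (norm_nonneg G).eq_or_lt with h0 | h0
    · rw [← h0]; positivity
    · exact le_of_mul_le_mul_right (by rwa [pow_two] at h1) h0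

end Mesh

open Mesh

variable {k : ℕ}

/-- The nodal interpolant is supported near the support of `φ`, hence inside `Ω` when the mesh is
fine. -/
theorem exists_interpolant (P : ModelProblem d) (hk : 1 ≤ k) {φ : Space d → ℝ}
    {δ : ℝ} (hδ : Metric.cthickening δ (tsupport φ) ⊆ P.Ω) (hc : HasCompactSupport φ) {M : Mesh P.Ω}
    (hM : M.size ≤ δ) :
    ∃ w ∈ Vh M k, ∀ T ∈ M.elements, ∃ ℓ : Space d →ᵃ[ℝ] ℝ, (∀ y ∈ T, ℓ y = φ y) ∧
      w =ᵐ[volume.restrict (interior (cell T))] ℓ := by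
  obtain ⟨v, ℓ, hℓ, hv, hv0⟩ := M.exists_nodal_interpolant φ
  have hfin : IsFiniteMeasure (volume.restrict P.Ω) := ⟨by simpa using P.volume_ne_top.lt_top⟩
  have hsupp : ∀ x ∉ Metric.cthickening δ (tsupport φ), v x = 0 := by
    intro x hx
    by_cases hxΩ : x ∈ closure P.Ω
    · obtain ⟨T, hT, hxT⟩ := M.exists_mem_cell hxΩ
      rw [hv ⟨T, hT⟩ x hxT]
      refine affineMap_eq_zero_of_mem_cell (fun y hy => ?_) hxT
      rw [hℓ ⟨T, hT⟩ y hy]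
      by_contra hy0
      exact hx (Metric.mem_cthickening_of_dist_le x y δ _ (subset_tsupport _ hy0)
        ((dist_le_diam_cell hxT (subset_cell T hy)).trans ((diam_cell_le_size hT).trans hM)))
    · exact hv0 x hxΩ
  have hts : tsupport v ⊆ Metric.cthickening δ (tsupport φ) :=
    closure_minimal (fun x hx => by_contra fun hx' => hx (hsupp x hx')) Metric.isClosed_cthickening
  have hvc : HasCompactSupport v := HasCompactSupport.of_support_subset_isCompact
    hc.isCompact.cthickening (subset_closure.trans hts)
  -- closed sets on which `v` is affine: the complement of `Ω`, where `v = 0`, and the elements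
  set S : Option M.elements → Set (Space d) := fun o => o.elim P.Ωᶜ fun T => cell T.1 with hS
  set ℓ' : Option M.elements → Space d →ᵃ[ℝ] ℝ := fun o => o.elim 0 ℓ with hℓ'
  set L : NNReal := ∑ o, ‖LinearMap.toContinuousLinearMap (ℓ' o).linear‖₊ with hL
  have hLip : LipschitzWith L v := by
    refine lipschitzWith_of_piecewise_affine (S := S) (ℓ := ℓ') ?_ ?_ ?_ ?_
    · rintro (_ | T)
      · exact P.isOpen.isClosed_compl
      · exact (isCompact_cell T.1).isClosed
    · refine eq_univ_of_forall fun x => mem_iUnion.2 ?_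
      by_cases hx : x ∈ P.Ω
      · obtain ⟨T, hT, hxT⟩ := M.exists_mem_cell (subset_closure hx)
        exact ⟨some ⟨T, hT⟩, hxT⟩
      · exact ⟨none, hx⟩
    · rintro (_ | T) x hx
      · exact hsupp x fun h => hx (hδ h)
      · exact hv T x hx
    · intro o z
      refine ((LinearMap.toContinuousLinearMap (ℓ' o).linear).le_opNorm z).trans
        (mul_le_mul_of_nonneg_right ?_ (norm_nonneg z))
      exact_mod_cast Finset.single_le_sum
        (f := fun o => ‖LinearMap.toContinuousLinearMap (ℓ' o).linear‖₊)
        (fun _ _ => zero_le) (Finset.mem_univ o)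
  have hmem : MemLp v 2 (volume.restrict P.Ω) := by
    obtain ⟨C, hC⟩ := hvc.exists_bound_of_continuous hLip.continuous
    exact MemLp.of_bound hLip.continuous.aestronglyMeasurable C (Filter.Eventually.of_forall hC)
  refine ⟨hmem.toLp, ⟨⟨v, ⟨hLip.continuous.continuousOn, fun T hT => ?_⟩, hmem.coeFn_toLp⟩, ?_⟩,
    fun T hT => ⟨ℓ ⟨T, hT⟩, hℓ ⟨T, hT⟩, ?_⟩⟩
  · obtain ⟨p, hp, he⟩ := mem_polySpace.1 (affine_mem_polySpace hk (ℓ ⟨T, hT⟩))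
    exact ⟨p, hp, fun x hx => (hv ⟨T, hT⟩ x hx).trans (congrFun he x)⟩
  · refine toLp_mem_H10 P.isOpen P.volume_ne_top hLip hvc (hts.trans hδ) ?_ hmem
    filter_upwards [ae_restrict_of_ae_restrict_of_subset subset_closure M.ae_exists_mem_interior]
      with x hx
    obtain ⟨T, hT, hxT⟩ := hx
    obtain ⟨δ, hδ, hb⟩ := Metric.isOpen_iff.1 isOpen_interior x hxT
    refine ⟨δ, hδ, gradient (ℓ ⟨T, hT⟩) x, fun y hy => ?_⟩
    rw [hv ⟨T, hT⟩ y (interior_subset (hb hy)), hv ⟨T, hT⟩ x (interior_subset hxT),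
      gradient_eq_of_affineMap, ← vsub_eq_sub, AffineMap.linearMap_vsub, vsub_eq_sub]
    ring
  · have hsub := interior_cell_subset P.polygonal hT
    filter_upwards [ae_restrict_of_ae_restrict_of_subset hsub hmem.coeFn_toLp,
      ae_restrict_mem isOpen_interior.measurableSet] with x hx hxT
    rw [hx, hv ⟨T, hT⟩ x (interior_subset hxT)]

/-- The nodal interpolants of a test function converge in `H¹`, at a rate that depends on the test
function and on the shape regularity constant only. -/
theorem exists_approx_testFunction (hd : 1 ≤ d) (P : ModelProblem d) (hk : 1 ≤ k) (γ : ℝ)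
    {φ : Space d → ℝ} (hφ : IsTestFunction P.Ω φ) {p : L2 P.Ω}
    (hp : p =ᵐ[volume.restrict P.Ω] φ) (hpm : p ∈ H10 P.Ω) {ε : ℝ} (hε : 0 < ε) :
    ∃ h₀ : ℝ, 0 < h₀ ∧ ∀ M : Mesh P.Ω, M.ShapeRegular γ → M.size ≤ h₀ →
      ∃ w ∈ Vh M k, ‖p - w‖ ≤ ε ∧ ‖weakGradient (p - w)‖ ≤ ε := by
  have hfin : IsFiniteMeasure (volume.restrict P.Ω) := ⟨by simpa using P.volume_ne_top.lt_top⟩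
  obtain ⟨δ, hδ, hδΩ⟩ := hφ.2.1.isCompact.exists_cthickening_subset_open P.isOpen hφ.2.2
  obtain ⟨Λ, hΛ⟩ := ContDiff.lipschitzWith_of_hasCompactSupport (𝕂 := ℝ) (n := 1)
    (hφ.2.1.fderiv (𝕜 := ℝ)) ((hφ.1.fderiv_right (m := 1) (by norm_cast))) (by norm_num)
  set K : ℝ := (measureUnivNNReal (volume.restrict P.Ω) : ℝ) ^ (2 : ℝ≥0∞).toReal⁻¹ with hK
  have hK0 : 0 ≤ K := by positivity
  -- the pointwise errors are at most `(Λ + |8 γ Λ|) h`, and `K` bounds `L²` norms by maximum norms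
  set D : ℝ := K * (Λ + |8 * γ * Λ|) + 1 with hD
  have hD0 : 0 < D := by positivity
  refine ⟨min δ (min 1 (ε / D)), by positivity, fun M hM hsize => ?_⟩
  obtain ⟨w, hw, hwℓ⟩ := exists_interpolant P hk hδΩ hφ.2.1 (hsize.trans (min_le_left _ _))
  have h1 : M.size ≤ 1 := hsize.trans ((min_le_right _ _).trans (min_le_left _ _))
  have h2 : M.size ≤ ε / D := hsize.trans ((min_le_right _ _).trans (min_le_right _ _))
  have hs0 : 0 ≤ M.size := Real.iSup_nonneg fun T => Metric.diam_nonneg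
  have hmem : p - w ∈ H10 P.Ω := sub_mem hpm hw.2
  have hev : ∀ T ∈ M.elements, ∀ᵐ x ∂volume.restrict (interior (cell T)),
      ‖(p - w) x‖ ≤ (Λ + |8 * γ * Λ|) * M.size ∧
        ‖weakGradient (p - w) x‖ ≤ (Λ + |8 * γ * Λ|) * M.size := by
    intro T hT
    obtain ⟨ℓ, hℓ, hwT⟩ := hwℓ T hT
    have hsub := interior_cell_subset P.polygonal hT
    have hf : ContDiff ℝ 1 fun y => φ y - ℓ y :=
      hφ.contDiff_one.sub (contDiff_of_mem_polySpace (affine_mem_polySpace le_rfl ℓ))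
    have hpw : (p - w : L2 P.Ω) =ᵐ[volume.restrict (interior (cell T))] fun y => φ y - ℓ y := by
      filter_upwards [ae_restrict_of_ae_restrict_of_subset hsub hp, hwT,
        ae_restrict_of_ae_restrict_of_subset hsub (Lp.coeFn_sub p w)] with x h1 h2 h3
      rw [h3, Pi.sub_apply, h1, h2]
    have hg := (isWeakGradient_weakGradient P.isOpen hmem).ae_eq_gradient
      P.isOpen.measurableSet isOpen_interior hsub hf hpw
    have hdT := diam_cell_le_size hT
    have hd0 : 0 ≤ Metric.diam (cell T) := Metric.diam_nonneg
    filter_upwards [hpw, hg, ae_restrict_mem isOpen_interior.measurableSet] with x hx1 hx2 hx3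
    obtain ⟨e1, e2⟩ := interpolation_error hM hd hT hφ.differentiable hΛ hℓ (interior_subset hx3)
    rw [hx1, hx2, Real.norm_eq_abs]
    refine ⟨e1.trans ?_, e2.trans ?_⟩
    · have : Metric.diam (cell T) ^ 2 ≤ M.size := by nlinarith
      have := mul_le_mul_of_nonneg_left this Λ.coe_nonneg
      have := mul_nonneg (abs_nonneg (8 * γ * Λ)) hs0
      linarith
    · have := mul_le_mul (le_abs_self (8 * γ * Λ)) hdT hd0 (abs_nonneg _)
      have := mul_nonneg Λ.coe_nonneg hs0
      linarith
  have hall : ∀ᵐ x ∂volume.restrict P.Ω, ‖(p - w) x‖ ≤ (Λ + |8 * γ * Λ|) * M.size ∧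
        ‖weakGradient (p - w) x‖ ≤ (Λ + |8 * γ * Λ|) * M.size := by
    have h3 : ∀ᵐ x : Space d, ∀ T ∈ M.elements, x ∈ interior (cell T) →
        ‖(p - w) x‖ ≤ (Λ + |8 * γ * Λ|) * M.size ∧
          ‖weakGradient (p - w) x‖ ≤ (Λ + |8 * γ * Λ|) * M.size :=
      (ae_ball_iff M.elements.countable_toSet).2 fun T hT =>
        (ae_restrict_iff' isOpen_interior.measurableSet).1 (hev T hT)
    filter_upwards [ae_restrict_of_ae h3,
      ae_restrict_of_ae_restrict_of_subset subset_closure M.ae_exists_mem_interior] with x hx hxT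
    obtain ⟨T, hT, hxT⟩ := hxT
    exact hx T hT hxT
  have hfinal : K * ((Λ + |8 * γ * Λ|) * M.size) ≤ ε := by
    have := (le_div_iff₀ hD0).1 h2
    have h4 : K * ((Λ + |8 * γ * Λ|) * M.size) ≤ M.size * D := by
      rw [hD]; nlinarith
    linarith
  have hnn : 0 ≤ (Λ + |8 * γ * Λ|) * M.size := by positivity
  exact ⟨w, hw, (Lp.norm_le_of_ae_bound hnn (hall.mono fun x hx => hx.1)).trans hfinal,
    (Lp.norm_le_of_ae_bound hnn (hall.mono fun x hx => hx.2)).trans hfinal⟩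

/-- Functions of `H₀¹` can be approximated in the finite element spaces of all sufficiently fine
shape regular meshes. -/
theorem exists_approx (hd : 1 ≤ d) (P : ModelProblem d) (hk : 1 ≤ k) (γ : ℝ) {u : L2 P.Ω}
    (hu : u ∈ H10 P.Ω) {ε : ℝ} (hε : 0 < ε) :
    ∃ h₀ : ℝ, 0 < h₀ ∧ ∀ M : Mesh P.Ω, M.ShapeRegular γ → M.size ≤ h₀ →
      ∃ w ∈ Vh M k, ‖u - w‖ ≤ ε ∧ ‖weakGradient (u - w)‖ ≤ ε := by
  obtain ⟨p, hp, hdist⟩ := Metric.mem_closure_iff.1 ((mem_H10_iff P.isOpen).1 hu) (ε / 2)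
    (half_pos hε)
  obtain ⟨φ, hφ, h1, -⟩ := exists_of_mem_testGraph hp
  have hpc := subset_closure hp
  have hpm : p.1 ∈ H10 P.Ω := ⟨p, hpc, rfl⟩
  have hp2 : weakGradient p.1 = p.2 := (isWeakGradient_of_mem_closure hpc).weakGradient_eq P.isOpen
  obtain ⟨h₀, hh₀, hM⟩ := exists_approx_testFunction hd P hk γ hφ h1 hpm (half_pos hε)
  refine ⟨h₀, hh₀, fun M hreg hsize => ?_⟩
  obtain ⟨w, hw, e1, e2⟩ := hM M hreg hsize
  rw [Prod.dist_eq, max_lt_iff, dist_eq_norm, dist_eq_norm, ← hp2] at hdist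
  refine ⟨w, hw, ?_, ?_⟩
  · rw [← sub_add_sub_cancel u p.1 w]
    exact (norm_add_le _ _).trans (by linarith [hdist.1])
  · rw [← sub_add_sub_cancel u p.1 w, weakGradient_add P.isOpen (sub_mem hu hpm) (sub_mem hpm hw.2),
      weakGradient_sub P.isOpen hu hpm]
    exact (norm_add_le _ _).trans (by linarith [hdist.2])

/-! ### The spectral gap and the discrete spectral projections -/

theorem orthonormal_normalize {V ι : Type*} [NormedAddCommGroup V] [InnerProductSpace ℝ V]
    {b : ι → V} (h0 : ∀ i, b i ≠ 0) (h : ∀ i j, i ≠ j → ⟪b i, b j⟫_ℝ = 0) :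
    Orthonormal ℝ fun i => ‖b i‖⁻¹ • b i := by
  refine ⟨fun i => norm_smul_inv_norm (h0 i), fun i j hij => ?_⟩
  change ⟪_ • b i, _ • b j⟫_ℝ = 0
  rw [real_inner_smul_left, real_inner_smul_right, h i j hij, mul_zero, mul_zero]

/-- Bump functions around different points are orthogonal. -/
theorem exists_orthonormal_H10 (hd : 1 ≤ d) {Ω : Set (Space d)} (hΩ : IsOpen Ω)
    (hne : Ω.Nonempty) (n : ℕ) : ∃ b : Fin n → H10 Ω, Orthonormal ℝ b := by
  have : Nonempty (Fin d) := ⟨⟨0, hd⟩⟩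
  have hinf : Ω.Infinite := by
    obtain ⟨x, hx⟩ := hne
    exact infinite_of_mem_nhds x (hΩ.mem_nhds hx)
  obtain ⟨s, hs, hcard⟩ := hinf.exists_subset_card_eq n
  obtain ⟨O, hO, hdisj⟩ := s.finite_toSet.t2_separation
  have hf : ∀ x : s, ∃ f : Space d → ℝ, tsupport f ⊆ O x ∩ Ω ∧ HasCompactSupport f ∧
      ContDiff ℝ (⊤ : ℕ∞) f ∧ range f ⊆ Icc 0 1 ∧ f x = 1 := fun x =>
    exists_contDiff_tsupport_subset
      (Filter.inter_mem ((hO x).2.mem_nhds (hO x).1) (hΩ.mem_nhds (hs x.2)))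
  choose f hfs hfc hfd hfr hf1 using hf
  have htest : ∀ x, IsTestFunction Ω (f x) := fun x =>
    ⟨hfd x, hfc x, (hfs x).trans inter_subset_right⟩
  set b : s → H10 Ω := fun x => ⟨((htest x).memLp (volume.restrict Ω)).toLp,
    ⟨_, subset_closure (htest x).mem_testGraph, rfl⟩⟩ with hb
  have hb0 : ∀ x, b x ≠ 0 := by
    intro x h0
    have h1 : ((htest x).memLp (volume.restrict Ω)).toLp = (0 : L2 Ω) := congr_arg Subtype.val h0
    have h1' := ((htest x).memLp (volume.restrict Ω)).coeFn_toLp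
    rw [h1] at h1'
    have h2 : IsOpen ({y | f x y ≠ 0} ∩ Ω) :=
      ((htest x).continuous.isOpen_preimage _ isOpen_compl_singleton).inter hΩ
    have h3 : volume ({y | f x y ≠ 0} ∩ Ω) = 0 := by
      rw [← Measure.restrict_apply' hΩ.measurableSet]
      exact h1'.symm.trans (Lp.coeFn_zero ℝ 2 (volume.restrict Ω))
    refine (h2.measure_pos volume ⟨x, ?_, hs x.2⟩).ne' h3
    change f x x ≠ 0
    rw [hf1]
    exact one_ne_zero
  have hborth : ∀ x y, x ≠ y → ⟪b x, b y⟫_ℝ = 0 := by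
    intro x y hxy
    change ⟪((htest x).memLp (volume.restrict Ω)).toLp,
      ((htest y).memLp (volume.restrict Ω)).toLp⟫_ℝ = 0
    rw [L2.inner_def]
    refine integral_eq_zero_of_ae ?_
    filter_upwards [((htest x).memLp (volume.restrict Ω)).coeFn_toLp,
      ((htest y).memLp (volume.restrict Ω)).coeFn_toLp] with z h1 h2
    rw [h1, h2]
    by_cases hz : z ∈ O x
    · have : z ∉ tsupport (f y) := fun hz' =>
        disjoint_left.1 (hdisj x.2 y.2 (fun h => hxy (Subtype.ext h))) hz (hfs y hz').1
      simp [image_eq_zero_of_notMem_tsupport this]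
    · have : z ∉ tsupport (f x) := fun hz' => hz (hfs x hz').1
      simp [image_eq_zero_of_notMem_tsupport this]
  exact ⟨_, orthonormal_normalize (fun i => hb0 ((s.equivFinOfCardEq hcard).symm i))
    fun i j hij => hborth _ _ (by simpa using hij)⟩

theorem exists_isCoerciveForm_energy (hd : 1 ≤ d) (P : ModelProblem d) :
    ∃ κ, IsCoerciveForm (energy P) κ ∧
      ∀ u ∈ H10 P.Ω, κ * (‖u‖ ^ 2 + ‖weakGradient u‖ ^ 2) ≤ aForm P u u := by
  obtain ⟨κ, hκ, h⟩ := exists_coercive hd P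
  refine ⟨κ, ⟨energy_comm, hκ, fun u => ?_⟩, h⟩
  refine le_trans ?_ (h u u.2)
  have : ‖u‖ = ‖(u : L2 P.Ω)‖ := rfl
  rw [this]
  nlinarith [sq_nonneg ‖weakGradient (u : L2 P.Ω)‖]

section Eigen

variable {P : ModelProblem d} {X : Submodule ℝ (L2 P.Ω)} {q : ℕ} {m : Fin q → ℕ}

/-- A doubly indexed family in `H₀¹(Ω)` as a family over the index pairs. -/
def liftFamily (hX : X ≤ H10 P.Ω) (u : (i : Fin q) → Fin (m i) → L2 P.Ω)
    (hu : ∀ i j, u i j ∈ X) : (Σ i, Fin (m i)) → H10 P.Ω :=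
  fun s => ⟨u s.1 s.2, hX (hu s.1 s.2)⟩

/-- The eigenvalue problems in subspaces of `H₀¹(Ω)` as instances of the abstract one. -/
theorem isEigenfamily_liftFamily (hX : X ≤ H10 P.Ω) {lam : (i : Fin q) → Fin (m i) → ℝ}
    {u : (i : Fin q) → Fin (m i) → L2 P.Ω} (hu : ∀ i j, IsEigenpair P X (lam i j) (u i j))
    (ho : IsBOrthonormal P u) :
    IsEigenfamily (energy P) (X.comap (H10 P.Ω).subtype) (fun s : Σ i, Fin (m i) => lam s.1 s.2)
      (liftFamily hX u fun i j => (hu i j).1) := by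
  refine ⟨⟨fun s => ?_, fun s t hst => ?_⟩, fun s => (hu s.1 s.2).1, fun s w hw => ?_⟩
  · have h := ho.1 s.1 s.2
    rw [bForm_eq_inner, real_inner_self_eq_norm_sq] at h
    have h0 := norm_nonneg (u s.1 s.2)
    change ‖u s.1 s.2‖ = 1
    nlinarith
  · have h := ho.2 s.1 s.2 t.1 t.2 hst
    rwa [bForm_eq_inner] at h
  · have h := (hu s.1 s.2).2.2 w hw
    rwa [bForm_eq_inner] at h

theorem isEigenpair_of_forall {μ : ℝ} {v : H10 P.Ω} (hv : (v : L2 P.Ω) ∈ X) (hv0 : v ≠ 0)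
    (h : ∀ w : H10 P.Ω, (w : L2 P.Ω) ∈ X → energy P v w = μ * ⟪v, w⟫_ℝ) (hX : X ≤ H10 P.Ω) :
    IsEigenpair P X μ v := by
  refine ⟨hv, fun h0 => hv0 (Subtype.ext h0), fun w hw => ?_⟩
  have := h ⟨w, hX hw⟩ hw
  rwa [bForm_eq_inner]

/-- There is a next eigenvalue `Λ`, which dominates the energy on the orthogonal complement of the
first eigenfunctions. -/
theorem exists_next_eigenvalue (hd : 1 ≤ d) {lam : Fin q → ℝ}
    (hlam : AreSmallestEigenvalues P lam) {U : (i : Fin q) → Fin (m i) → L2 P.Ω}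
    (hU : IsEigenbasis P lam U) :
    ∃ Λ : ℝ, (∃ v, IsEigenpair P (H10 P.Ω) Λ v) ∧ (∀ i, lam i < Λ) ∧
      ∀ w : H10 P.Ω, (∀ s, ⟪liftFamily le_rfl U (fun i j => (hU.1 i j).1) s, w⟫_ℝ = 0) →
        Λ * ‖w‖ ^ 2 ≤ energy P w w := by
  classical
  obtain ⟨κ, hκ, -⟩ := exists_isCoerciveForm_energy hd P
  have hfam := isEigenfamily_liftFamily le_rfl (lam := fun i _ => lam i) hU.1 hU.2.1
  rw [Submodule.comap_subtype_self] at hfam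
  set x := liftFamily le_rfl U (fun i j => (hU.1 i j).1) with hx
  -- `H₀¹(Ω)` is infinite dimensional
  have hne : ∃ w : H10 P.Ω, w ≠ 0 ∧ ∀ s, ⟪x s, w⟫_ℝ = 0 := by
    obtain ⟨b, hb⟩ := exists_orthonormal_H10 hd P.isOpen P.polygonal.2.1.nonempty
      (Fintype.card (Σ i, Fin (m i)) + 1)
    obtain ⟨c, hc, hcx⟩ := exists_combination (Finset.univ : Finset (Fin _))
      (Finset.univ : Finset (Σ i, Fin (m i))) (by simp) b x
    refine ⟨∑ s, c s • b s, fun h0 => ?_, fun s => hcx s (Finset.mem_univ s)⟩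
    have h1 : ⟪∑ s, c s • b s, ∑ s, c s • b s⟫_ℝ = ∑ s, c s ^ 2 := by
      rw [hb.inner_sum]
      simp [pow_two]
    rw [h0, inner_zero_left] at h1
    exact hc.ne h1
  obtain ⟨Λ, v, hv0, hvx, hv, hΛ⟩ := hfam.exists_next hκ (exists_cauchySeq_of_energy_le hd P)
    (exists_energy_limit hd P) hne
  have hpair := isEigenpair_of_forall v.2 hv0 (fun w _ => hv w) le_rfl
  refine ⟨Λ, ⟨v, hpair⟩, ?_, hΛ⟩
  -- `Λ` is none of the `lam i`, since `v` is orthogonal to their eigenspaces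
  rcases hlam.2.2 Λ v hpair with ⟨i, rfl⟩ | h
  · exfalso
    have h1 := hU.2.2 i v hpair
    have h2 : ∀ y ∈ Submodule.span ℝ (range (U i)), ⟪y, (v : L2 P.Ω)⟫_ℝ = 0 := by
      intro y hy
      refine Submodule.span_induction (p := fun u _ => ⟪u, (v : L2 P.Ω)⟫_ℝ = 0)
        ?_ (by simp) ?_ ?_ hy
      · rintro _ ⟨j, rfl⟩
        exact hvx ⟨i, j⟩
      · intro y z _ _ hy hz
        rw [inner_add_left, hy, hz, add_zero]
      · intro t y _ hy
        rw [real_inner_smul_left, hy, mul_zero]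
    exact hv0 (Subtype.ext (inner_self_eq_zero.1 (h2 v h1)))
  · exact h

end Eigen

/-- Vectors of `S` orthogonal to the `x s` are combinations of the remaining eigenvectors. -/
theorem IsEigenfamily.mul_norm_sq_le_apply_self {V : Type*} [NormedAddCommGroup V]
    [InnerProductSpace ℝ V] {a : LinearMap.BilinForm ℝ V} {S : Submodule ℝ V} {σ τ : Type*}
    [Fintype σ] [Fintype τ] {μ : τ → ℝ} {x : σ → V} {e : τ → V} (he : IsEigenfamily a S μ e)
    {c : ℝ} (hμ : ∀ t, c ≤ μ t)
    (hcomplete : ∀ w ∈ S, w = ∑ s, ⟪x s, w⟫_ℝ • x s + ∑ t, ⟪e t, w⟫_ℝ • e t)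
    {w : V} (hw : w ∈ S) (hwx : ∀ s, ⟪x s, w⟫_ℝ = 0) : c * ‖w‖ ^ 2 ≤ a w w := by
  have h1 := hcomplete w hw
  have h0 : ∑ s, ⟪x s, w⟫_ℝ • x s = 0 := Finset.sum_eq_zero fun s _ => by rw [hwx s, zero_smul]
  have h2 := he.norm_sq_sum Finset.univ fun t => ⟪e t, w⟫_ℝ
  have h3 := he.apply_sum_self Finset.univ fun t => ⟪e t, w⟫_ℝ
  rw [h0, zero_add] at h1
  rw [← h1] at h2 h3
  rw [h2, h3, Finset.mul_sum]
  exact Finset.sum_le_sum fun t _ => mul_le_mul_of_nonneg_right (hμ t) (sq_nonneg _)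

theorem formNorm_sub_comm {V : Type*} [NormedAddCommGroup V] [InnerProductSpace ℝ V]
    (a : LinearMap.BilinForm ℝ V) (u v : V) : formNorm a (u - v) = formNorm a (v - u) := by
  rw [← neg_sub, ← neg_one_smul ℝ, formNorm_smul]
  simp

/-- If the approximation error `ε` is small enough, then the bound of `sqrt_eigenvalue_mul_le`
places the discrete eigenvalue `t` within `δ` of the exact one. -/
theorem exists_bound_of_sqrt_mul_le {σ : Type*} [Finite σ] {lam : σ → ℝ} (hlam : ∀ s, 0 ≤ lam s)
    (c₁ c₂ : ℝ) {δ : ℝ} (hδ : 0 < δ) : ∃ ε > 0, ∀ s t, 0 ≤ t →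
      √t * (1 - ε * c₁) ≤ √(lam s) + ε * c₂ → t < lam s + δ := by
  have h : ∀ s, ∀ᶠ ε in 𝓝[>] (0 : ℝ), √(lam s) + ε * c₂ < √(lam s + δ) * (1 - ε * c₁) ∧
      0 < 1 - ε * c₁ := by
    intro s
    refine nhdsWithin_le_nhds (Filter.Eventually.and ?_ ?_)
    · have hc : Continuous fun ε : ℝ => √(lam s + δ) * (1 - ε * c₁) - (√(lam s) + ε * c₂) := by
        fun_prop
      have h0 : 0 < √(lam s + δ) * (1 - 0 * c₁) - (√(lam s) + 0 * c₂) := by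
        have := Real.sqrt_lt_sqrt (hlam s) (lt_add_of_pos_right (lam s) hδ)
        simpa using this
      filter_upwards [(hc.tendsto 0).eventually_const_lt h0] with ε hε
      linarith
    · have hc : Continuous fun ε : ℝ => 1 - ε * c₁ := by fun_prop
      exact (hc.tendsto 0).eventually_const_lt (by simp)
  obtain ⟨ε, hε, hε0⟩ := ((Filter.eventually_all.2 h).and self_mem_nhdsWithin).exists
  refine ⟨ε, hε0, fun s t ht hle => ?_⟩
  have h1 := lt_of_mul_lt_mul_right (hle.trans_lt (hε s).1) (hε s).2.le
  exact (Real.sqrt_lt_sqrt_iff ht).1 h1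

/-- On fine meshes the discrete eigenvalues are bounded, and the discrete spectral projections
project onto the spans of the corresponding discrete eigenfunctions. -/
theorem exists_discrete_bounds (hd : 1 ≤ d) {P : ModelProblem d} {k : ℕ} (hk : 1 ≤ k)
    (γ : ℝ) {q : ℕ} {lam : Fin q → ℝ} (hlam : AreSmallestEigenvalues P lam)
    {m : Fin q → ℕ} {r : Fin q → ℝ} (hr : ∀ i, 0 < r i)
    (hr' : ∀ i μ v, IsEigenpair P (H10 P.Ω) μ v → μ ≠ lam i → r i < |μ⁻¹ - (lam i)⁻¹|)
    {U : (i : Fin q) → Fin (m i) → L2 P.Ω} (hU : IsEigenbasis P lam U) :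
    ∃ h₀ : ℝ, 0 < h₀ ∧ ∃ B : ℝ, 0 < B ∧ ∀ M : Mesh P.Ω, M.ShapeRegular γ → M.size ≤ h₀ →
      ∀ (lamh : (i : Fin q) → Fin (m i) → ℝ) (uh : (i : Fin q) → Fin (m i) → L2 P.Ω),
        AreSmallestDiscreteEigenpairs P (Vh M k) lamh uh →
        (∀ i j, 0 < lamh i j ∧ lamh i j ≤ B) ∧
        ∀ i u, feProjection P (Vh M k) (lam i) (r i) u = ∑ j, ⟪uh i j, u⟫_ℝ • uh i j := by
  classical
  obtain ⟨κ, hκ, -⟩ := exists_isCoerciveForm_energy hd P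
  obtain ⟨Λ, ⟨vΛ, hvΛ⟩, hΛlt, hΛ⟩ := exists_next_eigenvalue hd hlam hU
  have hfam := isEigenfamily_liftFamily le_rfl (lam := fun i _ => lam i) hU.1 hU.2.1
  rw [Submodule.comap_subtype_self] at hfam
  set σ := Σ i, Fin (m i) with hσ
  set x := liftFamily le_rfl U (fun i j => (hU.1 i j).1) with hx
  have hpos : ∀ i, 0 < lam i := by
    intro i
    obtain ⟨v, hv⟩ := hlam.2.1 i
    obtain ⟨y, hy⟩ : ∃ y : H10 P.Ω, (y : L2 P.Ω) = v := ⟨⟨v, hv.1⟩, rfl⟩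
    have h1 := hv.2.2 v hv.1
    have h2 : 0 < aForm P v v := by
      rw [← hy, ← energy_apply]
      exact hκ.pos_of_ne fun h0 => hv.2.1 (by rw [← hy, h0]; rfl)
    rw [bForm_eq_inner, real_inner_self_eq_norm_sq] at h1
    rw [h1] at h2
    exact pos_of_mul_pos_left h2 (sq_nonneg _)
  -- reciprocals of numbers close to `lam i` lie inside the circle `i` and outside the other ones
  have hevent : ∀ i, ∀ᶠ t in 𝓝 (lam i), |t⁻¹ - (lam i)⁻¹| < r i ∧
      ∀ i', i' ≠ i → r i' < |t⁻¹ - (lam i')⁻¹| := by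
    intro i
    have hc : ∀ z : ℝ, ContinuousAt (fun t : ℝ => |t⁻¹ - z|) (lam i) := fun z =>
      ((continuousAt_inv₀ (hpos i).ne').sub continuousAt_const).abs
    refine Filter.Eventually.and ?_ (Filter.eventually_all.2 fun i' => ?_)
    · exact (hc _).eventually_lt_const (by simpa using hr i)
    · by_cases hii : i' = i
      · exact Filter.Eventually.of_forall fun t h => absurd hii h
      · obtain ⟨v, hv⟩ := hlam.2.1 i
        have h1 := hr' i' (lam i) v hv (fun h => hii (hlam.1.injective h).symm)
        filter_upwards [(hc _).eventually_const_lt h1] with t ht _ using ht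
  have hδ : ∃ δ > 0, δ ≤ 1 ∧ ∀ i t, lam i ≤ t → t < lam i + δ → |t⁻¹ - (lam i)⁻¹| < r i ∧
      ∀ i', i' ≠ i → r i' < |t⁻¹ - (lam i')⁻¹| := by
    have h1 : ∀ᶠ δ in 𝓝[>] (0 : ℝ), ∀ i, ∀ t, |t - lam i| < δ → |t⁻¹ - (lam i)⁻¹| < r i ∧
        ∀ i', i' ≠ i → r i' < |t⁻¹ - (lam i')⁻¹| := by
      refine Filter.eventually_all.2 fun i => ?_
      obtain ⟨δ, hδ, hb⟩ := Metric.eventually_nhds_iff.1 (hevent i)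
      filter_upwards [Ioo_mem_nhdsGT hδ] with δ' hδ' t ht
      exact hb (by rw [Real.dist_eq]; exact ht.trans hδ'.2)
    obtain ⟨δ, h2, h3⟩ := (h1.and (Ioo_mem_nhdsGT zero_lt_one)).exists
    refine ⟨δ, h3.1, h3.2.le, fun i t h4 h5 => h2 i t ?_⟩
    rw [abs_of_nonneg (by linarith)]
    linarith
  obtain ⟨δ, hδ0, hδ1, hδ⟩ := hδ
  obtain ⟨ε, hε, hεt⟩ := exists_bound_of_sqrt_mul_le (σ := σ) (lam := fun s => lam s.1)
    (fun s => (hpos s.1).le) (√(Fintype.card σ) / √κ) (√(Fintype.card σ)) hδ0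
  obtain ⟨K, hK, hKle⟩ := exists_aForm_le P
  -- with this accuracy the error in the energy norm is at most `ε`
  set ε' := ε / √(2 * K) with hε'
  have hε'0 : 0 < ε' := by positivity
  have happ : ∀ s : σ, ∃ h₀ : ℝ, 0 < h₀ ∧ ∀ M : Mesh P.Ω, M.ShapeRegular γ → M.size ≤ h₀ →
      ∃ w ∈ Vh M k, ‖U s.1 s.2 - w‖ ≤ ε' ∧ ‖weakGradient (U s.1 s.2 - w)‖ ≤ ε' := fun s =>
    exists_approx hd P hk γ (hU.1 s.1 s.2).1 hε'0
  choose h₀ hh₀ hM₀ using happ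
  obtain ⟨hs, hs0, hsle⟩ : ∃ hs : ℝ, 0 < hs ∧ ∀ s, hs ≤ h₀ s := by
    obtain ⟨hs, h1, h2⟩ := ((Filter.eventually_all.2 fun s =>
      Ioo_mem_nhdsGT (hh₀ s)).and self_mem_nhdsWithin).exists
    exact ⟨hs, h2, fun s => (h1 s).2.le⟩
  refine ⟨hs, hs0, |Λ| + 1, by positivity, fun M hreg hsize lamh uh huh => ?_⟩
  have hV : Vh M k ≤ H10 P.Ω := inf_le_right
  have hxh := isEigenfamily_liftFamily hV huh.1 huh.2.1
  set S := (Vh M k).comap (H10 P.Ω).subtype with hS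
  set xh := liftFamily hV uh (fun i j => (huh.1 i j).1) with hxhdef
  have hfinV : FiniteDimensional ℝ (Vh M k) := by
    have := finiteDimensional_feSpace (M := M) (k := k) P.polygonal
    exact Submodule.finiteDimensional_of_le (inf_le_left : Vh M k ≤ feSpace M k)
  have hfinS : FiniteDimensional ℝ S := by
    let f : S →ₗ[ℝ] Vh M k := (H10 P.Ω).subtype.restrict fun x hx => hx
    refine FiniteDimensional.of_injective f fun x y hxy => Subtype.ext (Subtype.ext ?_)
    exact congr_arg (fun z : Vh M k => (z : L2 P.Ω)) hxy
  obtain ⟨n, μ, e, he, hxe, hcomplete⟩ := hxh.exists_complement hκ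
  have hmono : ∀ s t : σ, lam s.1 < lam t.1 → lamh s.1 s.2 ≤ lamh t.1 t.2 := fun s t hst =>
    huh.2.2.2.1 _ _ _ _ (hlam.1.lt_iff_lt.1 hst)
  have hμ : ∀ t (s : σ), lamh s.1 s.2 ≤ μ t := by
    intro t s
    refine huh.2.2.2.2 (μ t) (e t) ?_ ?_ s.1 s.2
    · exact isEigenpair_of_forall (he.mem t) (he.orthonormal.ne_zero t)
        (fun w hw => he.apply t w hw) hV
    · intro i j
      rw [bForm_eq_inner, real_inner_comm]
      exact hxe ⟨i, j⟩ t
  have hge : ∀ s : σ, lam s.1 ≤ lamh s.1 s.2 :=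
    IsEigenfamily.eigenvalue_le hκ hfam hΛ (fun s => (hΛlt s.1).le) hxh hmono
  have hxc : ∀ s : σ, ∀ w ∈ S, (∀ s, ⟪xh s, w⟫_ℝ = 0) →
      lamh s.1 s.2 * ‖w‖ ^ 2 ≤ energy P w w := by
    intro s w hw hwx
    exact he.mul_norm_sq_le_apply_self (fun t => hμ t s) hcomplete hw hwx
  choose w hwV hw1 hw2 using fun s => hM₀ s M hreg (hsize.trans (hsle s))
  have hup := IsEigenfamily.sqrt_eigenvalue_mul_le hκ hfam hxh hmono hxc (ε := ε)
    (v := fun s => (⟨w s, hV (hwV s)⟩ : H10 P.Ω)) (fun s => hwV s) (fun s => by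
      rw [formNorm_sub_comm]
      refine Real.sqrt_le_iff.2 ⟨hε.le, ?_⟩
      refine (hKle (U s.1 s.2 - w s)).trans ?_
      have h1 := pow_le_pow_left₀ (norm_nonneg _) (hw1 s) 2
      have h2 := pow_le_pow_left₀ (norm_nonneg _) (hw2 s) 2
      have h3 : ε' ^ 2 = ε ^ 2 / (2 * K) := by
        rw [hε', div_pow, Real.sq_sqrt (by positivity)]
      calc _ ≤ K * (ε' ^ 2 + ε' ^ 2) := by gcongr
        _ = ε ^ 2 := by rw [h3]; field_simp; ring)
  have hlt : ∀ s : σ, lamh s.1 s.2 < lam s.1 + δ := fun s =>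
    hεt s _ ((hpos s.1).le.trans (hge s)) (by
      have := hup s
      rwa [mul_div_assoc] at this)
  refine ⟨fun i j => ⟨(hpos i).trans_le (hge ⟨i, j⟩), ?_⟩, fun i u => ?_⟩
  · have h1 := hlt ⟨i, j⟩
    have h2 := hΛlt i
    have h3 := le_abs_self Λ
    simp only at h1
    linarith
  -- since `r i < 1 / lam i - 1 / Λ`, neither `0` nor reciprocals of numbers `≥ Λ` lie in the circle
  · have hΛi := hr' i Λ vΛ hvΛ (hΛlt i).ne'
    have hΛ0 : 0 < Λ := (hpos i).trans (hΛlt i)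
    have hinv : Λ⁻¹ < (lam i)⁻¹ := (inv_lt_inv₀ hΛ0 (hpos i)).2 (hΛlt i)
    have hΛinv : 0 < Λ⁻¹ := inv_pos.2 hΛ0
    rw [abs_sub_comm, abs_of_pos (sub_pos.2 hinv)] at hΛi
    have hSi := feProjection_eq_sum hκ hV hxh he hxe hcomplete (lam := lam i) (hr i)
      (by rw [abs_of_pos (inv_pos.2 (hpos i))]; linarith)
      (Finset.univ.filter fun s : σ => s.1 = i) (fun s hs => by
        obtain rfl := (Finset.mem_filter.1 hs).2
        exact (hδ s.1 _ (hge s) (hlt s)).1)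
      (fun s hs => by
        have hne : s.1 ≠ i := fun h => hs (Finset.mem_filter.2 ⟨Finset.mem_univ s, h⟩)
        exact (hδ s.1 _ (hge s) (hlt s)).2 i hne.symm)
      (fun t => by
        have h1 : Λ ≤ μ t := IsEigenfamily.next_le hΛ hxh (he.orthonormal.ne_zero t) (he.mem t)
          (fun w hw => he.apply t w hw) (fun s => hxe s t) (fun s => hμ t s)
        have h2 : (μ t)⁻¹ ≤ Λ⁻¹ := inv_anti₀ hΛ0 h1
        rw [abs_sub_comm, abs_of_pos (by linarith)]
        linarith) u
    rw [hSi, Finset.sum_filter, Fintype.sum_sigma, Finset.sum_eq_single i]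
    · simp [hxhdef, liftFamily]
    · intro i' _ hne
      simp [hne]
    · simp

/-! ### Comparison of the two families of approximations -/

section Comparison

variable {V : Type*} [NormedAddCommGroup V] [InnerProductSpace ℝ V]
  {a : LinearMap.BilinForm ℝ V} {κ : ℝ} {σ ι : Type*} {S : Submodule ℝ V} {lam : σ → ℝ} {x : σ → V}

theorem IsEigenfamily.comp_injective (hx : IsEigenfamily a S lam x) {f : ι → σ}
    (hf : Function.Injective f) :
    IsEigenfamily a (Submodule.span ℝ (range (x ∘ f))) (lam ∘ f) (x ∘ f) :=
  ⟨hx.orthonormal.comp f hf, fun i => Submodule.subset_span ⟨i, rfl⟩, fun i _ hw =>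
    hx.apply (f i) _ (Submodule.span_le.2 (by rintro _ ⟨j, rfl⟩; exact hx.mem (f j)) hw)⟩

theorem eq_zero_of_mem_span {y : ι → V} {b : V →ₗ[ℝ] ℝ} (hb : ∀ i, b (y i) = 0) {v : V}
    (hv : v ∈ Submodule.span ℝ (range y)) : b v = 0 :=
  (Submodule.span_le.2 (by rintro _ ⟨i, rfl⟩; exact hb i) :
    Submodule.span ℝ (range y) ≤ LinearMap.ker b) hv

/-- The projection is explicit because the `y l` are `a`-orthogonal. -/
theorem IsEigenfamily.exists_projection [Fintype ι] {lamn : ι → ℝ} {y : ι → V}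
    (h : IsCoerciveForm a κ) (hy : IsEigenfamily a (Submodule.span ℝ (range y)) lamn y) (w : V) :
    ∃ p ∈ Submodule.span ℝ (range y), ∀ v ∈ Submodule.span ℝ (range y), a (w - p) v = 0 := by
  have hmem : ∑ j, (a w (y j) / lamn j) • y j ∈ Submodule.span ℝ (range y) :=
    Submodule.sum_mem _ fun j _ => Submodule.smul_mem _ _ (hy.mem j)
  refine ⟨_, hmem, fun v hv => eq_zero_of_mem_span (fun l => ?_) hv⟩
  rw [map_sub, LinearMap.sub_apply, h.symm (∑ j, (a w (y j) / lamn j) • y j), hy.apply l _ hmem,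
    hy.inner_sum_right _ (Finset.mem_univ l), mul_div_cancel₀ _ (hy.pos h l).ne', sub_self]

/-- The `a`-orthogonal projection is the best approximation in the energy norm. -/
theorem IsCoerciveForm.formNorm_sub_le (h : IsCoerciveForm a κ) {Y : Submodule ℝ V} {z p v : V}
    (hp : p ∈ Y) (hv : v ∈ Y) (horth : ∀ v ∈ Y, a (z - p) v = 0) :
    formNorm a (z - p) ≤ formNorm a (z - v) := by
  refine Real.sqrt_le_sqrt ?_
  have h1 := horth _ (Y.sub_mem hp hv)
  have h2 : a (z - v) (z - v) = a (z - p) (z - p) + a (p - v) (p - v) := by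
    rw [← sub_add_sub_cancel z p v]
    simp only [map_add, LinearMap.add_apply, h1, h.symm (p - v) (z - p)]
    ring
  rw [h2]
  linarith [h.nonneg (p - v)]

/-- The residual contribution `∑ ⟪w, x l⟫ λ_l x_l` of `w` represents the functional `a(w, ·)` on
`S`. The corresponding sum for the `a`-orthogonal projection `p` of `w` onto the span of the `y l`
is the orthogonal projection of the former, hence at least as close to it as its `a`-orthogonal
projection. -/
theorem IsEigenfamily.sub_projection_le [Fintype σ] [Fintype ι] (h : IsCoerciveForm a κ)
    (hx : IsEigenfamily a S lam x) {lamn : ι → ℝ} {y : ι → V}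
    (hy : IsEigenfamily a (Submodule.span ℝ (range y)) lamn y) (hyS : ∀ j, y j ∈ S) {D B : ℝ}
    (hD : ∀ z ∈ Submodule.span ℝ (range x), ∀ p ∈ Submodule.span ℝ (range y),
      (∀ v ∈ Submodule.span ℝ (range y), a (z - p) v = 0) →
        formNorm a (z - p) ≤ D * formNorm a z)
    (hB : ∀ s, lam s ≤ B) (hB0 : 0 ≤ B) {u w p : V} (hu : ‖u‖ = 1) (hw : w = ∑ s, ⟪x s, u⟫_ℝ • x s)
    (hp : p ∈ Submodule.span ℝ (range y))
    (hwp : ∀ v ∈ Submodule.span ℝ (range y), a (w - p) v = 0) :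
    ‖∑ s, (⟪w, x s⟫_ℝ * lam s) • x s - ∑ j, (⟪p, y j⟫_ℝ * lamn j) • y j‖ ^ 2
        ≤ κ⁻¹ * (D ^ 2 * B ^ 3) ∧ a (w - p) (w - p) ≤ D ^ 2 * B := by
  have hbessel : ∑ s, ⟪x s, u⟫_ℝ ^ 2 ≤ 1 := by
    have := hx.orthonormal.sum_inner_products_le (s := Finset.univ) u
    simpa [hu] using this
  have hspan : ∀ c : σ → ℝ, ∑ s, c s • x s ∈ Submodule.span ℝ (range x) := fun c =>
    Submodule.sum_mem _ fun s _ => Submodule.smul_mem _ _ (Submodule.subset_span ⟨s, rfl⟩)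
  have hsq : ∀ {z p : V}, z ∈ Submodule.span ℝ (range x) → p ∈ Submodule.span ℝ (range y) →
      (∀ v ∈ Submodule.span ℝ (range y), a (z - p) v = 0) →
      a (z - p) (z - p) ≤ D ^ 2 * a z z := fun {z p} hz hp' ho => by
    rw [← h.formNorm_sq, ← h.formNorm_sq z, ← mul_pow]
    exact pow_le_pow_left₀ (formNorm_nonneg _) (hD z hz p hp' ho) 2
  have hwx : ∀ s, ⟪w, x s⟫_ℝ = ⟪x s, u⟫_ℝ := fun s => by
    rw [real_inner_comm, hw, hx.inner_sum_right _ (Finset.mem_univ s)]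
  refine ⟨?_, ?_⟩
  · set f := ∑ s, (⟪w, x s⟫_ℝ * lam s) • x s with hf
    set g := ∑ j, (⟪p, y j⟫_ℝ * lamn j) • y j with hg
    have hgy : g ∈ Submodule.span ℝ (range y) :=
      Submodule.sum_mem _ fun j _ => Submodule.smul_mem _ _ (hy.mem j)
    have hfg : ∀ j, ⟪f - g, y j⟫_ℝ = 0 := by
      intro j
      have h1 : a w (y j) = ⟪f, y j⟫_ℝ := by
        rw [hw, hx.apply_sum _ _ (hyS j), hf, sum_inner]
        refine Finset.sum_congr rfl fun s _ => ?_
        rw [real_inner_smul_left, hwx]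
        ring
      have h2 : a p (y j) = ⟪p, y j⟫_ℝ * lamn j := by
        rw [h.symm, hy.apply j p hp, real_inner_comm, mul_comm]
      have h3 := hwp _ (hy.mem j)
      rw [map_sub, LinearMap.sub_apply, h1, h2] at h3
      rw [inner_sub_left, real_inner_comm (y j) g, hg, hy.inner_sum_right _ (Finset.mem_univ j)]
      exact h3
    -- `g` is the best approximation of `f` in the weak norm, `p'` the one in the energy norm
    obtain ⟨p', hp', ho⟩ := hy.exists_projection h f
    have hperp : ⟪f - g, g - p'⟫_ℝ = 0 :=
      eq_zero_of_mem_span (b := (innerSL ℝ (f - g) : V →ₗ[ℝ] ℝ)) hfg (Submodule.sub_mem _ hgy hp')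
    have h1 : ‖f - g‖ ^ 2 ≤ ‖f - p'‖ ^ 2 := by
      rw [← sub_add_sub_cancel f g p', norm_add_sq_real, hperp]
      nlinarith [sq_nonneg ‖g - p'‖]
    have h2 := hsq (hspan _) hp' ho
    have h3 : a f f ≤ B ^ 3 := by
      rw [hf, hx.apply_sum_self]
      refine le_trans ?_
        ((mul_le_mul_of_nonneg_left hbessel (pow_nonneg hB0 3)).trans_eq (mul_one _))
      rw [Finset.mul_sum]
      refine Finset.sum_le_sum fun s _ => ?_
      rw [hwx]
      have h0 := (hx.pos h s).le
      have h4 : lam s ^ 3 ≤ B ^ 3 := pow_le_pow_left₀ h0 (hB s) 3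
      calc lam s * (⟪x s, u⟫_ℝ * lam s) ^ 2 = lam s ^ 3 * ⟪x s, u⟫_ℝ ^ 2 := by ring
        _ ≤ _ := mul_le_mul_of_nonneg_right h4 (sq_nonneg _)
    rw [← div_eq_inv_mul, le_div_iff₀' h.pos]
    exact ((mul_le_mul_of_nonneg_left h1 h.pos.le).trans (h.le _)).trans
      (h2.trans (mul_le_mul_of_nonneg_left h3 (sq_nonneg _)))
  · refine (hsq (hw ▸ hspan _) hp hwp).trans (mul_le_mul_of_nonneg_left ?_ (sq_nonneg _))
    refine le_trans ?_ ((mul_le_mul_of_nonneg_left hbessel hB0).trans_eq (mul_one _))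
    rw [hw, hx.apply_sum_self, Finset.mul_sum]
    exact Finset.sum_le_sum fun s _ => mul_le_mul_of_nonneg_right (hB s) (sq_nonneg _)

end Comparison

section Projection

variable {P : ModelProblem d} {κ : ℝ}

theorem coe_mem_span_range {ι : Type*} (y : ι → H10 P.Ω) (v : H10 P.Ω) :
    (v : L2 P.Ω) ∈ Submodule.span ℝ (range fun i => (y i : L2 P.Ω))
      ↔ v ∈ Submodule.span ℝ (range y) := by
  have h : (range fun i => (y i : L2 P.Ω)) = (H10 P.Ω).subtype '' range y := by
    rw [← range_comp]
    rfl
  rw [h, ← Submodule.map_span]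
  constructor
  · rintro ⟨z, hz, hzv⟩
    rwa [← Subtype.ext hzv]
  · exact fun hv => ⟨v, hv, rfl⟩

theorem coe_sum_smul {ι : Type*} [Fintype ι] (c : ι → ℝ) (y : ι → H10 P.Ω) :
    ((∑ i, c i • y i : H10 P.Ω) : L2 P.Ω) = ∑ i, c i • (y i : L2 P.Ω) := by
  rw [Submodule.coe_sum]
  rfl

/-- The `a`-orthogonal projection attains the infimum in the definition of `distA`, so by
homogeneity its error is bounded by `distA` times the norm. -/
theorem aNorm_sub_le_distA (h : IsCoerciveForm (energy P) κ) {X Y : Submodule ℝ (L2 P.Ω)}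
    (hY : Y ≤ H10 P.Ω) {z p : H10 P.Ω} (hz : (z : L2 P.Ω) ∈ X) (hp : (p : L2 P.Ω) ∈ Y)
    (horth : ∀ v : H10 P.Ω, (v : L2 P.Ω) ∈ Y → energy P (z - p) v = 0) :
    formNorm (energy P) (z - p) ≤ distA P X Y * formNorm (energy P) z := by
  have hbest : ∀ {z p v : H10 P.Ω}, (p : L2 P.Ω) ∈ Y → (v : L2 P.Ω) ∈ Y →
      (∀ v : H10 P.Ω, (v : L2 P.Ω) ∈ Y → energy P (z - p) v = 0) →
      formNorm (energy P) (z - p) ≤ formNorm (energy P) (z - v) := fun {z p v} hp hv ho =>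
    h.formNorm_sub_le (Y := Y.comap (H10 P.Ω).subtype) hp hv ho
  -- `distA` is a supremum over vectors of norm one: `z = 0` is treated apart
  rcases (formNorm_nonneg (a := energy P) z).eq_or_lt with h0 | h0
  · have h1 := hbest (v := 0) hp Y.zero_mem horth
    rwa [sub_zero, ← h0, ← mul_zero (distA P X Y), h0] at h1
  set N := formNorm (energy P) z with hN
  have hsmul : ∀ v : H10 P.Ω, formNorm (energy P) (N⁻¹ • v) = N⁻¹ * formNorm (energy P) v :=
    fun v => by rw [formNorm_smul, abs_of_pos (inv_pos.2 h0)]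
  have h1 : formNorm (energy P) (N⁻¹ • z) = 1 := by rw [hsmul, inv_mul_cancel₀ h0.ne']
  have hbelow : ∀ u : L2 P.Ω, BddBelow (range fun v : Y => aNorm P (u - v.1)) := fun u =>
    ⟨0, by rintro _ ⟨v, rfl⟩; exact Real.sqrt_nonneg _⟩
  have hbdd : BddAbove (range fun u : {u : L2 P.Ω // u ∈ X ∧ aNorm P u = 1} =>
      ⨅ v : Y, aNorm P (u.1 - v.1)) := by
    refine ⟨1, ?_⟩
    rintro _ ⟨u, rfl⟩
    refine (ciInf_le (hbelow u.1) (0 : Y)).trans_eq ?_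
    rw [Submodule.coe_zero, sub_zero, u.2.2]
  have h2 : N⁻¹ * formNorm (energy P) (z - p) ≤ distA P X Y := by
    refine le_trans ?_ (le_ciSup hbdd ⟨((N⁻¹ • z : H10 P.Ω) : L2 P.Ω), X.smul_mem _ hz, h1⟩)
    refine le_ciInf fun v => ?_
    have h3 := hbest (z := N⁻¹ • z) (p := N⁻¹ • p) (v := ⟨v.1, hY v.2⟩) (Y.smul_mem _ hp) v.2
      fun v hv => by
        rw [← smul_sub, map_smul, LinearMap.smul_apply, horth v hv, smul_zero]
    rw [← smul_sub, hsmul] at h3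
    exact h3
  rwa [inv_mul_le_iff₀ h0, mul_comm] at h2

/-- The projection exists on a span of eigenfunctions, so that `aProjection` takes no junk value.
-/
theorem aProjection_spec (h : IsCoerciveForm (energy P) κ) {ι : Type*} [Fintype ι]
    {lamn : ι → ℝ} {y : ι → H10 P.Ω}
    (hy : IsEigenfamily (energy P) (Submodule.span ℝ (range y)) lamn y) (w : H10 P.Ω) :
    ∃ p ∈ Submodule.span ℝ (range y),
      aProjection P (Submodule.span ℝ (range fun i => (y i : L2 P.Ω))) w = p ∧
      ∀ v ∈ Submodule.span ℝ (range y), energy P (w - p) v = 0 := by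
  have hle : Submodule.span ℝ (range fun i => (y i : L2 P.Ω)) ≤ H10 P.Ω :=
    Submodule.span_le.2 (by rintro _ ⟨i, rfl⟩; exact (y i).2)
  have hex : ∃ p ∈ Submodule.span ℝ (range fun i => (y i : L2 P.Ω)),
      ∀ v ∈ Submodule.span ℝ (range fun i => (y i : L2 P.Ω)), aForm P (w - p) v = 0 := by
    obtain ⟨p, hp, ho⟩ := hy.exists_projection h w
    exact ⟨p, (coe_mem_span_range y p).2 hp, fun v hv =>
      ho ⟨v, hle hv⟩ ((coe_mem_span_range y ⟨v, hle hv⟩).1 hv)⟩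
  rw [aProjection, dif_pos hex]
  obtain ⟨h1, h2⟩ := hex.choose_spec
  exact ⟨⟨hex.choose, hle h1⟩, (coe_mem_span_range y _).1 h1, rfl, fun v hv =>
    h2 v ((coe_mem_span_range y v).2 hv)⟩

/-- By orthonormality only the terms of the group `i` contribute on the span of this group. -/
theorem weightedSum_eq_of_mem_span {q : ℕ} {m : Fin q → ℕ} {u : (i : Fin q) → Fin (m i) → L2 P.Ω}
    (hu : IsBOrthonormal P u) (lam : (i : Fin q) → Fin (m i) → ℝ) {i : Fin q} {w : L2 P.Ω}
    (hw : w ∈ Submodule.span ℝ (range (u i))) :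
    weightedSum P lam u w = ∑ j, (⟪w, u i j⟫_ℝ * lam i j) • u i j := by
  rw [weightedSum, Finset.sum_eq_single i]
  · simp_rw [bForm_eq_inner]
  · intro i' _ hne
    refine Finset.sum_eq_zero fun j' _ => ?_
    have h0 : ⟪u i' j', w⟫_ℝ = 0 :=
      eq_zero_of_mem_span (b := (innerSL ℝ (u i' j') : L2 P.Ω →ₗ[ℝ] ℝ)) (fun j => by
        have := hu.2 i' j' i j fun h => hne (congr_arg Sigma.fst h)
        rwa [bForm_eq_inner] at this) hw
    rw [bForm_eq_inner, real_inner_comm, h0, zero_mul, zero_smul]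
  · exact fun h => absurd (Finset.mem_univ i) h

end Projection

/-- The differences which control the difference of the two estimators, in terms of the distance of
the spans of the corresponding families. -/
theorem sub_aProjection_le {P : ModelProblem d} {κ : ℝ} (h : IsCoerciveForm (energy P) κ)
    (hκ : ∀ u ∈ H10 P.Ω, κ * (‖u‖ ^ 2 + ‖weakGradient u‖ ^ 2) ≤ aForm P u u)
    {V : Submodule ℝ (L2 P.Ω)} (hV : V ≤ H10 P.Ω) {q : ℕ} {m : Fin q → ℕ}
    {lamh : (i : Fin q) → Fin (m i) → ℝ} {uh : (i : Fin q) → Fin (m i) → L2 P.Ω}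
    (huh : ∀ i j, IsEigenpair P V (lamh i j) (uh i j)) (hoh : IsBOrthonormal P uh)
    {lamn : (i : Fin q) → Fin (m i) → ℝ} {un : (i : Fin q) → Fin (m i) → L2 P.Ω}
    (hun : AreParOApproximations P V lamn un) {B : ℝ} (hB : ∀ i j, lamh i j ≤ B) (hB0 : 0 ≤ B)
    (i : Fin q) {u : L2 P.Ω} (hu : u ∈ H10 P.Ω) (hu1 : ‖u‖ = 1) {w w' : L2 P.Ω}
    (hw : w = ∑ j, ⟪uh i j, u⟫_ℝ • uh i j)
    (hw' : w' = aProjection P (Submodule.span ℝ (range (un i))) w) :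
    w ∈ V ∧ w' ∈ V ∧
    ‖weightedSum P lamh uh w - weightedSum P lamn un w'‖ ^ 2
        + ‖w - w'‖ ^ 2 + ‖weakGradient (w - w')‖ ^ 2
      ≤ κ⁻¹ * (B ^ 3 + B) * distA P (Submodule.span ℝ (range (uh i)))
          (Submodule.span ℝ (range (un i))) ^ 2 := by
  obtain ⟨X, hXV, hX, hpair, hon⟩ := hun
  have hinj : Function.Injective fun j : Fin (m i) => (⟨i, j⟩ : Σ i, Fin (m i)) :=
    fun j j' hj => by simpa using hj
  have hXH := hXV.trans hV
  have hxh := isEigenfamily_liftFamily hV huh hoh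
  have hyn := (isEigenfamily_liftFamily hXH hpair hon).comp_injective hinj
  obtain ⟨x, hx, hxi⟩ : ∃ x : Fin (m i) → H10 P.Ω, (∀ j, (x j : L2 P.Ω) = uh i j) ∧
      IsEigenfamily (energy P) (V.comap (H10 P.Ω).subtype) (lamh i) x :=
    ⟨_, fun j => rfl, hxh.orthonormal.comp _ hinj, fun j => hxh.mem ⟨i, j⟩,
      fun j => hxh.apply ⟨i, j⟩⟩
  obtain ⟨y, hy, hyi⟩ : ∃ y : Fin (m i) → H10 P.Ω, (∀ j, (y j : L2 P.Ω) = un i j) ∧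
      IsEigenfamily (energy P) (Submodule.span ℝ (range y)) (lamn i) y := ⟨_, fun j => rfl, hyn⟩
  have hxu : uh i = fun j => (x j : L2 P.Ω) := funext fun j => (hx j).symm
  have hyu : un i = fun j => (y j : L2 P.Ω) := funext fun j => (hy j).symm
  have hspany : Submodule.span ℝ (range (un i)) ≤ V :=
    Submodule.span_le.2 (by rintro _ ⟨j, rfl⟩; exact hXV (hpair i j).1)
  obtain ⟨u, rfl⟩ : ∃ u₀ : H10 P.Ω, (u₀ : L2 P.Ω) = u := ⟨⟨u, hu⟩, rfl⟩
  obtain ⟨w₀, hw₀⟩ : ∃ w₀ : H10 P.Ω, w₀ = ∑ j, ⟪x j, u⟫_ℝ • x j := ⟨_, rfl⟩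
  obtain rfl : w = w₀ := by
    rw [hw, hw₀, coe_sum_smul]
    exact Finset.sum_congr rfl fun j _ => by rw [← hx]; rfl
  obtain ⟨p, hp, hpe, hpo⟩ := aProjection_spec h hyi w₀
  rw [← hyu] at hpe
  obtain rfl : w' = p := hw'.trans hpe
  have hspx : ∀ z : H10 P.Ω, (z : L2 P.Ω) ∈ Submodule.span ℝ (range (uh i)) ↔
      z ∈ Submodule.span ℝ (range x) := fun z => by rw [hxu]; exact coe_mem_span_range x z
  have hspy : ∀ z : H10 P.Ω, (z : L2 P.Ω) ∈ Submodule.span ℝ (range (un i)) ↔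
      z ∈ Submodule.span ℝ (range y) := fun z => by rw [hyu]; exact coe_mem_span_range y z
  have hw₀mem : (w₀ : L2 P.Ω) ∈ Submodule.span ℝ (range (uh i)) := by
    rw [hw]
    exact Submodule.sum_mem _ fun j _ =>
      Submodule.smul_mem _ _ (Submodule.subset_span ⟨j, rfl⟩)
  have hpmem : (p : L2 P.Ω) ∈ Submodule.span ℝ (range (un i)) := (hspy p).2 hp
  have hspanx : Submodule.span ℝ (range (uh i)) ≤ V :=
    Submodule.span_le.2 (by rintro _ ⟨j, rfl⟩; exact (huh i j).1)
  obtain ⟨D, hD⟩ : ∃ D, D = distA P (Submodule.span ℝ (range (uh i)))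
    (Submodule.span ℝ (range (un i))) := ⟨_, rfl⟩
  obtain ⟨h1, h2⟩ := IsEigenfamily.sub_projection_le h hxi hyi
    (fun j => hspany ((hspy _).2 (hyi.mem j))) (D := D) (fun z hz p hp ho => hD ▸
      aNorm_sub_le_distA h (hspany.trans hV) ((hspx z).2 hz) ((hspy p).2 hp)
        fun v hv => ho v ((hspy v).1 hv))
    (hB i) hB0 hu1 hw₀ hp hpo
  have h3 : weightedSum P lamh uh w₀ - weightedSum P lamn un p
      = ((∑ j, (⟪w₀, x j⟫_ℝ * lamh i j) • x j - ∑ j, (⟪p, y j⟫_ℝ * lamn i j) • y j : H10 P.Ω) :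
        L2 P.Ω) := by
    rw [weightedSum_eq_of_mem_span hoh _ hw₀mem, weightedSum_eq_of_mem_span hon _ hpmem,
      Submodule.coe_sub, coe_sum_smul, coe_sum_smul, hxu, hyu]
    rfl
  have h4 : κ * (‖(w₀ - p : L2 P.Ω)‖ ^ 2 + ‖weakGradient (w₀ - p : L2 P.Ω)‖ ^ 2) ≤ D ^ 2 * B :=
    (hκ _ (w₀ - p).2).trans h2
  have h6 : ‖weightedSum P lamh uh w₀ - weightedSum P lamn un p‖ ^ 2
      ≤ κ⁻¹ * (D ^ 2 * B ^ 3) := by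
    rw [h3, Submodule.norm_coe]
    exact h1
  refine ⟨hspanx hw₀mem, hspany hpmem, ?_⟩
  have h7 := (le_inv_mul_iff₀ h.pos).2 h4
  rw [← hD, add_assoc]
  exact (add_le_add h6 h7).trans_eq (by ring)

end ParO

end

theorem mainTheorem4 {d : ℕ} (hd : 1 ≤ d) (P : ParO.ModelProblem d) (k : ℕ) (hk : 1 ≤ k)
    (γ : ℝ) {q : ℕ} (lam : Fin q → ℝ) (hlam : ParO.AreSmallestEigenvalues P lam)
    (m : Fin q → ℕ) (r : Fin q → ℝ) (hr : ∀ i, 0 < r i)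
    (hr' : ∀ i μ v, ParO.IsEigenpair P (ParO.H10 P.Ω) μ v → μ ≠ lam i →
      r i < |μ⁻¹ - (lam i)⁻¹|) :
    ∃ hstar : ℝ, 0 < hstar ∧ ∃ C : ℝ, 0 < C ∧
      ∀ M : ℕ → ParO.Mesh P.Ω, (∀ n, (M n).ShapeRegular γ) → (∀ n, ParO.Resolves (M n)) →
      (∀ n, (M n).size ≤ (M 0).size) → (M 0).size ≤ hstar →
      ∀ U : (i : Fin q) → Fin (m i) → ParO.L2 P.Ω, ParO.IsEigenbasis P lam U →
      ∀ (lamh : ℕ → (i : Fin q) → Fin (m i) → ℝ)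
        (uh : ℕ → (i : Fin q) → Fin (m i) → ParO.L2 P.Ω),
        (∀ n, ParO.AreSmallestDiscreteEigenpairs P (ParO.Vh (M n) k) (lamh n) (uh n)) →
      ∀ (lamn : ℕ → (i : Fin q) → Fin (m i) → ℝ)
        (un : ℕ → (i : Fin q) → Fin (m i) → ParO.L2 P.Ω),
        (∀ n, ParO.AreParOApproximations P (ParO.Vh (M n) k) (lamn n) (un n)) →
      ∀ n,
        let EU : (i : Fin q) → Fin (m i) → ParO.L2 P.Ω := fun i j =>
          ParO.feProjection P (ParO.Vh (M n) k) (lam i) (r i) (U i j)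
        let EtildeU : (i : Fin q) → Fin (m i) → ParO.L2 P.Ω := fun i j =>
          ParO.aProjection P (Submodule.span ℝ (Set.range (un n i))) (EU i j)
        |ParO.estimator P (M n) k (lamh n) (uh n) EU
            - ParO.estimator P (M n) k (lamn n) (un n) EtildeU| ^ 2
          ≤ C * ∑ i, (ParO.distA P (Submodule.span ℝ (Set.range (uh n i)))
                (Submodule.span ℝ (Set.range (un n i))) ^ 2
              + ∑ j, |lamh n i j - lamn n i j| ^ 2) := by
  by_cases hex : ∃ U : (i : Fin q) → Fin (m i) → ParO.L2 P.Ω, ParO.IsEigenbasis P lam U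
  swap
  -- the constants precede the choice of the eigenbasis; without any eigenbasis nothing is claimed
  · exact ⟨1, one_pos, 1, one_pos, fun M _ _ _ _ U hU => absurd ⟨U, hU⟩ hex⟩
  obtain ⟨U₀, hU₀⟩ := hex
  obtain ⟨κ, hcoer, hκ⟩ := ParO.exists_isCoerciveForm_energy hd P
  obtain ⟨C₀, hC₀, hest⟩ := ParO.exists_estimator_sub_le hd P k γ
  obtain ⟨h₀, hh₀, B, hB, hdisc⟩ := ParO.exists_discrete_bounds hd hk γ hlam hr hr' hU₀
  have hκ0 := hcoer.pos
  set N : ℝ := ∑ i, (m i : ℝ) with hN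
  have hN0 : 0 ≤ N := Finset.sum_nonneg fun i _ => Nat.cast_nonneg _
  have hmN : ∀ i, (m i : ℝ) ≤ N := fun i =>
    Finset.single_le_sum (f := fun i => (m i : ℝ)) (fun i _ => Nat.cast_nonneg _)
      (Finset.mem_univ i)
  -- the constant of `sub_aProjection_le`
  set G : ℝ := κ⁻¹ * (B ^ 3 + B) with hG
  have hG0 : 0 < G := by positivity
  refine ⟨min h₀ 1, by positivity, C₀ * (G * (N + 1)), by positivity, ?_⟩
  intro M hreg hres hsize hsize0 U hU lamh uh huh lamn un hun n EU EtildeU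
  have hsn : (M n).size ≤ min h₀ 1 := (hsize n).trans hsize0
  obtain ⟨hbound, hproj⟩ := hdisc (M n) (hreg n) (hsn.trans (min_le_left _ _)) _ _ (huh n)
  have hV : ParO.Vh (M n) k ≤ ParO.H10 P.Ω := inf_le_right
  have hij : ∀ i j, EU i j ∈ ParO.Vh (M n) k ∧ EtildeU i j ∈ ParO.Vh (M n) k ∧
      ‖ParO.weightedSum P (lamh n) (uh n) (EU i j)
          - ParO.weightedSum P (lamn n) (un n) (EtildeU i j)‖ ^ 2
        + ‖EU i j - EtildeU i j‖ ^ 2 + ‖ParO.weakGradient (EU i j - EtildeU i j)‖ ^ 2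
      ≤ G * ParO.distA P (Submodule.span ℝ (Set.range (uh n i)))
          (Submodule.span ℝ (Set.range (un n i))) ^ 2 := by
    intro i j
    have hnorm : ‖U i j‖ = 1 := by
      have h := hU.2.1.1 i j
      rw [ParO.bForm_eq_inner, real_inner_self_eq_norm_sq] at h
      exact (pow_eq_one_iff_of_nonneg (norm_nonneg _) two_ne_zero).1 h
    exact ParO.sub_aProjection_le hcoer hκ hV (huh n).1 (huh n).2.1 (hun n)
      (fun i j => (hbound i j).2) hB.le i (hU.1 i j).1 hnorm (hproj i (U i j)) rfl
  have h := hest (M n) (hreg n) (hres n) (hsn.trans (min_le_right _ _)) (lamh n) (lamn n) (uh n)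
    (un n) EU EtildeU (fun i j => (hij i j).1) fun i j => (hij i j).2.1
  refine h.trans ?_
  rw [mul_assoc]
  refine mul_le_mul_of_nonneg_left ?_ hC₀.le
  rw [Finset.mul_sum]
  refine Finset.sum_le_sum fun i _ => ?_
  set D := ParO.distA P (Submodule.span ℝ (Set.range (uh n i)))
    (Submodule.span ℝ (Set.range (un n i))) with hD
  have hnn : 0 ≤ ∑ j, |lamh n i j - lamn n i j| ^ 2 := Finset.sum_nonneg fun j _ => sq_nonneg _
  calc _ ≤ ∑ _j : Fin (m i), G * D ^ 2 := Finset.sum_le_sum fun j _ => (hij i j).2.2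
    _ = m i * (G * D ^ 2) := by simp
    _ ≤ (N + 1) * (G * D ^ 2) :=
        mul_le_mul_of_nonneg_right (by linarith [hmN i]) (by positivity)
    _ = G * (N + 1) * D ^ 2 := by ring
    _ ≤ _ := mul_le_mul_of_nonneg_left (by linarith) (by positivity)
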